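/- Let $n\ge 1$ and let $\Omega\subset\mathbb{C}^n$ be a bounded smooth strictly pseudoconvex domain, i.e. a domain for which there is a smooth strictly plurisubharmonic function $\rho$ on a bounded neighbourhood of $\bar\Omega$ such that $\Omega=\{\rho<0\}$ and $d\rho\neq 0$ on $\partial\Omega$. Let $0<T<\infty$. Write $z_\alpha=x_\alpha+iy_\alpha$, $s=(x_1,y_1,\dots,x_n,y_n)$, $\dot u=\partial u/\partial t$ and $u_{\alpha\bar\beta}=\partial^2u/\partial z_\alpha\partial\bar z_\beta$, and put $$\|\varphi\|_{C^4(\Omega\times(0,T))}=\sum_{|j|+2l\le 4}\ \sup_{\Omega\times(0,T)}|D_s^jD_t^l\varphi|,\qquad \|f\|_{C^2((0,T)\times\Omega\times\mathbb{R})}=\sum_{j_1+|j_2|+j_3\le 2}\ \sup_{(0,T)\times\Omega\times\mathbb{R}}|D_t^{j_1}D_s^{j_2}D_u^{j_3}f|.$$ Given constants $C_u,C_\varphi,C_f\ge 0$, there exist a constant $M_0$ depending only on $\Omega,T,C_u,C_\varphi,C_f$ and, for every $0<\epsilon<T$, a constant $C$ depending only on $\Omega,\epsilon,T,C_u,C_\varphi,C_f$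 such that the following holds. Let $\varphi\in C^\infty(\bar\Omega\times[0,T))$ and $f\in C^\infty([0,T)\times\bar\Omega\times\mathbb{R})$, and let $u\in C^\infty(\Omega\times(0,T))\cap C^{2;1}(\bar\Omega\times[0,T))$, where $C^{2;1}$ means that $u(\cdot,t)\in C^2(\bar\Omega)$ for each $t$, $u(z,\cdot)\in C^1([0,T))$ for each $z$, and $\dot u$ and all second order space derivatives $u_{s_js_k}$ are continuous on $\bar\Omega\times[0,T)$. Suppose that $u$ is strictly plurisubharmonic in $z$ and that $$\dot u=\log\det(u_{\alpha\bar\beta})+f(t,z,u)\quad\text{on }\Omega\times(0,T),\qquad u=\varphi\quad\text{on }\partial\Omega\times[0,T),$$ $$\sup_{z\in\bar\Omega}|u(z,0)|\le C_u,\qquad f_u\le 0\ \text{ on }(0,T)\times\Omega\times\mathbb{R},\qquad \|f\|_{C^2((0,T)\times\Omega\times\mathbb{R})}\le C_f,\qquad \|\varphi\|_{C^4(\Omega\times(0,T))}\le C_\varphi .$$ Then $$|u|\le M_0\quad\text{on }\Omega\times(0,T),\qquad\text{and}\qquad |\nabla u|+|\dot u|+\Delta u\le C\quad\text{on }\Omega\times(\epsilon,T)\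 \text{ for every } 0<\epsilon<T,$$ where $\nabla$ and $\Delta$ are the Euclidean gradient and Laplacian in the space variable. -/

import Mathlib

open Set
open scoped ContDiff ENNReal NNReal ComplexOrder

noncomputable section

/-- The derivative of `g` in the direction `v`. -/
def dirDeriv {V : Type*} [NormedAddCommGroup V] [NormedSpace ℝ V] (v : V) (g : V → ℝ) : V → ℝ :=
  fun p => fderiv ℝ g p v

/-- The mixed partial derivative `D_{e 0}^{j 0} ⋯ D_{e (m-1)}^{j (m-1)} g` along a finite family
of directions `e`, with multi-index `j`. -/
def mixedDeriv {V : Type*} [NormedAddCommGroup V] [NormedSpace ℝ V] {m : ℕ}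
    (e : Fin m → V) (j : Fin m → ℕ) (g : V → ℝ) : V → ℝ :=
  (List.finRange m).foldr (fun i h => (dirDeriv (e i))^[j i] h) g

/-- The direction of the real coordinate `x_α` of `ℂⁿ`, where `z_α = x_α + i y_α`. -/
def dirX {n : ℕ} (α : Fin n) : EuclideanSpace ℂ (Fin n) := EuclideanSpace.single α 1

/-- The direction of the real coordinate `y_α` of `ℂⁿ`, where `z_α = x_α + i y_α`. -/
def dirY {n : ℕ} (α : Fin n) : EuclideanSpace ℂ (Fin n) := EuclideanSpace.single α Complex.I

/-- The complex Hessian `(∂²g / ∂z_α ∂z̄_β)` of a real function on `ℂⁿ`, with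
`∂/∂z_α = (∂/∂x_α - i ∂/∂y_α) / 2` and `∂/∂z̄_β = (∂/∂x_β + i ∂/∂y_β) / 2` multiplied out. -/
def complexHessian {n : ℕ} (g : EuclideanSpace ℂ (Fin n) → ℝ) (z : EuclideanSpace ℂ (Fin n)) :
    Matrix (Fin n) (Fin n) ℂ :=
  Matrix.of fun α β =>
    (((dirDeriv (dirX α) (dirDeriv (dirX β) g) z
        + dirDeriv (dirY α) (dirDeriv (dirY β) g) z : ℝ) : ℂ)
      + Complex.I * ((dirDeriv (dirX α) (dirDeriv (dirY β) g) z
        - dirDeriv (dirY α) (dirDeriv (dirX β) g) z : ℝ) : ℂ)) / 4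

/-- `Ω` is a bounded smooth strictly pseudoconvex domain of `ℂⁿ`: a nonempty connected open set
of the form `{ρ < 0}`, where `ρ` is a smooth strictly plurisubharmonic function on a bounded open
neighbourhood `U` of the closure of `Ω` with `dρ ≠ 0` on the boundary of `Ω`. -/
def IsBoundedSmoothStrictlyPseudoconvex {n : ℕ} (Ω : Set (EuclideanSpace ℂ (Fin n))) : Prop :=
  IsOpen Ω ∧ IsConnected Ω ∧
    ∃ (U : Set (EuclideanSpace ℂ (Fin n))) (ρ : EuclideanSpace ℂ (Fin n) → ℝ),
      IsOpen U ∧ Bornology.IsBounded U ∧ closure Ω ⊆ U ∧ ContDiffOn ℝ ∞ ρ U ∧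
      (∀ z ∈ U, (complexHessian ρ z).PosDef) ∧
      Ω = {z | z ∈ U ∧ ρ z < 0} ∧
      ∀ z ∈ frontier Ω, fderiv ℝ ρ z ≠ 0

/-- The class `C^{2;1}(Ω̄ × [0,T))`: each `u(·,t)` is `C²` on `Ω̄`, each `u(z,·)` is `C¹` on
`[0,T)`, and the time derivative and all second order space derivatives are continuous on
`Ω̄ × [0,T)`. -/
def IsC21 {n : ℕ} (Ω : Set (EuclideanSpace ℂ (Fin n))) (T : ℝ)
    (u : EuclideanSpace ℂ (Fin n) × ℝ → ℝ) : Prop :=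
  (∀ t ∈ Ico 0 T, ContDiffOn ℝ 2 (fun z => u (z, t)) (closure Ω)) ∧
  (∀ z ∈ closure Ω, ContDiffOn ℝ 1 (fun t => u (z, t)) (Ico 0 T)) ∧
  ContinuousOn (fun p : EuclideanSpace ℂ (Fin n) × ℝ =>
    derivWithin (fun t => u (p.1, t)) (Ico 0 T) p.2) (closure Ω ×ˢ Ico 0 T) ∧
  ContinuousOn (fun p : EuclideanSpace ℂ (Fin n) × ℝ =>
    iteratedFDerivWithin ℝ 2 (fun z => u (z, p.2)) (closure Ω) p.1) (closure Ω ×ˢ Ico 0 T)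

/-- The multi-indices of length `n` all of whose entries are at most `k`. -/
def boundedMultiIndices (n k : ℕ) : Finset (Fin n → ℕ) :=
  Fintype.piFinset fun _ => Finset.range (k + 1)

/-- The parabolic norm `‖φ‖_{C^k(Ω × (0,T))} = ∑_{|j| + 2 l ≤ k} sup |D_s^j D_t^l φ|`, with values
in `[0,∞]`; the space multi-index `j` is split as `(a, b)`, `a` for the coordinates `x` and `b` for
the coordinates `y`. -/
def parabolicCkNorm {n : ℕ} (k : ℕ) (Ω : Set (EuclideanSpace ℂ (Fin n))) (T : ℝ)
    (φ : EuclideanSpace ℂ (Fin n) × ℝ → ℝ) : ℝ≥0∞ :=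
  ∑ q ∈ (boundedMultiIndices n k ×ˢ boundedMultiIndices n k ×ˢ Finset.range (k + 1)).filter
      (fun q => ∑ i, q.1 i + ∑ i, q.2.1 i + 2 * q.2.2 ≤ k),
    ⨆ p ∈ Ω ×ˢ Ioo 0 T,
      ‖mixedDeriv (fun α => (dirX α, (0 : ℝ))) q.1
        (mixedDeriv (fun α => (dirY α, (0 : ℝ))) q.2.1
          ((dirDeriv ((0 : EuclideanSpace ℂ (Fin n)), (1 : ℝ)))^[q.2.2] φ)) p‖ₑ

/-- The norm `‖f‖_{C^k((0,T) × Ω × ℝ)} = ∑_{j₁ + |j₂| + j₃ ≤ k} sup |D_t^{j₁} D_s^{j₂} D_u^{j₃} f|`,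
with values in `[0,∞]`; here `q = (j₁, a, b, j₃)` and `j₂ = (a, b)`, `a` for the coordinates `x` and
`b` for the coordinates `y`. -/
def rhsCkNorm {n : ℕ} (k : ℕ) (Ω : Set (EuclideanSpace ℂ (Fin n))) (T : ℝ)
    (f : ℝ × EuclideanSpace ℂ (Fin n) × ℝ → ℝ) : ℝ≥0∞ :=
  ∑ q ∈ (Finset.range (k + 1) ×ˢ boundedMultiIndices n k ×ˢ boundedMultiIndices n k ×ˢ
        Finset.range (k + 1)).filter
      (fun q => q.1 + (∑ i, q.2.1 i + ∑ i, q.2.2.1 i) + q.2.2.2 ≤ k),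
    ⨆ p ∈ Ioo 0 T ×ˢ Ω ×ˢ (univ : Set ℝ),
      ‖((dirDeriv ((1 : ℝ), (0 : EuclideanSpace ℂ (Fin n)), (0 : ℝ)))^[q.1]
        (mixedDeriv (fun α => ((0 : ℝ), dirX α, (0 : ℝ))) q.2.1
          (mixedDeriv (fun α => ((0 : ℝ), dirY α, (0 : ℝ))) q.2.2.1
            ((dirDeriv ((0 : ℝ), (0 : EuclideanSpace ℂ (Fin n)), (1 : ℝ)))^[q.2.2.2] f)))) p‖ₑ

end

/-! Every estimate is a maximum principle for the linearized operator. At a fixed point q the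
positive form `hessForm u q` has an adapted frame w (`exists_isFrame`), and `heat w g` is ∂g/∂t
minus the trace of the complex Hessian of g against the inverse of that of u, with the coefficients
frozen at q. It therefore has constant coefficients and commutes with derivatives. Concavity of log
det says that `heat w u` minus the right hand side is largest at q; the first and second order
conditions at this maximum are the equation for the first derivatives of u and the inequality for
the pure second ones (`IsFlow.heat_dirDeriv`). The determinant is never differentiated.

The function u is bounded above by plurisubharmonicity and below by comparison with ρ - Kt (`le_u`).
The function t u̇ - u satisfies an equation from which the isolated u̇ cancels, and it starts from
-u(·,0), so the initial speed is irrelevant: for t ≥ a > 0 both u̇ and log det are bounded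
(`exists_abs_dt_le`). Then ∑ ‖w k‖², a multiple of the trace of the inverse complex Hessian, is
bounded below, and a multiple of ρ is a barrier: |u - φ| ≤ -Aρ, which bounds the gradient on the
boundary. Interior bounds come from `exists_power_bound`: if s ≥ 1 satisfies `heat w s` ≤ C s and s
≤ C Zⁿ, where Z is the good term produced by an auxiliary function N, the maximum principle for (t -
a) s^(1/(2n)) + N bounds s. It is used with s = 1 + u_ξ² (`exists_abs_grad_coord_le`) and with s = 1
+ Δu (`exists_trace_le`).

Second derivatives on the boundary remain. There u - φ vanishes, its differential is h dρ, and its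
Hessian on tangential vectors is h times that of ρ (`exists_tangential`). Mixed derivatives are
bounded by differentiating u - φ along an affine holomorphic field that is tangential to second
order at p: complex linearity keeps the commutator term bounded (`IsFrame.abs_sum_le`), and
`exists_barrier` applies. For the normal derivative one follows Trudinger: take a point where the
tangential Levi form of u, divided by (t - a)ⁿ, is minimal. Minimality, rewritten through h, is a
one-sided boundary inequality for the derivative of u - φ along an affine field with nonzero normal
component, and the barrier bounds the normal second derivative there (`exists_normal_le`). With the
lower bound of the determinant this gives a lower bound of the tangential Levi form on the whole
boundary (`exists_le_levi_tangential`); with the mixed derivatives and the upper bound of the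
determinant it bounds the Laplacian on the boundary (`exists_trace_frontier_le`).

All constants are chosen before the solution: each existential comes before the quantifier over
`SolData`. Estimates that lose some time are applied from a/2 on. -/

noncomputable section

/-! ### Hermitian parts of real bilinear forms and concavity of log det. -/

/-- Complex Euclidean space `ℂⁿ`. -/
abbrev Cn (n : ℕ) := EuclideanSpace ℂ (Fin n)

/-- Continuous real bilinear forms on `ℂⁿ`. -/
abbrev RealBilin (n : ℕ) := Cn n →L[ℝ] Cn n →L[ℝ] ℝ

/-- The Hermitian part of a real bilinear form, linear in the first variable. -/
def hform {n : ℕ} (B : RealBilin n) (x y : Cn n) : ℂ :=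
  (((B x y + B (Complex.I • x) (Complex.I • y) : ℝ) : ℂ)
    + Complex.I * ((B x (Complex.I • y) - B (Complex.I • x) y : ℝ) : ℂ)) / 4

/-- The Levi form of a real bilinear form. -/
def levi {n : ℕ} (B : RealBilin n) (x : Cn n) : ℝ :=
  B x x + B (Complex.I • x) (Complex.I • x)

/-- The matrix of the Hermitian part of a real bilinear form. -/
def leviMatrix {n : ℕ} (B : RealBilin n) : Matrix (Fin n) (Fin n) ℂ :=
  Matrix.of fun α β => hform B (dirX α) (dirX β)

/-- The trace of a real bilinear form over the real coordinate directions. -/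
def realTrace {n : ℕ} (B : RealBilin n) : ℝ := ∑ α : Fin n, levi B (dirX α)

lemma complex_smul_eq {n : ℕ} (c : ℂ) (x : Cn n) :
    c • x = c.re • x + c.im • (Complex.I • x) := by
  ext i
  simp only [PiLp.smul_apply, PiLp.add_apply, smul_eq_mul, Complex.real_smul]
  conv_lhs => rw [← Complex.re_add_im c]
  ring

lemma I_smul_I_smul {n : ℕ} (x : Cn n) : Complex.I • Complex.I • x = -x := by
  rw [smul_smul, Complex.I_mul_I, neg_one_smul]

lemma I_smul_real_smul {n : ℕ} (r : ℝ) (x : Cn n) :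
    Complex.I • r • x = r • Complex.I • x := smul_comm _ _ _

lemma hform_add_left {n : ℕ} (B : RealBilin n) (x x' y : Cn n) :
    hform B (x + x') y = hform B x y + hform B x' y := by
  simp only [hform, smul_add, map_add, add_apply]
  push_cast; ring

lemma hform_add_right {n : ℕ} (B : RealBilin n) (x y y' : Cn n) :
    hform B x (y + y') = hform B x y + hform B x y' := by
  simp only [hform, smul_add, map_add]
  push_cast; ring

lemma hform_smul_left {n : ℕ} (B : RealBilin n) (c : ℂ) (x y : Cn n) :
    hform B (c • x) y = c * hform B x y := by
  rw [complex_smul_eq c x]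
  simp only [hform, smul_add, map_add, add_apply, map_smul, smul_apply, I_smul_real_smul,
    I_smul_I_smul, map_neg, neg_apply, smul_eq_mul]
  conv_rhs => rw [← Complex.re_add_im c]
  push_cast
  linear_combination (((c.im : ℂ) * (B x (Complex.I • y) - B (Complex.I • x) y) ) / 4) *
    (- Complex.I_sq)

lemma hform_smul_right {n : ℕ} (B : RealBilin n) (c : ℂ) (x y : Cn n) :
    hform B x (c • y) = (starRingEnd ℂ) c * hform B x y := by
  rw [complex_smul_eq c y]
  simp only [hform, smul_add, map_add, map_smul, I_smul_real_smul,
    I_smul_I_smul, map_neg, smul_eq_mul]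
  have : (starRingEnd ℂ) c = c.re - c.im * Complex.I := by
    apply Complex.ext <;> simp
  rw [this]
  push_cast
  linear_combination (((c.im : ℂ) * (B x (Complex.I • y) - B (Complex.I • x) y) ) / 4) *
    (Complex.I_sq)

lemma hform_zero_left {n : ℕ} (B : RealBilin n) (y : Cn n) : hform B 0 y = 0 := by
  simp [hform]

lemma hform_zero_right {n : ℕ} (B : RealBilin n) (y : Cn n) : hform B y 0 = 0 := by
  simp [hform]

lemma hform_sum_left {n : ℕ} {ι : Type*} (s : Finset ι) (B : RealBilin n) (x : ι → Cn n)
    (y : Cn n) : hform B (∑ i ∈ s, x i) y = ∑ i ∈ s, hform B (x i) y := by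
  classical
  induction s using Finset.induction_on with
  | empty => simp [hform_zero_left]
  | insert a s ha ih => rw [Finset.sum_insert ha, Finset.sum_insert ha, hform_add_left, ih]

lemma hform_sum_right {n : ℕ} {ι : Type*} (s : Finset ι) (B : RealBilin n) (x : Cn n)
    (y : ι → Cn n) : hform B x (∑ i ∈ s, y i) = ∑ i ∈ s, hform B x (y i) := by
  classical
  induction s using Finset.induction_on with
  | empty => simp [hform_zero_right]
  | insert a s ha ih => rw [Finset.sum_insert ha, Finset.sum_insert ha, hform_add_right, ih]

lemma hform_re {n : ℕ} (B : RealBilin n) (x y : Cn n) :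
    (hform B x y).re = (B x y + B (Complex.I • x) (Complex.I • y)) / 4 := by
  rw [hform, Complex.div_ofNat_re]
  simp

lemma hform_im {n : ℕ} (B : RealBilin n) (x y : Cn n) :
    (hform B x y).im = (B x (Complex.I • y) - B (Complex.I • x) y) / 4 := by
  rw [hform, Complex.div_ofNat_im]
  simp

lemma hform_conj {n : ℕ} {B : RealBilin n} (hB : ∀ x y, B x y = B y x) (x y : Cn n) :
    (starRingEnd ℂ) (hform B x y) = hform B y x := by
  apply Complex.ext
  · rw [Complex.conj_re, hform_re, hform_re, hB x y, hB (Complex.I • x)]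
  · rw [Complex.conj_im, hform_im, hform_im, hB x, hB (Complex.I • x)]; ring

lemma hform_self {n : ℕ} {B : RealBilin n} (hB : ∀ x y, B x y = B y x) (x : Cn n) :
    hform B x x = ((levi B x / 4 : ℝ) : ℂ) := by
  apply Complex.ext
  · rw [hform_re, Complex.ofReal_re, levi]
  · rw [hform_im, hB x, Complex.ofReal_im]; ring

/-- `levi` sees only the Hermitian part of B, which is sesquilinear, so the phase of the scalar
drops out. -/
lemma levi_smul {n : ℕ} {B : RealBilin n} (c : ℂ) (x : Cn n) :
    levi B (c • x) = Complex.normSq c * levi B x := by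
  have h := hform_smul_left B c x (c • x)
  rw [hform_smul_right B c x x, ← mul_assoc, Complex.mul_conj] at h
  have h2 := congrArg Complex.re h
  rw [hform_re, Complex.re_ofReal_mul, hform_re] at h2
  simp only [levi]; linarith

lemma levi_real_smul {n : ℕ} {B : RealBilin n} (r : ℝ) (x : Cn n) :
    levi B (r • x) = r ^ 2 * levi B x := by
  simp only [levi, I_smul_real_smul, map_smul, smul_apply, smul_eq_mul]; ring

lemma sum_repr {n : ℕ} (e : OrthonormalBasis (Fin n) ℂ (Cn n)) (x : Cn n) :
    x = ∑ k, (e.repr x k) • e k := (e.sum_repr x).symm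

lemma hform_eq_sum {n : ℕ} (B : RealBilin n) (e : OrthonormalBasis (Fin n) ℂ (Cn n))
    (x y : Cn n) :
    hform B x y = ∑ j, ∑ k, e.repr x j * (starRingEnd ℂ) (e.repr y k) * hform B (e j) (e k) := by
  conv_lhs => rw [sum_repr e x, sum_repr e y]
  rw [hform_sum_left]
  refine Finset.sum_congr rfl fun j _ => ?_
  rw [hform_smul_left, hform_sum_right, Finset.mul_sum]
  refine Finset.sum_congr rfl fun k _ => ?_
  rw [hform_smul_right]; ring

lemma dirX_eq_basis {n : ℕ} (α : Fin n) :
    (dirX α : Cn n) = EuclideanSpace.basisFun (Fin n) ℂ α := by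
  simp [dirX]

lemma dirY_eq {n : ℕ} (α : Fin n) : (dirY α : Cn n) = Complex.I • dirX α := by
  ext i; simp [dirX, dirY]

/-- This is the formula of `complexHessian`, with the values of B in place of second derivatives. -/
lemma leviMatrix_apply {n : ℕ} (B : RealBilin n) (α β : Fin n) :
    leviMatrix B α β = (((B (dirX α) (dirX β) + B (dirY α) (dirY β) : ℝ) : ℂ)
      + Complex.I * ((B (dirX α) (dirY β) - B (dirY α) (dirX β) : ℝ) : ℂ)) / 4 := by
  simp only [leviMatrix, Matrix.of_apply, hform, dirY_eq]

lemma hform_eq_sum_leviMatrix {n : ℕ} (B : RealBilin n) (x y : Cn n) :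
    hform B x y = ∑ j, ∑ k, x j * (starRingEnd ℂ) (y k) * leviMatrix B j k := by
  rw [hform_eq_sum B (EuclideanSpace.basisFun (Fin n) ℂ)]
  simp [leviMatrix, dirX_eq_basis]

lemma leviMatrix_isHermitian {n : ℕ} {B : RealBilin n} (hB : ∀ x y, B x y = B y x) :
    (leviMatrix B).IsHermitian := by
  ext i j
  rw [Matrix.conjTranspose_apply]
  exact hform_conj hB _ _

/-- The conjugate on the right appears because `hform` is linear in its first variable, where the
matrix expression is conjugate linear. -/
lemma dotProduct_leviMatrix {n : ℕ} (B : RealBilin n) (x : Fin n → ℂ) :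
    star x ⬝ᵥ (leviMatrix B).mulVec x =
      hform B (WithLp.toLp 2 (star x)) (WithLp.toLp 2 (star x)) := by
  rw [hform_eq_sum_leviMatrix]
  simp only [dotProduct, Matrix.mulVec, Finset.mul_sum]
  refine Finset.sum_congr rfl fun j _ => Finset.sum_congr rfl fun k _ => ?_
  simp; ring

lemma leviMatrix_posDef_iff {n : ℕ} {B : RealBilin n} (hB : ∀ x y, B x y = B y x) :
    (leviMatrix B).PosDef ↔ ∀ x, x ≠ 0 → 0 < levi B x := by
  rw [Matrix.posDef_iff_dotProduct_mulVec]
  constructor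
  · rintro ⟨-, h⟩ x hx
    have := h (x := star (WithLp.ofLp x)) (by
      intro h0; apply hx; ext i; simpa using congrFun h0 i)
    rw [dotProduct_leviMatrix, star_star, hform_self hB] at this
    have h2 : (0:ℝ) < levi B x / 4 := by exact_mod_cast this
    linarith
  · intro h
    refine ⟨leviMatrix_isHermitian hB, fun x hx => ?_⟩
    rw [dotProduct_leviMatrix, hform_self hB]
    have : (0:ℝ) < levi B (WithLp.toLp 2 (star x)) / 4 := by
      have := h (WithLp.toLp 2 (star x)) (by
        intro h0; apply hx; ext i; simpa using congrArg (fun v : Cn n => v i) h0)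
      linarith
    exact_mod_cast this

lemma leviMatrix_posSemidef_iff {n : ℕ} {B : RealBilin n} (hB : ∀ x y, B x y = B y x) :
    (leviMatrix B).PosSemidef ↔ ∀ x, 0 ≤ levi B x := by
  rw [Matrix.posSemidef_iff_dotProduct_mulVec]
  constructor
  · rintro ⟨-, h⟩ x
    have := h (star (WithLp.ofLp x))
    rw [dotProduct_leviMatrix, star_star, hform_self hB] at this
    have h2 : (0:ℝ) ≤ levi B x / 4 := by exact_mod_cast this
    linarith
  · intro h
    refine ⟨leviMatrix_isHermitian hB, fun x => ?_⟩
    rw [dotProduct_leviMatrix, hform_self hB]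
    have : (0:ℝ) ≤ levi B (WithLp.toLp 2 (star x)) / 4 := by
      have := h (WithLp.toLp 2 (star x))
      linarith
    exact_mod_cast this

/-- An orthonormal basis diagonalizing the Hermitian part of a real bilinear form. -/
lemma exists_eigenframe {n : ℕ} {B : RealBilin n}
    (hpos : (leviMatrix B).PosDef) :
    ∃ (e : OrthonormalBasis (Fin n) ℂ (Cn n)) (l : Fin n → ℝ), (∀ k, 0 < l k) ∧
      (∀ j k, hform B (e j) (e k) = if j = k then (l j : ℂ) else 0) ∧
      ((∏ k, l k : ℝ) : ℂ) = (leviMatrix B).det := by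
  -- `hform` contracts the first index of `leviMatrix B` with its linear variable, so it is
  -- diagonalized by the eigenvectors of the transpose.
  have hT := hpos.transpose
  have hH := hT.isHermitian
  refine ⟨hH.eigenvectorBasis, hH.eigenvalues, fun k => hT.eigenvalues_pos k, ?_, ?_⟩
  · intro j k
    have h1 := hH.mulVec_eigenvectorBasis j
    have h2 : hform B (hH.eigenvectorBasis j) (hH.eigenvectorBasis k) =
        (hH.eigenvalues j : ℂ) * inner ℂ (hH.eigenvectorBasis k) (hH.eigenvectorBasis j) := by
      rw [hform_eq_sum_leviMatrix, Finset.sum_comm, EuclideanSpace.inner_eq_star_dotProduct,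
        dotProduct, Finset.mul_sum]
      refine Finset.sum_congr rfl fun β _ => ?_
      have h3 := congrFun h1 β
      simp only [Matrix.mulVec, dotProduct, Matrix.transpose_apply, Pi.smul_apply,
        Complex.real_smul] at h3
      rw [← mul_assoc, ← h3, Finset.sum_mul]
      refine Finset.sum_congr rfl fun α _ => ?_
      simp; ring
    rw [h2, orthonormal_iff_ite.mp hH.eigenvectorBasis.orthonormal]
    by_cases h : j = k
    · simp [h]
    · simp [h, Ne.symm h]
  · rw [← Matrix.det_transpose, hH.det_eq_prod_eigenvalues]
    push_cast; rfl

/-- Sum log x ≤ x - 1 over the eigenvalues. -/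
lemma log_det_le_trace {n : ℕ} {M : Matrix (Fin n) (Fin n) ℂ} (hM : M.PosDef) :
    Real.log M.det.re ≤ M.trace.re - n := by
  have hH := hM.isHermitian
  rw [hH.det_eq_prod_eigenvalues, hH.trace_eq_sum_eigenvalues]
  have h1 : (∏ i, (hH.eigenvalues i : ℂ)) = ((∏ i, hH.eigenvalues i : ℝ) : ℂ) := by push_cast; rfl
  have h2 : (∑ i, (hH.eigenvalues i : ℂ)) = ((∑ i, hH.eigenvalues i : ℝ) : ℂ) := by push_cast; rfl
  change Real.log (∏ i, (hH.eigenvalues i : ℂ)).re ≤ (∑ i, (hH.eigenvalues i : ℂ)).re - n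
  rw [h1, h2, Complex.ofReal_re, Complex.ofReal_re,
    Real.log_prod (fun i _ => (hM.eigenvalues_pos i).ne')]
  have h3 : (∑ i, hH.eigenvalues i) - n = ∑ i, (hH.eigenvalues i - 1) := by
    simp [Finset.sum_sub_distrib]
  rw [h3]
  exact Finset.sum_le_sum fun i _ => Real.log_le_sub_one_of_pos (hM.eigenvalues_pos i)

lemma hform_frame_matrix {n : ℕ} (B : RealBilin n) (v : Fin n → Cn n) :
    (Matrix.of fun j k => hform B (v j) (v k)) =
      (Matrix.of fun j α => v j α) * leviMatrix B * (Matrix.of fun j α => v j α).conjTranspose := by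
  ext j k
  rw [Matrix.of_apply, hform_eq_sum_leviMatrix, Matrix.mul_apply, Finset.sum_comm]
  refine Finset.sum_congr rfl fun β _ => ?_
  rw [Matrix.mul_apply, Finset.sum_mul]
  refine Finset.sum_congr rfl fun α _ => ?_
  simp [Matrix.conjTranspose_apply]; ring

/-- Concavity of `log det` in a frame normalizing the first form. -/
lemma log_det_le_of_frame {n : ℕ} {B B' : RealBilin n} (hB' : ∀ x y, B' x y = B' y x)
    (hpos : (leviMatrix B).PosDef) (hpos' : (leviMatrix B').PosDef) (v : Fin n → Cn n)
    (hv : ∀ j k, hform B (v j) (v k) = if j = k then 1 else 0) :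
    Real.log (leviMatrix B').det.re ≤
      Real.log (leviMatrix B).det.re + ∑ k, levi B' (v k) / 4 - n := by
  -- Written in the frame v, the first form becomes the identity and the second becomes M. Both
  -- determinants are multiplied by |det W|², so log det M is the difference of the two logarithms.
  set W : Matrix (Fin n) (Fin n) ℂ := Matrix.of fun j α => v j α with hW
  have h1 : W * leviMatrix B * W.conjTranspose = 1 := by
    rw [hW, ← hform_frame_matrix]
    ext j k
    rw [Matrix.of_apply, hv, Matrix.one_apply]
  have hdet1 : Complex.normSq W.det * (leviMatrix B).det.re = 1 := by
    have := congrArg Matrix.det h1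
    rw [Matrix.det_mul, Matrix.det_mul, Matrix.det_conjTranspose, Matrix.det_one, mul_right_comm,
      Complex.star_def, Complex.mul_conj] at this
    have := congrArg Complex.re this
    rwa [Complex.re_ofReal_mul, Complex.one_re] at this
  have hW0 : Complex.normSq W.det ≠ 0 := left_ne_zero_of_mul_eq_one hdet1
  have hWu : IsUnit W := by
    rw [Matrix.isUnit_iff_isUnit_det, isUnit_iff_ne_zero]
    intro h; apply hW0; simp [h]
  set M := W * leviMatrix B' * W.conjTranspose with hM
  have hMpos : M.PosDef := by
    apply hpos'.mul_mul_conjTranspose_same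
    exact Matrix.vecMul_injective_of_isUnit hWu
  have hdet2 : M.det.re = Complex.normSq W.det * (leviMatrix B').det.re := by
    rw [hM, Matrix.det_mul, Matrix.det_mul, Matrix.det_conjTranspose, mul_right_comm,
      Complex.star_def, Complex.mul_conj, Complex.re_ofReal_mul]
  have htr : M.trace.re = ∑ k, levi B' (v k) / 4 := by
    rw [hM, hW, ← hform_frame_matrix, Matrix.trace, Complex.re_sum]
    refine Finset.sum_congr rfl fun k _ => ?_
    simp [hform_self hB']
  have h3 := log_det_le_trace hMpos
  have hd1 : 0 < (leviMatrix B).det.re := (Complex.pos_iff.mp hpos.det_pos).1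
  have hd2 : 0 < (leviMatrix B').det.re := (Complex.pos_iff.mp hpos'.det_pos).1
  rw [hdet2, htr, Real.log_mul hW0 hd2.ne'] at h3
  have h4 : Real.log (Complex.normSq W.det) + Real.log (leviMatrix B).det.re = 0 := by
    rw [← Real.log_mul hW0 hd1.ne', hdet1, Real.log_one]
  linarith

end

/-! ### Frames adapted to a positive Levi form. -/

noncomputable section

/-- A frame of `ℂⁿ` adapted to a strictly positive Levi form. -/
structure IsFrame {n : ℕ} (B : RealBilin n) (w : Fin n → Cn n) : Prop where
  sum_levi : ∑ k, levi B (w k) = n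
  log_det_le : ∀ B' : RealBilin n, (∀ x y, B' x y = B' y x) → (leviMatrix B').PosDef →
    Real.log (leviMatrix B').det.re ≤ Real.log (leviMatrix B).det.re + ∑ k, levi B' (w k) - n
  trace_le : realTrace B ≤ 4 * n * (leviMatrix B).det.re * (4 * ∑ k, ‖w k‖ ^ 2) ^ (n - 1)
  sq_le : ∀ (a : Cn n →L[ℝ] ℝ) (x : Cn n), (a x) ^ 2 ≤
    realTrace B * (∑ k, ((a (w k)) ^ 2 + (a (Complex.I • w k)) ^ 2)) * ‖x‖ ^ 2
  abs_sum_le : ∀ M : Cn n →L[ℂ] Cn n,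
    |∑ k, (B (w k) (M (w k)) + B (Complex.I • w k) (M (Complex.I • w k)))| ≤ n * ‖M‖

lemma norm_I_smul {n : ℕ} (x : Cn n) : ‖Complex.I • x‖ = ‖x‖ := by simp [norm_smul]

lemma levi_eq_sum_of_eigenframe {n : ℕ} {B : RealBilin n} (hB : ∀ x y, B x y = B y x)
    {e : OrthonormalBasis (Fin n) ℂ (Cn n)} {l : Fin n → ℝ}
    (he : ∀ j k, hform B (e j) (e k) = if j = k then (l j : ℂ) else 0) (x : Cn n) :
    levi B x = 4 * ∑ k, l k * ‖e.repr x k‖ ^ 2 := by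
  have h := hform_eq_sum B e x x
  simp only [he, mul_ite, mul_zero, Finset.sum_ite_eq, Finset.mem_univ, if_true,
    Complex.mul_conj] at h
  rw [hform_self hB] at h
  have h2 := congrArg Complex.re h
  rw [Complex.ofReal_re, Complex.re_sum] at h2
  have h3 : ∀ k, (((Complex.normSq (e.repr x k) : ℝ) : ℂ) * (l k : ℂ)).re =
      l k * ‖e.repr x k‖ ^ 2 := fun k => by
    rw [← Complex.ofReal_mul, Complex.ofReal_re, Complex.normSq_eq_norm_sq]; ring
  simp only [h3] at h2
  linarith

lemma sum_norm_repr_sq {n : ℕ} (e : OrthonormalBasis (Fin n) ℂ (Cn n)) (x : Cn n) :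
    ∑ k, ‖e.repr x k‖ ^ 2 = ‖x‖ ^ 2 := by
  rw [← e.repr.norm_map x, EuclideanSpace.norm_sq_eq]

lemma realTrace_of_eigenframe {n : ℕ} {B : RealBilin n} (hB : ∀ x y, B x y = B y x)
    {e : OrthonormalBasis (Fin n) ℂ (Cn n)} {l : Fin n → ℝ}
    (he : ∀ j k, hform B (e j) (e k) = if j = k then (l j : ℂ) else 0) :
    realTrace B = 4 * ∑ k, l k := by
  unfold realTrace
  simp only [levi_eq_sum_of_eigenframe hB he]
  rw [← Finset.mul_sum, Finset.sum_comm]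
  congr 1
  refine Finset.sum_congr rfl fun k _ => ?_
  rw [← Finset.mul_sum]
  have : ∑ α, ‖e.repr (dirX α) k‖ ^ 2 = 1 := by
    have h := sum_norm_repr_sq (EuclideanSpace.basisFun (Fin n) ℂ) (e k)
    rw [e.orthonormal.1 k] at h
    rw [one_pow] at h
    rw [← h]
    refine Finset.sum_congr rfl fun α _ => ?_
    rw [OrthonormalBasis.repr_apply_apply, OrthonormalBasis.repr_apply_apply, dirX_eq_basis,
      norm_inner_symm]
  rw [this, mul_one]

/-- Each eigenvalue is the determinant times the inverses of the other n - 1 eigenvalues. -/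
lemma det_mul_inv_bound {n : ℕ} {l : Fin n → ℝ} (hl : ∀ k, 0 < l k) {Λ : ℝ}
    (hΛ : ∀ k, (l k)⁻¹ ≤ Λ) (k : Fin n) : l k ≤ (∏ j, l j) * Λ ^ (n - 1) := by
  have h1 : ∏ j, l j = l k * ∏ j ∈ Finset.univ.erase k, l j :=
    (Finset.mul_prod_erase _ _ (Finset.mem_univ k)).symm
  have h2 : 1 ≤ (∏ j ∈ Finset.univ.erase k, l j) * Λ ^ (n - 1) := by
    have : (n - 1) = (Finset.univ.erase k).card := by simp
    rw [this, ← Finset.prod_const, ← Finset.prod_mul_distrib]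
    calc (1 : ℝ) = ∏ j ∈ Finset.univ.erase k, (1 : ℝ) := by simp
      _ ≤ _ := Finset.prod_le_prod (fun _ _ => zero_le_one) fun j _ => by
        have := mul_le_mul_of_nonneg_left (hΛ j) (hl j).le
        rwa [mul_inv_cancel₀ (hl j).ne'] at this
  rw [h1, mul_assoc]
  exact le_mul_of_one_le_right (hl k).le h2

/-- With eigenvectors e k and eigenvalues l k of the Hermitian part, take w k = e k / (2√(l k)).
Then `levi B (w k)` = 1, and summing `levi B'` over w is the trace of the Hermitian part of B'
against the inverse of that of B. Moreover ‖w k‖² = 1/(4 l k), so ∑ ‖w k‖² controls all inverse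
eigenvalues; this is how `trace_le` follows from `det_mul_inv_bound`. -/
lemma exists_isFrame {n : ℕ} {B : RealBilin n} (hB : ∀ x y, B x y = B y x)
    (hpos : (leviMatrix B).PosDef) : ∃ w, IsFrame B w := by
  obtain ⟨e, l, hl, he, hdet⟩ := exists_eigenframe hpos
  have hdet' : (leviMatrix B).det.re = ∏ k, l k := by rw [← hdet, Complex.ofReal_re]
  have hs : ∀ k, 0 < √(l k) := fun k => Real.sqrt_pos.mpr (hl k)
  have hlevi : ∀ k, levi B (e k) = 4 * l k := fun k => by
    have := hform_self hB (e k)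
    rw [he, if_pos rfl] at this
    have : l k = levi B (e k) / 4 := by exact_mod_cast this
    linarith
  set w : Fin n → Cn n := fun k => (2 * √(l k))⁻¹ • e k with hw
  clear_value w
  have hwn : ∀ k, ‖w k‖ ^ 2 = (4 * l k)⁻¹ := fun k => by
    rw [hw]
    simp only [norm_smul, e.orthonormal.1 k, mul_one, norm_inv, Real.norm_eq_abs, inv_pow, sq_abs]
    rw [mul_pow, Real.sq_sqrt (hl k).le]; norm_num
  have htr := realTrace_of_eigenframe hB he
  have hew : ∀ k, e k = (2 * √(l k)) • w k := fun k => by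
    rw [hw]; simp only
    rw [smul_smul, mul_inv_cancel₀ (by have := hs k; positivity), one_smul]
  refine ⟨w, ?_, ?_, ?_, ?_, ?_⟩
  · have : ∀ k, levi B (w k) = 1 := fun k => by
      rw [hw]; simp only
      rw [levi_real_smul, hlevi, inv_pow, mul_pow, Real.sq_sqrt (hl k).le]
      have := hl k
      field_simp; norm_num
    simp [this]
  · intro B' hB' hpos'
    have h := log_det_le_of_frame hB' hpos hpos' (fun k => (2 : ℝ) • w k) (fun j k => by
      have h2 : ∀ k, (2 : ℝ) • w k = ((((√(l k))⁻¹ : ℝ)) : ℂ) • e k := fun k => by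
        rw [hw]; simp only
        rw [smul_smul, Complex.coe_smul]
        congr 1
        have := hs k
        field_simp
      rw [h2, h2, hform_smul_left, hform_smul_right, he]
      split_ifs with hjk
      · subst hjk
        rw [Complex.conj_ofReal, ← mul_assoc, ← Complex.ofReal_mul, ← Complex.ofReal_mul]
        rw [← mul_inv, Real.mul_self_sqrt (hl j).le, inv_mul_cancel₀ (hl j).ne']
        simp
      · simp)
    simp only [levi_real_smul] at h
    refine h.trans_eq ?_
    congr 2
    refine Finset.sum_congr rfl fun k _ => ?_
    ring
  · rw [htr, hdet', mul_assoc, mul_assoc]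
    refine mul_le_mul_of_nonneg_left ?_ (by norm_num)
    have h1 : ∀ k, (l k)⁻¹ ≤ 4 * ∑ k, ‖w k‖ ^ 2 := fun k => by
      have : ‖w k‖ ^ 2 ≤ ∑ k, ‖w k‖ ^ 2 := Finset.single_le_sum (f := fun k => ‖w k‖ ^ 2)
        (fun k _ => sq_nonneg ‖w k‖) (Finset.mem_univ k)
      rw [hwn k, mul_inv] at this
      linarith
    calc ∑ k, l k ≤ ∑ _k : Fin n, ((∏ j, l j) * (4 * ∑ k, ‖w k‖ ^ 2) ^ (n - 1)) :=
          Finset.sum_le_sum fun k _ => det_mul_inv_bound hl h1 k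
      _ = _ := by simp
  · intro a x
    have hterm : ∀ (c : ℂ) (y : Cn n), (a (c • y)) ^ 2 ≤
        ‖c‖ ^ 2 * ((a y) ^ 2 + (a (Complex.I • y)) ^ 2) := fun c y => by
      rw [complex_smul_eq, map_add, map_smul, map_smul, ← Complex.normSq_eq_norm_sq,
        Complex.normSq_apply, smul_eq_mul, smul_eq_mul]
      nlinarith [sq_nonneg (c.re * a (Complex.I • y) - c.im * a y)]
    have h1 : a x = ∑ k, a (e.repr x k • e k) := by
      conv_lhs => rw [sum_repr e x, map_sum]
    set b : Fin n → ℝ := fun k => √((a (e k)) ^ 2 + (a (Complex.I • e k)) ^ 2) with hb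
    have h2 : |a x| ≤ ∑ k, ‖e.repr x k‖ * b k := by
      rw [h1]
      refine (Finset.abs_sum_le_sum_abs _ _).trans (Finset.sum_le_sum fun k _ => ?_)
      rw [← Real.sqrt_sq_eq_abs]
      refine (Real.sqrt_le_sqrt (hterm _ _)).trans_eq ?_
      rw [Real.sqrt_mul (sq_nonneg _), Real.sqrt_sq (norm_nonneg _)]
    have h3 : (a x) ^ 2 ≤ (∑ k, ‖e.repr x k‖ * b k) ^ 2 := by
      rw [← sq_abs (a x)]
      exact pow_le_pow_left₀ (abs_nonneg _) h2 2
    have h4 := Finset.sum_mul_sq_le_sq_mul_sq Finset.univ (fun k => ‖e.repr x k‖) b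
    rw [sum_norm_repr_sq] at h4
    have h5 : ∑ k, b k ^ 2 ≤
        realTrace B * ∑ k, ((a (w k)) ^ 2 + (a (Complex.I • w k)) ^ 2) := by
      rw [Finset.mul_sum]
      refine Finset.sum_le_sum fun k _ => ?_
      rw [hb]; simp only
      rw [Real.sq_sqrt (by positivity), hew k, I_smul_real_smul, map_smul, map_smul, smul_eq_mul,
        smul_eq_mul, mul_pow, mul_pow _ (a (Complex.I • w k)), ← mul_add, mul_pow,
        Real.sq_sqrt (hl k).le]
      refine mul_le_mul_of_nonneg_right ?_ (by positivity)
      rw [htr]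
      have := Finset.single_le_sum (f := l) (fun k _ => (hl k).le) (Finset.mem_univ k)
      linarith
    calc (a x) ^ 2 ≤ ‖x‖ ^ 2 * ∑ k, b k ^ 2 := h3.trans h4
      _ ≤ ‖x‖ ^ 2 * (realTrace B * ∑ k, ((a (w k)) ^ 2 + (a (Complex.I • w k)) ^ 2)) :=
        mul_le_mul_of_nonneg_left h5 (sq_nonneg _)
      _ = _ := by ring
  -- In the eigenbasis `hform B (e k) (M (e k))` is l k times the conjugate of the k-th diagonal
  -- entry of M, and the normalization of w k divides by l k. What remains is the real part of the
  -- trace of M, whatever the size of B. Complex linearity of M moves I through M.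
  · intro M
    have h1 : ∀ k, B (w k) (M (w k)) + B (Complex.I • w k) (M (Complex.I • w k)) =
        (e.repr (M (e k)) k).re := fun k => by
      have h2 : hform B (e k) (M (e k)) = l k * (starRingEnd ℂ) (e.repr (M (e k)) k) := by
        conv_lhs => rw [sum_repr e (M (e k))]
        rw [hform_sum_right]
        simp only [hform_smul_right, he, mul_ite, mul_zero, Finset.sum_ite_eq, Finset.mem_univ,
          if_true]
        ring
      have h3 := congrArg Complex.re h2
      rw [hform_re, Complex.re_ofReal_mul, Complex.conj_re] at h3
      have h4 : M (w k) = (2 * √(l k))⁻¹ • M (e k) := by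
        rw [hw]; exact (M.restrictScalars ℝ).map_smul _ _
      rw [M.map_smul, h4, hw]
      simp only [I_smul_real_smul, map_smul, smul_apply, smul_eq_mul]
      have h5 := hs k
      have h6 := Real.sq_sqrt (hl k).le
      have h7 : B (e k) (M (e k)) + B (Complex.I • e k) (Complex.I • M (e k)) =
        4 * √(l k) ^ 2 * (e.repr (M (e k)) k).re := by rw [h6]; linarith
      rw [← mul_add, ← mul_add, h7]
      field_simp
      norm_num
    simp only [h1]
    refine (Finset.abs_sum_le_sum_abs _ _).trans ?_
    calc ∑ k, |(e.repr (M (e k)) k).re| ≤ ∑ _k : Fin n, ‖M‖ := by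
          refine Finset.sum_le_sum fun k _ => (Complex.abs_re_le_norm _).trans ?_
          rw [OrthonormalBasis.repr_apply_apply]
          refine (norm_inner_le_norm _ _).trans ?_
          rw [e.orthonormal.1 k, one_mul]
          refine (M.le_opNorm _).trans ?_
          rw [e.orthonormal.1 k, mul_one]
      _ = _ := by simp

/-- The real inner product of `ℂⁿ` as a bilinear form. -/
def innerForm (n : ℕ) : RealBilin n := innerSL ℝ

lemma innerForm_apply {n : ℕ} (x y : Cn n) : innerForm n x y = inner ℝ x y := rfl

lemma inner_I_smul_I_smul {n : ℕ} (x y : Cn n) :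
    inner ℝ (Complex.I • x) (Complex.I • y) = (inner ℝ x y : ℝ) := by
  have h := real_inner_eq_norm_add_mul_self_sub_norm_mul_self_sub_norm_mul_self_div_two
    (Complex.I • x) (Complex.I • y)
  rw [← smul_add, norm_I_smul, norm_I_smul, norm_I_smul,
    ← real_inner_eq_norm_add_mul_self_sub_norm_mul_self_sub_norm_mul_self_div_two] at h
  exact h

lemma levi_innerForm {n : ℕ} (s : ℝ) (x : Cn n) :
    levi (s • innerForm n : RealBilin n) x = 2 * s * ‖x‖ ^ 2 := by
  simp only [levi, smul_apply, innerForm_apply, smul_eq_mul,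
    real_inner_self_eq_norm_sq, norm_I_smul]
  ring

lemma real_inner_eq_re {n : ℕ} (x y : Cn n) : (inner ℝ x y : ℝ) = (inner ℂ x y).re := by
  simp [PiLp.inner_apply]

lemma leviMatrix_innerForm {n : ℕ} (s : ℝ) :
    leviMatrix (s • innerForm n : RealBilin n) = ((s / 2 : ℝ) : ℂ) • 1 := by
  have hsym : ∀ x y, (s • innerForm n : RealBilin n) x y = (s • innerForm n : RealBilin n) y x :=
    fun x y => by simp [innerForm_apply, real_inner_comm]
  ext i j
  rw [leviMatrix_apply]
  simp only [smul_apply, innerForm_apply, smul_eq_mul, real_inner_eq_re, Matrix.smul_apply,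
    Matrix.one_apply, dirX, dirY]
  by_cases h : i = j
  · subst h; simp [EuclideanSpace.inner_single_left]; ring
  · simp [h, EuclideanSpace.inner_single_left]

/-- The arithmetic-geometric mean inequality for the inverse eigenvalues, obtained by comparing B
with a multiple of the Euclidean form in `log_det_le`. -/
lemma IsFrame.sum_norm_sq_ge {n : ℕ} (hn : 1 ≤ n) {B : RealBilin n} {w : Fin n → Cn n}
    (h : IsFrame B w) :
    (n : ℝ) / 4 * Real.exp (-(Real.log (leviMatrix B).det.re) / n) ≤ ∑ k, ‖w k‖ ^ 2 := by
  set d := Real.log (leviMatrix B).det.re with hd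
  have hn' : (0 : ℝ) < n := by exact_mod_cast hn
  -- This multiple of the inner product has the same determinant as B, so the two logarithms cancel
  -- in `log_det_le`.
  set s : ℝ := 2 * Real.exp (d / n) with hs
  have hspos : 0 < s := by positivity
  have hsym : ∀ x y, (s • innerForm n : RealBilin n) x y = (s • innerForm n : RealBilin n) y x :=
    fun x y => by simp [innerForm_apply, real_inner_comm]
  have h1 := h.log_det_le (s • innerForm n) hsym ((leviMatrix_posDef_iff hsym).mpr fun x hx => by
    rw [levi_innerForm]; have := norm_pos_iff.mpr hx; positivity)
  rw [leviMatrix_innerForm, Matrix.det_smul, Matrix.det_one, mul_one, ← Complex.ofReal_pow,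
    Complex.ofReal_re, Real.log_pow] at h1
  have h2 : s / 2 = Real.exp (d / n) := by rw [hs]; ring
  rw [h2, Real.log_exp, Fintype.card_fin, mul_div_cancel₀ _ hn'.ne'] at h1
  simp only [levi_innerForm] at h1
  rw [← Finset.mul_sum] at h1
  have h3 : (n : ℝ) ≤ 4 * Real.exp (d / n) * ∑ k, ‖w k‖ ^ 2 := by
    rw [hs] at h1; linarith
  rw [neg_div, Real.exp_neg]
  have := Real.exp_pos (d / n)
  rw [← div_eq_mul_inv, div_le_iff₀ this]
  linarith

/-- A positive Levi form with bounded trace and determinant bounded below is bounded below. -/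
lemma levi_ge_of_trace_le {n : ℕ} {B : RealBilin n} (hB : ∀ x y, B x y = B y x)
    (hpos : (leviMatrix B).PosDef) {Λ : ℝ} (hΛ : realTrace B ≤ Λ) (x : Cn n) :
    (leviMatrix B).det.re * ‖x‖ ^ 2 ≤ levi B x * Λ ^ (n - 1) := by
  obtain ⟨e, l, hl, he, hdet⟩ := exists_eigenframe hpos
  have hdet' : (leviMatrix B).det.re = ∏ k, l k := by rw [← hdet, Complex.ofReal_re]
  have htr := realTrace_of_eigenframe hB he
  rw [hdet', levi_eq_sum_of_eigenframe hB he, ← sum_norm_repr_sq e x, Finset.mul_sum, mul_assoc,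
    Finset.sum_mul, Finset.mul_sum]
  refine Finset.sum_le_sum fun k _ => ?_
  have hlΛ : ∀ j, l j ≤ Λ := fun j => by
    have := Finset.single_le_sum (f := l) (fun k _ => (hl k).le) (Finset.mem_univ j)
    have := hl j
    linarith
  have hprod : ∏ j, l j ≤ l k * Λ ^ (n - 1) := by
    rw [← Finset.mul_prod_erase _ _ (Finset.mem_univ k)]
    refine mul_le_mul_of_nonneg_left ?_ (hl k).le
    have : (n - 1) = (Finset.univ.erase k).card := by simp
    rw [this, ← Finset.prod_const]
    exact Finset.prod_le_prod (fun j _ => (hl j).le) fun j _ => hlΛ j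
  have h0 : 0 ≤ l k * Λ ^ (n - 1) :=
    mul_nonneg (hl k).le (pow_nonneg ((hl k).le.trans (hlΛ k)) _)
  have h1 := mul_le_mul_of_nonneg_right hprod (sq_nonneg ‖e.repr x k‖)
  have h2 : 0 ≤ l k * Λ ^ (n - 1) * ‖e.repr x k‖ ^ 2 := by positivity
  nlinarith

/-- A Levi form bounded below with bounded determinant has bounded trace. -/
lemma trace_le_of_levi_ge {n : ℕ} {B : RealBilin n} (hB : ∀ x y, B x y = B y x)
    (hpos : (leviMatrix B).PosDef) {μ : ℝ} (hμ : 0 < μ) (hlow : ∀ x, μ * ‖x‖ ^ 2 ≤ levi B x) :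
    realTrace B * (μ / 4) ^ (n - 1) ≤ 4 * n * (leviMatrix B).det.re := by
  obtain ⟨e, l, hl, he, hdet⟩ := exists_eigenframe hpos
  have hdet' : (leviMatrix B).det.re = ∏ k, l k := by rw [← hdet, Complex.ofReal_re]
  have hlow' : ∀ k, μ / 4 ≤ l k := fun k => by
    have h1 := hlow (e k)
    have := hform_self hB (e k)
    rw [he, if_pos rfl] at this
    have : l k = levi B (e k) / 4 := by exact_mod_cast this
    rw [e.orthonormal.1 k] at h1
    linarith
  rw [hdet', realTrace_of_eigenframe hB he, mul_assoc, Finset.sum_mul, mul_assoc]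
  refine mul_le_mul_of_nonneg_left ?_ (by norm_num)
  calc ∑ k, l k * (μ / 4) ^ (n - 1) ≤ ∑ _k : Fin n, ∏ j, l j := by
        refine Finset.sum_le_sum fun k _ => ?_
        rw [← Finset.mul_prod_erase _ _ (Finset.mem_univ k)]
        refine mul_le_mul_of_nonneg_left ?_ (hl k).le
        have : (n - 1) = (Finset.univ.erase k).card := by simp
        rw [this, ← Finset.prod_const]
        exact Finset.prod_le_prod (fun j _ => by positivity) fun j _ => hlow' j
    _ = _ := by simp

end

/-! ### Directional derivatives, the parabolic operator in a frozen frame, maximum principles. -/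

noncomputable section

open Filter Topology

section Directional

variable {V : Type*} [NormedAddCommGroup V] [NormedSpace ℝ V]

lemma dirDeriv_contDiffOn {Q : Set V} (hQ : IsOpen Q) {g : V → ℝ} (hg : ContDiffOn ℝ ∞ g Q)
    (v : V) : ContDiffOn ℝ ∞ (dirDeriv v g) Q :=
  (hg.fderiv_of_isOpen hQ (m := ∞) (by simp)).clm_apply contDiffOn_const

lemma dirDeriv_congr {Q : Set V} (hQ : IsOpen Q) {g h : V → ℝ} (hgh : EqOn g h Q) (v : V) :
    EqOn (dirDeriv v g) (dirDeriv v h) Q := fun q hq => by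
  have : g =ᶠ[𝓝 q] h := hgh.eventuallyEq_of_mem (hQ.mem_nhds hq)
  simp only [dirDeriv, this.fderiv_eq]

lemma Filter.EventuallyEq.dirDeriv_eq {g h : V → ℝ} {q : V} (hgh : g =ᶠ[𝓝 q] h) (v : V) :
    dirDeriv v g q = dirDeriv v h q := by
  simp only [dirDeriv, hgh.fderiv_eq]

lemma dirDeriv_comm {g : V → ℝ} {q : V} (hg : ContDiffAt ℝ 2 g q) (v w : V) :
    dirDeriv v (dirDeriv w g) q = dirDeriv w (dirDeriv v g) q := by
  have h1 : DifferentiableAt ℝ (fderiv ℝ g) q :=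
    (hg.fderiv_right (m := 1) (by norm_num)).differentiableAt (by norm_num)
  have h2 := (hg.isSymmSndFDerivAt (by simp)).eq v w
  have h3 : ∀ v w, dirDeriv v (dirDeriv w g) q = fderiv ℝ (fderiv ℝ g) q v w := fun v w => by
    change fderiv ℝ (fun p => fderiv ℝ g p w) q v = _
    rw [fderiv_clm_apply h1 (differentiableAt_const _)]
    simp
  rw [h3, h3, h2]

lemma dirDeriv_add_apply {g h : V → ℝ} {q : V} (hg : DifferentiableAt ℝ g q)
    (hh : DifferentiableAt ℝ h q) (v : V) :
    dirDeriv v (fun p => g p + h p) q = dirDeriv v g q + dirDeriv v h q := by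
  simp only [dirDeriv]; rw [fderiv_fun_add hg hh]; rfl

lemma dirDeriv_sub_apply {g h : V → ℝ} {q : V} (hg : DifferentiableAt ℝ g q)
    (hh : DifferentiableAt ℝ h q) (v : V) :
    dirDeriv v (fun p => g p - h p) q = dirDeriv v g q - dirDeriv v h q := by
  simp only [dirDeriv]; rw [fderiv_fun_sub hg hh]; rfl

lemma dirDeriv_const_mul_apply {g : V → ℝ} {q : V} (hg : DifferentiableAt ℝ g q) (c : ℝ) (v : V) :
    dirDeriv v (fun p => c * g p) q = c * dirDeriv v g q := by
  simp only [dirDeriv]; rw [fderiv_const_mul hg]; rfl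

lemma dirDeriv_mul_apply {g h : V → ℝ} {q : V} (hg : DifferentiableAt ℝ g q)
    (hh : DifferentiableAt ℝ h q) (v : V) :
    dirDeriv v (fun p => g p * h p) q = g q * dirDeriv v h q + h q * dirDeriv v g q := by
  simp only [dirDeriv]; rw [fderiv_fun_mul hg hh]; rfl

lemma dirDeriv_comp_apply {ψ : ℝ → ℝ} {g : V → ℝ} {q : V} {c : ℝ} (hψ : HasDerivAt ψ c (g q))
    (hg : DifferentiableAt ℝ g q) (v : V) :
    dirDeriv v (fun p => ψ (g p)) q = c * dirDeriv v g q := by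
  have := (hψ.comp_hasFDerivAt q hg.hasFDerivAt).fderiv
  simp only [dirDeriv]
  change fderiv ℝ (ψ ∘ g) q v = _
  rw [this]; rfl

lemma dirDeriv_const (c : ℝ) (q v : V) : dirDeriv v (fun _ => c) q = 0 := by
  simp [dirDeriv]

lemma ContDiffAt.eventually_differentiableAt {g : V → ℝ} {q : V} (hg : ContDiffAt ℝ 2 g q) :
    ∀ᶠ p in 𝓝 q, DifferentiableAt ℝ g p :=
  (hg.eventually (by simp)).mono fun _ h => h.differentiableAt (by simp)

lemma ContDiffAt.differentiableAt_dirDeriv {g : V → ℝ} {q : V} (hg : ContDiffAt ℝ 2 g q) (v : V) :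
    DifferentiableAt ℝ (dirDeriv v g) q :=
  ((hg.fderiv_right (m := 1) (by norm_num)).differentiableAt (by norm_num)).clm_apply
    (differentiableAt_const _)

lemma dirDeriv_dirDeriv_add {g h : V → ℝ} {q : V} (hg : ContDiffAt ℝ 2 g q)
    (hh : ContDiffAt ℝ 2 h q) (v w : V) :
    dirDeriv v (dirDeriv w fun p => g p + h p) q =
      dirDeriv v (dirDeriv w g) q + dirDeriv v (dirDeriv w h) q := by
  have : dirDeriv w (fun p => g p + h p) =ᶠ[𝓝 q] fun p => dirDeriv w g p + dirDeriv w h p := by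
    filter_upwards [hg.eventually_differentiableAt, hh.eventually_differentiableAt] with p h1 h2
    exact dirDeriv_add_apply h1 h2 w
  rw [this.dirDeriv_eq, dirDeriv_add_apply (hg.differentiableAt_dirDeriv w)
    (hh.differentiableAt_dirDeriv w)]

lemma dirDeriv_dirDeriv_const_mul {g : V → ℝ} {q : V} (hg : ContDiffAt ℝ 2 g q) (c : ℝ) (v w : V) :
    dirDeriv v (dirDeriv w fun p => c * g p) q = c * dirDeriv v (dirDeriv w g) q := by
  have : dirDeriv w (fun p => c * g p) =ᶠ[𝓝 q] fun p => c * dirDeriv w g p := by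
    filter_upwards [hg.eventually_differentiableAt] with p h1
    exact dirDeriv_const_mul_apply h1 c w
  rw [this.dirDeriv_eq, dirDeriv_const_mul_apply (hg.differentiableAt_dirDeriv w)]

lemma dirDeriv_dirDeriv_mul {g h : V → ℝ} {q : V} (hg : ContDiffAt ℝ 2 g q)
    (hh : ContDiffAt ℝ 2 h q) (v w : V) :
    dirDeriv v (dirDeriv w fun p => g p * h p) q =
      g q * dirDeriv v (dirDeriv w h) q + h q * dirDeriv v (dirDeriv w g) q
        + dirDeriv v g q * dirDeriv w h q + dirDeriv v h q * dirDeriv w g q := by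
  have : dirDeriv w (fun p => g p * h p) =ᶠ[𝓝 q]
      fun p => g p * dirDeriv w h p + h p * dirDeriv w g p := by
    filter_upwards [hg.eventually_differentiableAt, hh.eventually_differentiableAt] with p h1 h2
    exact dirDeriv_mul_apply h1 h2 w
  have dg := hg.differentiableAt (by simp)
  have dh := hh.differentiableAt (by simp)
  have dg' := hg.differentiableAt_dirDeriv w
  have dh' := hh.differentiableAt_dirDeriv w
  rw [this.dirDeriv_eq, dirDeriv_add_apply (g := fun p => g p * dirDeriv w h p)
    (h := fun p => h p * dirDeriv w g p) (dg.mul dh') (dh.mul dg'),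
    dirDeriv_mul_apply dg dh', dirDeriv_mul_apply dh dg']
  ring

lemma dirDeriv_dirDeriv_comp {ψ ψ₁ : ℝ → ℝ} {g : V → ℝ} {q : V} {c : ℝ}
    (hψ : ∀ᶠ x in 𝓝 (g q), HasDerivAt ψ (ψ₁ x) x) (hψ₁ : HasDerivAt ψ₁ c (g q))
    (hg : ContDiffAt ℝ 2 g q) (v w : V) :
    dirDeriv v (dirDeriv w fun p => ψ (g p)) q =
      ψ₁ (g q) * dirDeriv v (dirDeriv w g) q + c * dirDeriv v g q * dirDeriv w g q := by
  have dg := hg.differentiableAt (by simp)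
  have : dirDeriv w (fun p => ψ (g p)) =ᶠ[𝓝 q] fun p => ψ₁ (g p) * dirDeriv w g p := by
    filter_upwards [hg.eventually_differentiableAt, dg.continuousAt.eventually hψ] with p h1 h2
    exact dirDeriv_comp_apply h2 h1 w
  have dc : DifferentiableAt ℝ (fun p => ψ₁ (g p)) q :=
    (hψ₁.comp_hasFDerivAt q dg.hasFDerivAt).differentiableAt
  rw [this.dirDeriv_eq, dirDeriv_mul_apply dc (hg.differentiableAt_dirDeriv w),
    dirDeriv_comp_apply hψ₁ dg]
  ring

lemma hasDerivAt_line {g : V → ℝ} {q v : V} {s : ℝ} (hg : DifferentiableAt ℝ g (q + s • v)) :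
    HasDerivAt (fun r : ℝ => g (q + r • v)) (dirDeriv v g (q + s • v)) s := by
  have h1 : HasDerivAt (fun r : ℝ => q + r • v) v s := by
    simpa using ((hasDerivAt_id s).smul_const v).const_add q
  exact hg.hasFDerivAt.comp_hasDerivAt s h1

/-- Necessary conditions for a local maximum along a line. -/
lemma dirDeriv_of_localMax_line {g : V → ℝ} {q v : V} (hg : ContDiffAt ℝ 2 g q)
    (hmax : ∀ᶠ s : ℝ in 𝓝 0, g (q + s • v) ≤ g q) :
    dirDeriv v g q = 0 ∧ dirDeriv v (dirDeriv v g) q ≤ 0 := by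
  set h : ℝ → ℝ := fun s => g (q + s • v) with hh
  have h0 : q + (0 : ℝ) • v = q := by simp
  have hc : Tendsto (fun s : ℝ => q + s • v) (𝓝 0) (𝓝 q) := by
    have : Continuous fun s : ℝ => q + s • v := by fun_prop
    simpa using this.tendsto 0
  have hd : deriv h =ᶠ[𝓝 0] fun s => dirDeriv v g (q + s • v) := by
    filter_upwards [hc.eventually hg.eventually_differentiableAt] with s hs
    exact (hasDerivAt_line hs).deriv
  have hloc : IsLocalMax h 0 := by
    filter_upwards [hmax] with s hs
    simpa [hh] using hs
  have hd0 : deriv h 0 = dirDeriv v g q := by rw [hd.eq_of_nhds, h0]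
  have hdd : deriv (deriv h) 0 = dirDeriv v (dirDeriv v g) q := by
    rw [hd.deriv_eq]
    have := (hasDerivAt_line (g := dirDeriv v g) (q := q) (v := v) (s := 0)
      (by rw [h0]; exact hg.differentiableAt_dirDeriv v)).deriv
    rw [this, h0]
  have hz := hloc.deriv_eq_zero
  refine ⟨by rw [← hd0, hz], ?_⟩
  -- A positive second derivative would make the point a local minimum as well; the function would
  -- be constant nearby and its second derivative zero.
  by_contra! hpos
  rw [← hdd] at hpos
  have hcont : ContinuousAt h 0 := by
    refine ContinuousAt.comp (g := g) ?_ (by fun_prop)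
    rw [h0]; exact hg.continuousAt
  have hmin := isLocalMin_of_deriv_deriv_pos hpos hz hcont
  have hconst : h =ᶠ[𝓝 0] fun _ => h 0 := by
    filter_upwards [hloc, hmin] with s h1 h2
    exact le_antisymm h1 h2
  have : deriv (deriv h) 0 = 0 := by
    rw [hconst.deriv.deriv_eq]; simp
  linarith

end Directional

/-- The derivative in the space direction `v`. -/
notation:max "dx" v:max => dirDeriv (v, (0 : ℝ))

/-- The derivative in time. -/
notation "dt" => dirDeriv ((0 : Cn _), (1 : ℝ))

/-- The space gradient. -/
def gradForm {n : ℕ} (g : Cn n × ℝ → ℝ) (q : Cn n × ℝ) : Cn n →L[ℝ] ℝ :=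
  (fderiv ℝ g q).comp (ContinuousLinearMap.inl ℝ (Cn n) ℝ)

/-- The space Hessian. -/
def hessForm {n : ℕ} (g : Cn n × ℝ → ℝ) (q : Cn n × ℝ) : RealBilin n :=
  (fderiv ℝ (fderiv ℝ g) q).bilinearComp (ContinuousLinearMap.inl ℝ (Cn n) ℝ)
    (ContinuousLinearMap.inl ℝ (Cn n) ℝ)

lemma gradForm_apply {n : ℕ} (g : Cn n × ℝ → ℝ) (q : Cn n × ℝ) (v : Cn n) :
    gradForm g q v = dx v g q := rfl

lemma hessForm_apply {n : ℕ} {g : Cn n × ℝ → ℝ} {q : Cn n × ℝ} (hg : ContDiffAt ℝ 2 g q)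
    (v w : Cn n) : hessForm g q v w = dx v (dx w g) q := by
  have h1 : DifferentiableAt ℝ (fderiv ℝ g) q :=
    (hg.fderiv_right (m := 1) (by norm_num)).differentiableAt (by norm_num)
  change _ = fderiv ℝ (fun p => fderiv ℝ g p (w, 0)) q (v, 0)
  rw [fderiv_clm_apply h1 (differentiableAt_const _)]
  simp [hessForm]

lemma hessForm_symm {n : ℕ} {g : Cn n × ℝ → ℝ} {q : Cn n × ℝ} (hg : ContDiffAt ℝ 2 g q)
    (v w : Cn n) : hessForm g q v w = hessForm g q w v := by
  rw [hessForm_apply hg, hessForm_apply hg, dirDeriv_comm hg]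

lemma Filter.EventuallyEq.hessForm_eq {n : ℕ} {g h : Cn n × ℝ → ℝ} {q : Cn n × ℝ}
    (hgh : g =ᶠ[𝓝 q] h) : hessForm g q = hessForm h q := by
  rw [hessForm, hessForm, hgh.fderiv.fderiv_eq]

/-- The linearized parabolic operator in the frame `w`. -/
def heat {n : ℕ} (w : Fin n → Cn n) (g : Cn n × ℝ → ℝ) (q : Cn n × ℝ) : ℝ :=
  dt g q - ∑ k, levi (hessForm g q) (w k)

/-- The square of the gradient in the frame `w`. -/
def gradSq {n : ℕ} (w : Fin n → Cn n) (g : Cn n × ℝ → ℝ) (q : Cn n × ℝ) : ℝ :=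
  ∑ k, ((dx (w k) g q) ^ 2 + (dx (Complex.I • w k) g q) ^ 2)

/-- The polarization of `gradSq`. -/
def gradProd {n : ℕ} (w : Fin n → Cn n) (g h : Cn n × ℝ → ℝ) (q : Cn n × ℝ) : ℝ :=
  ∑ k, (dx (w k) g q * dx (w k) h q + dx (Complex.I • w k) g q * dx (Complex.I • w k) h q)

lemma gradSq_nonneg {n : ℕ} (w : Fin n → Cn n) (g : Cn n × ℝ → ℝ) (q : Cn n × ℝ) :
    0 ≤ gradSq w g q := Finset.sum_nonneg fun _ _ => by positivity

section Heat

variable {n : ℕ} {w : Fin n → Cn n} {g h : Cn n × ℝ → ℝ} {q : Cn n × ℝ}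

lemma levi_hessForm (hg : ContDiffAt ℝ 2 g q) (v : Cn n) :
    levi (hessForm g q) v = dx v (dx v g) q + dx (Complex.I • v) (dx (Complex.I • v) g) q := by
  rw [levi, hessForm_apply hg, hessForm_apply hg]

lemma heat_congr (hgh : g =ᶠ[𝓝 q] h) : heat w g q = heat w h q := by
  rw [heat, heat, hgh.hessForm_eq, hgh.dirDeriv_eq]

lemma heat_add (hg : ContDiffAt ℝ 2 g q) (hh : ContDiffAt ℝ 2 h q) :
    heat w (fun p => g p + h p) q = heat w g q + heat w h q := by
  simp only [heat, levi_hessForm hg, levi_hessForm hh, levi_hessForm (hg.add hh),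
    dirDeriv_dirDeriv_add hg hh, Finset.sum_add_distrib,
    dirDeriv_add_apply (hg.differentiableAt (by simp)) (hh.differentiableAt (by simp))]
  ring

lemma heat_const_mul (hg : ContDiffAt ℝ 2 g q) (c : ℝ) :
    heat w (fun p => c * g p) q = c * heat w g q := by
  simp only [heat, levi_hessForm hg, levi_hessForm (contDiffAt_const.mul hg),
    dirDeriv_dirDeriv_const_mul hg, ← mul_add,
    ← Finset.mul_sum, dirDeriv_const_mul_apply (hg.differentiableAt (by simp)), mul_sub]

lemma heat_sub (hg : ContDiffAt ℝ 2 g q) (hh : ContDiffAt ℝ 2 h q) :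
    heat w (fun p => g p - h p) q = heat w g q - heat w h q := by
  have := heat_add (w := w) hg (contDiffAt_const.mul hh : ContDiffAt ℝ 2 (fun p => (-1) * h p) q)
  rw [heat_const_mul hh] at this
  rw [show (fun p => g p - h p) = fun p => g p + (-1) * h p from by ext; ring, this]; ring

lemma heat_mul (hg : ContDiffAt ℝ 2 g q) (hh : ContDiffAt ℝ 2 h q) :
    heat w (fun p => g p * h p) q =
      g q * heat w h q + h q * heat w g q - 2 * gradProd w g h q := by
  simp only [heat, gradProd, levi_hessForm hg, levi_hessForm hh, levi_hessForm (hg.mul hh),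
    dirDeriv_dirDeriv_mul hg hh,
    dirDeriv_mul_apply (hg.differentiableAt (by simp)) (hh.differentiableAt (by simp)), mul_sub,
    Finset.mul_sum]
  rw [show ∀ a b c d e f : ℝ, a + b - c = a - d + (b - e) - f ↔ c = d + e + f from
    fun a b c d e f => by constructor <;> intro h <;> linarith, ← Finset.sum_add_distrib,
    ← Finset.sum_add_distrib]
  exact Finset.sum_congr rfl fun k _ => by ring

lemma heat_comp {ψ ψ₁ : ℝ → ℝ} {c : ℝ} (hψ : ∀ᶠ x in 𝓝 (g q), HasDerivAt ψ (ψ₁ x) x)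
    (hψ₁ : HasDerivAt ψ₁ c (g q)) (hg : ContDiffAt ℝ 2 g q)
    (hc : ContDiffAt ℝ 2 (fun p => ψ (g p)) q) :
    heat w (fun p => ψ (g p)) q = ψ₁ (g q) * heat w g q - c * gradSq w g q := by
  simp only [heat, gradSq, levi_hessForm hg, levi_hessForm hc,
    dirDeriv_dirDeriv_comp hψ hψ₁ hg, mul_sub, Finset.mul_sum,
    dirDeriv_comp_apply hψ.self_of_nhds (hg.differentiableAt (by simp))]
  rw [sub_sub, ← Finset.sum_add_distrib]
  congr 1
  exact Finset.sum_congr rfl fun k _ => by ring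

lemma heat_sq (hg : ContDiffAt ℝ 2 g q) :
    heat w (fun p => g p ^ 2) q = 2 * g q * heat w g q - 2 * gradSq w g q := by
  have : (fun p => g p ^ 2) = fun p => g p * g p := by ext; ring
  rw [this, heat_mul hg hg, gradProd, gradSq]
  simp only [pow_two]; ring

lemma heat_const (c : ℝ) : heat w (fun _ => c) q = 0 := by
  have : ∀ (c : ℝ) (v : Cn n × ℝ), dirDeriv v (fun _ : Cn n × ℝ => c) = fun _ => 0 :=
    fun c v => by ext p; exact dirDeriv_const c p v
  simp [heat, levi_hessForm (g := fun _ : Cn n × ℝ => c) contDiffAt_const, this]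

lemma heat_nonneg_of_max (ht : 0 ≤ dt g q) (hh : ∀ v, hessForm g q v v ≤ 0) :
    0 ≤ heat w g q := by
  have : ∑ k, levi (hessForm g q) (w k) ≤ 0 :=
    Finset.sum_nonpos fun k _ => add_nonpos (hh _) (hh _)
  rw [heat]; linarith

end Heat

lemma hessForm_of_localMax {n : ℕ} {g : Cn n × ℝ → ℝ} {z : Cn n} {t : ℝ}
    (hg : ContDiffAt ℝ 2 g (z, t)) (hmax : ∀ᶠ y in 𝓝 z, g (y, t) ≤ g (z, t)) (v : Cn n) :
    dx v g (z, t) = 0 ∧ hessForm g (z, t) v v ≤ 0 := by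
  rw [hessForm_apply hg]
  refine dirDeriv_of_localMax_line hg ?_
  have hc : Tendsto (fun s : ℝ => z + s • v) (𝓝 0) (𝓝 z) := by
    have : Continuous fun s : ℝ => z + s • v := by fun_prop
    simpa using this.tendsto 0
  filter_upwards [hc.eventually hmax] with s hs
  simpa using hs

/-- Only earlier times are compared, because the maximum over a closed time interval may occur at
its end. -/
lemma dt_nonneg_of_max {n : ℕ} {g : Cn n × ℝ → ℝ} {z : Cn n} {a t : ℝ} (hat : a < t)
    (hg : DifferentiableAt ℝ g (z, t)) (hmax : ∀ s ∈ Ioo a t, g (z, s) ≤ g (z, t)) :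
    0 ≤ dt g (z, t) := by
  have h1 : HasDerivAt (fun s : ℝ => g (z, s)) (dt g (z, t)) t := by
    have h2 : HasDerivAt (fun s : ℝ => (z, s)) ((0 : Cn n), (1 : ℝ)) t :=
      (hasDerivAt_const t z).prodMk (hasDerivAt_id t)
    exact hg.hasFDerivAt.comp_hasDerivAt t h2
  rw [hasDerivAt_iff_tendsto_slope] at h1
  have h2 : Tendsto (slope (fun s : ℝ => g (z, s)) t) (𝓝[<] t) (𝓝 (dt g (z, t))) :=
    h1.mono_left (nhdsWithin_mono _ fun x hx => ne_of_lt hx)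
  refine ge_of_tendsto h2 ?_
  filter_upwards [Ioo_mem_nhdsLT hat] with s hs
  rw [slope_def_field]
  exact div_nonneg_of_nonpos (sub_nonpos.mpr (hmax s hs)) (sub_nonpos.mpr hs.2.le)

/-- The parabolic maximum principle. -/
lemma parabolic_max {n : ℕ} {Ω : Set (Cn n)} (hΩ : IsOpen Ω) (hb : Bornology.IsBounded Ω)
    {a b : ℝ} {G : Cn n × ℝ → ℝ}
    (hc : ContinuousOn G (closure Ω ×ˢ Icc a b))
    (hs : ∀ z ∈ Ω, ∀ t ∈ Ioc a b, ContDiffAt ℝ 2 G (z, t)) {M : ℝ}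
    (hbdry : ∀ z ∈ frontier Ω, ∀ t ∈ Icc a b, G (z, t) ≤ M)
    (hinit : ∀ z ∈ Ω, G (z, a) ≤ M)
    (hint : ∀ z ∈ Ω, ∀ t ∈ Ioc a b, M < G (z, t) → (∀ v, dx v G (z, t) = 0) →
      0 ≤ dt G (z, t) → (∀ v, hessForm G (z, t) v v ≤ 0) → False) :
    ∀ z ∈ closure Ω, ∀ t ∈ Icc a b, G (z, t) ≤ M := by
  intro z₀ hz₀ t₀ ht₀
  have hK : IsCompact (closure Ω ×ˢ Icc a b) :=
    hb.isCompact_closure.prod isCompact_Icc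
  obtain ⟨⟨z, t⟩, ⟨hz, ht⟩, hmax⟩ := hK.exists_isMaxOn ⟨(z₀, t₀), hz₀, ht₀⟩ hc
  simp only at hz ht
  refine (hmax (show (z₀, t₀) ∈ closure Ω ×ˢ Icc a b from ⟨hz₀, ht₀⟩)).trans ?_
  by_contra! hM
  have hzΩ : z ∈ Ω := by
    by_contra hz'
    exact absurd (hbdry z (by rw [hΩ.frontier_eq]; exact ⟨hz, hz'⟩) t ht) (not_le.mpr hM)
  have hta : a < t := by
    rcases ht.1.eq_or_lt with h | h
    · subst h; exact absurd (hinit z hzΩ) (not_le.mpr hM)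
    · exact h
  have hsm := hs z hzΩ t ⟨hta, ht.2⟩
  have hloc : ∀ᶠ y in 𝓝 z, G (y, t) ≤ G (z, t) := by
    filter_upwards [hΩ.mem_nhds hzΩ] with y hy
    exact hmax (show (y, t) ∈ closure Ω ×ˢ Icc a b from ⟨subset_closure hy, ht⟩)
  refine hint z hzΩ t ⟨hta, ht.2⟩ hM (fun v => (hessForm_of_localMax hsm hloc v).1) ?_
    (fun v => (hessForm_of_localMax hsm hloc v).2)
  refine dt_nonneg_of_max hta (hsm.differentiableAt (by simp)) fun s hs' => ?_
  exact hmax (show (z, s) ∈ closure Ω ×ˢ Icc a b from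
    ⟨subset_closure hzΩ, hs'.1.le, hs'.2.le.trans ht.2⟩)

/-- The elliptic maximum principle on a time slice. -/
lemma elliptic_max {n : ℕ} {Ω : Set (Cn n)} (hΩ : IsOpen Ω) (hb : Bornology.IsBounded Ω)
    {t : ℝ} {G : Cn n × ℝ → ℝ}
    (hc : ContinuousOn (fun z => G (z, t)) (closure Ω))
    (hs : ∀ z ∈ Ω, ContDiffAt ℝ 2 G (z, t)) {M : ℝ}
    (hbdry : ∀ z ∈ frontier Ω, G (z, t) ≤ M)
    (hint : ∀ z ∈ Ω, (∀ v, hessForm G (z, t) v v ≤ 0) → False) :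
    ∀ z ∈ closure Ω, G (z, t) ≤ M := by
  intro z₀ hz₀
  obtain ⟨z, hz, hmax⟩ := hb.isCompact_closure.exists_isMaxOn ⟨z₀, hz₀⟩ hc
  refine (hmax hz₀).trans ?_
  by_contra! hM
  have hzΩ : z ∈ Ω := by
    by_contra hz'
    exact absurd (hbdry z (by rw [hΩ.frontier_eq]; exact ⟨hz, hz'⟩)) (not_le.mpr hM)
  have hloc : ∀ᶠ y in 𝓝 z, G (y, t) ≤ G (z, t) := by
    filter_upwards [hΩ.mem_nhds hzΩ] with y hy
    exact hmax (subset_closure hy)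
  exact hint z hzΩ fun v => (hessForm_of_localMax (hs z hzΩ) hloc v).2

end

/-! ### Multi-index derivatives, real coordinates, functions with controlled derivatives. -/

noncomputable section

open Filter Topology

section Mixed

variable {V : Type*} [NormedAddCommGroup V] [NormedSpace ℝ V] {Q : Set V}

lemma ContDiffOn.contDiffAt_two (hQ : IsOpen Q) {g : V → ℝ} (hg : ContDiffOn ℝ ∞ g Q) {q : V}
    (hq : q ∈ Q) : ContDiffAt ℝ 2 g q :=
  (hg.contDiffAt (hQ.mem_nhds hq)).of_le (WithTop.coe_le_coe.mpr (le_top : (2 : ℕ∞) ≤ ⊤))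

lemma dirDeriv_comm_on (hQ : IsOpen Q) {g : V → ℝ} (hg : ContDiffOn ℝ ∞ g Q) (v w : V) :
    EqOn (dirDeriv v (dirDeriv w g)) (dirDeriv w (dirDeriv v g)) Q := fun _ hq =>
  dirDeriv_comm (hg.contDiffAt_two hQ hq) v w

lemma iterate_dirDeriv_contDiffOn (hQ : IsOpen Q) {g : V → ℝ} (hg : ContDiffOn ℝ ∞ g Q) (v : V)
    (k : ℕ) : ContDiffOn ℝ ∞ ((dirDeriv v)^[k] g) Q := by
  induction k with
  | zero => exact hg
  | succ k ih => rw [Function.iterate_succ_apply']; exact dirDeriv_contDiffOn hQ ih v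

lemma iterate_dirDeriv_congr (hQ : IsOpen Q) {g h : V → ℝ} (hgh : EqOn g h Q) (v : V) (k : ℕ) :
    EqOn ((dirDeriv v)^[k] g) ((dirDeriv v)^[k] h) Q := by
  induction k with
  | zero => exact hgh
  | succ k ih =>
    rw [Function.iterate_succ_apply', Function.iterate_succ_apply']
    exact dirDeriv_congr hQ ih v

lemma dirDeriv_iterate_comm (hQ : IsOpen Q) {g : V → ℝ} (hg : ContDiffOn ℝ ∞ g Q) (v w : V)
    (k : ℕ) : EqOn (dirDeriv v ((dirDeriv w)^[k] g)) ((dirDeriv w)^[k] (dirDeriv v g)) Q := by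
  induction k with
  | zero => exact fun _ _ => rfl
  | succ k ih =>
    rw [Function.iterate_succ_apply', Function.iterate_succ_apply']
    exact (dirDeriv_comm_on hQ (iterate_dirDeriv_contDiffOn hQ hg w k) v w).trans
      (dirDeriv_congr hQ ih w)

variable {m : ℕ} (e : Fin m → V) (j : Fin m → ℕ)

/-- The mixed derivative along a list of indices. -/
def listDeriv (l : List (Fin m)) (g : V → ℝ) : V → ℝ :=
  l.foldr (fun i h => (dirDeriv (e i))^[j i] h) g

lemma listDeriv_contDiffOn (hQ : IsOpen Q) {g : V → ℝ} (hg : ContDiffOn ℝ ∞ g Q)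
    (l : List (Fin m)) : ContDiffOn ℝ ∞ (listDeriv e j l g) Q := by
  induction l with
  | nil => exact hg
  | cons a l ih => exact iterate_dirDeriv_contDiffOn hQ ih _ _

lemma listDeriv_congr (hQ : IsOpen Q) {g h : V → ℝ} (hgh : EqOn g h Q) (l : List (Fin m)) :
    EqOn (listDeriv e j l g) (listDeriv e j l h) Q := by
  induction l with
  | nil => exact hgh
  | cons a l ih => exact iterate_dirDeriv_congr hQ ih _ _

lemma dirDeriv_listDeriv_comm (hQ : IsOpen Q) {g : V → ℝ} (hg : ContDiffOn ℝ ∞ g Q) (v : V)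
    (l : List (Fin m)) :
    EqOn (dirDeriv v (listDeriv e j l g)) (listDeriv e j l (dirDeriv v g)) Q := by
  induction l with
  | nil => exact fun _ _ => rfl
  | cons a l ih =>
    exact (dirDeriv_iterate_comm hQ (listDeriv_contDiffOn e j hQ hg l) v (e a) (j a)).trans
      (iterate_dirDeriv_congr hQ ih _ _)

lemma listDeriv_update_of_notMem (i : Fin m) (l : List (Fin m)) (hi : i ∉ l) (g : V → ℝ) :
    listDeriv e (Function.update j i (j i + 1)) l g = listDeriv e j l g := by
  induction l with
  | nil => rfl
  | cons a l ih =>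
    rw [List.mem_cons, not_or] at hi
    have := ih hi.2
    simp only [listDeriv, List.foldr_cons] at this ⊢
    rw [this, Function.update_of_ne (Ne.symm hi.1)]

/-- By symmetry of second derivatives the new derivative moves inward until it meets the block of
its own index. `Nodup` guarantees a single such block; with two of them the updated multi-index
would count the increment twice. -/
lemma listDeriv_update (hQ : IsOpen Q) {g : V → ℝ} (hg : ContDiffOn ℝ ∞ g Q) (i : Fin m)
    (l : List (Fin m)) (hl : l.Nodup) (hi : i ∈ l) :
    EqOn (dirDeriv (e i) (listDeriv e j l g))
      (listDeriv e (Function.update j i (j i + 1)) l g) Q := by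
  induction l with
  | nil => exact absurd hi List.not_mem_nil
  | cons a l ih =>
    rw [List.nodup_cons] at hl
    by_cases hai : a = i
    · subst hai
      have h1 := listDeriv_update_of_notMem e j a l hl.1 g
      simp only [listDeriv, List.foldr_cons] at h1 ⊢
      rw [h1, Function.update_self, Function.iterate_succ_apply']
      exact fun _ _ => rfl
    · have hil : i ∈ l := by
        rcases List.mem_cons.mp hi with h | h
        · exact absurd h.symm hai
        · exact h
      have h1 := dirDeriv_iterate_comm hQ (listDeriv_contDiffOn e j hQ hg l) (e i) (e a) (j a)
      have h2 := iterate_dirDeriv_congr hQ (ih hl.2 hil) (e a) (j a)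
      have h3 : listDeriv e (Function.update j i (j i + 1)) (a :: l) g =
          (dirDeriv (e a))^[j a] (listDeriv e (Function.update j i (j i + 1)) l g) := by
        simp only [listDeriv, List.foldr_cons]
        rw [Function.update_of_ne hai]
      rw [h3]
      exact h1.trans h2

lemma mixedDeriv_contDiffOn (hQ : IsOpen Q) {g : V → ℝ} (hg : ContDiffOn ℝ ∞ g Q) :
    ContDiffOn ℝ ∞ (mixedDeriv e j g) Q := listDeriv_contDiffOn e j hQ hg _

lemma mixedDeriv_congr (hQ : IsOpen Q) {g h : V → ℝ} (hgh : EqOn g h Q) :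
    EqOn (mixedDeriv e j g) (mixedDeriv e j h) Q := listDeriv_congr e j hQ hgh _

lemma dirDeriv_mixedDeriv_comm (hQ : IsOpen Q) {g : V → ℝ} (hg : ContDiffOn ℝ ∞ g Q) (v : V) :
    EqOn (dirDeriv v (mixedDeriv e j g)) (mixedDeriv e j (dirDeriv v g)) Q :=
  dirDeriv_listDeriv_comm e j hQ hg v _

lemma mixedDeriv_update (hQ : IsOpen Q) {g : V → ℝ} (hg : ContDiffOn ℝ ∞ g Q) (i : Fin m) :
    EqOn (dirDeriv (e i) (mixedDeriv e j g))
      (mixedDeriv e (Function.update j i (j i + 1)) g) Q :=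
  listDeriv_update e j hQ hg i _ (List.nodup_finRange m) (List.mem_finRange i)

lemma mixedDeriv_zero (g : V → ℝ) : mixedDeriv e 0 g = g := by
  have : ∀ l : List (Fin m), listDeriv e 0 l g = g := fun l => by
    induction l with
    | nil => rfl
    | cons a l ih => simp [listDeriv]
  exact this _

lemma sum_update (i : Fin m) : ∑ k, Function.update j i (j i + 1) k = ∑ k, j k + 1 := by
  rw [Finset.sum_update_of_mem (Finset.mem_univ i), ← Finset.add_sum_erase _ j (Finset.mem_univ i),
    Finset.sdiff_singleton_eq_erase]
  ring

end Mixed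

/-- The real coordinate directions of `ℂⁿ`. -/
def coordDir {n : ℕ} (p : Fin n × Bool) : Cn n := if p.2 then dirY p.1 else dirX p.1

/-- The real coordinates of a vector of `ℂⁿ`. -/
def coord {n : ℕ} (p : Fin n × Bool) (v : Cn n) : ℝ := if p.2 then (v p.1).im else (v p.1).re

lemma sum_coord {n : ℕ} (v : Cn n) : v = ∑ p : Fin n × Bool, coord p v • coordDir p := by
  rw [Fintype.sum_prod_type]
  simp only [Fintype.sum_bool, coord, coordDir, if_true, Bool.false_eq_true, if_false]
  ext i
  simp only [dirX, dirY, WithLp.ofLp_sum, WithLp.ofLp_add, WithLp.ofLp_smul, Finset.sum_apply,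
    Pi.add_apply, Pi.smul_apply, PiLp.single_apply, smul_ite, smul_zero,
    Finset.sum_add_distrib, Finset.sum_ite_eq, Finset.mem_univ, if_true, Complex.real_smul, mul_one]
  rw [add_comm, Complex.re_add_im]

lemma abs_coord_le {n : ℕ} (p : Fin n × Bool) (v : Cn n) : |coord p v| ≤ ‖v‖ := by
  unfold coord
  split_ifs
  · exact (Complex.abs_im_le_norm _).trans (PiLp.norm_apply_le v p.1)
  · exact (Complex.abs_re_le_norm _).trans (PiLp.norm_apply_le v p.1)

lemma norm_coordDir {n : ℕ} (p : Fin n × Bool) : ‖(coordDir p : Cn n)‖ = 1 := by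
  unfold coordDir
  split_ifs
  · simp [dirY]
  · simp [dirX]

lemma dx_eq_sum {n : ℕ} (v : Cn n) (g : Cn n × ℝ → ℝ) (q : Cn n × ℝ) :
    dx v g q = ∑ p : Fin n × Bool, coord p v * dx (coordDir p) g q := by
  conv_lhs => rw [← gradForm_apply, sum_coord v, map_sum]
  simp [gradForm_apply]

lemma abs_dx_le {n : ℕ} {g : Cn n × ℝ → ℝ} {q : Cn n × ℝ} {C : ℝ}
    (h : ∀ p : Fin n × Bool, |dx (coordDir p) g q| ≤ C) (v : Cn n) :
    |dx v g q| ≤ 2 * n * C * ‖v‖ := by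
  rw [dx_eq_sum]
  refine (Finset.abs_sum_le_sum_abs _ _).trans ?_
  calc ∑ p : Fin n × Bool, |coord p v * dx (coordDir p) g q|
      ≤ ∑ _p : Fin n × Bool, ‖v‖ * C := Finset.sum_le_sum fun p _ => by
        rw [abs_mul]
        exact mul_le_mul (abs_coord_le p v) (h p) (abs_nonneg _) (norm_nonneg _)
    _ = _ := by simp; ring

lemma hessForm_eq_sum {n : ℕ} {g : Cn n × ℝ → ℝ} {q : Cn n × ℝ} (v w : Cn n) :
    hessForm g q v w = ∑ p : Fin n × Bool, ∑ p' : Fin n × Bool,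
      coord p v * coord p' w * hessForm g q (coordDir p) (coordDir p') := by
  conv_lhs => rw [sum_coord v, sum_coord w]
  simp only [map_sum, sum_apply, map_smul, smul_apply, smul_eq_mul]
  rw [Finset.sum_comm]
  refine Finset.sum_congr rfl fun p _ => ?_
  rw [Finset.mul_sum]
  exact Finset.sum_congr rfl fun p' _ => by ring

lemma abs_hessForm_le {n : ℕ} {g : Cn n × ℝ → ℝ} {q : Cn n × ℝ} {C : ℝ}
    (h : ∀ p p' : Fin n × Bool, |hessForm g q (coordDir p) (coordDir p')| ≤ C) (v w : Cn n) :
    |hessForm g q v w| ≤ (2 * n) ^ 2 * C * ‖v‖ * ‖w‖ := by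
  rw [hessForm_eq_sum]
  refine (Finset.abs_sum_le_sum_abs _ _).trans ?_
  calc _ ≤ ∑ _p : Fin n × Bool, ∑ _p' : Fin n × Bool, ‖v‖ * ‖w‖ * C := by
        refine Finset.sum_le_sum fun p _ => (Finset.abs_sum_le_sum_abs _ _).trans
          (Finset.sum_le_sum fun p' _ => ?_)
        rw [abs_mul, abs_mul]
        exact mul_le_mul (mul_le_mul (abs_coord_le p v) (abs_coord_le p' w) (abs_nonneg _)
          (norm_nonneg _)) (h p p') (abs_nonneg _) (by positivity)
    _ = _ := by simp; ring

/-- A function on `Q` with bounds on the derivatives that enter the parabolic operator. -/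
structure Tame {n : ℕ} (Q : Set (Cn n × ℝ)) (C : ℝ) (g : Cn n × ℝ → ℝ) : Prop where
  smooth : ContDiffOn ℝ ∞ g Q
  bound : ∀ q ∈ Q, |g q| ≤ C
  dt_bound : ∀ q ∈ Q, |dt g q| ≤ C
  dx_bound : ∀ q ∈ Q, ∀ v, |dx v g q| ≤ C * ‖v‖
  hess_bound : ∀ q ∈ Q, ∀ v, |dx v (dx v g) q| ≤ C * ‖v‖ ^ 2

namespace Tame

variable {n : ℕ} {Q Q' : Set (Cn n × ℝ)} {C C' : ℝ} {g h : Cn n × ℝ → ℝ}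

lemma mono (hg : Tame Q C g) (hC : C ≤ C') : Tame Q C' g where
  smooth := hg.smooth
  bound q hq := (hg.bound q hq).trans hC
  dt_bound q hq := (hg.dt_bound q hq).trans hC
  dx_bound q hq v := (hg.dx_bound q hq v).trans (by gcongr)
  hess_bound q hq v := (hg.hess_bound q hq v).trans (by gcongr)

lemma mono_set (hg : Tame Q C g) (hQ : Q' ⊆ Q) : Tame Q' C g where
  smooth := hg.smooth.mono hQ
  bound q hq := hg.bound q (hQ hq)
  dt_bound q hq := hg.dt_bound q (hQ hq)
  dx_bound q hq v := hg.dx_bound q (hQ hq) v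
  hess_bound q hq v := hg.hess_bound q (hQ hq) v

lemma const (c : ℝ) (hc : |c| ≤ C) : Tame Q C (fun _ => c) := by
  have h0 : ∀ (c : ℝ) (v : Cn n × ℝ), dirDeriv v (fun _ : Cn n × ℝ => c) = fun _ => 0 :=
    fun c v => by ext p; exact dirDeriv_const c p v
  have hC : 0 ≤ C := (abs_nonneg c).trans hc
  refine ⟨contDiffOn_const, fun _ _ => hc, fun _ _ => ?_, fun _ _ v => ?_, fun _ _ v => ?_⟩
  · rw [h0]; simpa using hC
  · rw [h0]; simp only [abs_zero]; positivity
  · rw [h0, h0]; simp only [abs_zero]; positivity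

lemma add (hQ : IsOpen Q) (hg : Tame Q C g) (hh : Tame Q C' h) :
    Tame Q (C + C') (fun p => g p + h p) := by
  refine ⟨hg.smooth.add hh.smooth, fun q hq => ?_, fun q hq => ?_, fun q hq v => ?_,
    fun q hq v => ?_⟩
  all_goals
    have h1 := hg.smooth.contDiffAt_two hQ hq
    have h2 := hh.smooth.contDiffAt_two hQ hq
  · exact (abs_add_le _ _).trans (add_le_add (hg.bound q hq) (hh.bound q hq))
  · rw [dirDeriv_add_apply (h1.differentiableAt (by simp)) (h2.differentiableAt (by simp))]
    exact (abs_add_le _ _).trans (add_le_add (hg.dt_bound q hq) (hh.dt_bound q hq))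
  · rw [dirDeriv_add_apply (h1.differentiableAt (by simp)) (h2.differentiableAt (by simp)), add_mul]
    exact (abs_add_le _ _).trans (add_le_add (hg.dx_bound q hq v) (hh.dx_bound q hq v))
  · rw [dirDeriv_dirDeriv_add h1 h2, add_mul]
    exact (abs_add_le _ _).trans (add_le_add (hg.hess_bound q hq v) (hh.hess_bound q hq v))

/-- The factor 4 counts the four Leibniz terms of a pure second derivative. -/
lemma mul (hQ : IsOpen Q) (hg : Tame Q C g) (hh : Tame Q C' h) :
    Tame Q (4 * (C * C')) (fun p => g p * h p) := by
  refine ⟨hg.smooth.mul hh.smooth, fun q hq => ?_, fun q hq => ?_, fun q hq v => ?_,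
    fun q hq v => ?_⟩
  all_goals
    have h1 := hg.smooth.contDiffAt_two hQ hq
    have h2 := hh.smooth.contDiffAt_two hQ hq
    have h1' := h1.differentiableAt (by simp)
    have h2' := h2.differentiableAt (by simp)
    have b1 := hg.bound q hq
    have b2 := hh.bound q hq
    have hC : 0 ≤ C := (abs_nonneg _).trans b1
    have hC' : 0 ≤ C' := (abs_nonneg _).trans b2
    have key : ∀ {a b A B : ℝ}, |a| ≤ A → |b| ≤ B → |a * b| ≤ A * B := fun {a b A B} ha hb => by
      rw [abs_mul]; exact mul_le_mul ha hb (abs_nonneg _) ((abs_nonneg _).trans ha)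
  · have := key b1 b2
    have := mul_nonneg hC hC'
    linarith
  · rw [dirDeriv_mul_apply h1' h2']
    have e1 := key b1 (hh.dt_bound q hq)
    have e2 := key b2 (hg.dt_bound q hq)
    have := mul_nonneg hC hC'
    refine (abs_add_le _ _).trans ?_
    linarith
  · rw [dirDeriv_mul_apply h1' h2']
    have e1 := key b1 (hh.dx_bound q hq v)
    have e2 := key b2 (hg.dx_bound q hq v)
    have : 0 ≤ C * C' * ‖v‖ := by positivity
    refine (abs_add_le _ _).trans ?_
    linarith
  · rw [dirDeriv_dirDeriv_mul h1 h2]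
    have e1 := key b1 (hh.hess_bound q hq v)
    have e2 := key b2 (hg.hess_bound q hq v)
    have e3 := key (hg.dx_bound q hq v) (hh.dx_bound q hq v)
    have e4 := key (hh.dx_bound q hq v) (hg.dx_bound q hq v)
    refine (abs_add_le _ _).trans ?_
    have a1 := abs_add_le (g q * dx v (dx v h) q + h q * dx v (dx v g) q) (dx v g q * dx v h q)
    have a2 := abs_add_le (g q * dx v (dx v h) q) (h q * dx v (dx v g) q)
    linarith

lemma const_mul (hQ : IsOpen Q) (hg : Tame Q C g) (c : ℝ) :
    Tame Q (|c| * C) (fun p => c * g p) := by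
  refine ⟨contDiffOn_const.mul hg.smooth, fun q hq => ?_, fun q hq => ?_, fun q hq v => ?_,
    fun q hq v => ?_⟩
  all_goals have h1 := hg.smooth.contDiffAt_two hQ hq
  · rw [abs_mul]; exact mul_le_mul_of_nonneg_left (hg.bound q hq) (abs_nonneg _)
  · rw [dirDeriv_const_mul_apply (h1.differentiableAt (by simp)), abs_mul]
    exact mul_le_mul_of_nonneg_left (hg.dt_bound q hq) (abs_nonneg _)
  · rw [dirDeriv_const_mul_apply (h1.differentiableAt (by simp)), abs_mul, mul_assoc]
    exact mul_le_mul_of_nonneg_left (hg.dx_bound q hq v) (abs_nonneg _)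
  · rw [dirDeriv_dirDeriv_const_mul h1, abs_mul, mul_assoc]
    exact mul_le_mul_of_nonneg_left (hg.hess_bound q hq v) (abs_nonneg _)

lemma sum (hQ : IsOpen Q) {ι : Type*} (s : Finset ι) {C : ι → ℝ} {g : ι → Cn n × ℝ → ℝ}
    (hg : ∀ i ∈ s, Tame Q (C i) (g i)) :
    Tame Q (∑ i ∈ s, C i) (fun p => ∑ i ∈ s, g i p) := by
  classical
  induction s using Finset.induction_on with
  | empty => simpa using (const 0 (by simp) : Tame Q 0 fun _ => (0 : ℝ))
  | insert a s ha ih =>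
    have := (hg a (Finset.mem_insert_self a s)).add hQ
      (ih fun i hi => hg i (Finset.mem_insert_of_mem hi))
    simpa only [Finset.sum_insert ha] using this

lemma nonneg (hg : Tame Q C g) (hQ : Q.Nonempty) : 0 ≤ C := by
  obtain ⟨q, hq⟩ := hQ
  exact (abs_nonneg _).trans (hg.bound q hq)

lemma congr (hQ : IsOpen Q) (hg : Tame Q C g) (hgh : EqOn g h Q) : Tame Q C h := by
  have h1 : ∀ v, EqOn (dirDeriv v g) (dirDeriv v h) Q := fun v => dirDeriv_congr hQ hgh v
  refine ⟨hg.smooth.congr hgh.symm, fun q hq => ?_, fun q hq => ?_, fun q hq v => ?_,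
    fun q hq v => ?_⟩
  · rw [← hgh hq]; exact hg.bound q hq
  · rw [← h1 _ hq]; exact hg.dt_bound q hq
  · rw [← h1 _ hq]; exact hg.dx_bound q hq v
  · rw [← dirDeriv_congr hQ (h1 _) _ hq]; exact hg.hess_bound q hq v

lemma abs_levi_le (hQ : IsOpen Q) (hg : Tame Q C g) {q : Cn n × ℝ} (hq : q ∈ Q) (v : Cn n) :
    |levi (hessForm g q) v| ≤ 2 * C * ‖v‖ ^ 2 := by
  rw [levi_hessForm (hg.smooth.contDiffAt_two hQ hq)]
  have h1 := hg.hess_bound q hq v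
  have h2 := hg.hess_bound q hq (Complex.I • v)
  rw [norm_I_smul] at h2
  refine (abs_add_le _ _).trans ?_
  linarith

lemma abs_heat_le (hQ : IsOpen Q) (hg : Tame Q C g) {q : Cn n × ℝ} (hq : q ∈ Q)
    (w : Fin n → Cn n) : |heat w g q| ≤ C + 2 * C * ∑ k, ‖w k‖ ^ 2 := by
  refine (abs_sub _ _).trans (add_le_add (hg.dt_bound q hq) ?_)
  refine (Finset.abs_sum_le_sum_abs _ _).trans ?_
  rw [Finset.mul_sum]
  exact Finset.sum_le_sum fun k _ => hg.abs_levi_le hQ hq (w k)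

/-- Bounds on coordinate derivatives give a tame function. -/
lemma of_coord (hQ : IsOpen Q) (hg : ContDiffOn ℝ ∞ g Q) (h0 : ∀ q ∈ Q, |g q| ≤ C)
    (ht : ∀ q ∈ Q, |dt g q| ≤ C) (h1 : ∀ q ∈ Q, ∀ p, |dx (coordDir p) g q| ≤ C)
    (h2 : ∀ q ∈ Q, ∀ p p', |dx (coordDir p) (dx (coordDir p') g) q| ≤ C) :
    Tame Q ((2 * n + 1) ^ 2 * C) g := by
  have hn : (0 : ℝ) ≤ n := Nat.cast_nonneg n
  refine ⟨hg, fun q hq => ?_, fun q hq => ?_, fun q hq v => ?_, fun q hq v => ?_⟩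
  all_goals have hC : 0 ≤ C := (abs_nonneg _).trans (h0 q hq)
  · refine (h0 q hq).trans (le_mul_of_one_le_left hC ?_); nlinarith
  · refine (ht q hq).trans (le_mul_of_one_le_left hC ?_); nlinarith
  · refine (abs_dx_le (h1 q hq) v).trans ?_
    gcongr; nlinarith
  · have h3 := abs_hessForm_le (g := g) (q := q) (C := C) (fun p p' => by
      rw [hessForm_apply (hg.contDiffAt_two hQ hq)]; exact h2 q hq p p') v v
    rw [hessForm_apply (hg.contDiffAt_two hQ hq)] at h3
    refine h3.trans ?_
    rw [mul_assoc _ ‖v‖ ‖v‖, ← pow_two]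
    gcongr; linarith

end Tame

end

/-! ### From the parabolic and right-hand-side norms to bounds of derivatives along words. -/

noncomputable section

open Filter Topology

section Words

variable {n : ℕ} {V : Type*} [NormedAddCommGroup V] [NormedSpace ℝ V] {Q : Set V}

/-- Iterated derivative along a word of coordinate directions, `ι` embedding `ℂⁿ` in `V`. -/
def wordDeriv (ι : Cn n → V) (W : List (Fin n × Bool)) (g : V → ℝ) : V → ℝ :=
  W.foldr (fun p h => dirDeriv (ι (coordDir p)) h) g

lemma wordDeriv_contDiffOn (ι : Cn n → V) (hQ : IsOpen Q) {g : V → ℝ} (hg : ContDiffOn ℝ ∞ g Q)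
    (W : List (Fin n × Bool)) : ContDiffOn ℝ ∞ (wordDeriv ι W g) Q := by
  induction W with
  | nil => exact hg
  | cons p W ih => exact dirDeriv_contDiffOn hQ ih _

lemma dirDeriv_wordDeriv_comm (ι : Cn n → V) (hQ : IsOpen Q) {g : V → ℝ}
    (hg : ContDiffOn ℝ ∞ g Q) (v : V) (W : List (Fin n × Bool)) :
    EqOn (dirDeriv v (wordDeriv ι W g)) (wordDeriv ι W (dirDeriv v g)) Q := by
  induction W with
  | nil => exact fun _ _ => rfl
  | cons p W ih =>
    exact (dirDeriv_comm_on hQ (wordDeriv_contDiffOn ι hQ hg W) v _).trans (dirDeriv_congr hQ ih _)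

/-- The norms only contain derivatives taken in one fixed order. Sorting a word of coordinate
directions into that order shows that every word of the same total length is bounded too. -/
lemma exists_mixedDeriv_eq_wordDeriv (ι : Cn n → V) (hQ : IsOpen Q) {g : V → ℝ}
    (hg : ContDiffOn ℝ ∞ g Q) (W : List (Fin n × Bool)) :
    ∃ a b : Fin n → ℕ, ∑ i, a i + ∑ i, b i = W.length ∧
      EqOn (wordDeriv ι W g) (mixedDeriv (fun α => ι (dirX α)) a
        (mixedDeriv (fun α => ι (dirY α)) b g)) Q := by
  induction W with
  | nil => exact ⟨0, 0, by simp, fun q _ => by rw [mixedDeriv_zero, mixedDeriv_zero]; rfl⟩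
  | cons p W ih =>
    obtain ⟨a, b, hab, h⟩ := ih
    obtain ⟨α, c⟩ := p
    have h1 := dirDeriv_congr hQ h (ι (coordDir (α, c)))
    have hs := mixedDeriv_contDiffOn (fun α => ι (dirY α)) b hQ hg
    cases c with
    | false =>
      refine ⟨Function.update a α (a α + 1), b, ?_, ?_⟩
      · rw [sum_update, List.length_cons, ← hab]; ring
      · exact h1.trans (mixedDeriv_update (fun α => ι (dirX α)) a hQ hs α)
    | true =>
      refine ⟨a, Function.update b α (b α + 1), ?_, ?_⟩
      · rw [sum_update, List.length_cons, ← hab]; ring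
      · exact h1.trans ((dirDeriv_mixedDeriv_comm (fun α => ι (dirX α)) a hQ hs _).trans
          (mixedDeriv_congr _ a hQ (mixedDeriv_update (fun α => ι (dirY α)) b hQ hg α)))

end Words

/-- Embedding of space directions in space-time. -/
def spaceDir {n : ℕ} (v : Cn n) : Cn n × ℝ := (v, (0 : ℝ))

lemma mem_boundedMultiIndices {n k : ℕ} {a : Fin n → ℕ} (h : ∑ i, a i ≤ k) :
    a ∈ boundedMultiIndices n k := by
  rw [boundedMultiIndices, Fintype.mem_piFinset]
  intro i
  rw [Finset.mem_range, Nat.lt_succ_iff]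
  exact (Finset.single_le_sum (f := a) (fun _ _ => Nat.zero_le _) (Finset.mem_univ i)).trans h

lemma abs_le_of_enorm_le {x : ℝ} {C : ℝ≥0} (h : ‖x‖ₑ ≤ C) : |x| ≤ C := by
  rw [enorm_eq_nnnorm, ENNReal.coe_le_coe, ← NNReal.coe_le_coe] at h
  simpa using h

lemma abs_wordDeriv_le_of_parabolicCkNorm {n k : ℕ} {Ω : Set (Cn n)} (hΩ : IsOpen Ω) {T : ℝ}
    {φ : Cn n × ℝ → ℝ} (hφ : ContDiffOn ℝ ∞ φ (Ω ×ˢ Ioo 0 T)) {C : ℝ≥0}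
    (hC : parabolicCkNorm k Ω T φ ≤ C) (W : List (Fin n × Bool)) (l : ℕ)
    (hW : W.length + 2 * l ≤ k) {q : Cn n × ℝ} (hq : q ∈ Ω ×ˢ Ioo 0 T) :
    |wordDeriv spaceDir W ((dirDeriv ((0 : Cn n), (1 : ℝ)))^[l] φ) q| ≤ C := by
  have hQ : IsOpen (Ω ×ˢ Ioo 0 T) := hΩ.prod isOpen_Ioo
  obtain ⟨a, b, hab, h⟩ := exists_mixedDeriv_eq_wordDeriv spaceDir hQ
    (iterate_dirDeriv_contDiffOn hQ hφ ((0 : Cn n), (1 : ℝ)) l) W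
  rw [h hq]
  refine abs_le_of_enorm_le (le_trans ?_ hC)
  unfold parabolicCkNorm
  have hmem : (a, b, l) ∈ (boundedMultiIndices n k ×ˢ boundedMultiIndices n k ×ˢ
      Finset.range (k + 1)).filter
      (fun q => ∑ i, q.1 i + ∑ i, q.2.1 i + 2 * q.2.2 ≤ k) := by
    rw [Finset.mem_filter, Finset.mem_product, Finset.mem_product]
    refine ⟨⟨mem_boundedMultiIndices (by simp only; omega), mem_boundedMultiIndices (by simp only; omega), ?_⟩,
      by simp only; omega⟩
    rw [Finset.mem_range]; simp only; omega
  refine le_trans ?_ (Finset.single_le_sum (fun _ _ => zero_le) hmem)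
  exact le_iSup₂_of_le q hq le_rfl

/-- Space and time derivatives of functions bounded in the parabolic norm are tame. -/
lemma tame_wordDeriv {n : ℕ} {Ω : Set (Cn n)} (hΩ : IsOpen Ω) {T : ℝ}
    {φ : Cn n × ℝ → ℝ} (hφ : ContDiffOn ℝ ∞ φ (Ω ×ˢ Ioo 0 T)) {C : ℝ≥0}
    (hC : parabolicCkNorm 4 Ω T φ ≤ C) (W : List (Fin n × Bool)) (hW : W.length ≤ 2) :
    Tame (Ω ×ˢ Ioo 0 T) ((2 * n + 1) ^ 2 * C) (wordDeriv spaceDir W φ) := by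
  have hQ : IsOpen (Ω ×ˢ Ioo 0 T) := hΩ.prod isOpen_Ioo
  refine Tame.of_coord hQ (wordDeriv_contDiffOn _ hQ hφ W) (fun q hq => ?_) (fun q hq => ?_)
    (fun q hq p => ?_) (fun q hq p p' => ?_)
  · exact abs_wordDeriv_le_of_parabolicCkNorm hΩ hφ hC W 0 (by omega) hq
  -- A time derivative has weight 2, so on top of a word of length at most 2 it just fits into the
  -- order 4.
  · rw [dirDeriv_wordDeriv_comm _ hQ hφ _ W hq]
    exact abs_wordDeriv_le_of_parabolicCkNorm hΩ hφ hC W 1 (by omega) hq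
  · exact abs_wordDeriv_le_of_parabolicCkNorm hΩ hφ hC (p :: W) 0
      (by simp only [List.length_cons]; omega) hq
  · exact abs_wordDeriv_le_of_parabolicCkNorm hΩ hφ hC (p :: p' :: W) 0
      (by simp only [List.length_cons]; omega) hq

/-- The space-time-value domain of the right hand side. -/
abbrev RhsSpace (n : ℕ) := ℝ × Cn n × ℝ

/-- Embedding of space directions in the domain of the right hand side. -/
def rhsSpaceDir {n : ℕ} (v : Cn n) : RhsSpace n := ((0 : ℝ), v, (0 : ℝ))

lemma abs_deriv_le_of_rhsCkNorm {n k : ℕ} {Ω : Set (Cn n)} (hΩ : IsOpen Ω) {T : ℝ}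
    {f : RhsSpace n → ℝ} (hf : ContDiffOn ℝ ∞ f (Ioo 0 T ×ˢ Ω ×ˢ univ)) {C : ℝ≥0}
    (hC : rhsCkNorm k Ω T f ≤ C) (j : ℕ) (W : List (Fin n × Bool)) (l : ℕ)
    (hW : j + W.length + l ≤ k) {q : RhsSpace n} (hq : q ∈ Ioo 0 T ×ˢ Ω ×ˢ (univ : Set ℝ)) :
    |(dirDeriv ((1 : ℝ), (0 : Cn n), (0 : ℝ)))^[j] (wordDeriv rhsSpaceDir W
      ((dirDeriv ((0 : ℝ), (0 : Cn n), (1 : ℝ)))^[l] f)) q| ≤ C := by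
  have hQ : IsOpen (Ioo 0 T ×ˢ Ω ×ˢ (univ : Set ℝ)) := isOpen_Ioo.prod (hΩ.prod isOpen_univ)
  obtain ⟨a, b, hab, h⟩ := exists_mixedDeriv_eq_wordDeriv rhsSpaceDir hQ
    (iterate_dirDeriv_contDiffOn hQ hf ((0 : ℝ), (0 : Cn n), (1 : ℝ)) l) W
  rw [iterate_dirDeriv_congr hQ h _ j hq]
  refine abs_le_of_enorm_le (le_trans ?_ hC)
  unfold rhsCkNorm
  have hmem : (j, a, b, l) ∈ (Finset.range (k + 1) ×ˢ boundedMultiIndices n k ×ˢ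
        boundedMultiIndices n k ×ˢ Finset.range (k + 1)).filter
      (fun q => q.1 + (∑ i, q.2.1 i + ∑ i, q.2.2.1 i) + q.2.2.2 ≤ k) := by
    rw [Finset.mem_filter, Finset.mem_product, Finset.mem_product, Finset.mem_product]
    refine ⟨⟨?_, mem_boundedMultiIndices (by simp only; omega),
      mem_boundedMultiIndices (by simp only; omega), ?_⟩, by simp only; omega⟩
    all_goals rw [Finset.mem_range]; simp only; omega
  refine le_trans ?_ (Finset.single_le_sum (fun _ _ => zero_le) hmem)
  exact le_iSup₂_of_le q hq le_rfl

end

/-! ### Quantitative geometry of the domain and its boundary. -/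

noncomputable section

open Filter Topology

/-- A function of the space variable as a function on space-time. -/
def liftFn {n : ℕ} (h : Cn n → ℝ) : Cn n × ℝ → ℝ := fun q => h q.1

lemma dirDeriv_liftFn {n : ℕ} {h : Cn n → ℝ} {q : Cn n × ℝ} (hh : DifferentiableAt ℝ h q.1)
    (v : Cn n) (s : ℝ) : dirDeriv (v, s) (liftFn h) q = dirDeriv v h q.1 := by
  have h1 : HasFDerivAt (liftFn h) ((fderiv ℝ h q.1).comp (ContinuousLinearMap.fst ℝ (Cn n) ℝ)) q :=
    hh.hasFDerivAt.comp q hasFDerivAt_fst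
  simp [dirDeriv, h1.fderiv]

lemma dirDeriv_slice {n : ℕ} {g : Cn n × ℝ → ℝ} {z : Cn n} {t : ℝ}
    (hg : DifferentiableAt ℝ g (z, t)) (v : Cn n) :
    dirDeriv v (fun w => g (w, t)) z = dx v g (z, t) := by
  have h1 : HasFDerivAt (fun w : Cn n => (w, t)) (ContinuousLinearMap.inl ℝ (Cn n) ℝ) z :=
    hasFDerivAt_prodMk_left z t
  have h2 := hg.hasFDerivAt.comp z h1
  have h3 : HasFDerivAt (fun w => g (w, t))
    ((fderiv ℝ g (z, t)).comp (ContinuousLinearMap.inl ℝ (Cn n) ℝ)) z := h2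
  simp [dirDeriv, h3.fderiv]

lemma dirDeriv_dirDeriv_slice {n : ℕ} {g : Cn n × ℝ → ℝ} {z : Cn n} {t : ℝ}
    (hg : ContDiffAt ℝ 2 g (z, t)) (v w : Cn n) :
    dirDeriv v (dirDeriv w (fun y => g (y, t))) z = dx v (dx w g) (z, t) := by
  have hc : Tendsto (fun y : Cn n => (y, t)) (𝓝 z) (𝓝 (z, t)) :=
    (Continuous.prodMk_left t).tendsto z
  have : dirDeriv w (fun y => g (y, t)) =ᶠ[𝓝 z] fun y => dx w g (y, t) := by
    filter_upwards [hc.eventually hg.eventually_differentiableAt] with y hy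
    exact dirDeriv_slice hy w
  rw [this.dirDeriv_eq, dirDeriv_slice (hg.differentiableAt_dirDeriv _)]

lemma complexHessian_slice {n : ℕ} {g : Cn n × ℝ → ℝ} {z : Cn n} {t : ℝ}
    (hg : ContDiffAt ℝ 2 g (z, t)) :
    complexHessian (fun w => g (w, t)) z = leviMatrix (hessForm g (z, t)) := by
  ext α β
  rw [leviMatrix_apply]
  simp only [complexHessian, Matrix.of_apply, dirDeriv_dirDeriv_slice hg, hessForm_apply hg]

lemma wordDeriv_liftFn {n : ℕ} {W : Set (Cn n)} (hW : IsOpen W) {h : Cn n → ℝ}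
    (hh : ContDiffOn ℝ ∞ h W) (L : List (Fin n × Bool)) :
    EqOn (wordDeriv spaceDir L (liftFn h)) (liftFn (wordDeriv id L h)) (W ×ˢ univ) := by
  induction L with
  | nil => exact fun _ _ => rfl
  | cons p L ih =>
    intro q hq
    have h1 := dirDeriv_congr (hW.prod isOpen_univ) ih (spaceDir (coordDir p)) hq
    have h2 : DifferentiableAt ℝ (wordDeriv id L h) q.1 :=
      ((wordDeriv_contDiffOn id hW hh L).contDiffAt_two hW hq.1).differentiableAt (by simp)
    exact h1.trans (dirDeriv_liftFn h2 _ _)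

/-- Quantitative data of a strictly pseudoconvex domain with defining function `ρ`. -/
structure Geometry {n : ℕ} (Ω W : Set (Cn n)) (ρ : Cn n → ℝ) (r R κ C₀ : ℝ) : Prop where
  isOpen : IsOpen Ω
  nonempty : Ω.Nonempty
  isOpen_nbhd : IsOpen W
  r_pos : 0 < r
  κ_pos : 0 < κ
  ball_subset : ∀ p ∈ closure Ω, Metric.ball p r ⊆ W
  norm_le : ∀ z ∈ W, ‖z‖ ≤ R
  smooth : ContDiffOn ℝ ∞ ρ W
  eq_sublevel : Ω = {z | z ∈ W ∧ ρ z < 0}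
  levi_ge : ∀ z ∈ closure Ω, ∀ t v, κ * ‖v‖ ^ 2 ≤ levi (hessForm (liftFn ρ) (z, t)) v
  grad_ge : ∀ p ∈ frontier Ω, ∀ t, κ ≤ ‖gradForm (liftFn ρ) (p, t)‖
  tame : ∀ L : List (Fin n × Bool), L.length ≤ 2 →
    Tame (W ×ˢ univ) C₀ (wordDeriv spaceDir L (liftFn ρ))

lemma liftFn_contDiffOn {n : ℕ} {W : Set (Cn n)} {h : Cn n → ℝ} (hh : ContDiffOn ℝ ∞ h W) :
    ContDiffOn ℝ ∞ (liftFn h) (W ×ˢ univ) :=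
  hh.comp contDiff_fst.contDiffOn fun _ hq => hq.1

/-- Everything is compactness. W is a thickening of the closure of Ω whose closed thickening still
lies in the given neighbourhood, which bounds the derivatives of ρ on W. The constant κ comes from
the minima of the Levi form on unit vectors over the closure of Ω and of the norm of dρ on the
boundary. -/
lemma exists_geometry {n : ℕ} {Ω : Set (Cn n)} (hΩ : IsBoundedSmoothStrictlyPseudoconvex Ω) :
    ∃ (W : Set (Cn n)) (ρ : Cn n → ℝ) (r R κ C₀ : ℝ), Geometry Ω W ρ r R κ C₀ := by
  obtain ⟨hopen, hconn, U, ρ, hU, hUb, hΩU, hρ, hpsh, heq, hreg⟩ := hΩ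
  have hΩb : Bornology.IsBounded Ω := hUb.subset (subset_closure.trans hΩU)
  have hcomp : IsCompact (closure Ω) := hΩb.isCompact_closure
  obtain ⟨δ, hδ, hδU⟩ := hcomp.exists_cthickening_subset_open hU hΩU
  set W := Metric.thickening δ (closure Ω) with hW
  have hWo : IsOpen W := Metric.isOpen_thickening
  have hWU : W ⊆ U := (Metric.thickening_subset_cthickening _ _).trans hδU
  have hΩW : closure Ω ⊆ W := Metric.self_subset_thickening hδ _
  have hKc : IsCompact (Metric.cthickening δ (closure Ω)) :=
    Metric.isCompact_of_isClosed_isBounded Metric.isClosed_cthickening (hUb.subset hδU)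
  obtain ⟨R, hR⟩ := hUb.exists_norm_le
  have hρW := hρ.mono hWU
  have hlift := liftFn_contDiffOn hρ
  have hUo : IsOpen (U ×ˢ (univ : Set ℝ)) := hU.prod isOpen_univ
  have hC2 : ∀ z ∈ U, ∀ t : ℝ, ContDiffAt ℝ 2 (liftFn ρ) (z, t) := fun z hz t =>
    hlift.contDiffAt_two hUo ⟨hz, mem_univ _⟩
  have hhess : ∀ z ∈ U, ∀ t v w, hessForm (liftFn ρ) (z, t) v w = dirDeriv v (dirDeriv w ρ) z :=
    fun z hz t v w => by
      rw [hessForm_apply (hC2 z hz t), ← dirDeriv_dirDeriv_slice (hC2 z hz t)]; rfl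
  have hgrad : ∀ z ∈ U, ∀ t v, gradForm (liftFn ρ) (z, t) v = fderiv ℝ ρ z v :=
    fun z hz t v => by
      rw [gradForm_apply, ← dirDeriv_slice ((hC2 z hz t).differentiableAt (by simp))]; rfl
  -- the Levi form
  have hcont : ∀ v w : Cn n, ContinuousOn (dirDeriv v (dirDeriv w ρ)) U := fun v w =>
    (dirDeriv_contDiffOn hU (dirDeriv_contDiffOn hU hρ w) v).continuousOn
  have hhc : ContinuousOn (fun z => hessForm (liftFn ρ) (z, 0)) U := by
    rw [continuousOn_clm_apply]; intro v
    rw [continuousOn_clm_apply]; intro w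
    exact (hcont v w).congr fun z hz => hhess z hz 0 v w
  have hlc : ContinuousOn (fun x : Cn n × Cn n => levi (hessForm (liftFn ρ) (x.1, 0)) x.2)
      (closure Ω ×ˢ Metric.sphere 0 1) := by
    have h1 : ContinuousOn (fun x : Cn n × Cn n => hessForm (liftFn ρ) (x.1, 0))
        (closure Ω ×ˢ Metric.sphere 0 1) :=
      hhc.comp continuousOn_fst fun x hx => hΩU hx.1
    have h2 : ContinuousOn (fun x : Cn n × Cn n => x.2) (closure Ω ×ˢ Metric.sphere 0 1) :=
      continuousOn_snd
    have h3 : ContinuousOn (fun x : Cn n × Cn n => Complex.I • x.2)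
      (closure Ω ×ˢ Metric.sphere 0 1) := h2.const_smul Complex.I
    exact ((h1.clm_apply h2).clm_apply h2).add ((h1.clm_apply h3).clm_apply h3)
  obtain ⟨κ₁, hκ₁, hκ₁'⟩ := (hcomp.prod (isCompact_sphere (0 : Cn n) 1)).exists_forall_le' hlc
    (a := 0) (fun x hx => by
      have hz := hΩU hx.1
      have := hpsh x.1 hz
      have h2 := complexHessian_slice (hC2 x.1 hz 0)
      rw [show (fun w => liftFn ρ (w, (0 : ℝ))) = ρ from rfl] at h2
      rw [h2] at this
      refine (leviMatrix_posDef_iff fun v w => hessForm_symm (hC2 x.1 hz 0) v w).mp this x.2 ?_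
      intro h0
      have := hx.2
      rw [h0] at this; simp at this)
  have hfr : IsCompact (frontier Ω) := hcomp.of_isClosed_subset isClosed_frontier
    frontier_subset_closure
  have hgc : ContinuousOn (fun z => ‖gradForm (liftFn ρ) (z, 0)‖) (frontier Ω) := by
    refine ContinuousOn.norm ?_
    rw [continuousOn_clm_apply]; intro v
    exact ((dirDeriv_contDiffOn hU hρ v).continuousOn.mono
      (frontier_subset_closure.trans hΩU)).congr
      fun z hz => hgrad z (hΩU (frontier_subset_closure hz)) 0 v
  obtain ⟨κ₂, hκ₂, hκ₂'⟩ := hfr.exists_forall_le' hgc (a := 0) (fun z hz => by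
    rw [norm_pos_iff]
    intro h0
    apply hreg z hz
    ext v
    rw [← hgrad z (hΩU (frontier_subset_closure hz)) 0 v, h0])
  -- bounds on derivatives
  have hbd : ∀ L : List (Fin n × Bool), ∃ C, ∀ z ∈ W, |wordDeriv id L ρ z| ≤ C := fun L => by
    obtain ⟨C, hC⟩ := hKc.exists_bound_of_continuousOn
      ((wordDeriv_contDiffOn id hU hρ L).continuousOn.mono hδU)
    exact ⟨C, fun z hz => hC z (Metric.thickening_subset_cthickening _ _ hz)⟩
  choose C hC using hbd
  -- There are finitely many words of length at most 4. This length is needed because tameness of a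
  -- derivative along two directions involves two more.
  obtain ⟨M, hM⟩ := ((List.finite_length_le (Fin n × Bool) 4).image C).bddAbove
  have hCM : ∀ L : List (Fin n × Bool), L.length ≤ 4 → ∀ q ∈ W ×ˢ (univ : Set ℝ),
      |wordDeriv spaceDir L (liftFn ρ) q| ≤ M := fun L hL q hq => by
    rw [wordDeriv_liftFn hWo hρW L hq]
    exact (hC L q.1 hq.1).trans (hM ⟨L, hL, rfl⟩)
  have hliftW := liftFn_contDiffOn hρW
  have hWo' : IsOpen (W ×ˢ (univ : Set ℝ)) := hWo.prod isOpen_univ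
  obtain ⟨z₀, hz₀⟩ := hconn.nonempty
  refine ⟨W, ρ, δ, R, min κ₁ κ₂, (2 * n + 1) ^ 2 * M, ⟨hopen, hconn.nonempty, hWo, hδ,
    lt_min hκ₁ hκ₂, ?_, fun z hz => hR z (hWU hz), hρW, ?_, ?_, ?_, ?_⟩⟩
  · intro p hp z hz
    exact Metric.mem_thickening_iff.mpr ⟨p, hp, hz⟩
  · ext z
    constructor
    · intro hz
      exact ⟨hΩW (subset_closure hz), by rw [heq] at hz; exact hz.2⟩
    · rintro ⟨h1, h2⟩
      rw [heq]; exact ⟨hWU h1, h2⟩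
  · intro z hz t v
    have h0 : levi (hessForm (liftFn ρ) (z, t)) v = levi (hessForm (liftFn ρ) (z, 0)) v := by
      simp only [levi, hhess z (hΩU hz)]
    rw [h0]
    rcases eq_or_ne v 0 with rfl | hv
    · simp [levi]
    have hv' := norm_pos_iff.mpr hv
    have h1 := hκ₁' (z, ‖v‖⁻¹ • v) ⟨hz, by
      rw [mem_sphere_zero_iff_norm, norm_smul, norm_inv, norm_norm, inv_mul_cancel₀ hv'.ne']⟩
    simp only [levi_real_smul] at h1
    have h2 : κ₁ * ‖v‖ ^ 2 ≤ levi (hessForm (liftFn ρ) (z, 0)) v := by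
      have := mul_le_mul_of_nonneg_right h1 (sq_nonneg ‖v‖)
      refine this.trans_eq ?_
      field_simp
    exact (mul_le_mul_of_nonneg_right (min_le_left _ _) (sq_nonneg _)).trans h2
  · intro p hp t
    have h0 : gradForm (liftFn ρ) (p, t) = gradForm (liftFn ρ) (p, 0) := by
      ext v
      rw [hgrad p (hΩU (frontier_subset_closure hp)), hgrad p (hΩU (frontier_subset_closure hp))]
    rw [h0]
    exact (min_le_right _ _).trans (hκ₂' p hp)
  · intro L hL
    refine Tame.of_coord hWo' (wordDeriv_contDiffOn _ hWo' hliftW L) (fun q hq => ?_)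
      (fun q hq => ?_) (fun q hq p => ?_) (fun q hq p p' => ?_)
    · exact hCM L (by omega) q hq
    · rw [dirDeriv_congr hWo' (wordDeriv_liftFn hWo hρW L) _ hq, dirDeriv_liftFn]
      · have : (0 : ℝ) ≤ M := (abs_nonneg _).trans (hCM [] (by simp) (z₀, 0)
          ⟨hΩW (subset_closure hz₀), mem_univ _⟩)
        simpa [dirDeriv] using this
      · exact ((wordDeriv_contDiffOn id hWo hρW L).contDiffAt_two hWo hq.1).differentiableAt
          (by simp)
    · exact hCM (p :: L) (by simp only [List.length_cons]; omega) q hq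
    · exact hCM (p :: p' :: L) (by simp only [List.length_cons]; omega) q hq

namespace Geometry

variable {n : ℕ} {Ω W : Set (Cn n)} {ρ : Cn n → ℝ} {r R κ C₀ : ℝ}

lemma closure_subset (hG : Geometry Ω W ρ r R κ C₀) : closure Ω ⊆ W := fun p hp =>
  hG.ball_subset p hp (Metric.mem_ball_self hG.r_pos)

lemma isBounded (hG : Geometry Ω W ρ r R κ C₀) : Bornology.IsBounded Ω :=
  (isBounded_iff_forall_norm_le.mpr ⟨R, hG.norm_le⟩).subset (subset_closure.trans hG.closure_subset)

lemma isCompact_closure (hG : Geometry Ω W ρ r R κ C₀) : IsCompact (closure Ω) :=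
  hG.isBounded.isCompact_closure

lemma isCompact_frontier (hG : Geometry Ω W ρ r R κ C₀) : IsCompact (frontier Ω) :=
  hG.isCompact_closure.of_isClosed_subset isClosed_frontier frontier_subset_closure

lemma contDiffAt (hG : Geometry Ω W ρ r R κ C₀) {z : Cn n} (hz : z ∈ W) (t : ℝ) :
    ContDiffAt ℝ 2 (liftFn ρ) (z, t) :=
  (liftFn_contDiffOn hG.smooth).contDiffAt_two (hG.isOpen_nbhd.prod isOpen_univ) ⟨hz, mem_univ _⟩

lemma hasFDerivAt (hG : Geometry Ω W ρ r R κ C₀) {z : Cn n} (hz : z ∈ W) (t : ℝ) :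
    HasFDerivAt ρ (gradForm (liftFn ρ) (z, t)) z := by
  have h := (hG.smooth.contDiffAt_two hG.isOpen_nbhd hz).differentiableAt (by simp)
  have h2 : gradForm (liftFn ρ) (z, t) = fderiv ℝ ρ z := by
    ext v
    rw [gradForm_apply, dirDeriv_liftFn (q := (z, t)) h]; rfl
  rw [h2]; exact h.hasFDerivAt

lemma neg_of_mem (hG : Geometry Ω W ρ r R κ C₀) {z : Cn n} (hz : z ∈ Ω) : ρ z < 0 := by
  rw [hG.eq_sublevel] at hz; exact hz.2

lemma eq_zero (hG : Geometry Ω W ρ r R κ C₀) {p : Cn n} (hp : p ∈ frontier Ω) : ρ p = 0 := by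
  have hc : ContinuousOn ρ (closure Ω) := hG.smooth.continuousOn.mono hG.closure_subset
  refine le_antisymm ?_ ?_
  · exact le_on_closure (fun z hz => (hG.neg_of_mem hz).le) hc continuousOn_const
      (frontier_subset_closure hp)
  · by_contra! h
    rw [hG.isOpen.frontier_eq] at hp
    apply hp.2
    rw [hG.eq_sublevel]
    exact ⟨hG.closure_subset hp.1, h⟩

lemma nonpos (hG : Geometry Ω W ρ r R κ C₀) {z : Cn n} (hz : z ∈ closure Ω) : ρ z ≤ 0 := by
  by_cases h : z ∈ Ω
  · exact (hG.neg_of_mem h).le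
  · exact (hG.eq_zero (by rw [hG.isOpen.frontier_eq]; exact ⟨hz, h⟩)).le

lemma exists_inward (hG : Geometry Ω W ρ r R κ C₀) {p : Cn n} (hp : p ∈ frontier Ω) (t : ℝ) :
    ∃ v, gradForm (liftFn ρ) (p, t) v < 0 := by
  have h1 : gradForm (liftFn ρ) (p, t) ≠ 0 := by
    intro h
    have := hG.grad_ge p hp t
    rw [h, norm_zero] at this
    exact absurd hG.κ_pos (not_lt.mpr this)
  obtain ⟨v, hv⟩ : ∃ v, gradForm (liftFn ρ) (p, t) v ≠ 0 := by
    by_contra! h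
    exact h1 (ContinuousLinearMap.ext h)
  rcases lt_or_gt_of_ne hv with h | h
  · exact ⟨v, h⟩
  · exact ⟨-v, by rw [map_neg]; linarith⟩

lemma hasDerivAt_line (hG : Geometry Ω W ρ r R κ C₀) {p : Cn n} (hp : p ∈ W) (t : ℝ) (v : Cn n) :
    HasDerivAt (fun s : ℝ => ρ (p + s • v)) (gradForm (liftFn ρ) (p, t) v) 0 := by
  have h1 : HasDerivAt (fun s : ℝ => p + s • v) v 0 := by
    simpa using ((hasDerivAt_id (0 : ℝ)).smul_const v).const_add p
  have h2 : HasFDerivAt ρ (gradForm (liftFn ρ) (p, t)) (p + (0 : ℝ) • v) := by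
    simpa using hG.hasFDerivAt hp t
  exact h2.comp_hasDerivAt 0 h1

lemma eventually_mem (hG : Geometry Ω W ρ r R κ C₀) {p : Cn n} (hp : p ∈ frontier Ω) {t : ℝ}
    {v : Cn n} (hv : gradForm (liftFn ρ) (p, t) v < 0) :
    ∀ᶠ s : ℝ in 𝓝[>] 0, p + s • v ∈ Ω := by
  have hpW := hG.closure_subset (frontier_subset_closure hp)
  have h1 := hG.hasDerivAt_line hpW t v
  rw [hasDerivAt_iff_tendsto_slope] at h1
  have h2 := h1.mono_left (nhdsWithin_mono (0 : ℝ) fun x (hx : x ∈ Ioi 0) => ne_of_gt hx)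
  have h3 := h2.eventually (gt_mem_nhds hv)
  have hc : Tendsto (fun s : ℝ => p + s • v) (𝓝[>] 0) (𝓝 p) := by
    have : Continuous fun s : ℝ => p + s • v := by fun_prop
    simpa using (this.tendsto 0).mono_left nhdsWithin_le_nhds
  filter_upwards [h3, hc.eventually (hG.isOpen_nbhd.mem_nhds hpW), self_mem_nhdsWithin]
    with s hs hsW hs0
  rw [hG.eq_sublevel]
  refine ⟨hsW, ?_⟩
  rw [slope_def_field] at hs
  have hs0' : (0 : ℝ) < s := hs0
  simp only [zero_smul, add_zero, sub_zero, hG.eq_zero hp] at hs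
  by_contra! h
  exact absurd hs (not_lt.mpr (div_nonneg h hs0'.le))

/-- At a boundary point every v with dρ(v) < 0 enters Ω and so lies in the tangent cone. These v
form a nonempty open half-space, which spans. -/
lemma uniqueDiffOn (hG : Geometry Ω W ρ r R κ C₀) : UniqueDiffOn ℝ (closure Ω) := by
  intro p hp
  refine ⟨?_, subset_closure hp⟩
  suffices h : Submodule.span ℝ (tangentConeAt ℝ (closure Ω) p) = ⊤ by
    rw [h]; simp
  by_cases hpΩ : p ∈ Ω
  · rw [tangentConeAt_of_mem_nhds (mem_of_superset (hG.isOpen.mem_nhds hpΩ) subset_closure)]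
    simp
  have hpf : p ∈ frontier Ω := by rw [hG.isOpen.frontier_eq]; exact ⟨hp, hpΩ⟩
  apply Submodule.eq_top_of_nonempty_interior'
  obtain ⟨v, hv⟩ := hG.exists_inward hpf 0
  refine ⟨v, mem_interior.mpr ⟨{v | gradForm (liftFn ρ) (p, 0) v < 0}, ?_, ?_, hv⟩⟩
  · intro w hw
    refine Submodule.subset_span ?_
    refine mem_tangentConeAt_of_add_smul_mem (l := 𝓝[>] (0 : ℝ)) (c := id)
      (tendsto_id'.mpr (nhdsWithin_mono _ fun x (hx : x ∈ Ioi 0) => ne_of_gt hx)) ?_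
    filter_upwards [hG.eventually_mem hpf hw] with s hs
    exact subset_closure hs
  · exact isOpen_lt (gradForm (liftFn ρ) (p, 0)).continuous continuous_const

/-- One-sided bound of a boundary derivative by a barrier. -/
lemma deriv_le_of_barrier (hG : Geometry Ω W ρ r R κ C₀) {p : Cn n} (hp : p ∈ frontier Ω) {t : ℝ}
    {g : Cn n → ℝ} {g' : Cn n →L[ℝ] ℝ} (hg : HasFDerivWithinAt g g' (closure Ω) p)
    {K A B : ℝ} {v : Cn n} (hv : gradForm (liftFn ρ) (p, t) v < 0)
    (h : ∀ᶠ s : ℝ in 𝓝[>] 0, g (p + s • v) - g p ≤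
      K * ‖s • v‖ ^ 2 - A * ρ (p + s • v) + B * ‖s • v‖) :
    g' v ≤ -A * gradForm (liftFn ρ) (p, t) v + B * ‖v‖ := by
  have hpW := hG.closure_subset (frontier_subset_closure hp)
  set S : Set ℝ := {s | p + s • v ∈ closure Ω} with hS
  have h1 : HasDerivWithinAt (fun s : ℝ => p + s • v) v S 0 := by
    have : HasDerivAt (fun s : ℝ => p + s • v) v 0 := by
      simpa using ((hasDerivAt_id (0 : ℝ)).smul_const v).const_add p
    exact this.hasDerivWithinAt
  have h2 : HasDerivWithinAt (fun s : ℝ => g (p + s • v)) (g' v) S 0 := by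
    refine HasFDerivWithinAt.comp_hasDerivWithinAt (t := closure Ω) (0 : ℝ) ?_ h1 fun s hs => hs
    simpa using hg
  have hmem : S ∈ 𝓝[>] (0 : ℝ) := by
    filter_upwards [hG.eventually_mem hp hv] with s hs
    exact subset_closure hs
  have h3 : HasDerivWithinAt (fun s : ℝ => g (p + s • v)) (g' v) (Ioi 0) 0 :=
    h2.mono_of_mem_nhdsWithin hmem
  rw [hasDerivWithinAt_iff_tendsto_slope' (by simp)] at h3
  have h4 := hG.hasDerivAt_line hpW t v
  rw [hasDerivAt_iff_tendsto_slope] at h4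
  have h5 := h4.mono_left (nhdsWithin_mono (0 : ℝ) fun x (hx : x ∈ Ioi 0) => ne_of_gt hx)
  have h6 : Tendsto (fun s : ℝ => s) (𝓝[>] 0) (𝓝 0) := nhdsWithin_le_nhds
  -- After division by s the quadratic term of the barrier tends to zero, while ρ contributes its
  -- derivative since ρ(p) = 0.
  have h7 : Tendsto (fun s : ℝ => K * ‖v‖ ^ 2 * s - A * slope (fun s : ℝ => ρ (p + s • v)) 0 s
      + B * ‖v‖) (𝓝[>] 0)
      (𝓝 (K * ‖v‖ ^ 2 * 0 - A * gradForm (liftFn ρ) (p, t) v + B * ‖v‖)) :=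
    ((h6.const_mul _).sub (h5.const_mul A)).add_const _
  have h8 := le_of_tendsto_of_tendsto h3 h7 (by
    filter_upwards [h, self_mem_nhdsWithin] with s hs hs0
    have hs0' : (0 : ℝ) < s := hs0
    simp only [slope_def_field, zero_smul, add_zero, sub_zero, hG.eq_zero hp]
    rw [norm_smul, Real.norm_of_nonneg hs0'.le] at hs
    rw [div_le_iff₀ hs0']
    refine hs.trans_eq ?_
    field_simp)
  linarith

/-- Two-sided bound of a boundary derivative by a barrier. -/
lemma abs_deriv_le_of_barrier (hG : Geometry Ω W ρ r R κ C₀) {p : Cn n} (hp : p ∈ frontier Ω)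
    {t : ℝ} {g : Cn n → ℝ} {g' : Cn n →L[ℝ] ℝ} (hg : HasFDerivWithinAt g g' (closure Ω) p)
    {K A : ℝ} (hgp : g p = 0) (h : ∀ z ∈ Ω, |g z| ≤ K * ‖z - p‖ ^ 2 - A * ρ z) (v : Cn n) :
    |g' v| ≤ A * |gradForm (liftFn ρ) (p, t) v| := by
  have hin : ∀ v, gradForm (liftFn ρ) (p, t) v < 0 →
      |g' v| ≤ -A * gradForm (liftFn ρ) (p, t) v := by
    intro v hv
    have e1 : ∀ᶠ s : ℝ in 𝓝[>] 0, |g (p + s • v)| ≤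
        K * ‖s • v‖ ^ 2 - A * ρ (p + s • v) := by
      filter_upwards [hG.eventually_mem hp hv] with s hs
      simpa using h _ hs
    have h1 := hG.deriv_le_of_barrier hp hg (K := K) (A := A) (B := 0) hv (by
      filter_upwards [e1] with s hs
      have := le_abs_self (g (p + s • v)); linarith)
    have h2 := hG.deriv_le_of_barrier hp hg.neg (K := K) (A := A) (B := 0) hv (by
      filter_upwards [e1] with s hs
      simp only [Pi.neg_apply]
      have := neg_abs_le (g (p + s • v)); linarith)
    rw [abs_le]
    simp only [neg_apply] at h2
    constructor <;> linarith
  rcases lt_trichotomy (gradForm (liftFn ρ) (p, t) v) 0 with hv | hv | hv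
  · rw [abs_of_neg hv]
    have := hin v hv; linarith
  -- A tangential v need not enter Ω along its ray. It is the limit of the inward vectors v + ε v₀,
  -- for which the bound tends to 0.
  · rw [hv, abs_zero, mul_zero]
    obtain ⟨v₀, hv₀⟩ := hG.exists_inward hp t
    have h1 : Tendsto (fun ε : ℝ => |g' (v + ε • v₀)|) (𝓝[>] 0) (𝓝 |g' v|) := by
      have : Continuous fun ε : ℝ => |g' (v + ε • v₀)| := by fun_prop
      simpa using (this.tendsto 0).mono_left nhdsWithin_le_nhds
    have h2 : Tendsto (fun ε : ℝ => -A * (ε * gradForm (liftFn ρ) (p, t) v₀)) (𝓝[>] 0) (𝓝 0) := by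
      have : Continuous fun ε : ℝ => -A * (ε * gradForm (liftFn ρ) (p, t) v₀) := by fun_prop
      simpa using (this.tendsto 0).mono_left nhdsWithin_le_nhds
    refine le_of_tendsto_of_tendsto h1 h2 ?_
    filter_upwards [self_mem_nhdsWithin] with ε hε
    have hε' : (0 : ℝ) < ε := hε
    have h3 : gradForm (liftFn ρ) (p, t) (v + ε • v₀) = ε * gradForm (liftFn ρ) (p, t) v₀ := by
      rw [map_add, hv, map_smul, zero_add, smul_eq_mul]
    have h4 := hin (v + ε • v₀) (by rw [h3]; exact mul_neg_of_pos_of_neg hε' hv₀)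
    rwa [h3] at h4
  · have := hin (-v) (by rw [map_neg]; linarith)
    rw [map_neg, abs_neg, map_neg] at this
    rw [abs_of_pos hv]; linarith

end Geometry

end

/-! ### Regularity of u and φ up to the boundary. -/

noncomputable section

open Filter Topology

lemma hasFDerivAt_slice {n : ℕ} {g : Cn n × ℝ → ℝ} {z : Cn n} {t : ℝ}
    (hg : DifferentiableAt ℝ g (z, t)) : HasFDerivAt (fun y => g (y, t)) (gradForm g (z, t)) z :=
  hg.hasFDerivAt.comp z (hasFDerivAt_prodMk_left z t)

lemma hasFDerivAt_gradForm_slice {n : ℕ} {g : Cn n × ℝ → ℝ} {z : Cn n} {t : ℝ}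
    (hg : ContDiffAt ℝ 2 g (z, t)) :
    HasFDerivAt (fun y => gradForm g (y, t)) (hessForm g (z, t)) z := by
  have h1 : DifferentiableAt ℝ (fderiv ℝ g) (z, t) :=
    (hg.fderiv_right (m := 1) (by norm_num)).differentiableAt (by norm_num)
  have h0 : HasFDerivAt (fun y : Cn n => (y, t)) (ContinuousLinearMap.inl ℝ (Cn n) ℝ) z :=
    hasFDerivAt_prodMk_left z t
  have h2 := HasFDerivAt.comp (g := fderiv ℝ g) z h1.hasFDerivAt h0
  have h3 := h2.clm_comp (hasFDerivAt_const (ContinuousLinearMap.inl ℝ (Cn n) ℝ) z)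
  refine h3.congr_fderiv ?_
  ext v w
  simp [hessForm]

lemma bilin_eq_sum {n : ℕ} (B : RealBilin n) (v w : Cn n) :
    B v w = ∑ p, ∑ p', coord p v * coord p' w * B (coordDir p) (coordDir p') := by
  conv_lhs => rw [sum_coord v, sum_coord w]
  simp only [map_sum, sum_apply, map_smul, smul_apply, smul_eq_mul]
  rw [Finset.sum_comm]
  refine Finset.sum_congr rfl fun p _ => ?_
  rw [Finset.mul_sum]
  exact Finset.sum_congr rfl fun p' _ => by ring

lemma norm_bilin_le {n : ℕ} {B : RealBilin n} {C : ℝ} (hC : 0 ≤ C)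
    (h : ∀ p p' : Fin n × Bool, |B (coordDir p) (coordDir p')| ≤ C) :
    ‖B‖ ≤ (2 * n) ^ 2 * C := by
  refine ContinuousLinearMap.opNorm_le_bound₂ _ (by positivity) fun v w => ?_
  rw [bilin_eq_sum, Real.norm_eq_abs]
  refine (Finset.abs_sum_le_sum_abs _ _).trans ?_
  calc _ ≤ ∑ _p : Fin n × Bool, ∑ _p' : Fin n × Bool, ‖v‖ * ‖w‖ * C := by
        refine Finset.sum_le_sum fun p _ => (Finset.abs_sum_le_sum_abs _ _).trans
          (Finset.sum_le_sum fun p' _ => ?_)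
        rw [abs_mul, abs_mul]
        exact mul_le_mul (mul_le_mul (abs_coord_le p v) (abs_coord_le p' w) (abs_nonneg _)
          (norm_nonneg _)) (h p p') (abs_nonneg _) (by positivity)
    _ = _ := by simp; ring

lemma exists_norm_bilin_le {X : Type*} [TopologicalSpace X] {n : ℕ} {K : Set X}
    (hK : IsCompact K) {F : X → RealBilin n}
    (hF : ∀ v w, ContinuousOn (fun x => F x v w) K) : ∃ M, ∀ x ∈ K, ‖F x‖ ≤ M := by
  choose M hM using fun v w => hK.exists_bound_of_continuousOn (hF v w)
  refine ⟨(2 * n) ^ 2 * ∑ p : Fin n × Bool, ∑ p' : Fin n × Bool, |M (coordDir p) (coordDir p')|,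
    fun x hx => norm_bilin_le (by positivity) fun p p' => ?_⟩
  refine ((hM _ _ x hx).trans (le_abs_self _)).trans ?_
  refine (Finset.single_le_sum (f := fun p' => |M (coordDir p) (coordDir p')|)
    (fun _ _ => abs_nonneg _) (Finset.mem_univ p')).trans ?_
  exact Finset.single_le_sum (f := fun p => ∑ p', |M (coordDir p) (coordDir p')|)
    (fun _ _ => Finset.sum_nonneg fun _ _ => abs_nonneg _) (Finset.mem_univ p)

/-- `g` is `C²` in space up to the boundary, with gradient `g₁` and Hessian `g₂` continuous. -/
structure IsC2UpTo {n : ℕ} (Ω : Set (Cn n)) (T : ℝ) (g : Cn n × ℝ → ℝ)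
    (g₁ : Cn n × ℝ → Cn n →L[ℝ] ℝ) (g₂ : Cn n × ℝ → RealBilin n) : Prop where
  cont : ContinuousOn g (closure Ω ×ˢ Ioo 0 T)
  cont₁ : ContinuousOn g₁ (closure Ω ×ˢ Ioo 0 T)
  cont₂ : ∀ v w, ContinuousOn (fun q => g₂ q v w) (closure Ω ×ˢ Ioo 0 T)
  deriv₁ : ∀ z ∈ closure Ω, ∀ t ∈ Ioo 0 T,
    HasFDerivWithinAt (fun y => g (y, t)) (g₁ (z, t)) (closure Ω) z
  deriv₂ : ∀ z ∈ closure Ω, ∀ t ∈ Ioo 0 T,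
    HasFDerivWithinAt (fun y => g₁ (y, t)) (g₂ (z, t)) (closure Ω) z

namespace IsC2UpTo

variable {n : ℕ} {Ω : Set (Cn n)} {T : ℝ} {g h : Cn n × ℝ → ℝ}
  {g₁ h₁ : Cn n × ℝ → Cn n →L[ℝ] ℝ} {g₂ h₂ : Cn n × ℝ → RealBilin n}

lemma eq₁ (hg : IsC2UpTo Ω T g g₁ g₂) (hΩ : IsOpen Ω) (hs : ContDiffOn ℝ ∞ g (Ω ×ˢ Ioo 0 T))
    {q : Cn n × ℝ} (hq : q ∈ Ω ×ˢ Ioo 0 T) : g₁ q = gradForm g q := by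
  have h1 := (hg.deriv₁ q.1 (subset_closure hq.1) q.2 hq.2).hasFDerivAt
    (mem_of_superset (hΩ.mem_nhds hq.1) subset_closure)
  have h2 := hasFDerivAt_slice (g := g) (z := q.1) (t := q.2)
    ((hs.contDiffAt_two (hΩ.prod isOpen_Ioo) hq).differentiableAt (by simp))
  exact h1.unique h2

lemma eq₂ (hg : IsC2UpTo Ω T g g₁ g₂) (hΩ : IsOpen Ω) (hs : ContDiffOn ℝ ∞ g (Ω ×ˢ Ioo 0 T))
    {q : Cn n × ℝ} (hq : q ∈ Ω ×ˢ Ioo 0 T) : g₂ q = hessForm g q := by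
  have h1 := (hg.deriv₂ q.1 (subset_closure hq.1) q.2 hq.2).hasFDerivAt
    (mem_of_superset (hΩ.mem_nhds hq.1) subset_closure)
  have h2 := hasFDerivAt_gradForm_slice (g := g) (z := q.1) (t := q.2)
    (hs.contDiffAt_two (hΩ.prod isOpen_Ioo) hq)
  have h3 : (fun y => g₁ (y, q.2)) =ᶠ[𝓝 q.1] fun y => gradForm g (y, q.2) := by
    filter_upwards [hΩ.mem_nhds hq.1] with y hy
    exact hg.eq₁ hΩ hs ⟨hy, hq.2⟩
  exact h1.unique (h2.congr_of_eventuallyEq h3)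

lemma sub (hg : IsC2UpTo Ω T g g₁ g₂) (hh : IsC2UpTo Ω T h h₁ h₂) :
    IsC2UpTo Ω T (fun q => g q - h q) (fun q => g₁ q - h₁ q) (fun q => g₂ q - h₂ q) where
  cont := hg.cont.sub hh.cont
  cont₁ := hg.cont₁.sub hh.cont₁
  cont₂ v w := (hg.cont₂ v w).sub (hh.cont₂ v w)
  deriv₁ z hz t ht := (hg.deriv₁ z hz t ht).sub (hh.deriv₁ z hz t ht)
  deriv₂ z hz t ht := (hg.deriv₂ z hz t ht).sub (hh.deriv₂ z hz t ht)

lemma slice_continuousOn {X : Type*} [TopologicalSpace X] {F : Cn n × ℝ → X}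
    (hF : ContinuousOn F (closure Ω ×ˢ Ioo 0 T)) {t : ℝ} (ht : t ∈ Ioo 0 T) :
    ContinuousOn (fun z => F (z, t)) (closure Ω) :=
  hF.comp (Continuous.prodMk_left t).continuousOn fun _ hz => ⟨hz, ht⟩

/-- The Hessian is symmetric up to the boundary. -/
lemma symm (hg : IsC2UpTo Ω T g g₁ g₂) (hΩ : IsOpen Ω) (hs : ContDiffOn ℝ ∞ g (Ω ×ˢ Ioo 0 T))
    {z : Cn n} (hz : z ∈ closure Ω) {t : ℝ} (ht : t ∈ Ioo 0 T) (v w : Cn n) :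
    g₂ (z, t) v w = g₂ (z, t) w v := by
  have hc : ∀ v w, ContinuousOn (fun z => g₂ (z, t) v w) (closure Ω) := fun v w =>
    slice_continuousOn (hg.cont₂ v w) ht
  have hi : ∀ v w, ∀ z ∈ Ω, g₂ (z, t) v w ≤ g₂ (z, t) w v := fun v w z hz => by
    rw [hg.eq₂ hΩ hs ⟨hz, ht⟩,
      hessForm_symm (hs.contDiffAt_two (hΩ.prod isOpen_Ioo) (show (z, t) ∈ _ from ⟨hz, ht⟩))]
  exact le_antisymm (le_on_closure (hi v w) (hc v w) (hc w v) hz)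
    (le_on_closure (hi w v) (hc w v) (hc v w) hz)

end IsC2UpTo

namespace Geometry

variable {n : ℕ} {Ω W : Set (Cn n)} {ρ : Cn n → ℝ} {r R κ C₀ : ℝ}

/-- Near a boundary point, nearby points are joined in the domain to a common interior point. -/
lemma exists_segment_subset (hG : Geometry Ω W ρ r R κ C₀) {p : Cn n} (hp : p ∈ frontier Ω) :
    ∃ (v : Cn n) (η s₀ : ℝ), 0 < η ∧ 0 < s₀ ∧ ∀ s ∈ Ioc 0 s₀, p + s • v ∈ Ω ∧
      ∀ z ∈ closure Ω, ‖z - p‖ ≤ η * s → segment ℝ z (p + s • v) ⊆ closure Ω := by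
  have hpW := hG.closure_subset (frontier_subset_closure hp)
  obtain ⟨v, hv⟩ := hG.exists_inward hp 0
  have hcont : ContinuousAt (fun x : Cn n × Cn n => fderiv ℝ ρ x.1 x.2) (p, v) := by
    have h1 : ContinuousAt (fderiv ℝ ρ) p :=
      ((hG.smooth.contDiffAt_two hG.isOpen_nbhd hpW).fderiv_right (m := 1)
        (by norm_num)).continuousAt
    have h2 : ContinuousAt (fun x : Cn n × Cn n => fderiv ℝ ρ x.1) (p, v) :=
      ContinuousAt.comp (g := fderiv ℝ ρ) (by exact h1) continuousAt_fst
    exact h2.clm_apply continuousAt_snd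
  have hv' : fderiv ℝ ρ p v < 0 := by
    rw [← (hG.hasFDerivAt hpW 0).fderiv] at hv; exact hv
  have hev := (hcont.eventually (gt_mem_nhds hv')).and
    (continuousAt_fst.eventually (hG.isOpen_nbhd.mem_nhds hpW))
  obtain ⟨δ, hδ, hball⟩ := Metric.eventually_nhds_iff_ball.mp hev
  have hδ' : ∀ x w : Cn n, ‖x - p‖ < δ → ‖w - v‖ < δ → fderiv ℝ ρ x w < 0 ∧ x ∈ W :=
    fun x w hx hw => hball (x, w) (by
      rw [mem_ball_iff_norm, Prod.norm_def]; exact max_lt hx hw)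
  refine ⟨v, δ / 2, δ / (2 * (‖v‖ + δ)), by positivity, by positivity, ?_⟩
  intro s hs
  have hs1 : s * (‖v‖ + δ) ≤ δ / 2 := by
    have := hs.2
    rw [le_div_iff₀ (by positivity)] at this
    linarith
  have key : ∀ z ∈ closure Ω, ‖z - p‖ ≤ δ / 2 * s → ∀ τ ∈ Ioc (0 : ℝ) 1,
      z + τ • (p + s • v - z) ∈ Ω := by
    intro z hz hzp τ hτ
    have hs0 := hs.1
    have hin : ∀ τ ∈ Icc (0 : ℝ) 1, ‖z + τ • (p + s • v - z) - p‖ < δ := by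
      intro τ hτ
      have : z + τ • (p + s • v - z) - p = (1 - τ) • (z - p) + τ • (s • v) := by module
      rw [this]
      refine (norm_add_le _ _).trans_lt ?_
      rw [norm_smul, norm_smul, norm_smul, Real.norm_of_nonneg (by linarith [hτ.2]),
        Real.norm_of_nonneg hτ.1, Real.norm_of_nonneg hs0.le]
      have a1 : (1 - τ) * ‖z - p‖ ≤ δ / 2 * s :=
        (mul_le_of_le_one_left (norm_nonneg _) (by linarith [hτ.1])).trans hzp
      have a2 : τ * (s * ‖v‖) ≤ s * ‖v‖ := mul_le_of_le_one_left (by positivity) hτ.2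
      nlinarith
    -- When ‖z - p‖ ≤ ηs the direction p + sv - z is s times a vector close to the inward v. Hence ρ
    -- strictly decreases along the segment, starting from a value ≤ 0.
    have hdir : ∀ x, ‖x - p‖ < δ → fderiv ℝ ρ x (p + s • v - z) < 0 := by
      intro x hx
      have : p + s • v - z = s • (v + s⁻¹ • (p - z)) := by
        rw [smul_add, smul_smul, mul_inv_cancel₀ hs0.ne', one_smul]; abel
      rw [this, map_smul, smul_eq_mul]
      refine mul_neg_of_pos_of_neg hs0 (hδ' x _ hx ?_).1
      rw [add_sub_cancel_left, norm_smul, norm_inv, Real.norm_of_nonneg hs0.le, norm_sub_rev,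
        inv_mul_lt_iff₀ hs0]
      nlinarith
    set F : ℝ → ℝ := fun τ => ρ (z + τ • (p + s • v - z)) with hF
    have hd : ∀ τ ∈ Icc (0 : ℝ) 1,
        HasDerivAt F (fderiv ℝ ρ (z + τ • (p + s • v - z)) (p + s • v - z)) τ := by
      intro τ hτ
      have hxW := (hδ' _ v (hin τ hτ) (by simpa using hδ)).2
      have h1 : HasDerivAt (fun τ : ℝ => z + τ • (p + s • v - z)) (p + s • v - z) τ := by
        simpa using ((hasDerivAt_id τ).smul_const (p + s • v - z)).const_add z
      exact ((hG.smooth.contDiffAt_two hG.isOpen_nbhd hxW).differentiableAt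
        (by simp)).hasFDerivAt.comp_hasDerivAt τ h1
    have hanti : StrictAntiOn F (Icc 0 1) := by
      refine strictAntiOn_of_deriv_neg (convex_Icc 0 1)
        (fun τ hτ => (hd τ hτ).continuousAt.continuousWithinAt) fun τ hτ => ?_
      rw [interior_Icc] at hτ
      have hτ' := Ioo_subset_Icc_self hτ
      rw [(hd τ hτ').deriv]
      exact hdir _ (hin τ hτ')
    have h0 := hanti (left_mem_Icc.mpr zero_le_one) (Ioc_subset_Icc_self hτ) hτ.1
    rw [hG.eq_sublevel]
    refine ⟨(hδ' _ v (hin τ (Ioc_subset_Icc_self hτ)) (by simpa using hδ)).2, ?_⟩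
    have h1 : F 0 ≤ 0 := by
      simp only [hF, zero_smul, add_zero]; exact hG.nonpos hz
    exact lt_of_lt_of_le h0 h1
  constructor
  · have := key p (frontier_subset_closure hp) (by simp; have := hs.1; positivity) 1
      ⟨one_pos, le_rfl⟩
    simpa using this
  · intro z hz hzp x hx
    rw [segment_eq_image'] at hx
    obtain ⟨τ, hτ, rfl⟩ := hx
    rcases hτ.1.eq_or_lt with h | h
    · simp only [← h, zero_smul, add_zero]; exact hz
    · exact subset_closure (key z hz hzp τ ⟨h, hτ.2⟩)

end Geometry

/-- Joint continuity of u is not part of `IsC21`. The time derivative is bounded on compact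
subcylinders, so u is Lipschitz in t uniformly in z there; combine this with continuity in z at one
time. -/
lemma isC21_continuousOn {n : ℕ} {Ω : Set (Cn n)} {T : ℝ} (hb : Bornology.IsBounded Ω)
    {u : Cn n × ℝ → ℝ} (h : IsC21 Ω T u) : ContinuousOn u (closure Ω ×ˢ Ico 0 T) := by
  obtain ⟨h1, h2, h3, -⟩ := h
  rintro ⟨p, t₀⟩ ⟨hp, ht₀⟩
  simp only at hp ht₀
  obtain ⟨b, hb1, hb2⟩ := exists_between ht₀.2
  have hsub : Icc 0 b ⊆ Ico 0 T := fun s hs => ⟨hs.1, hs.2.trans_lt hb2⟩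
  obtain ⟨M, hM⟩ := (hb.isCompact_closure.prod (isCompact_Icc (a := (0 : ℝ)) (b := b))
    ).exists_bound_of_continuousOn (h3.mono (prod_mono subset_rfl hsub))
  have hlip : ∀ z ∈ closure Ω, ∀ s ∈ Icc 0 b, |u (z, s) - u (z, t₀)| ≤ M * |s - t₀| := by
    intro z hz s hs
    have hd : ∀ x ∈ Icc 0 b, HasDerivWithinAt (fun t => u (z, t))
        (derivWithin (fun t => u (z, t)) (Ico 0 T) x) (Icc 0 b) x := fun x hx =>
      (((h2 z hz).differentiableOn (by simp)) x (hsub hx)).hasDerivWithinAt.mono hsub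
    exact (convex_Icc 0 b).norm_image_sub_le_of_norm_hasDerivWithin_le hd
      (fun x hx => hM (z, x) ⟨hz, hx⟩) ⟨ht₀.1, hb1.le⟩ hs
  rw [ContinuousWithinAt, tendsto_iff_norm_sub_tendsto_zero]
  have hc1 : Tendsto (fun q : Cn n × ℝ => M * |q.2 - t₀|)
      (𝓝[closure Ω ×ˢ Ico 0 T] (p, t₀)) (𝓝 0) := by
    have : Continuous fun q : Cn n × ℝ => M * |q.2 - t₀| := by fun_prop
    simpa using (this.tendsto (p, t₀)).mono_left nhdsWithin_le_nhds
  have hc2 : Tendsto (fun q : Cn n × ℝ => |u (q.1, t₀) - u (p, t₀)|)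
      (𝓝[closure Ω ×ˢ Ico 0 T] (p, t₀)) (𝓝 0) := by
    have h4 : ContinuousWithinAt (fun z => u (z, t₀)) (closure Ω) p :=
      (h1 t₀ ht₀).continuousOn p hp
    have h5 : Tendsto (fun q : Cn n × ℝ => q.1) (𝓝[closure Ω ×ˢ Ico 0 T] (p, t₀))
        (𝓝[closure Ω] p) := by
      refine tendsto_nhdsWithin_iff.mpr ⟨(continuous_fst.tendsto (p, t₀)).mono_left
        nhdsWithin_le_nhds, ?_⟩
      filter_upwards [self_mem_nhdsWithin] with q hq
      exact hq.1
    have h6 := tendsto_iff_norm_sub_tendsto_zero.mp (h4.tendsto.comp h5)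
    exact h6
  refine squeeze_zero' (Eventually.of_forall fun _ => norm_nonneg _) ?_ (by simpa using hc1.add hc2)
  have hev : ∀ᶠ q : Cn n × ℝ in 𝓝[closure Ω ×ˢ Ico 0 T] (p, t₀), q.2 < b :=
    nhdsWithin_le_nhds (continuous_snd.tendsto (p, t₀) (gt_mem_nhds hb1))
  filter_upwards [self_mem_nhdsWithin, hev] with q hq hqb
  have := hlip q.1 hq.1 q.2 ⟨hq.2.1, hqb.le⟩
  rw [Real.norm_eq_abs]
  calc |u q - u (p, t₀)| = |(u (q.1, q.2) - u (q.1, t₀)) + (u (q.1, t₀) - u (p, t₀))| := by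
        congr 1; ring
    _ ≤ _ := (abs_add_le _ _).trans (add_le_add this le_rfl)

/-- The point is joint continuity of the gradient at boundary points, which `IsC21` does not
contain. The Hessian is bounded on compact subcylinders, so along the segments of
`exists_segment_subset` the gradient at (z, τ) differs little from that at (p + sv, τ), uniformly in
τ; at that interior point u is smooth in space-time. -/
lemma exists_isC2UpTo_of_isC21 {n : ℕ} {Ω W : Set (Cn n)} {ρ : Cn n → ℝ} {r R κ C₀ : ℝ}
    (hG : Geometry Ω W ρ r R κ C₀) {T : ℝ} {u : Cn n × ℝ → ℝ}
    (hs : ContDiffOn ℝ ∞ u (Ω ×ˢ Ioo 0 T)) (h : IsC21 Ω T u) :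
    ∃ u₁ u₂, IsC2UpTo Ω T u u₁ u₂ := by
  have hcu := isC21_continuousOn hG.isBounded h
  obtain ⟨h1, -, -, h4⟩ := h
  have hU := hG.uniqueDiffOn
  have hIoo : Ioo 0 T ⊆ Ico 0 T := Ioo_subset_Ico_self
  set u₁ : Cn n × ℝ → Cn n →L[ℝ] ℝ := fun q =>
    fderivWithin ℝ (fun z => u (z, q.2)) (closure Ω) q.1 with hu₁
  set u₂ : Cn n × ℝ → RealBilin n := fun q =>
    fderivWithin ℝ (fun y => fderivWithin ℝ (fun z => u (z, q.2)) (closure Ω) y)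
      (closure Ω) q.1 with hu₂
  have hd1 : ∀ z ∈ closure Ω, ∀ t ∈ Ioo 0 T,
      HasFDerivWithinAt (fun y => u (y, t)) (u₁ (z, t)) (closure Ω) z := fun z hz t ht =>
    ((h1 t (hIoo ht)).differentiableOn (by simp) z hz).hasFDerivWithinAt
  have hd2 : ∀ z ∈ closure Ω, ∀ t ∈ Ioo 0 T,
      HasFDerivWithinAt (fun y => u₁ (y, t)) (u₂ (z, t)) (closure Ω) z := fun z hz t ht =>
    (((h1 t (hIoo ht)).fderivWithin hU (m := 1) (by norm_num)).differentiableOn (by simp)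
      z hz).hasFDerivWithinAt
  have hc2 : ∀ v w, ContinuousOn (fun q => u₂ q v w) (closure Ω ×ˢ Ioo 0 T) := by
    intro v w
    have h5 : ContinuousOn (fun p : Cn n × ℝ =>
        iteratedFDerivWithin ℝ 2 (fun z => u (z, p.2)) (closure Ω) p.1 ![v, w])
        (closure Ω ×ˢ Ioo 0 T) :=
      (ContinuousMultilinearMap.apply ℝ (fun _ : Fin 2 => Cn n) ℝ
        ![v, w]).continuous.comp_continuousOn (h4.mono (prod_mono subset_rfl hIoo))
    refine h5.congr fun q hq => ?_
    change _ = iteratedFDerivWithin ℝ 2 (fun z => u (z, q.2)) (closure Ω) q.1 ![v, w]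
    rw [iteratedFDerivWithin_two_apply _ hU hq.1]
    rfl
  refine ⟨u₁, u₂, hcu.mono (prod_mono subset_rfl hIoo), ?_, hc2, hd1, hd2⟩
  have heq : ∀ q ∈ Ω ×ˢ Ioo 0 T, u₁ q = gradForm u q := fun q hq => by
    have e1 := (hd1 q.1 (subset_closure hq.1) q.2 hq.2).hasFDerivAt
      (mem_of_superset (hG.isOpen.mem_nhds hq.1) subset_closure)
    exact e1.unique (hasFDerivAt_slice ((hs.contDiffAt_two (hG.isOpen.prod isOpen_Ioo)
      hq).differentiableAt (by simp)))
  have hopen : IsOpen (Ω ×ˢ Ioo 0 T) := hG.isOpen.prod isOpen_Ioo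
  have hint : ∀ q ∈ Ω ×ˢ Ioo 0 T, ContinuousAt u₁ q := fun q hq => by
    have e1 : ContinuousAt (gradForm u) q := by
      have : ContinuousAt (fderiv ℝ u) q :=
        ((hs.contDiffAt_two hopen hq).fderiv_right (m := 1) (by norm_num)).continuousAt
      exact this.clm_comp continuousAt_const
    refine e1.congr ?_
    filter_upwards [hopen.mem_nhds hq] with y hy
    exact (heq y hy).symm
  rintro ⟨p, t₀⟩ ⟨hp, ht₀⟩
  simp only at hp ht₀
  by_cases hpΩ : p ∈ Ω
  · exact (hint (p, t₀) ⟨hpΩ, ht₀⟩).continuousWithinAt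
  have hpf : p ∈ frontier Ω := by rw [hG.isOpen.frontier_eq]; exact ⟨hp, hpΩ⟩
  obtain ⟨a, ha0, hat⟩ := exists_between ht₀.1
  obtain ⟨b, htb, hbT⟩ := exists_between ht₀.2
  have hsub : Icc a b ⊆ Ioo 0 T := fun s hs => ⟨ha0.trans_le hs.1, hs.2.trans_lt hbT⟩
  obtain ⟨M, hM⟩ := exists_norm_bilin_le (hG.isCompact_closure.prod (isCompact_Icc (a := a)
    (b := b))) (fun v w => (hc2 v w).mono (prod_mono subset_rfl hsub))
  obtain ⟨v, η, s₀, hη, hs₀, hseg⟩ := hG.exists_segment_subset hpf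
  have hM0 : 0 ≤ M := (ContinuousLinearMap.opNorm_nonneg _).trans (hM (p, t₀) ⟨hp, hat.le, htb.le⟩)
  have hlip : ∀ s ∈ Ioc 0 s₀, ∀ z ∈ closure Ω, ‖z - p‖ ≤ η * s → ∀ τ ∈ Icc a b,
      ‖u₁ (z, τ) - u₁ (p + s • v, τ)‖ ≤ M * (s * (η + ‖v‖)) := by
    intro s hs' z hz hzp τ hτ
    have hsegz := (hseg s hs').2 z hz hzp
    have e1 : ∀ x ∈ segment ℝ z (p + s • v),
        HasFDerivWithinAt (fun y => u₁ (y, τ)) (u₂ (x, τ)) (segment ℝ z (p + s • v)) x :=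
      fun x hx => (hd2 x (hsegz hx) τ (hsub hτ)).mono hsegz
    have e2 := (convex_segment z (p + s • v)).norm_image_sub_le_of_norm_hasFDerivWithin_le e1
      (fun x hx => hM (x, τ) ⟨hsegz hx, hτ⟩) (right_mem_segment ℝ z (p + s • v))
      (left_mem_segment ℝ z (p + s • v))
    refine e2.trans (mul_le_mul_of_nonneg_left ?_ hM0)
    have : z - (p + s • v) = (z - p) - s • v := by abel
    rw [this]
    refine (norm_sub_le _ _).trans ?_
    rw [norm_smul, Real.norm_of_nonneg hs'.1.le]
    linarith
  rw [Metric.continuousWithinAt_iff']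
  intro ε hε
  -- This s makes each of the two segment errors less than ε/3; the third part is left to continuity
  -- in time at the interior point.
  obtain ⟨s, hs0, hss⟩ : ∃ s ∈ Ioc 0 s₀, M * (s * (η + ‖v‖)) < ε / 3 := by
    have hden : 0 < M * (η + ‖v‖) + 1 := by positivity
    refine ⟨min s₀ (ε / 4 / (M * (η + ‖v‖) + 1)), ⟨by positivity, min_le_left _ _⟩, ?_⟩
    have hle : min s₀ (ε / 4 / (M * (η + ‖v‖) + 1)) ≤ ε / 4 / (M * (η + ‖v‖) + 1) :=
      min_le_right _ _
    have e3 := mul_le_mul_of_nonneg_right hle hden.le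
    rw [div_mul_cancel₀ _ hden.ne'] at e3
    have hm : 0 < min s₀ (ε / 4 / (M * (η + ‖v‖) + 1)) := by positivity
    nlinarith
  have hz' := (hseg s hs0).1
  have hct := (hint (p + s • v, t₀) ⟨hz', ht₀⟩)
  have hct2 : ContinuousAt (fun q : Cn n × ℝ => u₁ (p + s • v, q.2)) (p, t₀) :=
    ContinuousAt.comp (g := u₁) (f := fun q : Cn n × ℝ => (p + s • v, q.2)) hct (by fun_prop)
  have hev1 := (Metric.continuousAt_iff'.mp hct2) (ε / 3) (by linarith)
  have hev2 : ∀ᶠ q : Cn n × ℝ in 𝓝 (p, t₀), ‖q.1 - p‖ ≤ η * s := by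
    have hc : Continuous fun q : Cn n × ℝ => ‖q.1 - p‖ := by fun_prop
    have := hc.tendsto (p, t₀)
    simp only [sub_self, norm_zero] at this
    exact this (Iic_mem_nhds (mul_pos hη hs0.1))
  have hev3 : ∀ᶠ q : Cn n × ℝ in 𝓝 (p, t₀), q.2 ∈ Icc a b :=
    continuous_snd.tendsto (p, t₀) (Icc_mem_nhds hat htb)
  filter_upwards [self_mem_nhdsWithin, nhdsWithin_le_nhds hev1, nhdsWithin_le_nhds hev2,
    nhdsWithin_le_nhds hev3] with q hq a1 a2 a3
  have b1 := hlip s hs0 q.1 hq.1 a2 q.2 a3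
  have b2 := hlip s hs0 p hp (by simp; exact mul_nonneg hη.le hs0.1.le) t₀ ⟨hat.le, htb.le⟩
  rw [dist_eq_norm] at a1 ⊢
  have : u₁ q - u₁ (p, t₀) = (u₁ (q.1, q.2) - u₁ (p + s • v, q.2))
      + (u₁ (p + s • v, q.2) - u₁ (p + s • v, t₀)) - (u₁ (p, t₀) - u₁ (p + s • v, t₀)) := by
    abel
  rw [this]
  have c1 := norm_sub_le ((u₁ (q.1, q.2) - u₁ (p + s • v, q.2))
      + (u₁ (p + s • v, q.2) - u₁ (p + s • v, t₀))) (u₁ (p, t₀) - u₁ (p + s • v, t₀))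
  have c2 := norm_add_le (u₁ (q.1, q.2) - u₁ (p + s • v, q.2))
    (u₁ (p + s • v, q.2) - u₁ (p + s • v, t₀))
  linarith

lemma exists_isC2UpTo_of_contDiffOn {n : ℕ} {Ω W : Set (Cn n)} {ρ : Cn n → ℝ} {r R κ C₀ : ℝ}
    (hG : Geometry Ω W ρ r R κ C₀) {T : ℝ} {φ : Cn n × ℝ → ℝ}
    (hφ : ContDiffOn ℝ ∞ φ (closure Ω ×ˢ Ico 0 T)) : ∃ φ₁ φ₂, IsC2UpTo Ω T φ φ₁ φ₂ := by
  set S := closure Ω ×ˢ Ico 0 T with hS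
  have hU : UniqueDiffOn ℝ S := hG.uniqueDiffOn.prod (uniqueDiffOn_Ico 0 T)
  have hφ' : ContDiffOn ℝ ∞ (fderivWithin ℝ φ S) S := hφ.fderivWithin hU (m := ∞) (by simp)
  have hφ'' : ContDiffOn ℝ ∞ (fderivWithin ℝ (fderivWithin ℝ φ S) S) S :=
    hφ'.fderivWithin hU (m := ∞) (by simp)
  set i := ContinuousLinearMap.inl ℝ (Cn n) ℝ with hi
  have hsub : closure Ω ×ˢ Ioo 0 T ⊆ S := prod_mono subset_rfl Ioo_subset_Ico_self
  have hline : ∀ (z : Cn n) (t : ℝ), HasFDerivWithinAt (fun y : Cn n => (y, t)) i (closure Ω) z :=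
    fun z t => (hasFDerivAt_prodMk_left z t).hasFDerivWithinAt
  have hmaps : ∀ t ∈ Ioo 0 T, MapsTo (fun y : Cn n => (y, t)) (closure Ω) S := fun t ht y hy =>
    ⟨hy, Ioo_subset_Ico_self ht⟩
  refine ⟨fun q => (fderivWithin ℝ φ S q).comp i,
    fun q => (fderivWithin ℝ (fderivWithin ℝ φ S) S q).bilinearComp i i,
    hφ.continuousOn.mono hsub, ?_, ?_, ?_, ?_⟩
  · exact (hφ'.continuousOn.mono hsub).clm_comp continuousOn_const
  · intro v w
    exact ((hφ''.continuousOn.mono hsub).clm_apply continuousOn_const).clm_apply continuousOn_const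
  · intro z hz t ht
    have h1 := (hφ.differentiableOn (by simp) (z, t) (hmaps t ht hz)).hasFDerivWithinAt
    exact h1.comp z (hline z t) (hmaps t ht)
  · intro z hz t ht
    have h1 := (hφ'.differentiableOn (by simp) (z, t) (hmaps t ht hz)).hasFDerivWithinAt
    have h2 := h1.comp z (hline z t) (hmaps t ht)
    have h3 := h2.clm_comp (hasFDerivWithinAt_const i z (closure Ω))
    refine h3.congr_fderiv ?_
    ext v w
    simp

end

/-! ### Differentiating the flow equation with a frozen frame. -/

noncomputable section

open Filter Topology

lemma dirDeriv_sum_apply {V : Type*} [NormedAddCommGroup V] [NormedSpace ℝ V] {ι : Type*}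
    (s : Finset ι) {g : ι → V → ℝ} {q : V} (hg : ∀ i ∈ s, DifferentiableAt ℝ (g i) q) (v : V) :
    dirDeriv v (fun p => ∑ i ∈ s, g i p) q = ∑ i ∈ s, dirDeriv v (g i) q := by
  simp only [dirDeriv]
  rw [fderiv_fun_sum hg, sum_apply]

section HeatSmooth

variable {n : ℕ} {Q : Set (Cn n × ℝ)} {g : Cn n × ℝ → ℝ}

lemma heat_eqOn (hQ : IsOpen Q) (hg : ContDiffOn ℝ ∞ g Q) (w : Fin n → Cn n) :
    EqOn (heat w g) (fun q => dt g q - ∑ k, (dx (w k) (dx (w k) g) q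
      + dx (Complex.I • w k) (dx (Complex.I • w k) g) q)) Q := fun q hq => by
  simp only [heat, levi_hessForm (hg.contDiffAt_two hQ hq)]

lemma heat_contDiffOn (hQ : IsOpen Q) (hg : ContDiffOn ℝ ∞ g Q) (w : Fin n → Cn n) :
    ContDiffOn ℝ ∞ (heat w g) Q := by
  refine ContDiffOn.congr ?_ (heat_eqOn hQ hg w)
  refine (dirDeriv_contDiffOn hQ hg _).sub (ContDiffOn.sum fun k _ => ?_)
  exact (dirDeriv_contDiffOn hQ (dirDeriv_contDiffOn hQ hg _) _).add
    (dirDeriv_contDiffOn hQ (dirDeriv_contDiffOn hQ hg _) _)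

/-- The operator with frozen frame commutes with directional derivatives. -/
lemma dirDeriv_heat (hQ : IsOpen Q) (hg : ContDiffOn ℝ ∞ g Q) (w : Fin n → Cn n)
    (d : Cn n × ℝ) : EqOn (dirDeriv d (heat w g)) (heat w (dirDeriv d g)) Q := by
  intro q hq
  have hd : ∀ {h : Cn n × ℝ → ℝ}, ContDiffOn ℝ ∞ h Q → DifferentiableAt ℝ h q := fun hh =>
    (hh.contDiffAt_two hQ hq).differentiableAt (by simp)
  have h2 : ∀ v v', ContDiffOn ℝ ∞ (dirDeriv v (dirDeriv v' g)) Q := fun v v' =>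
    dirDeriv_contDiffOn hQ (dirDeriv_contDiffOn hQ hg _) _
  have hc : ∀ v, dirDeriv d (dirDeriv v (dirDeriv v g)) q
      = dirDeriv v (dirDeriv v (dirDeriv d g)) q := fun v =>
    dirDeriv_iterate_comm hQ hg d v 2 hq
  rw [dirDeriv_congr hQ (heat_eqOn hQ hg w) d hq,
    heat_eqOn hQ (dirDeriv_contDiffOn hQ hg d) w hq]
  have hs : ∀ k, DifferentiableAt ℝ (fun q => dx (w k) (dx (w k) g) q
      + dx (Complex.I • w k) (dx (Complex.I • w k) g) q) q := fun k =>
    (hd (h2 _ _)).add (hd (h2 _ _))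
  rw [dirDeriv_sub_apply (hd (dirDeriv_contDiffOn hQ hg _))
    (DifferentiableAt.fun_sum fun k _ => hs k),
    dirDeriv_sum_apply _ fun k _ => hs k, dirDeriv_comm_on hQ hg d _ hq]
  congr 1
  refine Finset.sum_congr rfl fun k _ => ?_
  rw [dirDeriv_add_apply (hd (h2 _ _)) (hd (h2 _ _)), hc, hc]

end HeatSmooth

/-- The right hand side of the flow along a solution. -/
def rhs {n : ℕ} (f : RhsSpace n → ℝ) (u : Cn n × ℝ → ℝ) (q : Cn n × ℝ) : ℝ := f (q.2, q.1, u q)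

/-- The direction of the unknown in the domain of the right hand side. -/
def valDir (n : ℕ) : RhsSpace n := ((0 : ℝ), (0 : Cn n), (1 : ℝ))

/-- The time direction in the domain of the right hand side. -/
def timeDir (n : ℕ) : RhsSpace n := ((1 : ℝ), (0 : Cn n), (0 : ℝ))

lemma dirDeriv_rhs {n : ℕ} {f : RhsSpace n → ℝ} {u : Cn n × ℝ → ℝ} {q : Cn n × ℝ}
    (hf : DifferentiableAt ℝ f (q.2, q.1, u q)) (hu : DifferentiableAt ℝ u q) (v : Cn n) (s : ℝ) :
    dirDeriv (v, s) (rhs f u) q = s * rhs (dirDeriv (timeDir n) f) u q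
      + rhs (dirDeriv (rhsSpaceDir v) f) u q
      + dirDeriv (v, s) u q * rhs (dirDeriv (valDir n) f) u q := by
  have h1 : HasFDerivAt (fun q : Cn n × ℝ => (q.2, q.1, u q))
      ((ContinuousLinearMap.snd ℝ (Cn n) ℝ).prod
        ((ContinuousLinearMap.fst ℝ (Cn n) ℝ).prod (fderiv ℝ u q))) q :=
    hasFDerivAt_snd.prodMk (hasFDerivAt_fst.prodMk hu.hasFDerivAt)
  have h2 : HasFDerivAt (rhs f u) ((fderiv ℝ f (q.2, q.1, u q)).comp
      ((ContinuousLinearMap.snd ℝ (Cn n) ℝ).prod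
        ((ContinuousLinearMap.fst ℝ (Cn n) ℝ).prod (fderiv ℝ u q)))) q :=
    HasFDerivAt.comp (g := f) q hf.hasFDerivAt h1
  simp only [rhs, dirDeriv]
  rw [h2.fderiv]
  have : ((s, v, fderiv ℝ u q (v, s)) : RhsSpace n) = s • timeDir n + rhsSpaceDir v
      + fderiv ℝ u q (v, s) • valDir n := by
    ext <;> simp [timeDir, rhsSpaceDir, valDir]
  change fderiv ℝ f (q.2, q.1, u q) (s, v, fderiv ℝ u q (v, s)) = _
  rw [this, map_add, map_add, map_smul, map_smul]
  rfl

/-- A solution of the flow on `Ω × (0,T)`, with bounds on the right hand side. -/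
structure IsFlow {n : ℕ} (Ω : Set (Cn n)) (T F : ℝ) (f : RhsSpace n → ℝ) (u : Cn n × ℝ → ℝ) :
    Prop where
  isOpen : IsOpen Ω
  smooth_rhs : ContDiffOn ℝ ∞ f (Ioo 0 T ×ˢ Ω ×ˢ univ)
  smooth : ContDiffOn ℝ ∞ u (Ω ×ˢ Ioo 0 T)
  posDef : ∀ q ∈ Ω ×ˢ Ioo 0 T, (leviMatrix (hessForm u q)).PosDef
  eq : ∀ q ∈ Ω ×ˢ Ioo 0 T, dt u q = Real.log (leviMatrix (hessForm u q)).det.re + rhs f u q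
  rhs_le : ∀ p ∈ Ioo 0 T ×ˢ Ω ×ˢ (univ : Set ℝ), |f p| ≤ F
  rhs_t : ∀ p ∈ Ioo 0 T ×ˢ Ω ×ˢ (univ : Set ℝ), |dirDeriv (timeDir n) f p| ≤ F
  rhs_x : ∀ p ∈ Ioo 0 T ×ˢ Ω ×ˢ (univ : Set ℝ), ∀ i, |dirDeriv (rhsSpaceDir (coordDir i)) f p| ≤ F
  rhs_u : ∀ p ∈ Ioo 0 T ×ˢ Ω ×ˢ (univ : Set ℝ), |dirDeriv (valDir n) f p| ≤ F
  rhs_u_nonpos : ∀ p ∈ Ioo 0 T ×ˢ Ω ×ˢ (univ : Set ℝ), dirDeriv (valDir n) f p ≤ 0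
  rhs_xx : ∀ p ∈ Ioo 0 T ×ˢ Ω ×ˢ (univ : Set ℝ), ∀ i,
    |dirDeriv (rhsSpaceDir (coordDir i)) (dirDeriv (rhsSpaceDir (coordDir i)) f) p| ≤ F
  rhs_xu : ∀ p ∈ Ioo 0 T ×ˢ Ω ×ˢ (univ : Set ℝ), ∀ i,
    |dirDeriv (rhsSpaceDir (coordDir i)) (dirDeriv (valDir n) f) p| ≤ F
  rhs_uu : ∀ p ∈ Ioo 0 T ×ˢ Ω ×ˢ (univ : Set ℝ),
    |dirDeriv (valDir n) (dirDeriv (valDir n) f) p| ≤ F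

namespace IsFlow

variable {n : ℕ} {Ω : Set (Cn n)} {T F : ℝ} {f : RhsSpace n → ℝ} {u : Cn n × ℝ → ℝ}
  {q : Cn n × ℝ}

lemma isOpen_prod (hu : IsFlow Ω T F f u) : IsOpen (Ω ×ˢ Ioo 0 T) := hu.isOpen.prod isOpen_Ioo

lemma isOpen_rhs (hu : IsFlow Ω T F f u) : IsOpen (Ioo 0 T ×ˢ Ω ×ˢ (univ : Set ℝ)) :=
  isOpen_Ioo.prod (hu.isOpen.prod isOpen_univ)

lemma mem_rhs (u : Cn n × ℝ → ℝ) (hq : q ∈ Ω ×ˢ Ioo 0 T) : (q.2, q.1, u q) ∈ Ioo 0 T ×ˢ Ω ×ˢ (univ : Set ℝ) :=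
  ⟨hq.2, hq.1, mem_univ _⟩

lemma contDiffAt (hu : IsFlow Ω T F f u) (hq : q ∈ Ω ×ˢ Ioo 0 T) : ContDiffAt ℝ 2 u q :=
  hu.smooth.contDiffAt_two hu.isOpen_prod hq

lemma hess_symm (hu : IsFlow Ω T F f u) (hq : q ∈ Ω ×ˢ Ioo 0 T) (v w : Cn n) :
    hessForm u q v w = hessForm u q w v := hessForm_symm (hu.contDiffAt hq) v w

lemma exists_frame (hu : IsFlow Ω T F f u) (hq : q ∈ Ω ×ˢ Ioo 0 T) :
    ∃ w, IsFrame (hessForm u q) w := exists_isFrame (hu.hess_symm hq) (hu.posDef q hq)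

lemma smooth_rhs_comp (hu : IsFlow Ω T F f u) {h : RhsSpace n → ℝ}
    (hh : ContDiffOn ℝ ∞ h (Ioo 0 T ×ˢ Ω ×ˢ univ)) : ContDiffOn ℝ ∞ (rhs h u) (Ω ×ˢ Ioo 0 T) :=
  hh.comp (contDiffOn_snd.prodMk (contDiffOn_fst.prodMk hu.smooth)) fun _ hq => mem_rhs u hq

lemma dirDeriv_rhs_comp (hu : IsFlow Ω T F f u) {h : RhsSpace n → ℝ}
    (hh : ContDiffOn ℝ ∞ h (Ioo 0 T ×ˢ Ω ×ˢ univ)) (hq : q ∈ Ω ×ˢ Ioo 0 T) (v : Cn n) (s : ℝ) :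
    dirDeriv (v, s) (rhs h u) q = s * rhs (dirDeriv (timeDir n) h) u q
      + rhs (dirDeriv (rhsSpaceDir v) h) u q
      + dirDeriv (v, s) u q * rhs (dirDeriv (valDir n) h) u q :=
  dirDeriv_rhs ((hh.contDiffAt_two hu.isOpen_rhs (mem_rhs u hq)).differentiableAt (by simp))
    ((hu.contDiffAt hq).differentiableAt (by simp)) v s

lemma heat_self {w : Fin n → Cn n} (hw : IsFrame (hessForm u q) w) :
    heat w u q = dt u q - n := by rw [heat, hw.sum_levi]

/-- Differentiating the flow once and twice. -/
lemma heat_dirDeriv (hu : IsFlow Ω T F f u) (hq : q ∈ Ω ×ˢ Ioo 0 T) {w : Fin n → Cn n}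
    (hw : IsFrame (hessForm u q) w) (d : Cn n × ℝ) :
    heat w (dirDeriv d u) q = dirDeriv d (rhs f u) q ∧
      heat w (dirDeriv d (dirDeriv d u)) q ≤ dirDeriv d (dirDeriv d (rhs f u)) q := by
  have hQ := hu.isOpen_prod
  -- The frame w belongs to q and stays fixed as the argument of J varies. By the equation, J is log
  -- det minus the trace in w, and concavity makes q a maximum of J in all space-time directions.
  -- Vanishing of the first derivative gives the equation, the sign of the second derivative gives
  -- the inequality.
  set J : Cn n × ℝ → ℝ := fun q => heat w u q - rhs f u q with hJ
  have hs1 := heat_contDiffOn hQ hu.smooth w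
  have hs2 := hu.smooth_rhs_comp hu.smooth_rhs
  have hJs : ContDiffOn ℝ ∞ J (Ω ×ˢ Ioo 0 T) := hs1.sub hs2
  have hmax : ∀ q' ∈ Ω ×ˢ Ioo 0 T, J q' ≤ J q := by
    intro q' hq'
    have h1 := hw.log_det_le _ (hu.hess_symm hq') (hu.posDef q' hq')
    have h2 := hw.sum_levi
    simp only [hJ, heat]
    rw [hu.eq q hq, hu.eq q' hq', h2]
    linarith
  have hc : Tendsto (fun s : ℝ => q + s • d) (𝓝 0) (𝓝 q) := by
    have : Continuous fun s : ℝ => q + s • d := by fun_prop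
    simpa using this.tendsto 0
  obtain ⟨h1, h2⟩ := dirDeriv_of_localMax_line (v := d) (hJs.contDiffAt_two hQ hq) (by
    filter_upwards [hc.eventually (hQ.mem_nhds hq)] with s hs
    exact hmax _ hs)
  have hd : ∀ {h : Cn n × ℝ → ℝ}, ContDiffOn ℝ ∞ h (Ω ×ˢ Ioo 0 T) → ∀ q' ∈ Ω ×ˢ Ioo 0 T,
      DifferentiableAt ℝ h q' := fun hh q' hq' =>
    (hh.contDiffAt_two hQ hq').differentiableAt (by simp)
  have e1 : EqOn (dirDeriv d J) (fun q => heat w (dirDeriv d u) q - dirDeriv d (rhs f u) q)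
      (Ω ×ˢ Ioo 0 T) := fun q' hq' => by
    rw [hJ, dirDeriv_sub_apply (hd hs1 q' hq') (hd hs2 q' hq'), dirDeriv_heat hQ hu.smooth w d hq']
  have hu1 := dirDeriv_contDiffOn hQ hu.smooth d
  have e2 : dirDeriv d (dirDeriv d J) q = heat w (dirDeriv d (dirDeriv d u)) q
      - dirDeriv d (dirDeriv d (rhs f u)) q := by
    rw [dirDeriv_congr hQ e1 d hq, dirDeriv_sub_apply (hd (heat_contDiffOn hQ hu1 w) q hq)
      (hd (dirDeriv_contDiffOn hQ hs2 d) q hq), dirDeriv_heat hQ hu1 w d hq]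
  rw [e1 hq] at h1
  rw [e2] at h2
  constructor <;> linarith

/-- The equation for the time derivative. -/
lemma heat_dt (hu : IsFlow Ω T F f u) (hq : q ∈ Ω ×ˢ Ioo 0 T) {w : Fin n → Cn n}
    (hw : IsFrame (hessForm u q) w) : ∃ b c : ℝ, |b| ≤ F ∧ |c| ≤ F ∧ c ≤ 0 ∧
      heat w (dt u) q = b + c * dt u q := by
  refine ⟨_, _, hu.rhs_t _ (mem_rhs u hq), hu.rhs_u _ (mem_rhs u hq),
    hu.rhs_u_nonpos _ (mem_rhs u hq), ?_⟩
  rw [(hu.heat_dirDeriv hq hw _).1, hu.dirDeriv_rhs_comp hu.smooth_rhs hq]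
  have : rhs (dirDeriv (rhsSpaceDir (0 : Cn n)) f) u q = 0 := by
    simp only [rhs, dirDeriv]
    rw [show rhsSpaceDir (0 : Cn n) = 0 from rfl, map_zero]
  rw [this]; simp only [rhs]; ring

lemma abs_rhsSpaceDir_le (hu : IsFlow Ω T F f u) (hq : q ∈ Ω ×ˢ Ioo 0 T) (v : Cn n) :
    |rhs (dirDeriv (rhsSpaceDir v) f) u q| ≤ 2 * n * F * ‖v‖ := by
  have h1 : rhs (dirDeriv (rhsSpaceDir v) f) u q
      = ∑ p : Fin n × Bool, coord p v * rhs (dirDeriv (rhsSpaceDir (coordDir p)) f) u q := by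
    simp only [rhs, dirDeriv]
    have : rhsSpaceDir v = ∑ p : Fin n × Bool, coord p v • rhsSpaceDir (coordDir p) := by
      set L : Cn n →ₗ[ℝ] RhsSpace n :=
        (LinearMap.inr ℝ ℝ (Cn n × ℝ)).comp (LinearMap.inl ℝ (Cn n) ℝ) with hL
      have hL' : ∀ v, rhsSpaceDir v = L v := fun v => rfl
      simp only [hL', ← map_smul, ← map_sum, ← sum_coord v]
    rw [this, map_sum]
    simp only [map_smul, smul_eq_mul]
  rw [h1]
  refine (Finset.abs_sum_le_sum_abs _ _).trans ?_
  calc _ ≤ ∑ _p : Fin n × Bool, ‖v‖ * F := Finset.sum_le_sum fun p _ => by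
        rw [abs_mul]
        exact mul_le_mul (abs_coord_le p v) (hu.rhs_x _ (mem_rhs u hq) p) (abs_nonneg _)
          (norm_nonneg _)
    _ = _ := by simp; ring

/-- The equation for the space derivatives. -/
lemma heat_dx (hu : IsFlow Ω T F f u) (hq : q ∈ Ω ×ˢ Ioo 0 T) {w : Fin n → Cn n}
    (hw : IsFrame (hessForm u q) w) : ∃ (b : Cn n → ℝ) (c : ℝ), |c| ≤ F ∧ c ≤ 0 ∧
      ∀ v, |b v| ≤ 2 * n * F * ‖v‖ ∧ heat w (dx v u) q = b v + c * dx v u q := by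
  refine ⟨fun v => rhs (dirDeriv (rhsSpaceDir v) f) u q, rhs (dirDeriv (valDir n) f) u q,
    hu.rhs_u _ (mem_rhs u hq), hu.rhs_u_nonpos _ (mem_rhs u hq),
    fun v => ⟨hu.abs_rhsSpaceDir_le hq v, ?_⟩⟩
  rw [(hu.heat_dirDeriv hq hw _).1, hu.dirDeriv_rhs_comp hu.smooth_rhs hq]
  ring

/-- The inequality for the pure second derivatives in coordinate directions. -/
lemma heat_dx_dx (hu : IsFlow Ω T F f u) (hq : q ∈ Ω ×ˢ Ioo 0 T) {w : Fin n → Cn n}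
    (hw : IsFrame (hessForm u q) w) : ∃ c : ℝ, |c| ≤ F ∧ c ≤ 0 ∧
      ∀ i, heat w (dx (coordDir i) (dx (coordDir i) u)) q ≤
        2 * F * (1 + (dx (coordDir i) u q) ^ 2) + c * dx (coordDir i) (dx (coordDir i) u) q := by
  refine ⟨_, hu.rhs_u _ (mem_rhs u hq), hu.rhs_u_nonpos _ (mem_rhs u hq), fun i => ?_⟩
  have hQ := hu.isOpen_prod
  set v : Cn n := coordDir i with hv
  refine (hu.heat_dirDeriv hq hw _).2.trans ?_
  have hR := hu.isOpen_rhs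
  have sx := dirDeriv_contDiffOn hR hu.smooth_rhs (rhsSpaceDir v)
  have su := dirDeriv_contDiffOn hR hu.smooth_rhs (valDir n)
  have hd : ∀ {h : Cn n × ℝ → ℝ}, ContDiffOn ℝ ∞ h (Ω ×ˢ Ioo 0 T) → DifferentiableAt ℝ h q :=
    fun hh => (hh.contDiffAt_two hQ hq).differentiableAt (by simp)
  have e1 : EqOn (dx v (rhs f u)) (fun q => rhs (dirDeriv (rhsSpaceDir v) f) u q
      + dx v u q * rhs (dirDeriv (valDir n) f) u q) (Ω ×ˢ Ioo 0 T) := fun q' hq' => by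
    rw [hu.dirDeriv_rhs_comp hu.smooth_rhs hq', zero_mul, zero_add]
  have hu1 := dirDeriv_contDiffOn hQ hu.smooth (v, (0 : ℝ))
  rw [dirDeriv_congr hQ e1 _ hq, dirDeriv_add_apply (hd (hu.smooth_rhs_comp sx))
    ((hd hu1).fun_mul (hd (hu.smooth_rhs_comp su))),
    dirDeriv_mul_apply (hd hu1) (hd (hu.smooth_rhs_comp su)),
    hu.dirDeriv_rhs_comp sx hq, hu.dirDeriv_rhs_comp su hq]
  have e2 : rhs (dirDeriv (valDir n) (dirDeriv (rhsSpaceDir v) f)) u q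
      = rhs (dirDeriv (rhsSpaceDir v) (dirDeriv (valDir n) f)) u q :=
    dirDeriv_comm_on hR hu.smooth_rhs _ _ (mem_rhs u hq)
  rw [e2]
  have b1 := abs_le.mp (hu.rhs_xx _ (mem_rhs u hq) i)
  have b2 := abs_le.mp (hu.rhs_xu _ (mem_rhs u hq) i)
  have b3 := abs_le.mp (hu.rhs_uu _ (mem_rhs u hq))
  simp only [rhs, ← hv] at b1 b2 b3 ⊢
  set a := dx v u q
  set x := dirDeriv (rhsSpaceDir v) (dirDeriv (valDir n) f) (q.2, q.1, u q)
  set y := dirDeriv (valDir n) (dirDeriv (valDir n) f) (q.2, q.1, u q)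
  -- Since |x| ≤ F, this is 2|a| ≤ 1 + a².
  have h1 : 2 * (a * x) ≤ F * (1 + a ^ 2) := by
    rcases le_total 0 a with h | h
    · nlinarith [mul_le_mul_of_nonneg_left b2.2 h, sq_nonneg (a - 1)]
    · nlinarith [mul_le_mul_of_nonpos_left b2.1 h, sq_nonneg (a + 1)]
  have h2 : a ^ 2 * y ≤ a ^ 2 * F := mul_le_mul_of_nonneg_left b3.2 (sq_nonneg a)
  nlinarith [b1.2]

end IsFlow

end

/-! ### Bounds of u, of its time derivative and of the determinant. -/

noncomputable section

open Filter Topology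

/-- A solution of the Dirichlet problem together with its boundary values, right hand side and
space derivatives up to the boundary. -/
structure SolData (n : ℕ) where
  φ : Cn n × ℝ → ℝ
  f : RhsSpace n → ℝ
  u : Cn n × ℝ → ℝ
  φ₁ : Cn n × ℝ → Cn n →L[ℝ] ℝ
  φ₂ : Cn n × ℝ → RealBilin n
  u₁ : Cn n × ℝ → Cn n →L[ℝ] ℝ
  u₂ : Cn n × ℝ → RealBilin n

/-- The Dirichlet problem, with bounds `Cu`, `B`, `F` on the initial values, the boundary values
and the right hand side. -/
structure IsSolution {n : ℕ} (Ω : Set (Cn n)) (T Cu B F : ℝ) (S : SolData n) : Prop where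
  flow : IsFlow Ω T F S.f S.u
  c21 : IsC21 Ω T S.u
  cont : ContinuousOn S.u (closure Ω ×ˢ Ico 0 T)
  c2 : IsC2UpTo Ω T S.u S.u₁ S.u₂
  smooth_φ : ContDiffOn ℝ ∞ S.φ (closure Ω ×ˢ Ico 0 T)
  c2_φ : IsC2UpTo Ω T S.φ S.φ₁ S.φ₂
  tame_φ : ∀ L : List (Fin n × Bool), L.length ≤ 2 →
    Tame (Ω ×ˢ Ioo 0 T) B (wordDeriv spaceDir L S.φ)
  boundary : ∀ z ∈ frontier Ω, ∀ t ∈ Ico 0 T, S.u (z, t) = S.φ (z, t)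
  initial : ∀ z ∈ closure Ω, |S.u (z, 0)| ≤ Cu

section

variable {n : ℕ} {q : Cn n × ℝ} {w : Fin n → Cn n}

lemma dirDeriv_snd (v : Cn n) (s : ℝ) (q : Cn n × ℝ) :
    dirDeriv (v, s) (fun q : Cn n × ℝ => q.2) q = s := by
  have : HasFDerivAt (fun q : Cn n × ℝ => q.2) (ContinuousLinearMap.snd ℝ (Cn n) ℝ) q :=
    hasFDerivAt_snd
  simp [dirDeriv, this.fderiv]

lemma contDiffAt_time : ContDiffAt ℝ 2 (fun q : Cn n × ℝ => q.2) q := contDiffAt_snd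

lemma heat_snd : heat w (fun q => q.2) q = 1 := by
  have h : ∀ v : Cn n, dx v (fun q : Cn n × ℝ => q.2) = fun _ => 0 := fun v => by
    ext q; exact dirDeriv_snd v 0 q
  simp [heat, levi_hessForm contDiffAt_time, h, dirDeriv_snd, dirDeriv_const]

lemma gradProd_snd_left {g : Cn n × ℝ → ℝ} : gradProd w (fun q => q.2) g q = 0 := by
  simp [gradProd, dirDeriv_snd]

lemma heat_time_mul {g : Cn n × ℝ → ℝ} (hg : ContDiffAt ℝ 2 g q) :
    heat w (fun q => q.2 * g q) q = q.2 * heat w g q + g q := by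
  rw [heat_mul contDiffAt_time hg, heat_snd, gradProd_snd_left]; ring

lemma not_posDef_of_max (hn : 1 ≤ n) {B : RealBilin n} (hB : ∀ x y, B x y = B y x)
    (hpos : (leviMatrix B).PosDef) (h : ∀ v, B v v ≤ 0) : False := by
  have h1 := (leviMatrix_posDef_iff hB).mp hpos (coordDir (⟨0, hn⟩, false)) (by
    intro h0
    have := norm_coordDir (⟨0, hn⟩, false)
    rw [h0, norm_zero] at this
    exact zero_ne_one this)
  have := h (coordDir (⟨0, hn⟩, false))
  have := h (Complex.I • coordDir (⟨0, hn⟩, false))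
  rw [levi] at h1
  linarith

end

namespace Geometry

variable {n : ℕ} {Ω W : Set (Cn n)} {ρ : Cn n → ℝ} {r R κ C₀ : ℝ}

lemma abs_le (hG : Geometry Ω W ρ r R κ C₀) {z : Cn n} (hz : z ∈ W) : |ρ z| ≤ C₀ :=
  (hG.tame [] (by simp)).bound (z, 0) ⟨hz, mem_univ _⟩

lemma C₀_nonneg (hG : Geometry Ω W ρ r R κ C₀) : 0 ≤ C₀ := by
  obtain ⟨z, hz⟩ := hG.nonempty
  exact (abs_nonneg _).trans (hG.abs_le (hG.closure_subset (subset_closure hz)))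

lemma R_nonneg (hG : Geometry Ω W ρ r R κ C₀) : 0 ≤ R := by
  obtain ⟨z, hz⟩ := hG.nonempty
  exact (norm_nonneg _).trans (hG.norm_le z (hG.closure_subset (subset_closure hz)))

lemma heat_le (hG : Geometry Ω W ρ r R κ C₀) {q : Cn n × ℝ} (hq : q.1 ∈ closure Ω)
    (w : Fin n → Cn n) : heat w (liftFn ρ) q ≤ -κ * ∑ k, ‖w k‖ ^ 2 := by
  have h := (hG.smooth.contDiffAt_two hG.isOpen_nbhd (hG.closure_subset hq)).differentiableAt
    (by simp)
  rw [heat, dirDeriv_liftFn h]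
  have h1 : κ * ∑ k, ‖w k‖ ^ 2 ≤ ∑ k, levi (hessForm (liftFn ρ) q) (w k) := by
    rw [Finset.mul_sum]
    exact Finset.sum_le_sum fun k _ => hG.levi_ge q.1 hq q.2 (w k)
  have h2 : dirDeriv (0 : Cn n) ρ q.1 = 0 := by simp [dirDeriv]
  linarith

end Geometry

namespace IsSolution

variable {n : ℕ} {Ω W : Set (Cn n)} {ρ : Cn n → ℝ} {r R κ C₀ T Cu B F : ℝ} {S : SolData n}

lemma bound_nonneg (hS : IsSolution Ω T Cu B F S) (hG : Geometry Ω W ρ r R κ C₀) (hT : 0 < T) :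
    0 ≤ Cu ∧ 0 ≤ B ∧ 0 ≤ F := by
  obtain ⟨z, hz⟩ := hG.nonempty
  have hq : (z, T / 2) ∈ Ω ×ˢ Ioo 0 T := ⟨hz, by simp only; constructor <;> linarith⟩
  exact ⟨(abs_nonneg _).trans (hS.initial z (subset_closure hz)),
    (hS.tame_φ [] (by simp)).nonneg ⟨_, hq⟩,
    (abs_nonneg _).trans (hS.flow.rhs_le _ (IsFlow.mem_rhs S.u hq))⟩

lemma abs_φ_le (hS : IsSolution Ω T Cu B F S) {z : Cn n} (hz : z ∈ closure Ω) {t : ℝ}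
    (ht : t ∈ Ioo 0 T) : |S.φ (z, t)| ≤ B := by
  have hc := IsC2UpTo.slice_continuousOn hS.c2_φ.cont ht
  exact le_on_closure (fun z hz => (hS.tame_φ [] (by simp)).bound (z, t) ⟨hz, ht⟩) hc.abs
    continuousOn_const hz

/-- On each time slice u is strictly plurisubharmonic, so it has no interior maximum and is bounded
by its boundary values. -/
lemma u_le (hS : IsSolution Ω T Cu B F S) (hG : Geometry Ω W ρ r R κ C₀) (hn : 1 ≤ n)
    {z : Cn n} (hz : z ∈ closure Ω) {t : ℝ} (ht : t ∈ Ioo 0 T) : S.u (z, t) ≤ B := by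
  refine elliptic_max hG.isOpen hG.isBounded (IsC2UpTo.slice_continuousOn hS.c2.cont ht)
    (fun z hz => hS.flow.contDiffAt ⟨hz, ht⟩) (fun z hz => ?_) (fun z hz h => ?_) z hz
  · rw [hS.boundary z hz t (Ioo_subset_Ico_self ht)]
    exact (le_abs_self _).trans (hS.abs_φ_le (frontier_subset_closure hz) ht)
  · exact not_posDef_of_max hn (hS.flow.hess_symm ⟨hz, ht⟩) (hS.flow.posDef _ ⟨hz, ht⟩) h

/-- The elementary inequality behind lower barriers. -/
lemma exp_barrier {κ x : ℝ} (hκ : 0 < κ) : x - κ / 4 * Real.exp x ≤ Real.log (4 / κ) - 1 := by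
  have h1 := Real.add_one_le_exp (x - Real.log (4 / κ))
  rw [Real.exp_sub, Real.exp_log (by positivity)] at h1
  have h2 : κ / 4 * Real.exp x = Real.exp x / (4 / κ) := by field_simp
  rw [h2]; linarith

/-- Comparison with ρ - Kt. At an interior maximum of ρ - Kt - u the logarithm L of the determinant
of u could be very negative, but then the inverse Hessian is large: ∑ ‖w k‖² ≥ (n/4) exp(-L/n), and
the strict plurisubharmonicity of ρ turns this into a term dominating -L. The value of K leaves a
margin of 1. -/
lemma le_u (hS : IsSolution Ω T Cu B F S) (hG : Geometry Ω W ρ r R κ C₀) (hn : 1 ≤ n) (hT : 0 < T)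
    {z : Cn n} (hz : z ∈ closure Ω) {t : ℝ} (ht : t ∈ Ioo 0 T) :
    ρ z - (n * |Real.log (4 / κ)| + F + 1) * t - S.u (z, t) ≤ max Cu B := by
  obtain ⟨hCu, hB, hF⟩ := hS.bound_nonneg hG hT
  set K := n * |Real.log (4 / κ)| + F + 1 with hK
  have hK0 : 0 ≤ K := by positivity
  have hn' : (0 : ℝ) < n := by exact_mod_cast hn
  set G : Cn n × ℝ → ℝ := fun q => (liftFn ρ q - K * q.2) - S.u q with hGdef
  have hsub : Icc 0 t ⊆ Ico 0 T := fun s hs => ⟨hs.1, hs.2.trans_lt ht.2⟩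
  have hcρ : ContinuousOn (liftFn ρ) (closure Ω ×ˢ Icc 0 t) :=
    (liftFn_contDiffOn hG.smooth).continuousOn.mono
      (prod_mono hG.closure_subset (subset_univ _))
  have hmain := parabolic_max hG.isOpen hG.isBounded (a := 0) (b := t) (G := G) (M := max Cu B)
    ((hcρ.sub (continuousOn_const.mul continuousOn_snd)).sub
      (hS.cont.mono (prod_mono subset_rfl hsub))) ?_ ?_ ?_ ?_ z hz t ⟨ht.1.le, le_rfl⟩
  · exact hmain
  · intro z hz s hs
    have hs' : s ∈ Ioo 0 T := ⟨hs.1, hs.2.trans_lt ht.2⟩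
    exact ((hG.contDiffAt (hG.closure_subset (subset_closure hz)) s).sub
      (contDiffAt_const.mul contDiffAt_time)).sub (hS.flow.contDiffAt ⟨hz, hs'⟩)
  · intro z hz s hs
    have h0 := hG.eq_zero hz
    simp only [hGdef, liftFn, h0]
    have h1 : 0 ≤ K * s := mul_nonneg hK0 hs.1
    rcases hs.1.eq_or_lt with h | h
    · have := neg_abs_le (S.u (z, s))
      rw [← h] at this h1 ⊢
      have h2 := hS.initial z (frontier_subset_closure hz)
      have := le_max_left Cu B
      linarith
    · have hs' : s ∈ Ioo 0 T := ⟨h, hs.2.trans_lt ht.2⟩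
      rw [hS.boundary z hz s (Ioo_subset_Ico_self hs')]
      have h2 := neg_abs_le (S.φ (z, s))
      have h3 := hS.abs_φ_le (frontier_subset_closure hz) hs'
      have := le_max_right Cu B
      linarith
  · intro z hz
    simp only [hGdef, liftFn]
    have h2 := hS.initial z (subset_closure hz)
    have h3 := neg_abs_le (S.u (z, 0))
    have h4 := hG.neg_of_mem hz
    have := le_max_left Cu B
    linarith
  · intro z hz s hs _ _ hdt hh
    have hs' : s ∈ Ioo 0 T := ⟨hs.1, hs.2.trans_lt ht.2⟩
    have hq : (z, s) ∈ Ω ×ˢ Ioo 0 T := ⟨hz, hs'⟩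
    obtain ⟨w, hw⟩ := hS.flow.exists_frame hq
    have h1 : 0 ≤ heat w G (z, s) := heat_nonneg_of_max hdt hh
    have cρ := hG.contDiffAt (hG.closure_subset (subset_closure hz)) s
    have ct : ContDiffAt ℝ 2 (fun q : Cn n × ℝ => K * q.2) (z, s) :=
      contDiffAt_const.mul contDiffAt_time
    rw [hGdef, heat_sub (cρ.sub ct) (hS.flow.contDiffAt hq), heat_sub cρ ct,
      heat_const_mul contDiffAt_time, heat_snd, IsFlow.heat_self hw, hS.flow.eq _ hq] at h1
    have h2 := hG.heat_le (q := (z, s)) (subset_closure hz) w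
    have h3 := hw.sum_norm_sq_ge hn
    have h4 := abs_le.mp (hS.flow.rhs_le _ (IsFlow.mem_rhs S.u hq))
    change -F ≤ rhs S.f S.u (z, s) ∧ _ at h4
    set L := Real.log (leviMatrix (hessForm S.u (z, s))).det.re
    -- The linear growth in -L is absorbed by the exponential coming from ρ.
    have h5 := exp_barrier (x := -L / n) hG.κ_pos
    have h6 : (n : ℝ) * (-L / n) = -L := by field_simp
    have h7 := mul_le_mul_of_nonneg_left h5 hn'.le
    have h8 := mul_le_mul_of_nonneg_left h3 hG.κ_pos.le
    have h9 := mul_le_mul_of_nonneg_left (le_abs_self (Real.log (4 / κ))) hn'.le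
    have h10 : (n : ℝ) * (-L / n - κ / 4 * Real.exp (-L / n)) =
        -L - κ * (n / 4 * Real.exp (-L / n)) := by rw [mul_sub, h6]; ring
    rw [h10] at h7
    rw [hK] at h1
    linarith [h4.1]

/-- The uniform bound. -/
lemma exists_abs_u_le (hG : Geometry Ω W ρ r R κ C₀) (hn : 1 ≤ n) (hT : 0 < T) (Cu B F : ℝ) :
    ∃ M, 0 ≤ M ∧ ∀ S, IsSolution Ω T Cu B F S → ∀ z ∈ closure Ω, ∀ t ∈ Ioo 0 T,
      |S.u (z, t)| ≤ M := by
  refine ⟨|B| + C₀ + |Cu| + (n * |Real.log (4 / κ)| + |F| + 1) * T, ?_, ?_⟩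
  · have := hG.C₀_nonneg; positivity
  · intro S hS z hz t ht
    obtain ⟨hCu, hB, hF⟩ := hS.bound_nonneg hG hT
    rw [abs_of_nonneg hCu, abs_of_nonneg hB, abs_of_nonneg hF]
    have h1 := hS.u_le hG hn hz ht
    have h2 := hS.le_u hG hn hT hz ht
    have h3 := (_root_.abs_le.mp (hG.abs_le (hG.closure_subset hz))).1
    have h4 : max Cu B ≤ Cu + B := max_le (by linarith) (by linarith)
    have h5 : (n * |Real.log (4 / κ)| + F + 1) * t ≤ (n * |Real.log (4 / κ)| + F + 1) * T := by
      have : 0 ≤ n * |Real.log (4 / κ)| + F + 1 := by positivity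
      exact mul_le_mul_of_nonneg_left ht.2.le this
    have h6 : 0 ≤ (n * |Real.log (4 / κ)| + F + 1) * T := by positivity
    have := hG.C₀_nonneg
    rw [_root_.abs_le]
    constructor <;> linarith

/-- The time derivative up to the boundary. -/
def timeDeriv (T : ℝ) (u : Cn n × ℝ → ℝ) (q : Cn n × ℝ) : ℝ :=
  derivWithin (fun t => u (q.1, t)) (Ico 0 T) q.2

lemma timeDeriv_eq {u : Cn n × ℝ → ℝ} {q : Cn n × ℝ} (hu : DifferentiableAt ℝ u q)
    (hq : q.2 ∈ Ioo 0 T) : timeDeriv T u q = dt u q := by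
  have h2 : HasDerivAt (fun s : ℝ => (q.1, s)) ((0 : Cn n), (1 : ℝ)) q.2 :=
    (hasDerivAt_const q.2 q.1).prodMk (hasDerivAt_id q.2)
  have h3 : HasDerivAt (fun s : ℝ => u (q.1, s)) (dt u q) q.2 :=
    HasFDerivAt.comp_hasDerivAt (l := u) q.2 hu.hasFDerivAt h2
  rw [timeDeriv, derivWithin_of_mem_nhds (Ico_mem_nhds hq.1 hq.2), h3.deriv]

/-- Since u = φ on the lateral boundary at all times, the time derivatives agree there. The bound on
∂φ/∂t is known only inside and passes to the boundary by continuity. -/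
lemma abs_timeDeriv_frontier_le (hS : IsSolution Ω T Cu B F S) (hG : Geometry Ω W ρ r R κ C₀)
    {z : Cn n} (hz : z ∈ frontier Ω) {t : ℝ} (ht : t ∈ Ioo 0 T) :
    |timeDeriv T S.u (z, t)| ≤ B := by
  set E := closure Ω ×ˢ Ico 0 T with hE
  have hU : UniqueDiffOn ℝ E := hG.uniqueDiffOn.prod (uniqueDiffOn_Ico 0 T)
  have hmem : ∀ y ∈ closure Ω, (y, t) ∈ E := fun y hy => ⟨hy, Ioo_subset_Ico_self ht⟩
  have h1 : ∀ y ∈ closure Ω, timeDeriv T S.φ (y, t) = fderivWithin ℝ S.φ E (y, t) (0, 1) := by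
    intro y hy
    have e1 := (hS.smooth_φ.differentiableOn (by simp) (y, t) (hmem y hy)).hasFDerivWithinAt
    have e2 : HasDerivWithinAt (fun s : ℝ => (y, s)) ((0 : Cn n), (1 : ℝ)) (Ico 0 T) t :=
      ((hasDerivAt_const t y).prodMk (hasDerivAt_id t)).hasDerivWithinAt
    have e3 := e1.comp_hasDerivWithinAt t e2 fun s hs => ⟨hy, hs⟩
    exact e3.derivWithin (uniqueDiffOn_Ico 0 T t (Ioo_subset_Ico_self ht))
  have h2 : timeDeriv T S.u (z, t) = timeDeriv T S.φ (z, t) :=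
    derivWithin_congr (fun s hs => hS.boundary z hz s hs)
      (hS.boundary z hz t (Ioo_subset_Ico_self ht))
  have hzc := frontier_subset_closure hz
  rw [h2, h1 z hzc]
  have hc : ContinuousOn (fun y => fderivWithin ℝ S.φ E (y, t) (0, 1)) (closure Ω) := by
    have e1 : ContinuousOn (fderivWithin ℝ S.φ E) E :=
      (hS.smooth_φ.fderivWithin hU (m := ∞) (by simp)).continuousOn
    exact (e1.comp (Continuous.prodMk_left t).continuousOn hmem).clm_apply continuousOn_const
  refine le_on_closure (fun y hy => ?_) hc.abs continuousOn_const hzc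
  rw [← h1 y (subset_closure hy)]
  have hT' : Tame (Ω ×ˢ Ioo 0 T) B S.φ := hS.tame_φ [] (by simp)
  have hq : (y, t) ∈ Ω ×ˢ Ioo 0 T := ⟨hy, ht⟩
  rw [timeDeriv_eq ((hT'.smooth.contDiffAt_two hS.flow.isOpen_prod hq).differentiableAt (by simp))
    ht]
  exact hT'.dt_bound _ hq

/-- The maximum principle is applied to σ(t u̇ - u) - Kt, σ being a sign. The factor t removes u̇ at
the initial time. In the equation the u̇ from differentiating t cancels the one from `heat_self`,
leaving t b + c t u̇ + n with b = f_t and c = f_u ≤ 0. -/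
lemma time_mul_dt_le (hS : IsSolution Ω T Cu B F S) (hG : Geometry Ω W ρ r R κ C₀) (hT : 0 < T)
    {M : ℝ} (hM : ∀ z ∈ closure Ω, ∀ t ∈ Ioo 0 T, |S.u (z, t)| ≤ M) {σ : ℝ} (hσ : |σ| = 1)
    {z : Cn n} (hz : z ∈ Ω) {t : ℝ} (ht : t ∈ Ioo 0 T) :
    σ * (t * dt S.u (z, t)) ≤ (T * B + M + Cu) + M + (T * F + n + 1) * T := by
  obtain ⟨hCu, hB, hF⟩ := hS.bound_nonneg hG hT
  have hM0 : 0 ≤ M := (abs_nonneg _).trans (hM z (subset_closure hz) t ht)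
  have hσabs : ∀ x, σ * x ≤ |x| := fun x => by
    have := le_abs_self (σ * x); rwa [abs_mul, hσ, one_mul] at this
  set K := T * F + n + 1 with hK
  have hK0 : 0 ≤ K := by positivity
  set G : Cn n × ℝ → ℝ := fun q => σ * (q.2 * timeDeriv T S.u q - S.u q) - K * q.2 with hGdef
  have hsub : Icc 0 t ⊆ Ico 0 T := fun s hs => ⟨hs.1, hs.2.trans_lt ht.2⟩
  have hs' : ∀ s, s ∈ Ioc 0 t → s ∈ Ioo 0 T := fun s hs => ⟨hs.1, hs.2.trans_lt ht.2⟩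
  have hO := hS.flow.isOpen_prod
  have hdt := dirDeriv_contDiffOn hO hS.flow.smooth ((0 : Cn n), (1 : ℝ))
  have htd : ∀ q ∈ Ω ×ˢ Ioo 0 T, timeDeriv T S.u q = dt S.u q := fun q hq =>
    timeDeriv_eq ((hS.flow.contDiffAt hq).differentiableAt (by simp)) hq.2
  set G' : Cn n × ℝ → ℝ := fun q => σ * (q.2 * dt S.u q - S.u q) - K * q.2 with hG'def
  have hGG : ∀ q ∈ Ω ×ˢ Ioo 0 T, G =ᶠ[𝓝 q] G' := fun q hq => by
    filter_upwards [hO.mem_nhds hq] with q' hq'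
    simp only [hGdef, hG'def, htd q' hq']
  have c1 : ∀ q ∈ Ω ×ˢ Ioo 0 T, ContDiffAt ℝ 2 (dt S.u) q := fun q hq => hdt.contDiffAt_two hO hq
  have c2 : ∀ q ∈ Ω ×ˢ Ioo 0 T, ContDiffAt ℝ 2 (fun q : Cn n × ℝ => q.2 * dt S.u q) q :=
    fun q hq => contDiffAt_time.mul (c1 q hq)
  have hG'c : ∀ q ∈ Ω ×ˢ Ioo 0 T, ContDiffAt ℝ 2 G' q := fun q hq =>
    (contDiffAt_const.mul ((c2 q hq).sub (hS.flow.contDiffAt hq))).sub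
      (contDiffAt_const.mul contDiffAt_time)
  have hcont : ContinuousOn G (closure Ω ×ˢ Icc 0 t) :=
    (((continuousOn_const.mul ((continuousOn_snd.mul hS.c21.2.2.1).sub hS.cont)).sub
      (continuousOn_const.mul continuousOn_snd))).mono (prod_mono subset_rfl hsub)
  have hmain := parabolic_max hG.isOpen hG.isBounded (a := 0) (b := t) (G := G)
    (M := T * B + M + Cu) hcont
    (fun z hz s hs => (hG'c (z, s) ⟨hz, hs' s hs⟩).congr_of_eventuallyEq
      (hGG (z, s) ⟨hz, hs' s hs⟩)) ?_ ?_ ?_ z (subset_closure hz) t ⟨ht.1.le, le_rfl⟩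
  · simp only [hGdef] at hmain
    rw [htd (z, t) ⟨hz, ht⟩] at hmain
    have h1 := hσabs (S.u (z, t))
    have h2 := hM z (subset_closure hz) t ht
    have h3 : K * t ≤ K * T := mul_le_mul_of_nonneg_left ht.2.le hK0
    rw [mul_sub] at hmain
    linarith
  · intro z hz s hs
    simp only [hGdef]
    have h1 : 0 ≤ K * s := mul_nonneg hK0 hs.1
    have hTB : 0 ≤ T * B := by positivity
    rcases hs.1.eq_or_lt with h | h
    · rw [← h]
      have h2 := hS.initial z (frontier_subset_closure hz)
      have h3 := hσabs (-S.u (z, 0))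
      rw [abs_neg] at h3
      simp only [zero_mul, zero_sub, mul_zero, sub_zero]
      linarith
    · have hs2 : s ∈ Ioo 0 T := hs' s ⟨h, hs.2⟩
      have h2 := hS.abs_timeDeriv_frontier_le hG hz hs2
      have h3 := hσabs (s * timeDeriv T S.u (z, s) - S.u (z, s))
      have h4 := abs_sub (s * timeDeriv T S.u (z, s)) (S.u (z, s))
      rw [abs_mul, abs_of_nonneg hs.1] at h4
      have h5 := hM z (frontier_subset_closure hz) s hs2
      have h6 : s * |timeDeriv T S.u (z, s)| ≤ T * B :=
        mul_le_mul hs2.2.le h2 (abs_nonneg _) hT.le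
      linarith
  · intro z hz
    simp only [hGdef, zero_mul, zero_sub, mul_zero, sub_zero]
    have h2 := hS.initial z (subset_closure hz)
    have h3 := hσabs (-S.u (z, 0))
    rw [abs_neg] at h3
    have hTB : 0 ≤ T * B := by positivity
    linarith
  · intro z hz s hs hbig _ hdt hh
    have hq : (z, s) ∈ Ω ×ˢ Ioo 0 T := ⟨hz, hs' s hs⟩
    obtain ⟨w, hw⟩ := hS.flow.exists_frame hq
    have h1 : 0 ≤ heat w G (z, s) := heat_nonneg_of_max hdt hh
    rw [heat_congr (hGG _ hq), hG'def,
      heat_sub (contDiffAt_const.mul ((c2 _ hq).sub (hS.flow.contDiffAt hq)))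
        (contDiffAt_const.mul contDiffAt_time),
      heat_const_mul ((c2 _ hq).sub (hS.flow.contDiffAt hq)), heat_const_mul contDiffAt_time,
      heat_sub (c2 _ hq) (hS.flow.contDiffAt hq), heat_time_mul (c1 _ hq), heat_snd,
      IsFlow.heat_self hw] at h1
    obtain ⟨b, c, hb, -, hc0, hbc⟩ := hS.flow.heat_dt hq hw
    rw [hbc] at h1
    simp only [hGdef] at hbig
    rw [htd _ hq] at hbig
    have hTB : 0 ≤ T * B := by positivity
    -- Where the test function exceeds the claimed bound, σ t u̇ is nonnegative, so the term with
    -- f_u has the favourable sign.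
    have h2 : 0 ≤ σ * (s * dt S.u (z, s)) := by
      have e1 := hσabs (-S.u (z, s))
      rw [abs_neg] at e1
      have e2 := hM z (subset_closure hz) s (hs' s hs)
      have e3 : 0 ≤ K * s := mul_nonneg hK0 hs.1.le
      rw [mul_sub] at hbig
      linarith
    have h3 := mul_nonpos_of_nonpos_of_nonneg hc0 h2
    have h4 : σ * (s * b) ≤ T * F := by
      refine (hσabs _).trans ?_
      rw [abs_mul, abs_of_nonneg hs.1.le]
      exact mul_le_mul (hs' s hs).2.le hb (abs_nonneg _) hT.le
    have h5 : σ * n ≤ n := (hσabs _).trans_eq (abs_of_nonneg (by positivity))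
    have h6 : σ * (s * (b + c * dt S.u (z, s)) + dt S.u (z, s) - (dt S.u (z, s) - n)) =
        σ * (s * b) + c * (σ * (s * dt S.u (z, s))) + σ * n := by ring
    simp only at h1
    rw [h6] at h1
    linarith

/-- The bound of the time derivative and of the determinant away from the initial time. -/
lemma exists_abs_dt_le (hG : Geometry Ω W ρ r R κ C₀) (hn : 1 ≤ n) (hT : 0 < T) (Cu B F : ℝ)
    {a : ℝ} (ha : 0 < a) : ∃ K, 0 ≤ K ∧ ∀ S, IsSolution Ω T Cu B F S → ∀ z ∈ Ω, ∀ t ∈ Ioo 0 T,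
      a ≤ t → |dt S.u (z, t)| ≤ K ∧
        |Real.log (leviMatrix (hessForm S.u (z, t))).det.re| ≤ K := by
  obtain ⟨M, hM0, hM⟩ := exists_abs_u_le hG hn hT Cu B F
  -- Absolute values are taken because the constant precedes the solution, and only the existence of
  -- a solution forces `Cu`, `B` and `F` to be nonnegative. The same device recurs below.
  set C := (T * |B| + M + |Cu|) + M + (T * |F| + n + 1) * T with hC
  refine ⟨C / a + |F|, by positivity, ?_⟩
  intro S hS z hz t ht hat
  obtain ⟨hCu, hB, hF⟩ := hS.bound_nonneg hG hT
  have h1 := hS.time_mul_dt_le hG hT (hM S hS) (σ := 1) (by simp) hz ht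
  have h2 := hS.time_mul_dt_le hG hT (hM S hS) (σ := -1) (by simp) hz ht
  rw [← abs_of_nonneg hCu, ← abs_of_nonneg hB, ← abs_of_nonneg hF, ← hC] at h1 h2
  have h3 : |dt S.u (z, t)| ≤ C / a := by
    rw [le_div_iff₀ ha]
    have h4 : t * |dt S.u (z, t)| ≤ C := by
      rw [← abs_of_pos ht.1, ← abs_mul, abs_of_pos ht.1, _root_.abs_le]
      constructor <;> linarith
    have := mul_le_mul_of_nonneg_right hat (abs_nonneg (dt S.u (z, t)))
    linarith
  have hq : (z, t) ∈ Ω ×ˢ Ioo 0 T := ⟨hz, ht⟩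
  have h4 := hS.flow.eq _ hq
  have h5 : |rhs S.f S.u (z, t)| ≤ F := hS.flow.rhs_le _ (IsFlow.mem_rhs S.u hq)
  refine ⟨h3.trans (by simp), ?_⟩
  have h6 : Real.log (leviMatrix (hessForm S.u (z, t))).det.re =
    dt S.u (z, t) - rhs S.f S.u (z, t) := by rw [h4]; ring
  rw [h6, abs_of_nonneg hF]
  exact (abs_sub _ _).trans (by linarith)

end IsSolution

end

/-! ### Comparison with the boundary values and the gradient on the boundary. -/

noncomputable section

open Filter Topology

section Forms

variable {n : ℕ} {g h : Cn n × ℝ → ℝ} {q : Cn n × ℝ}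

lemma hessForm_add (hg : ContDiffAt ℝ 2 g q) (hh : ContDiffAt ℝ 2 h q) :
    hessForm (fun p => g p + h p) q = hessForm g q + hessForm h q := by
  ext v w
  rw [add_apply, add_apply, hessForm_apply hg, hessForm_apply hh, hessForm_apply (hg.add hh),
    dirDeriv_dirDeriv_add hg hh]

lemma hessForm_const_mul (hg : ContDiffAt ℝ 2 g q) (c : ℝ) :
    hessForm (fun p => c * g p) q = c • hessForm g q := by
  ext v w
  rw [smul_apply, smul_apply, hessForm_apply hg, hessForm_apply (contDiffAt_const.mul hg),
    dirDeriv_dirDeriv_const_mul hg, smul_eq_mul]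

lemma hessForm_sub (hg : ContDiffAt ℝ 2 g q) (hh : ContDiffAt ℝ 2 h q) :
    hessForm (fun p => g p - h p) q = hessForm g q - hessForm h q := by
  have := hessForm_add hg (contDiffAt_const.mul hh : ContDiffAt ℝ 2 (fun p => (-1) * h p) q)
  rw [hessForm_const_mul hh] at this
  rw [show (fun p => g p - h p) = fun p => g p + (-1) * h p from by ext; ring, this]
  ext v w; simp [sub_eq_add_neg]

lemma levi_add (A B : RealBilin n) (x : Cn n) : levi (A + B) x = levi A x + levi B x := by
  simp only [levi, add_apply]; ring

lemma levi_sub (A B : RealBilin n) (x : Cn n) : levi (A - B) x = levi A x - levi B x := by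
  simp only [levi, sub_apply]; ring

lemma levi_smul_form (c : ℝ) (A : RealBilin n) (x : Cn n) : levi (c • A) x = c * levi A x := by
  simp only [levi, smul_apply, smul_eq_mul]; ring

lemma Tame.abs_sum_levi_le {Q : Set (Cn n × ℝ)} {C : ℝ} (hQ : IsOpen Q) (hg : Tame Q C g)
    (hq : q ∈ Q) (w : Fin n → Cn n) :
    |∑ k, levi (hessForm g q) (w k)| ≤ 2 * C * ∑ k, ‖w k‖ ^ 2 := by
  rw [Finset.mul_sum]
  exact (Finset.abs_sum_le_sum_abs _ _).trans
    (Finset.sum_le_sum fun k _ => hg.abs_levi_le hQ hq (w k))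

end Forms

section SqDist

variable {n : ℕ}

/-- The squared distance to a point of space. -/
def sqDist (p : Cn n) (q : Cn n × ℝ) : ℝ := ‖q.1 - p‖ ^ 2

lemma contDiff_sqDist (p : Cn n) : ContDiff ℝ ∞ (sqDist p) :=
  ContDiff.norm_sq ℝ (contDiff_fst.sub contDiff_const)

lemma dirDeriv_sqDist (p v : Cn n) (s : ℝ) (q : Cn n × ℝ) :
    dirDeriv (v, s) (sqDist p) q = 2 * inner ℝ (q.1 - p) v := by
  have h1 : HasFDerivAt (fun q : Cn n × ℝ => q.1 - p) (ContinuousLinearMap.fst ℝ (Cn n) ℝ) q :=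
    hasFDerivAt_fst.sub_const p
  have h2 : HasFDerivAt (sqDist p) _ q := h1.norm_sq
  rw [dirDeriv, h2.fderiv]
  simp [inner_sub_left]

lemma dx_dx_sqDist (p v w : Cn n) (q : Cn n × ℝ) :
    dx v (dx w (sqDist p)) q = 2 * inner ℝ v w := by
  have h0 : dx w (sqDist p) = fun q => 2 * inner ℝ (q.1 - p) w :=
    funext fun q => dirDeriv_sqDist p w 0 q
  have h1 : HasFDerivAt (fun q : Cn n × ℝ => q.1 - p) (ContinuousLinearMap.fst ℝ (Cn n) ℝ) q :=
    hasFDerivAt_fst.sub_const p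
  have h2 := (h1.inner ℝ (hasFDerivAt_const w q)).const_mul 2
  rw [h0, dirDeriv, h2.fderiv]
  simp

lemma contDiffAt_sqDist (p : Cn n) (q : Cn n × ℝ) : ContDiffAt ℝ 2 (sqDist p) q :=
  (contDiff_sqDist p).contDiffAt.of_le (WithTop.coe_le_coe.mpr (le_top : (2 : ℕ∞) ≤ ⊤))

lemma heat_sqDist (p : Cn n) (w : Fin n → Cn n) (q : Cn n × ℝ) :
    heat w (sqDist p) q = -4 * ∑ k, ‖w k‖ ^ 2 := by
  rw [heat, dirDeriv_sqDist, inner_zero_right, mul_zero, zero_sub, neg_mul, Finset.mul_sum]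
  congr 1
  refine Finset.sum_congr rfl fun k _ => ?_
  rw [levi_hessForm (contDiffAt_sqDist p q),
    dx_dx_sqDist, dx_dx_sqDist, real_inner_self_eq_norm_sq, real_inner_self_eq_norm_sq,
    norm_I_smul]
  ring

lemma gradSq_sqDist_le (p : Cn n) (w : Fin n → Cn n) {q : Cn n × ℝ} {R : ℝ}
    (hR : ‖q.1 - p‖ ≤ R) : gradSq w (sqDist p) q ≤ 8 * R ^ 2 * ∑ k, ‖w k‖ ^ 2 := by
  rw [gradSq, Finset.mul_sum]
  refine Finset.sum_le_sum fun k _ => ?_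
  have h : ∀ v : Cn n, (dx v (sqDist p) q) ^ 2 ≤ 4 * R ^ 2 * ‖v‖ ^ 2 := fun v => by
    rw [dirDeriv_sqDist, mul_pow]
    have h1 := abs_real_inner_le_norm (q.1 - p) v
    have h2 : (inner ℝ (q.1 - p) v : ℝ) ^ 2 ≤ (R * ‖v‖) ^ 2 := by
      rw [← sq_abs]
      exact pow_le_pow_left₀ (abs_nonneg _)
        (h1.trans (mul_le_mul_of_nonneg_right hR (norm_nonneg v))) 2
    nlinarith
  have h1 := h (w k)
  have h2 := h (Complex.I • w k)
  rw [norm_I_smul] at h2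
  linarith

end SqDist

namespace IsSolution

variable {n : ℕ} {Ω W : Set (Cn n)} {ρ : Cn n → ℝ} {r R κ C₀ T Cu B F : ℝ} {S : SolData n}

/-- A bound on log det keeps the trace of the inverse Hessian away from zero, so that a strictly
plurisubharmonic barrier absorbs constants as well as multiples of ∑ ‖w k‖². -/
lemma frame_ge (hn : 1 ≤ n) {A : RealBilin n} {w : Fin n → Cn n} (hw : IsFrame A w) {K : ℝ}
    (hK : |Real.log (leviMatrix A).det.re| ≤ K) : n / 4 * Real.exp (-K) ≤ ∑ k, ‖w k‖ ^ 2 := by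
  refine le_trans ?_ (hw.sum_norm_sq_ge hn)
  have hn' : (1 : ℝ) ≤ n := by exact_mod_cast hn
  have h1 := (abs_le.mp hK).2
  have h0 : 0 ≤ K := (abs_nonneg _).trans hK
  have : -K ≤ -(Real.log (leviMatrix A).det.re) / n := by
    rw [le_div_iff₀ (by linarith)]
    nlinarith
  gcongr

/-- Comparison of the solution with its boundary values near the boundary. -/
lemma exists_abs_sub_le (hG : Geometry Ω W ρ r R κ C₀) (hn : 1 ≤ n) (hT : 0 < T) (Cu B F : ℝ)
    {a : ℝ} (ha : 0 < a) : ∃ A, 0 ≤ A ∧ ∀ S, IsSolution Ω T Cu B F S → ∀ z ∈ closure Ω,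
      ∀ t ∈ Ioo 0 T, a ≤ t → |S.u (z, t) - S.φ (z, t)| ≤ -A * ρ z := by
  obtain ⟨K, hK0, hK⟩ := exists_abs_dt_le hG hn hT Cu B F ha
  have hκ := hG.κ_pos
  refine ⟨(2 * |B| + 8 * Real.exp K) / κ, by positivity, ?_⟩
  intro S hS z hz t ht hat
  obtain ⟨hCu, hB, hF⟩ := hS.bound_nonneg hG hT
  rw [abs_of_nonneg hB]
  -- In the trace over w the Levi form of Aρ is at least Aκ ∑ ‖w k‖². The part 2B pays for φ; the
  -- part 8 exp K is worth at least 2n by `frame_ge`, more than the trace n of u itself.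
  set A := (2 * B + 8 * Real.exp K) / κ with hA
  have hAκ : A * κ = 2 * B + 8 * Real.exp K := by rw [hA]; field_simp
  have hA0 : 0 ≤ A := by positivity
  have hO := hS.flow.isOpen_prod
  have hφ : Tame (Ω ×ˢ Ioo 0 T) B S.φ := hS.tame_φ [] (by simp)
  have cφ : ∀ z ∈ Ω, ContDiffAt ℝ 2 S.φ (z, t) := fun z hz =>
    hφ.smooth.contDiffAt_two hO ⟨hz, ht⟩
  have cu : ∀ z ∈ Ω, ContDiffAt ℝ 2 S.u (z, t) := fun z hz => hS.flow.contDiffAt ⟨hz, ht⟩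
  have cρ : ∀ z ∈ Ω, ContDiffAt ℝ 2 (fun q => A * liftFn ρ q) (z, t) := fun z hz =>
    contDiffAt_const.mul (hG.contDiffAt (hG.closure_subset (subset_closure hz)) t)
  have scu := IsC2UpTo.slice_continuousOn hS.c2.cont ht
  have scφ := IsC2UpTo.slice_continuousOn hS.c2_φ.cont ht
  have scρ : ContinuousOn (fun z => A * liftFn ρ (z, t)) (closure Ω) :=
    continuousOn_const.mul (hG.smooth.continuousOn.mono hG.closure_subset)
  have key : ∀ z ∈ Ω, ∃ w, IsFrame (hessForm S.u (z, t)) w ∧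
      n < A * ∑ k, levi (hessForm (liftFn ρ) (z, t)) (w k)
        - |∑ k, levi (hessForm S.φ (z, t)) (w k)| := by
    intro z hz
    have hq : (z, t) ∈ Ω ×ˢ Ioo 0 T := ⟨hz, ht⟩
    obtain ⟨w, hw⟩ := hS.flow.exists_frame hq
    refine ⟨w, hw, ?_⟩
    have h1 := frame_ge hn hw (hK S hS z hz t ht hat).2
    have h2 := hφ.abs_sum_levi_le hO hq w
    have h3 : κ * ∑ k, ‖w k‖ ^ 2 ≤ ∑ k, levi (hessForm (liftFn ρ) (z, t)) (w k) := by
      rw [Finset.mul_sum]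
      exact Finset.sum_le_sum fun k _ => hG.levi_ge z (subset_closure hz) t (w k)
    have h4 := mul_le_mul_of_nonneg_left h3 hA0
    rw [← mul_assoc, hAκ] at h4
    have h5 : 8 * Real.exp K * (n / 4 * Real.exp (-K)) = 2 * n := by
      rw [Real.exp_neg]; field_simp; norm_num
    have h6 := mul_le_mul_of_nonneg_left h1 (by positivity : 0 ≤ 8 * Real.exp K)
    have hn' : (1 : ℝ) ≤ n := by exact_mod_cast hn
    linarith
  have hbd : ∀ z ∈ frontier Ω, S.u (z, t) = S.φ (z, t) := fun z hz =>
    hS.boundary z hz t (Ioo_subset_Ico_self ht)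
  have hlow := elliptic_max hG.isOpen hG.isBounded (t := t) (M := 0)
    (G := fun q => (S.φ q - S.u q) + A * liftFn ρ q) ((scφ.sub scu).add scρ)
    (fun z hz => ((cφ z hz).sub (cu z hz)).add (cρ z hz))
    (fun z hz => by simp [liftFn, hG.eq_zero hz, hbd z hz]) (fun z hz hh => by
      obtain ⟨w, hw, h1⟩ := key z hz
      have h2 : ∑ k, levi (hessForm (fun q => (S.φ q - S.u q) + A * liftFn ρ q) (z, t)) (w k) ≤ 0 :=
        Finset.sum_nonpos fun k _ => add_nonpos (hh _) (hh _)
      rw [hessForm_add ((cφ z hz).sub (cu z hz)) (cρ z hz), hessForm_sub (cφ z hz) (cu z hz),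
        hessForm_const_mul (hG.contDiffAt (hG.closure_subset (subset_closure hz)) t)] at h2
      simp only [levi_add, levi_sub, levi_smul_form, Finset.sum_add_distrib,
        Finset.sum_sub_distrib, ← Finset.mul_sum, hw.sum_levi] at h2
      have h3 := neg_abs_le (∑ k, levi (hessForm S.φ (z, t)) (w k))
      linarith) z hz
  have hup := elliptic_max hG.isOpen hG.isBounded (t := t) (M := 0)
    (G := fun q => (S.u q - S.φ q) + A * liftFn ρ q) ((scu.sub scφ).add scρ)
    (fun z hz => ((cu z hz).sub (cφ z hz)).add (cρ z hz))
    (fun z hz => by simp [liftFn, hG.eq_zero hz, hbd z hz]) (fun z hz hh => by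
      obtain ⟨w, hw, h1⟩ := key z hz
      have h2 : ∑ k, levi (hessForm (fun q => (S.u q - S.φ q) + A * liftFn ρ q) (z, t)) (w k) ≤ 0 :=
        Finset.sum_nonpos fun k _ => add_nonpos (hh _) (hh _)
      rw [hessForm_add ((cu z hz).sub (cφ z hz)) (cρ z hz), hessForm_sub (cu z hz) (cφ z hz),
        hessForm_const_mul (hG.contDiffAt (hG.closure_subset (subset_closure hz)) t)] at h2
      simp only [levi_add, levi_sub, levi_smul_form, Finset.sum_add_distrib,
        Finset.sum_sub_distrib, ← Finset.mul_sum, hw.sum_levi] at h2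
      have h3 := le_abs_self (∑ k, levi (hessForm S.φ (z, t)) (w k))
      have hn' : (1 : ℝ) ≤ n := by exact_mod_cast hn
      linarith) z hz
  simp only [liftFn] at hlow hup
  rw [abs_le]
  constructor <;> linarith

/-- The boundary gradient estimate, relative to the defining function. -/
lemma exists_abs_grad_sub_le (hG : Geometry Ω W ρ r R κ C₀) (hn : 1 ≤ n) (hT : 0 < T)
    (Cu B F : ℝ) {a : ℝ} (ha : 0 < a) : ∃ A, 0 ≤ A ∧ ∀ S, IsSolution Ω T Cu B F S →
      ∀ p ∈ frontier Ω, ∀ t ∈ Ioo 0 T, a ≤ t → ∀ v,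
      |(S.u₁ (p, t) - S.φ₁ (p, t)) v| ≤ A * |gradForm (liftFn ρ) (p, t) v| := by
  obtain ⟨A, hA0, hA⟩ := exists_abs_sub_le hG hn hT Cu B F ha
  refine ⟨A, hA0, fun S hS p hp t ht hat v => ?_⟩
  have hpc := frontier_subset_closure hp
  refine hG.abs_deriv_le_of_barrier (K := 0) hp
    ((hS.c2.sub hS.c2_φ).deriv₁ p hpc t ht) ?_ (fun z hz => ?_) v
  · simp only [hS.boundary p hp t (Ioo_subset_Ico_self ht), sub_self]
  · have := hA S hS z (subset_closure hz) t ht hat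
    linarith

lemma φ₁_le (hS : IsSolution Ω T Cu B F S) {z : Cn n} (hz : z ∈ closure Ω) {t : ℝ}
    (ht : t ∈ Ioo 0 T) (v : Cn n) : |S.φ₁ (z, t) v| ≤ B * ‖v‖ := by
  have hc : ContinuousOn (fun z => S.φ₁ (z, t) v) (closure Ω) :=
    (IsC2UpTo.slice_continuousOn hS.c2_φ.cont₁ ht).clm_apply continuousOn_const
  refine le_on_closure (fun z hz => ?_) hc.abs continuousOn_const hz
  have hφ : Tame (Ω ×ˢ Ioo 0 T) B S.φ := hS.tame_φ [] (by simp)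
  rw [hS.c2_φ.eq₁ hS.flow.isOpen hφ.smooth ⟨hz, ht⟩]
  exact hφ.dx_bound (z, t) ⟨hz, ht⟩ v

lemma φ₂_le (hS : IsSolution Ω T Cu B F S) {z : Cn n} (hz : z ∈ closure Ω) {t : ℝ}
    (ht : t ∈ Ioo 0 T) (v : Cn n) : |S.φ₂ (z, t) v v| ≤ B * ‖v‖ ^ 2 := by
  have hc : ContinuousOn (fun z => S.φ₂ (z, t) v v) (closure Ω) :=
    IsC2UpTo.slice_continuousOn (hS.c2_φ.cont₂ v v) ht
  refine le_on_closure (fun z hz => ?_) hc.abs continuousOn_const hz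
  have hφ : Tame (Ω ×ˢ Ioo 0 T) B S.φ := hS.tame_φ [] (by simp)
  have hq : (z, t) ∈ Ω ×ˢ Ioo 0 T := ⟨hz, ht⟩
  rw [hS.c2_φ.eq₂ hS.flow.isOpen hφ.smooth hq,
    hessForm_apply (hφ.smooth.contDiffAt_two hS.flow.isOpen_prod hq)]
  exact hφ.hess_bound (z, t) hq v

lemma exists_abs_grad_frontier_le (hG : Geometry Ω W ρ r R κ C₀) (hn : 1 ≤ n) (hT : 0 < T)
    (Cu B F : ℝ) {a : ℝ} (ha : 0 < a) : ∃ A, 0 ≤ A ∧ ∀ S, IsSolution Ω T Cu B F S →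
      ∀ p ∈ frontier Ω, ∀ t ∈ Ioo 0 T, a ≤ t → ∀ v, |S.u₁ (p, t) v| ≤ A * ‖v‖ := by
  obtain ⟨A, hA0, hA⟩ := exists_abs_grad_sub_le hG hn hT Cu B F ha
  refine ⟨A * C₀ + |B|, by have := hG.C₀_nonneg; positivity, fun S hS p hp t ht hat v => ?_⟩
  have hpc := frontier_subset_closure hp
  have h1 := hA S hS p hp t ht hat v
  have h2 := hS.φ₁_le hpc ht v
  have h3 : |gradForm (liftFn ρ) (p, t) v| ≤ C₀ * ‖v‖ :=
    (hG.tame [] (by simp)).dx_bound (p, t) ⟨hG.closure_subset hpc, mem_univ _⟩ v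
  have h4 : S.u₁ (p, t) v = (S.u₁ (p, t) - S.φ₁ (p, t)) v + S.φ₁ (p, t) v := by
    rw [sub_apply]; ring
  have h5 := mul_le_mul_of_nonneg_left h3 hA0
  have h6 : B * ‖v‖ ≤ |B| * ‖v‖ := mul_le_mul_of_nonneg_right (le_abs_self B) (norm_nonneg v)
  rw [h4]
  refine (abs_add_le _ _).trans ?_
  linarith

end IsSolution

end

/-! ### The maximum principle for a small power. -/

noncomputable section

open Filter Topology

section Shift

variable {n : ℕ} {q : Cn n × ℝ} {w : Fin n → Cn n} {g h : Cn n × ℝ → ℝ}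

lemma contDiffAt_shift (a : ℝ) : ContDiffAt ℝ 2 (fun q : Cn n × ℝ => q.2 - a) q :=
  contDiffAt_snd.sub contDiffAt_const

lemma dirDeriv_shift (a : ℝ) (v : Cn n) (s : ℝ) :
    dirDeriv (v, s) (fun q : Cn n × ℝ => q.2 - a) q = s := by
  rw [dirDeriv_sub_apply differentiableAt_snd (differentiableAt_const a), dirDeriv_snd,
    dirDeriv_const, sub_zero]

lemma heat_shift_mul (a : ℝ) (hg : ContDiffAt ℝ 2 g q) :
    heat w (fun q => (q.2 - a) * g q) q = (q.2 - a) * heat w g q + g q := by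
  have h1 : heat w (fun q : Cn n × ℝ => q.2 - a) q = 1 := by
    rw [heat_sub contDiffAt_time contDiffAt_const, heat_snd, heat_const, sub_zero]
  have h2 : gradProd w (fun q : Cn n × ℝ => q.2 - a) g q = 0 := by
    simp [gradProd, dirDeriv_shift]
  rw [heat_mul (contDiffAt_shift a) hg, h1, h2]; ring

lemma dx_shift_mul (a : ℝ) (hg : DifferentiableAt ℝ g q) (v : Cn n) :
    dx v (fun q => (q.2 - a) * g q) q = (q.2 - a) * dx v g q := by
  rw [dirDeriv_mul_apply (differentiableAt_snd.sub_const a) hg, dirDeriv_shift]; ring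

/-- At a critical point of c g + h the gradient of g is traded for that of h. -/
lemma gradSq_const_mul_eq {c : ℝ} (hgh : ∀ v, c * dx v g q = -dx v h q) :
    c ^ 2 * gradSq w g q = gradSq w h q := by
  rw [gradSq, gradSq, Finset.mul_sum]
  refine Finset.sum_congr rfl fun k _ => ?_
  have h1 := hgh (w k)
  have h2 := hgh (Complex.I • w k)
  have h3 : (c * dx (w k) g q) ^ 2 = (dx (w k) h q) ^ 2 := by rw [h1]; ring
  have h4 : (c * dx (Complex.I • w k) g q) ^ 2 = (dx (Complex.I • w k) h q) ^ 2 := by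
    rw [h2]; ring
  rw [mul_add, ← mul_pow, ← mul_pow, h3, h4]

/-- The operator on a power of a subsolution. -/
lemma heat_rpow_le {σ C₁ : ℝ} (hσ : 0 < σ) (hg : ContDiffAt ℝ 2 g q)
    (h1 : 1 ≤ g q) (hh : heat w g q ≤ C₁ * g q) :
    ContDiffAt ℝ 2 (fun p => g p ^ σ) q ∧
    heat w (fun p => g p ^ σ) q ≤
      σ * C₁ * g q ^ σ + gradSq w (fun p => g p ^ σ) q / (σ * g q ^ σ) := by
  have hpos : 0 < g q := by linarith
  have hc : ContDiffAt ℝ 2 (fun p => g p ^ σ) q := hg.rpow_const_of_ne hpos.ne'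
  refine ⟨hc, ?_⟩
  have hψ : ∀ᶠ x in 𝓝 (g q), HasDerivAt (fun x : ℝ => x ^ σ) (σ * x ^ (σ - 1)) x := by
    filter_upwards [lt_mem_nhds hpos] with x hx
    exact Real.hasDerivAt_rpow_const (Or.inl hx.ne')
  have hψ₁ : HasDerivAt (fun x : ℝ => σ * x ^ (σ - 1)) (σ * ((σ - 1) * (g q) ^ (σ - 1 - 1)))
      (g q) := (Real.hasDerivAt_rpow_const (Or.inl hpos.ne')).const_mul σ
  rw [heat_comp (ψ := fun x => x ^ σ) hψ hψ₁ hg hc]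
  have hgr : gradSq w (fun p => g p ^ σ) q = (σ * g q ^ (σ - 1)) ^ 2 * gradSq w g q := by
    rw [gradSq, gradSq, Finset.mul_sum]
    refine Finset.sum_congr rfl fun k _ => ?_
    rw [dirDeriv_comp_apply (ψ := fun x => x ^ σ) hψ.self_of_nhds (hg.differentiableAt (by simp)),
      dirDeriv_comp_apply (ψ := fun x => x ^ σ) hψ.self_of_nhds (hg.differentiableAt (by simp))]
    ring
  rw [hgr]
  set Y := g q ^ σ with hY
  have hYpos : 0 < Y := Real.rpow_pos_of_pos hpos σ
  have e1 : g q ^ (σ - 1) = Y / g q := by rw [Real.rpow_sub_one hpos.ne']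
  have e2 : g q ^ (σ - 1 - 1) = Y / g q / g q := by rw [Real.rpow_sub_one hpos.ne', e1]
  rw [e1, e2]
  have a1 : σ * (Y / g q) * heat w g q ≤ σ * C₁ * Y := by
    have := mul_le_mul_of_nonneg_left hh (by positivity : 0 ≤ σ * (Y / g q))
    refine this.trans_eq ?_
    field_simp
  have hP : 0 ≤ Y / g q / g q * gradSq w g q :=
    mul_nonneg (by positivity) (gradSq_nonneg w g q)
  have a2 : (σ * (Y / g q)) ^ 2 * gradSq w g q / (σ * Y) = σ * (Y / g q / g q * gradSq w g q) := by
    field_simp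
  have a3 : σ * ((σ - 1) * (Y / g q / g q)) * gradSq w g q =
      (σ - 1) * (σ * (Y / g q / g q * gradSq w g q)) := by ring
  rw [a2, a3]
  -- The second order term of the power is σ(1 - σ) times the gradient term, here bounded by σ times
  -- it; this holds for every σ > 0.
  nlinarith [mul_nonneg hσ.le (mul_nonneg hσ.le hP)]

end Shift

/-- A priori bound of a positive subsolution by the maximum principle applied to a small power. -/
lemma exists_power_bound {σ : ℝ} (hσ : 0 < σ) {τ S₀ N₀ C₁ C₂ C₃ C₄ : ℝ} (hτ : 0 ≤ τ)
    (hS₀ : 0 ≤ S₀) (hN₀ : 0 ≤ N₀) (hC₁ : 0 ≤ C₁) (hC₂ : 0 ≤ C₂) (hC₃ : 0 ≤ C₃) (hC₄ : 0 ≤ C₄) :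
    ∃ C, 0 ≤ C ∧ ∀ {n : ℕ} {Ω : Set (Cn n)} {a b : ℝ} {s N : Cn n × ℝ → ℝ}, IsOpen Ω →
      Bornology.IsBounded Ω → b - a ≤ τ →
      ContinuousOn s (closure Ω ×ˢ Icc a b) → ContinuousOn N (closure Ω ×ˢ Icc a b) →
      (∀ z ∈ closure Ω, ∀ t ∈ Icc a b, 1 ≤ s (z, t)) →
      (∀ z ∈ closure Ω, ∀ t ∈ Icc a b, |N (z, t)| ≤ N₀) →
      (∀ z ∈ frontier Ω, ∀ t ∈ Icc a b, s (z, t) ≤ S₀) →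
      (∀ z ∈ Ω, ∀ t ∈ Ioc a b, ContDiffAt ℝ 2 s (z, t) ∧ ContDiffAt ℝ 2 N (z, t) ∧
        ∃ (w : Fin n → Cn n) (Z : ℝ), 0 ≤ Z ∧ heat w s (z, t) ≤ C₁ * s (z, t) ∧
          heat w N (z, t) ≤ C₂ - Z ∧ gradSq w N (z, t) ≤ C₃ * Z ∧ (s (z, t) ^ σ) ^ 2 ≤ C₄ * Z) →
      ∀ z ∈ closure Ω, ∀ t ∈ Icc a b, (t - a) * s (z, t) ^ σ ≤ C := by
  set c := C₄ * (2 * C₂) with hc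
  set d := 2 * C₄ * (1 + τ * (σ * C₁)) with hd
  have hc0 : 0 ≤ c := by positivity
  have hd0 : 0 ≤ d := by positivity
  set Ci := 2 * C₃ / σ + τ * (c + d + 1) + 1 with hCi
  have hCi0 : 0 < Ci := by positivity
  refine ⟨τ * S₀ ^ σ + Ci + 2 * N₀, by positivity, ?_⟩
  intro n Ω a b s N hΩ hb hab hs hN hs1 hNb hfr hint z hz t ht
  have hpow : ∀ z ∈ closure Ω, ∀ t ∈ Icc a b, 0 < s (z, t) ^ σ := fun z hz t ht =>
    Real.rpow_pos_of_pos (by linarith [hs1 z hz t ht]) σ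
  -- The factor q.2 - a removes the initial values of s, and N provides the good term -Z.
  have hmain := parabolic_max hΩ hb (a := a) (b := b)
    (G := fun q => (q.2 - a) * s q ^ σ + N q) (M := τ * S₀ ^ σ + Ci + N₀) ?_ ?_ ?_ ?_ ?_ z hz t ht
  · have := (abs_le.mp (hNb z hz t ht)).1
    simp only at hmain
    linarith
  · refine (((continuousOn_snd.sub continuousOn_const)).mul
      (hs.rpow_const fun q hq => Or.inl ?_)).add hN
    have := hs1 q.1 hq.1 q.2 hq.2
    exact (by linarith : (0 : ℝ) < s q).ne'
  · intro z hz t ht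
    obtain ⟨h1, h2, -⟩ := hint z hz t ht
    have := hs1 z (subset_closure hz) t (Ioc_subset_Icc_self ht)
    exact ((contDiffAt_shift a).mul (h1.rpow_const_of_ne (by linarith))).add h2
  · intro z hz t ht
    have hzc := frontier_subset_closure hz
    have h1 : s (z, t) ^ σ ≤ S₀ ^ σ :=
      Real.rpow_le_rpow (by linarith [hs1 z hzc t ht]) (hfr z hz t ht) hσ.le
    have h2 : (t - a) * s (z, t) ^ σ ≤ τ * S₀ ^ σ :=
      mul_le_mul (by linarith [ht.2]) h1 (hpow z hzc t ht).le hτ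
    have := (abs_le.mp (hNb z hzc t ht)).2
    simp only
    linarith
  · intro z hz
    simp only [sub_self, zero_mul, zero_add]
    have hS : 0 ≤ τ * S₀ ^ σ := by positivity
    by_cases hab' : a ≤ b
    · have := (abs_le.mp (hNb z (subset_closure hz) a ⟨le_rfl, hab'⟩)).2
      linarith
    · exact absurd (ht.1.trans ht.2) hab'
  · intro z hz t ht hbig hgrad hdt hh
    obtain ⟨h1, h2, w, Z, hZ, e1, e2, e3, e4⟩ := hint z hz t ht
    have hzc := subset_closure hz
    have htI := Ioc_subset_Icc_self ht
    have hs1' := hs1 z hzc t htI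
    obtain ⟨f1, f2⟩ := heat_rpow_le hσ h1 hs1' e1
    have h3 : 0 ≤ heat w (fun q => (q.2 - a) * s q ^ σ + N q) (z, t) := heat_nonneg_of_max hdt hh
    rw [heat_add ((contDiffAt_shift a).mul f1) h2, heat_shift_mul a f1] at h3
    have hg : ∀ v, (t - a) * dx v (fun p => s p ^ σ) (z, t) = -dx v N (z, t) := fun v => by
      have := hgrad v
      rw [dirDeriv_add_apply (((contDiffAt_shift a).mul f1).differentiableAt (by simp))
        (h2.differentiableAt (by simp)), dx_shift_mul a (f1.differentiableAt (by simp))] at this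
      simp only at this
      linarith
    have h4 := gradSq_const_mul_eq (w := w) hg
    simp only at h3 hbig
    set Y := s (z, t) ^ σ with hY
    have hYpos : 0 < Y := hpow z hzc t htI
    set Γ := gradSq w (fun p => s p ^ σ) (z, t)
    have hta : 0 < t - a := by linarith [ht.1]
    have htτ : t - a ≤ τ := by linarith [ht.2]
    have hNup := (abs_le.mp (hNb z hzc t htI)).2
    have hP : Ci < (t - a) * Y := by
      have : 0 ≤ τ * S₀ ^ σ := by positivity
      linarith
    have hPpos : 0 < (t - a) * Y := hCi0.trans hP
    -- By criticality (t - a)² Γ equals the gradient square of N, which is at most C₃ Z; the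
    -- remaining denominator σ(t - a)Y is at least 2C₃.
    have h5 : (t - a) * (Γ / (σ * Y)) ≤ Z / 2 := by
      have : (t - a) * (Γ / (σ * Y)) = ((t - a) ^ 2 * Γ) / (σ * ((t - a) * Y)) := by
        field_simp
      rw [this, h4, div_le_iff₀ (by positivity)]
      refine e3.trans ?_
      have h6 : 2 * C₃ ≤ σ * ((t - a) * Y) := by
        have h7 : 2 * C₃ / σ ≤ (t - a) * Y := by
          have : 0 ≤ τ * (c + d + 1) := by positivity
          linarith
        rw [div_le_iff₀ hσ] at h7
        linarith
      nlinarith [mul_le_mul_of_nonneg_right h6 hZ]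
    have h6 := mul_le_mul_of_nonneg_left f2 hta.le
    rw [mul_add] at h6
    have h7 : (t - a) * (σ * C₁ * Y) ≤ τ * (σ * C₁) * Y := by
      have := mul_le_mul_of_nonneg_right htτ (by positivity : 0 ≤ σ * C₁ * Y)
      linarith
    -- Nonnegativity of the operator at the maximum bounds Z linearly in Y, while Y² ≤ C₄ Z by
    -- hypothesis: the quadratic inequality closes.
    have h8 : Z ≤ 2 * C₂ + 2 * (1 + τ * (σ * C₁)) * Y := by linarith
    have h9 : Y ^ 2 ≤ c + d * Y := by
      have := mul_le_mul_of_nonneg_left h8 hC₄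
      rw [hc, hd]
      linarith
    have h10 : Y ≤ c + d + 1 := by
      by_contra! hY1
      have : 1 ≤ Y := by linarith
      nlinarith
    have h11 : (t - a) * Y ≤ τ * (c + d + 1) := mul_le_mul htτ h10 hYpos.le hτ
    have : 0 ≤ 2 * C₃ / σ := by positivity
    linarith

/-- Control of a power by the frame. -/
lemma rpow_sq_le_of_le_pow {n : ℕ} (hn : 1 ≤ n) {s C Z : ℝ} (hs : 0 ≤ s) (hC : 0 ≤ C) (hZ : 0 ≤ Z)
    (h : s ≤ C * Z ^ n) : (s ^ (1 / (2 * n) : ℝ)) ^ 2 ≤ C ^ (1 / n : ℝ) * Z := by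
  have hn' : (n : ℝ) ≠ 0 := by positivity
  have h1 : (s ^ (1 / (2 * n) : ℝ)) ^ 2 = s ^ (1 / n : ℝ) := by
    rw [← Real.rpow_natCast, ← Real.rpow_mul hs]
    congr 1
    push_cast; field_simp
  rw [h1]
  refine (Real.rpow_le_rpow hs h (by positivity)).trans_eq ?_
  rw [Real.mul_rpow hC (pow_nonneg hZ n), one_div, Real.pow_rpow_inv_natCast hZ (by omega)]

/-- Undoes the power 1/(2n) once a positive time δ has elapsed. -/
lemma le_pow_of_mul_rpow_le {n : ℕ} (hn : 1 ≤ n) {s C δ : ℝ} (hs : 0 ≤ s) (hδ : 0 < δ)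
    (h : δ * s ^ (1 / (2 * n) : ℝ) ≤ C) : s ≤ (C / δ) ^ (2 * n) := by
  have h1 : s ^ (1 / (2 * n) : ℝ) ≤ C / δ := by rw [le_div_iff₀ hδ]; linarith
  have h2 := pow_le_pow_left₀ (by positivity) h1 (2 * n)
  refine le_trans (le_of_eq ?_) h2
  rw [← Real.rpow_natCast, ← Real.rpow_mul hs]
  have hn' : (n : ℝ) ≠ 0 := by positivity
  push_cast
  rw [one_div_mul_cancel (by positivity), Real.rpow_one]

end

/-! ### The gradient estimate. -/

noncomputable section

open Filter Topology

lemma gradSq_le_of_combination {n : ℕ} {w : Fin n → Cn n} {g h k : Cn n × ℝ → ℝ} {q : Cn n × ℝ}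
    {c : ℝ} (H : ∀ v, dx v h q = c * dx v g q + dx v k q) :
    gradSq w h q ≤ 2 * c ^ 2 * gradSq w g q + 2 * gradSq w k q := by
  simp only [gradSq, Finset.mul_sum, ← Finset.sum_add_distrib]
  refine Finset.sum_le_sum fun i _ => ?_
  rw [H, H]
  nlinarith [sq_nonneg (c * dx (w i) g q - dx (w i) k q),
    sq_nonneg (c * dx (Complex.I • w i) g q - dx (Complex.I • w i) k q)]

lemma sum_norm_sq_nonneg {n : ℕ} (w : Fin n → Cn n) : 0 ≤ ∑ k, ‖w k‖ ^ 2 :=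
  Finset.sum_nonneg fun _ _ => sq_nonneg _

namespace IsFlow

variable {n : ℕ} {Ω : Set (Cn n)} {T F : ℝ} {f : RhsSpace n → ℝ} {u : Cn n × ℝ → ℝ}
  {q : Cn n × ℝ}

lemma det_pos (hu : IsFlow Ω T F f u) (hq : q ∈ Ω ×ˢ Ioo 0 T) :
    0 < (leviMatrix (hessForm u q)).det.re :=
  (Complex.pos_iff.mp (hu.posDef q hq).det_pos).1

lemma det_bounds (hu : IsFlow Ω T F f u) (hq : q ∈ Ω ×ˢ Ioo 0 T) {K : ℝ}
    (hK : |Real.log (leviMatrix (hessForm u q)).det.re| ≤ K) :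
    Real.exp (-K) ≤ (leviMatrix (hessForm u q)).det.re ∧
      (leviMatrix (hessForm u q)).det.re ≤ Real.exp K := by
  have h := abs_le.mp hK
  have hp := hu.det_pos hq
  exact ⟨(Real.le_log_iff_exp_le hp).mp h.1, (Real.log_le_iff_le_exp hp).mp h.2⟩

lemma trace_le_of_frame (hu : IsFlow Ω T F f u) (hq : q ∈ Ω ×ˢ Ioo 0 T) {K : ℝ}
    (hK : |Real.log (leviMatrix (hessForm u q)).det.re| ≤ K) {w : Fin n → Cn n}
    (hw : IsFrame (hessForm u q) w) :
    realTrace (hessForm u q) ≤ 4 * n * Real.exp K * (4 * ∑ k, ‖w k‖ ^ 2) ^ (n - 1) := by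
  refine hw.trace_le.trans ?_
  have := (hu.det_bounds hq hK).2
  gcongr

end IsFlow

lemma one_le_mul_pow {n : ℕ} {K Z : ℝ} (h : Real.exp (-K) ≤ Z) : 1 ≤ Real.exp K ^ n * Z ^ n := by
  rw [← mul_pow]
  refine one_le_pow₀ ?_
  have := mul_le_mul_of_nonneg_left h (Real.exp_pos K).le
  rwa [← Real.exp_add, add_neg_cancel, Real.exp_zero] at this

namespace IsSolution

variable {n : ℕ} {Ω W : Set (Cn n)} {ρ : Cn n → ℝ} {r R κ C₀ T Cu B F : ℝ} {S : SolData n}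

lemma exp_le_frame (hn : 1 ≤ n) {A : RealBilin n} {w : Fin n → Cn n} (hw : IsFrame A w) {K : ℝ}
    (hK : |Real.log (leviMatrix A).det.re| ≤ K) : Real.exp (-K) ≤ 4 * ∑ k, ‖w k‖ ^ 2 := by
  have h := frame_ge hn hw hK
  have hn' : (1 : ℝ) ≤ n := by exact_mod_cast hn
  have := Real.exp_pos (-K)
  nlinarith

-- `exists_power_bound` with s = 1 + u_ξ² and N = u²/2 + |z|². The operator on N produces -Z with Z
-- = `gradSq w u` + 4 ∑ ‖w k‖², up to u(u̇ - n), which is already bounded. The choice σ = 1/(2n)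
-- fits the bound s ≤ C Zⁿ.
set_option maxHeartbeats 400000 in
lemma exists_abs_grad_coord_le (hG : Geometry Ω W ρ r R κ C₀) (hn : 1 ≤ n) (hT : 0 < T)
    (Cu B F : ℝ) {a : ℝ} (ha : 0 < a) : ∃ A, 0 ≤ A ∧ ∀ S, IsSolution Ω T Cu B F S →
      ∀ z ∈ closure Ω, ∀ t ∈ Ioo 0 T, a ≤ t → ∀ i, |S.u₁ (z, t) (coordDir i)| ≤ A := by
  obtain ⟨M, hM0, hM⟩ := exists_abs_u_le hG hn hT Cu B F
  obtain ⟨K, hK0, hK⟩ := exists_abs_dt_le hG hn hT Cu B F (half_pos ha)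
  obtain ⟨A, hA0, hA⟩ := exists_abs_grad_frontier_le hG hn hT Cu B F (half_pos ha)
  have hR := hG.R_nonneg
  have hn' : (1 : ℝ) ≤ n := by exact_mod_cast hn
  have hC4 : 0 ≤ Real.exp K ^ n + 4 * n * Real.exp K := by positivity
  have hC4' : 0 ≤ 4 * n * Real.exp K := by positivity
  have hC1 : ∀ F : ℝ, 0 ≤ F → 0 ≤ 2 * n * F := fun F hF => by positivity
  obtain ⟨C, hC0, hC⟩ := exists_power_bound (σ := 1 / (2 * n)) (by positivity) (τ := T)
    (S₀ := 1 + A ^ 2) (N₀ := M ^ 2 + R ^ 2) (C₁ := 2 * n * |F|) (C₂ := M * (K + n))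
    (C₃ := 2 * M ^ 2 + 4 * R ^ 2)
    (C₄ := (Real.exp K ^ n + 4 * n * Real.exp K) ^ (1 / n : ℝ)) hT.le (by positivity)
    (by positivity) (by positivity) (by positivity) (by positivity) (by positivity)
  refine ⟨√((C / (a / 2)) ^ (2 * n)), Real.sqrt_nonneg _, ?_⟩
  intro S hS z hz t ht hat i
  obtain ⟨hCu, hB, hF⟩ := hS.bound_nonneg hG hT
  set ξ : Cn n := coordDir i with hξ
  have hξ1 : ‖ξ‖ = 1 := norm_coordDir i
  set s : Cn n × ℝ → ℝ := fun q => 1 + (S.u₁ q ξ) ^ 2 with hs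
  have hs1 : ∀ q, 1 ≤ s q := fun q => by simp only [hs]; linarith [sq_nonneg (S.u₁ q ξ)]
  set N : Cn n × ℝ → ℝ := fun q => 1 / 2 * S.u q ^ 2 + sqDist 0 q with hN
  have hsub : Icc (a / 2) t ⊆ Ioo 0 T := fun s hs => ⟨by linarith [hs.1], hs.2.trans_lt ht.2⟩
  have hsubc : closure Ω ×ˢ Icc (a / 2) t ⊆ closure Ω ×ˢ Ioo 0 T := prod_mono subset_rfl hsub
  have hO := hS.flow.isOpen_prod
  have hmain := hC (a := a / 2) (b := t) (s := s) (N := N) hG.isOpen hG.isBounded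
    (by linarith [ht.2]) ?_ ?_ ?_ ?_ ?_ ?_ z hz t ⟨by linarith, le_rfl⟩
  · have h1 : (a / 2) * s (z, t) ^ (1 / (2 * n) : ℝ) ≤ C := by
      exact le_trans (mul_le_mul_of_nonneg_right (by linarith)
        (Real.rpow_nonneg (zero_le_one.trans (hs1 _)) _)) hmain
    have h2 := le_pow_of_mul_rpow_le hn (zero_le_one.trans (hs1 _)) (half_pos ha) h1
    refine Real.abs_le_sqrt ?_
    simp only [hs] at h2
    linarith
  · exact continuousOn_const.add (((hS.c2.cont₁.mono hsubc).clm_apply continuousOn_const).pow 2)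
  · exact (continuousOn_const.mul ((hS.c2.cont.mono hsubc).pow 2)).add
      (contDiff_sqDist 0).continuous.continuousOn
  · exact fun z _ t _ => hs1 _
  · intro z hz t ht
    have h1 := hM S hS z hz t (hsub ht)
    have h2 : S.u (z, t) ^ 2 ≤ M ^ 2 := sq_le_sq' (abs_le.mp h1).1 (abs_le.mp h1).2
    have h3 : ‖z‖ ^ 2 ≤ R ^ 2 :=
      pow_le_pow_left₀ (norm_nonneg z) (hG.norm_le z (hG.closure_subset hz)) 2
    simp only [hN, sqDist, sub_zero]
    rw [abs_of_nonneg (add_nonneg (mul_nonneg (by norm_num) (sq_nonneg _)) (sq_nonneg _))]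
    linarith [sq_nonneg M]
  · intro z hz t ht
    have h1 := hA S hS z hz t (hsub ht) ht.1 ξ
    rw [hξ1, mul_one] at h1
    simp only [hs]
    linarith [sq_le_sq' (abs_le.mp h1).1 (abs_le.mp h1).2]
  · intro z hz t ht'
    have htI := Ioc_subset_Icc_self ht'
    have hq : (z, t) ∈ Ω ×ˢ Ioo 0 T := ⟨hz, hsub htI⟩
    obtain ⟨w, hw⟩ := hS.flow.exists_frame hq
    have cu := hS.flow.contDiffAt hq
    have su := dirDeriv_contDiffOn hO hS.flow.smooth (ξ, (0 : ℝ))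
    have cu1 : ContDiffAt ℝ 2 (dx ξ S.u) (z, t) := su.contDiffAt_two hO hq
    have hse : s =ᶠ[𝓝 (z, t)] fun q => 1 + (dx ξ S.u q) ^ 2 := by
      filter_upwards [hO.mem_nhds hq] with q hq
      simp only [hs, hS.c2.eq₁ hG.isOpen hS.flow.smooth hq, gradForm_apply]
    have hsc : ContDiffAt ℝ 2 (fun q => 1 + (dx ξ S.u q) ^ 2) (z, t) :=
      contDiffAt_const.add (cu1.pow 2)
    have hNc1 : ContDiffAt ℝ 2 (fun q => 1 / 2 * S.u q ^ 2) (z, t) :=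
      contDiffAt_const.mul (cu.pow 2)
    have hNc : ContDiffAt ℝ 2 N (z, t) := hNc1.add (contDiffAt_sqDist 0 _)
    have hsum : 0 ≤ 4 * ∑ k, ‖w k‖ ^ 2 := mul_nonneg (by norm_num) (sum_norm_sq_nonneg w)
    have hZ : 0 ≤ gradSq w S.u (z, t) + 4 * ∑ k, ‖w k‖ ^ 2 := add_nonneg (gradSq_nonneg _ _ _) hsum
    refine ⟨hsc.congr_of_eventuallyEq hse, hNc, w, gradSq w S.u (z, t) + 4 * ∑ k, ‖w k‖ ^ 2,
      hZ, ?_, ?_, ?_, ?_⟩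
    · obtain ⟨b, c, -, hc0, hbc⟩ := hS.flow.heat_dx hq hw
      obtain ⟨hb, he⟩ := hbc ξ
      rw [heat_congr hse, heat_add contDiffAt_const (cu1.pow 2), heat_const, heat_sq cu1, he,
        hse.eq_of_nhds, abs_of_nonneg hF]
      rw [hξ1, mul_one] at hb
      have h1 := gradSq_nonneg w (dx ξ S.u) (z, t)
      set x := dx ξ S.u (z, t)
      have h2 : 2 * (x * b ξ) ≤ 2 * n * F * (1 + x ^ 2) := by
        have := abs_le.mp hb
        rcases le_total 0 x with h | h
        · nlinarith [mul_le_mul_of_nonneg_left this.2 h,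
            mul_nonneg (hC1 F hF) (sq_nonneg (x - 1))]
        · nlinarith [mul_le_mul_of_nonpos_left this.1 h,
            mul_nonneg (hC1 F hF) (sq_nonneg (x + 1))]
      have h3 : c * x ^ 2 ≤ 0 := mul_nonpos_of_nonpos_of_nonneg hc0 (sq_nonneg x)
      linarith
    · rw [hN, heat_add hNc1 (contDiffAt_sqDist 0 _), heat_const_mul (cu.pow 2), heat_sq cu,
        heat_sqDist, IsFlow.heat_self hw]
      have h1 := hM S hS z (subset_closure hz) t (hsub htI)
      have h2 := (hK S hS z hz t (hsub htI) ht'.1.le).1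
      have h3 : S.u (z, t) * (dt S.u (z, t) - n) ≤ M * (K + n) := by
        refine (le_abs_self _).trans ?_
        rw [abs_mul]
        refine mul_le_mul h1 ((abs_sub _ _).trans ?_) (abs_nonneg _) hM0
        rw [abs_of_nonneg (zero_le_one.trans hn')]
        linarith
      linarith
    · have H : ∀ v, dx v N (z, t) = S.u (z, t) * dx v S.u (z, t) + dx v (sqDist 0) (z, t) := by
        intro v
        have du := cu.differentiableAt (by simp)
        rw [hN, dirDeriv_add_apply (hNc1.differentiableAt (by simp))
          ((contDiffAt_sqDist 0 _).differentiableAt (by simp)),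
          dirDeriv_const_mul_apply (g := fun q => S.u q ^ 2) (du.pow 2)]
        have : (fun q => S.u q ^ 2) = fun q => S.u q * S.u q := by ext; ring
        rw [this, dirDeriv_mul_apply du du]
        ring
      refine (gradSq_le_of_combination H).trans ?_
      have h1 := hM S hS z (subset_closure hz) t (hsub htI)
      have h2 : S.u (z, t) ^ 2 ≤ M ^ 2 := sq_le_sq' (abs_le.mp h1).1 (abs_le.mp h1).2
      have h3 := gradSq_sqDist_le 0 w (q := (z, t)) (R := R)
        (by simpa using hG.norm_le z (hG.closure_subset (subset_closure hz)))
      have h4 := mul_le_mul_of_nonneg_right h2 (gradSq_nonneg w S.u (z, t))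
      have h5 := sum_norm_sq_nonneg w
      have h6 := gradSq_nonneg w S.u (z, t)
      have h7 := mul_nonneg (sq_nonneg M) h5
      have h8 := mul_nonneg (sq_nonneg R) h6
      nlinarith
    -- u_ξ² is at most the trace times `gradSq w u`, and the trace is at most a constant times the
    -- (n - 1)-st power of 4 ∑ ‖w k‖²; the product has degree n in Z. The summand 1 of s is absorbed
    -- because Z ≥ exp(-K).
    · have hKt := (hK S hS z hz t (hsub htI) ht'.1.le).2
      have h1 := hw.sq_le (gradForm S.u (z, t)) ξ
      have h2 := hS.flow.trace_le_of_frame hq hKt hw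
      have h3 := exp_le_frame hn hw hKt
      rw [hξ1, one_pow, mul_one] at h1
      simp only [gradForm_apply] at h1
      set g := gradSq w S.u (z, t) with hg
      have hg0 : 0 ≤ g := gradSq_nonneg _ _ _
      change _ ≤ _ * g at h1
      set τ := 4 * ∑ k, ‖w k‖ ^ 2 with hτ
      have hτ0 : 0 ≤ τ := hsum
      refine rpow_sq_le_of_le_pow hn (zero_le_one.trans (hs1 _)) hC4 (add_nonneg hg0 hτ0) ?_
      rw [hse.eq_of_nhds, add_mul]
      refine add_le_add (one_le_mul_pow (by linarith)) ?_
      refine h1.trans ((mul_le_mul_of_nonneg_right h2 hg0).trans ?_)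
      rw [mul_assoc]
      refine mul_le_mul_of_nonneg_left ?_ hC4'
      calc τ ^ (n - 1) * g ≤ (g + τ) ^ (n - 1) * (g + τ) := by
            exact mul_le_mul (pow_le_pow_left₀ hτ0 (by linarith) _) (by linarith) hg0
              (pow_nonneg (by linarith) _)
        _ = (g + τ) ^ n := by rw [← pow_succ, Nat.sub_add_cancel hn]

/-- The gradient estimate up to the boundary. -/
lemma exists_abs_grad_le (hG : Geometry Ω W ρ r R κ C₀) (hn : 1 ≤ n) (hT : 0 < T)
    (Cu B F : ℝ) {a : ℝ} (ha : 0 < a) : ∃ A, 0 ≤ A ∧ ∀ S, IsSolution Ω T Cu B F S →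
      ∀ z ∈ closure Ω, ∀ t ∈ Ioo 0 T, a ≤ t → ∀ v, |S.u₁ (z, t) v| ≤ A * ‖v‖ := by
  obtain ⟨A, hA0, hA⟩ := exists_abs_grad_coord_le hG hn hT Cu B F ha
  refine ⟨2 * n * A, by positivity, fun S hS z hz t ht hat v => ?_⟩
  conv_lhs => rw [sum_coord v]
  simp only [map_sum, map_smul, smul_eq_mul]
  refine (Finset.abs_sum_le_sum_abs _ _).trans ?_
  calc _ ≤ ∑ _p : Fin n × Bool, ‖v‖ * A := Finset.sum_le_sum fun p _ => by
        rw [abs_mul]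
        exact mul_le_mul (abs_coord_le p v) (hA S hS z hz t ht hat p) (abs_nonneg _)
          (norm_nonneg _)
    _ = _ := by simp; ring

end IsSolution

end

/-! ### Affine holomorphic vector fields at boundary points. -/

noncomputable section

open Filter Topology

lemma coord_eq_inner {n : ℕ} (i : Fin n × Bool) (v : Cn n) :
    coord i v = inner ℝ (coordDir i) v := by
  rw [real_inner_eq_re]
  obtain ⟨α, c⟩ := i
  cases c <;> simp [coord, coordDir, dirX, dirY, EuclideanSpace.inner_single_left]

/-- The defining function of the differential of `ρ`. -/
def dRho {n : ℕ} (ρ : Cn n → ℝ) (z : Cn n) : Cn n →L[ℝ] ℝ := gradForm (liftFn ρ) (z, 0)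

/-- The Hessian of `ρ`. -/
def hRho {n : ℕ} (ρ : Cn n → ℝ) (z : Cn n) : RealBilin n := hessForm (liftFn ρ) (z, 0)

/-- The gradient vector of `ρ`. -/
def nRho {n : ℕ} (ρ : Cn n → ℝ) (z : Cn n) : Cn n :=
  (InnerProductSpace.toDual ℝ (Cn n)).symm (dRho ρ z)

lemma inner_nRho {n : ℕ} (ρ : Cn n → ℝ) (z v : Cn n) : inner ℝ (nRho ρ z) v = dRho ρ z v :=
  InnerProductSpace.toDual_symm_apply

lemma norm_nRho {n : ℕ} (ρ : Cn n → ℝ) (z : Cn n) : ‖nRho ρ z‖ = ‖dRho ρ z‖ :=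
  LinearIsometryEquiv.norm_map _ _

lemma dRho_nRho {n : ℕ} (ρ : Cn n → ℝ) (z : Cn n) : dRho ρ z (nRho ρ z) = ‖nRho ρ z‖ ^ 2 := by
  rw [← inner_nRho, real_inner_self_eq_norm_sq]

lemma dRho_smul_nRho {n : ℕ} (ρ : Cn n → ℝ) (z : Cn n) (c : ℂ) :
    dRho ρ z (c • nRho ρ z) = c.re * ‖nRho ρ z‖ ^ 2 := by
  rw [← inner_nRho, real_inner_eq_re, inner_smul_right, inner_self_eq_norm_sq_to_K]
  have : (((‖nRho ρ z‖ : ℝ) : ℂ) ^ 2) = ((‖nRho ρ z‖ ^ 2 : ℝ) : ℂ) := by push_cast; rfl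
  simp only [Complex.coe_algebraMap]
  rw [this, Complex.re_mul_ofReal]

namespace Tame

variable {n : ℕ} {Ω W : Set (Cn n)} {ρ : Cn n → ℝ} {r R κ C₀ : ℝ}

/-- First and second order Taylor bounds on the closure of the domain. -/
lemma taylor (hG : Geometry Ω W ρ r R κ C₀) {C : ℝ} {g : Cn n × ℝ → ℝ}
    (hg : Tame (W ×ˢ univ) C g) {p z : Cn n} (hp : p ∈ closure Ω) (hz : z ∈ closure Ω) :
    |g (z, 0) - g (p, 0)| ≤ C * (1 + 2 / r + 2 / r ^ 2) * ‖z - p‖ ∧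
      |g (z, 0) - g (p, 0) - dx (z - p) g (p, 0)| ≤ C * (1 + 2 / r + 2 / r ^ 2) * ‖z - p‖ ^ 2 := by
  have hr := hG.r_pos
  have hpW : ((p, 0) : Cn n × ℝ) ∈ W ×ˢ (univ : Set ℝ) := ⟨hG.closure_subset hp, mem_univ _⟩
  have hzW : ((z, 0) : Cn n × ℝ) ∈ W ×ˢ (univ : Set ℝ) := ⟨hG.closure_subset hz, mem_univ _⟩
  have hC : 0 ≤ C := (abs_nonneg _).trans (hg.bound _ hpW)
  set d := ‖z - p‖ with hd
  have hd0 : 0 ≤ d := norm_nonneg _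
  have b1 := hg.bound _ hpW
  have b2 := hg.bound _ hzW
  have b3 := hg.dx_bound _ hpW (z - p)
  have i1 : 0 ≤ 2 / r := by positivity
  have i2 : 0 ≤ 2 / r ^ 2 := by positivity
  have hCd : 0 ≤ C * d := mul_nonneg hC hd0
  have hCd2 : 0 ≤ C * d ^ 2 := mul_nonneg hC (sq_nonneg d)
  -- If ‖z - p‖ ≥ r the sup bounds suffice, at the cost of the terms 2/r and 2/r² in the constant.
  -- Otherwise the segment stays in the ball of radius r, inside W, although Ω need not be convex,
  -- and the mean value inequality applies.
  rcases le_or_gt r d with hrd | hrd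
  · have e1 : 2 ≤ 2 / r * d := by rw [div_mul_eq_mul_div, le_div_iff₀ hr]; linarith
    have e2 : 2 ≤ 2 / r ^ 2 * d ^ 2 := by
      rw [div_mul_eq_mul_div, le_div_iff₀ (by positivity)]
      nlinarith
    have e3 : d ≤ 2 / r * d ^ 2 := by nlinarith
    have t1 := abs_sub (g (z, 0)) (g (p, 0))
    have t2 := abs_sub (g (z, 0) - g (p, 0)) (dx (z - p) g (p, 0))
    constructor
    · nlinarith [mul_le_mul_of_nonneg_left e1 hC, mul_nonneg i2 hCd]
    · nlinarith [mul_le_mul_of_nonneg_left e2 hC, mul_le_mul_of_nonneg_left e3 hC]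
  · have hball : ∀ s ∈ Icc (0 : ℝ) 1, (((p, 0) : Cn n × ℝ) + s • (z - p, (0 : ℝ))) ∈
        W ×ˢ (univ : Set ℝ) := by
      intro s hs
      refine ⟨hG.ball_subset p hp ?_, mem_univ _⟩
      rw [mem_ball_iff_norm]
      simp only [Prod.fst_add, Prod.smul_fst, add_sub_cancel_left, norm_smul,
        Real.norm_of_nonneg hs.1]
      exact lt_of_le_of_lt (mul_le_of_le_one_left hd0 hs.2) hrd
    have hO : IsOpen (W ×ˢ (univ : Set ℝ)) := hG.isOpen_nbhd.prod isOpen_univ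
    have hgd : ∀ {k : Cn n × ℝ → ℝ}, ContDiffOn ℝ ∞ k (W ×ˢ univ) → ∀ s ∈ Icc (0 : ℝ) 1,
        HasDerivWithinAt (fun s : ℝ => k ((p, 0) + s • (z - p, (0 : ℝ))))
          (dx (z - p) k ((p, 0) + s • (z - p, (0 : ℝ)))) (Icc 0 1) s := fun hk s hs =>
      (_root_.hasDerivAt_line ((hk.contDiffAt_two hO (hball s hs)).differentiableAt
        (by simp))).hasDerivWithinAt
    have h0 : (0 : ℝ) ∈ Icc (0 : ℝ) 1 := ⟨le_rfl, zero_le_one⟩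
    have h1 : (1 : ℝ) ∈ Icc (0 : ℝ) 1 := ⟨zero_le_one, le_rfl⟩
    have hend : ((p, 0) : Cn n × ℝ) + (1 : ℝ) • (z - p, (0 : ℝ)) = (z, 0) := by ext <;> simp
    have hst : ((p, 0) : Cn n × ℝ) + (0 : ℝ) • (z - p, (0 : ℝ)) = (p, 0) := by simp
    have m1 := (convex_Icc (0 : ℝ) 1).norm_image_sub_le_of_norm_hasDerivWithin_le
      (hgd hg.smooth) (fun s hs => hg.dx_bound _ (hball s hs) (z - p)) h0 h1
    rw [hend, hst, sub_zero, norm_one, mul_one] at m1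
    have m2 : ∀ s ∈ Icc (0 : ℝ) 1, ‖dx (z - p) g ((p, 0) + s • (z - p, (0 : ℝ)))
        - dx (z - p) g (p, 0)‖ ≤ C * d ^ 2 := by
      intro s hs
      have := (convex_Icc (0 : ℝ) 1).norm_image_sub_le_of_norm_hasDerivWithin_le
        (hgd (dirDeriv_contDiffOn hO hg.smooth (z - p, (0 : ℝ))))
        (fun s hs => hg.hess_bound _ (hball s hs) (z - p)) h0 hs
      rw [hst, sub_zero, Real.norm_of_nonneg hs.1] at this
      refine this.trans ?_
      rw [← hd]
      nlinarith [hs.2]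
    have m3 := (convex_Icc (0 : ℝ) 1).norm_image_sub_le_of_norm_hasDerivWithin_le
      (f := fun s : ℝ => g ((p, 0) + s • (z - p, (0 : ℝ))) - s * dx (z - p) g (p, 0))
      (fun s hs => (hgd hg.smooth s hs).sub
        ((hasDerivWithinAt_id s _).mul_const (dx (z - p) g (p, 0))))
      (fun s hs => by rw [one_mul]; exact m2 s hs) h0 h1
    rw [hend, hst, sub_zero, norm_one, mul_one, one_mul, zero_mul, sub_zero, Real.norm_eq_abs]
      at m3
    rw [Real.norm_eq_abs] at m1
    have e4 : g (z, 0) - dx (z - p) g (p, 0) - g (p, 0)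
      = g (z, 0) - g (p, 0) - dx (z - p) g (p, 0) := by ring
    rw [e4] at m3
    constructor
    · refine m1.trans ?_
      nlinarith [mul_nonneg i1 hCd, mul_nonneg i2 hCd]
    · refine m3.trans ?_
      nlinarith [mul_nonneg i1 hCd2, mul_nonneg i2 hCd2]

end Tame

namespace Geometry

variable {n : ℕ} {Ω W : Set (Cn n)} {ρ : Cn n → ℝ} {r R κ C₀ : ℝ}

lemma gradForm_eq (hG : Geometry Ω W ρ r R κ C₀) {z : Cn n} (hz : z ∈ W) (t : ℝ) :
    gradForm (liftFn ρ) (z, t) = dRho ρ z :=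
  (hG.hasFDerivAt hz t).unique (hG.hasFDerivAt hz 0)

lemma abs_dRho_le (hG : Geometry Ω W ρ r R κ C₀) {z : Cn n} (hz : z ∈ W) (v : Cn n) :
    |dRho ρ z v| ≤ C₀ * ‖v‖ :=
  (hG.tame [] (by simp)).dx_bound (z, 0) ⟨hz, mem_univ _⟩ v

lemma norm_nRho_le (hG : Geometry Ω W ρ r R κ C₀) {z : Cn n} (hz : z ∈ W) : ‖nRho ρ z‖ ≤ C₀ := by
  rw [norm_nRho]
  exact ContinuousLinearMap.opNorm_le_bound _ hG.C₀_nonneg fun v => hG.abs_dRho_le hz v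

lemma le_norm_nRho (hG : Geometry Ω W ρ r R κ C₀) {p : Cn n} (hp : p ∈ frontier Ω) :
    κ ≤ ‖nRho ρ p‖ := by
  rw [norm_nRho]; exact hG.grad_ge p hp 0

lemma hRho_eq (hG : Geometry Ω W ρ r R κ C₀) {z : Cn n} (hz : z ∈ W) (v w : Cn n) :
    hRho ρ z v w = dx v (dx w (liftFn ρ)) (z, 0) :=
  hessForm_apply (hG.contDiffAt hz 0) v w

lemma norm_hRho_le (hG : Geometry Ω W ρ r R κ C₀) {z : Cn n} (hz : z ∈ W) :
    ‖hRho ρ z‖ ≤ (2 * n) ^ 2 * C₀ := by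
  refine norm_bilin_le hG.C₀_nonneg fun i j => ?_
  rw [hG.hRho_eq hz]
  exact (hG.tame [i, j] (by simp)).bound (z, 0) ⟨hz, mem_univ _⟩

lemma abs_hRho_le (hG : Geometry Ω W ρ r R κ C₀) {z : Cn n} (hz : z ∈ W) (v w : Cn n) :
    |hRho ρ z v w| ≤ (2 * n) ^ 2 * C₀ * ‖v‖ * ‖w‖ :=
  ((hRho ρ z).le_opNorm₂ v w).trans (by gcongr; exact hG.norm_hRho_le hz)

lemma levi_hRho_ge (hG : Geometry Ω W ρ r R κ C₀) {z : Cn n} (hz : z ∈ closure Ω) (v : Cn n) :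
    κ * ‖v‖ ^ 2 ≤ levi (hRho ρ z) v := hG.levi_ge z hz 0 v

/-- Taylor bounds of the differential of the defining function. -/
lemma exists_dRho_taylor (hG : Geometry Ω W ρ r R κ C₀) : ∃ C, 0 ≤ C ∧ ∀ p ∈ closure Ω,
    ∀ z ∈ closure Ω, ∀ v, |dRho ρ z v - dRho ρ p v| ≤ C * ‖z - p‖ * ‖v‖ ∧
      |dRho ρ z v - dRho ρ p v - hRho ρ p (z - p) v| ≤ C * ‖z - p‖ ^ 2 * ‖v‖ := by
  have hr := hG.r_pos
  have hC₀ := hG.C₀_nonneg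
  set C := C₀ * (1 + 2 / r + 2 / r ^ 2) with hC
  refine ⟨2 * n * C, by positivity, ?_⟩
  intro p hp z hz v
  have hdr : ∀ x, dRho ρ x v = ∑ i : Fin n × Bool, coord i v * dx (coordDir i) (liftFn ρ) (x, 0) :=
    fun x => dx_eq_sum v (liftFn ρ) (x, 0)
  have hhr : hRho ρ p (z - p) v = ∑ i : Fin n × Bool, coord i v *
      dx (z - p) (dx (coordDir i) (liftFn ρ)) (p, 0) := by
    conv_lhs => rw [sum_coord v]
    rw [map_sum]
    refine Finset.sum_congr rfl fun i _ => ?_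
    rw [map_smul, smul_eq_mul, hG.hRho_eq (hG.closure_subset hp)]
  have ht := fun i => Tame.taylor hG (hG.tame [i] (by simp)) hp hz
  have hsum : ∀ (x : Fin n × Bool → ℝ) (A : ℝ), (∀ i, |x i| ≤ A) →
      |∑ i, coord i v * x i| ≤ 2 * n * A * ‖v‖ := by
    intro x A hx
    refine (Finset.abs_sum_le_sum_abs _ _).trans ?_
    calc _ ≤ ∑ _i : Fin n × Bool, ‖v‖ * A := Finset.sum_le_sum fun i _ => by
          rw [abs_mul]
          exact mul_le_mul (abs_coord_le i v) (hx i) (abs_nonneg _) (norm_nonneg _)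
      _ = _ := by simp; ring
  constructor
  · rw [hdr, hdr, ← Finset.sum_sub_distrib]
    simp only [← mul_sub]
    refine (hsum _ _ fun i => (ht i).1).trans_eq (by ring)
  · rw [hdr, hdr, hhr, ← Finset.sum_sub_distrib, ← Finset.sum_sub_distrib]
    simp only [← mul_sub]
    refine (hsum _ _ fun i => (ht i).2).trans_eq (by ring)

/-- An affine holomorphic vector field with prescribed normal component to second order at a
boundary point. -/
lemma exists_field (hG : Geometry Ω W ρ r R κ C₀) : ∃ C, 0 ≤ C ∧ ∀ p ∈ frontier Ω,
    ∀ (Y : Cn n) (l : Cn n →L[ℝ] ℝ), ∃ M : Cn n →L[ℂ] Cn n, ‖M‖ ≤ C * (‖l‖ + ‖Y‖) ∧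
      (∀ v, dRho ρ p (M v) = l v - hRho ρ p v Y) ∧
      ∀ z ∈ closure Ω, |dRho ρ z (Y + M (z - p)) - (dRho ρ p Y + l (z - p))| ≤
        C * (‖l‖ + ‖Y‖) * ‖z - p‖ ^ 2 := by
  obtain ⟨C₁, hC₁, hT⟩ := hG.exists_dRho_taylor
  have hC₀ := hG.C₀_nonneg
  have hκ := hG.κ_pos
  set H := (2 * n : ℝ) ^ 2 * C₀ with hH
  have hH0 : 0 ≤ H := by positivity
  set C₂ := (1 + H) / κ with hC₂
  have hC₂0 : 0 ≤ C₂ := by positivity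
  refine ⟨C₂ + (C₁ + C₁ * C₂), by positivity, ?_⟩
  intro p hp Y l
  have hpc := frontier_subset_closure hp
  have hpW := hG.closure_subset hpc
  -- The derivative at p of z ↦ dρ_z(Y + M(z - p)) is D²ρ(·, Y) + dρ_p(M ·), so dρ_p ∘ M has to be
  -- m. Every real functional is the real part of a complex linear one, and dρ_p(c ν) = Re(c) ‖ν‖²
  -- for the gradient ν; hence M can be taken complex linear with values in the complex line of ν.
  set m : StrongDual ℝ (Cn n) := l - (hRho ρ p).flip Y with hm
  have hmv : ∀ v, m v = l v - hRho ρ p v Y := fun v => by simp [hm]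
  set c : Cn n →L[ℂ] ℂ := m.extendRCLike with hc
  have hre : ∀ v, (c v).re = m v := fun v => 
    StrongDual.re_extendRCLike_apply (𝕜 := ℂ) m v
  set ν := nRho ρ p with hν
  have hν0 : 0 < ‖ν‖ := hκ.trans_le (hG.le_norm_nRho hp)
  set M : Cn n →L[ℂ] Cn n := c.smulRight ((((‖ν‖ ^ 2)⁻¹ : ℝ) : ℂ) • ν) with hM
  have hMv : ∀ v, M v = ((c v) * (((‖ν‖ ^ 2)⁻¹ : ℝ) : ℂ)) • ν := fun v => by
    simp only [hM, ContinuousLinearMap.smulRight_apply, smul_smul]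
  have hmn : ‖m‖ ≤ (1 + H) * (‖l‖ + ‖Y‖) := by
    refine (norm_sub_le _ _).trans ?_
    have h1 : ‖(hRho ρ p).flip Y‖ ≤ H * ‖Y‖ := by
      refine ((hRho ρ p).flip.le_opNorm Y).trans ?_
      rw [ContinuousLinearMap.opNorm_flip]
      exact mul_le_mul_of_nonneg_right (hG.norm_hRho_le hpW) (norm_nonneg Y)
    have := mul_nonneg hH0 (norm_nonneg l)
    have := norm_nonneg Y
    linarith
  have hcn : ‖c‖ = ‖m‖ := StrongDual.norm_extendRCLike m
  have hMn : ‖M‖ ≤ C₂ * (‖l‖ + ‖Y‖) := by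
    rw [hM, ContinuousLinearMap.norm_smulRight_apply, norm_smul, hcn, Complex.norm_real,
      Real.norm_of_nonneg (by positivity)]
    have h1 : (‖ν‖ ^ 2)⁻¹ * ‖ν‖ = ‖ν‖⁻¹ := by field_simp
    rw [h1, hC₂, div_mul_eq_mul_div, ← div_eq_mul_inv]
    exact div_le_div₀ (by positivity) hmn hκ (hG.le_norm_nRho hp)
  have hdM : ∀ v, dRho ρ p (M v) = l v - hRho ρ p v Y := by
    intro v
    rw [hMv, dRho_smul_nRho, Complex.re_mul_ofReal, hre, hmv, ← hν, mul_assoc,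
      inv_mul_cancel₀ (by positivity), mul_one]
  have hN : 0 ≤ ‖l‖ + ‖Y‖ := by positivity
  refine ⟨M, hMn.trans (mul_le_mul_of_nonneg_right (by
    have := mul_nonneg hC₁ hC₂0; linarith) hN), hdM, ?_⟩
  intro z hz
  obtain ⟨-, t2⟩ := hT p hpc z hz Y
  obtain ⟨t1, -⟩ := hT p hpc z hz (M (z - p))
  have e1 : dRho ρ z (Y + M (z - p)) - (dRho ρ p Y + l (z - p)) =
      (dRho ρ z Y - dRho ρ p Y - hRho ρ p (z - p) Y)
        + (dRho ρ z (M (z - p)) - dRho ρ p (M (z - p))) := by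
    rw [map_add, hdM]; ring
  rw [e1]
  refine (abs_add_le _ _).trans ?_
  set d := ‖z - p‖
  have hd0 : 0 ≤ d := norm_nonneg _
  have h2 : ‖M (z - p)‖ ≤ C₂ * (‖l‖ + ‖Y‖) * d :=
    (M.le_opNorm _).trans (mul_le_mul_of_nonneg_right hMn hd0)
  have h3 := mul_le_mul_of_nonneg_left h2 (mul_nonneg hC₁ hd0)
  have h4 : C₁ * d ^ 2 * ‖Y‖ ≤ C₁ * d ^ 2 * (‖l‖ + ‖Y‖) :=
    mul_le_mul_of_nonneg_left (by linarith [norm_nonneg l]) (by positivity)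
  have h5 : 0 ≤ C₂ * (‖l‖ + ‖Y‖) * d ^ 2 := by positivity
  nlinarith

end Geometry

end

/-! ### Barriers for derivatives along affine holomorphic fields. -/

noncomputable section

open Filter Topology

section Affine

variable {n : ℕ} {q : Cn n × ℝ} {w : Fin n → Cn n}

/-- An affine function of space. -/
def affFn (c : ℝ) (L : Cn n →L[ℝ] ℝ) (q : Cn n × ℝ) : ℝ := c + L q.1

lemma contDiff_affFn (c : ℝ) (L : Cn n →L[ℝ] ℝ) : ContDiff ℝ ∞ (affFn c L) :=
  contDiff_const.add (L.contDiff.comp contDiff_fst)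

lemma contDiffAt_affFn (c : ℝ) (L : Cn n →L[ℝ] ℝ) : ContDiffAt ℝ 2 (affFn c L) q :=
  (contDiff_affFn c L).contDiffAt.of_le (WithTop.coe_le_coe.mpr (le_top : (2 : ℕ∞) ≤ ⊤))

lemma dirDeriv_affFn (c : ℝ) (L : Cn n →L[ℝ] ℝ) (v : Cn n) (s : ℝ) (q : Cn n × ℝ) :
    dirDeriv (v, s) (affFn c L) q = L v := by
  have h : HasFDerivAt (affFn c L) (L.comp (ContinuousLinearMap.fst ℝ (Cn n) ℝ)) q :=
    (L.hasFDerivAt.comp q hasFDerivAt_fst).const_add c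
  simp [dirDeriv, h.fderiv]

lemma dx_dx_affFn (c : ℝ) (L : Cn n →L[ℝ] ℝ) (v v' : Cn n) (q : Cn n × ℝ) :
    dx v (dx v' (affFn c L)) q = 0 := by
  have : dx v' (affFn c L) = fun _ => L v' := funext fun q => dirDeriv_affFn c L v' 0 q
  rw [this, dirDeriv_const]

lemma heat_affFn (c : ℝ) (L : Cn n →L[ℝ] ℝ) : heat w (affFn c L) q = 0 := by
  simp [heat, dirDeriv_affFn, levi_hessForm (contDiffAt_affFn c L), dx_dx_affFn]

lemma tame_affFn {Q : Set (Cn n × ℝ)} {R : ℝ} (hR0 : 0 ≤ R) (hR : ∀ q ∈ Q, ‖q.1‖ ≤ R) (c : ℝ)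
    (L : Cn n →L[ℝ] ℝ) : Tame Q (|c| + ‖L‖ * (R + 1)) (affFn c L) := by
  have hL := norm_nonneg L
  have hc := abs_nonneg c
  have hLR := mul_nonneg hL hR0
  refine ⟨(contDiff_affFn c L).contDiffOn, fun q hq => ?_, fun q hq => ?_, fun q hq v => ?_,
    fun q hq v => ?_⟩
  · refine (abs_add_le _ _).trans ?_
    have h1 : |L q.1| ≤ ‖L‖ * ‖q.1‖ := L.le_opNorm q.1
    have h2 := mul_le_mul_of_nonneg_left (hR q hq) hL
    linarith
  · rw [dirDeriv_affFn, map_zero, abs_zero]; linarith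
  · rw [dirDeriv_affFn]
    have h1 : |L v| ≤ ‖L‖ * ‖v‖ := L.le_opNorm v
    have h2 := mul_nonneg hc (norm_nonneg v)
    have h3 := mul_nonneg hLR (norm_nonneg v)
    linarith
  · rw [dx_dx_affFn, abs_zero]
    exact mul_nonneg (by linarith) (sq_nonneg _)

lemma heat_sum {ι : Type*} (s : Finset ι) {g : ι → Cn n × ℝ → ℝ}
    (hg : ∀ i ∈ s, ContDiffAt ℝ 2 (g i) q) :
    heat w (fun p => ∑ i ∈ s, g i p) q = ∑ i ∈ s, heat w (g i) q := by
  classical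
  induction s using Finset.induction_on with
  | empty => simp [heat_const]
  | insert i s hi ih =>
    have h1 := fun j hj => hg j (Finset.mem_insert_of_mem hj)
    simp only [Finset.sum_insert hi]
    rw [heat_add (hg i (Finset.mem_insert_self i s)) (ContDiffAt.sum h1), ih h1]

end Affine

/-- The coefficients of an affine field. -/
def fieldCoeff {n : ℕ} (p Y : Cn n) (M : Cn n →L[ℂ] Cn n) (i : Fin n × Bool) : Cn n × ℝ → ℝ :=
  affFn (coord i (Y - M p)) ((innerSL ℝ (coordDir i)).comp (M.restrictScalars ℝ))

lemma fieldCoeff_apply {n : ℕ} (p Y : Cn n) (M : Cn n →L[ℂ] Cn n) (i : Fin n × Bool)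
    (q : Cn n × ℝ) : fieldCoeff p Y M i q = coord i (Y + M (q.1 - p)) := by
  simp only [fieldCoeff, affFn, ContinuousLinearMap.comp_apply,
    ContinuousLinearMap.coe_restrictScalars', innerSL_apply_apply, coord_eq_inner]
  rw [← inner_add_right, map_sub]
  congr 1; abel

lemma dirDeriv_fieldCoeff {n : ℕ} (p Y : Cn n) (M : Cn n →L[ℂ] Cn n) (i : Fin n × Bool)
    (v : Cn n) (s : ℝ) (q : Cn n × ℝ) :
    dirDeriv (v, s) (fieldCoeff p Y M i) q = coord i (M v) := by
  rw [fieldCoeff, dirDeriv_affFn, coord_eq_inner]; rfl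

/-- The derivative along an affine field, in coordinates. -/
def fieldDeriv {n : ℕ} (p Y : Cn n) (M : Cn n →L[ℂ] Cn n) (g : Cn n × ℝ → ℝ) (q : Cn n × ℝ) : ℝ :=
  ∑ i, fieldCoeff p Y M i q * dx (coordDir i) g q

lemma fieldDeriv_eq {n : ℕ} (p Y : Cn n) (M : Cn n →L[ℂ] Cn n) (g : Cn n × ℝ → ℝ)
    (q : Cn n × ℝ) : fieldDeriv p Y M g q = gradForm g q (Y + M (q.1 - p)) := by
  rw [gradForm_apply, dx_eq_sum]
  simp only [fieldDeriv, fieldCoeff_apply]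

/-- The coefficients are affine, so besides differentiated equations only the cross terms survive.
They assemble into the Hessian of g paired with M in the frame, which for g = u is bounded by n‖M‖
through `IsFrame.abs_sum_le` although the Hessian itself is not yet controlled. This is why M is
complex linear. -/
lemma heat_fieldDeriv {n : ℕ} {Q : Set (Cn n × ℝ)} (hQ : IsOpen Q) {g : Cn n × ℝ → ℝ}
    (hg : ContDiffOn ℝ ∞ g Q) (p Y : Cn n) (M : Cn n →L[ℂ] Cn n) (w : Fin n → Cn n)
    {q : Cn n × ℝ} (hq : q ∈ Q) : ContDiffAt ℝ 2 (fieldDeriv p Y M g) q ∧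
    heat w (fieldDeriv p Y M g) q = ∑ i, coord i (Y + M (q.1 - p)) * heat w (dx (coordDir i) g) q
      - 2 * ∑ k, (hessForm g q (w k) (M (w k))
        + hessForm g q (Complex.I • w k) (M (Complex.I • w k))) := by
  have hgi : ∀ i : Fin n × Bool, ContDiffAt ℝ 2 (dx (coordDir i) g) q := fun i =>
    (dirDeriv_contDiffOn hQ hg _).contDiffAt_two hQ hq
  have hY : ∀ i, ContDiffAt ℝ 2 (fieldCoeff p Y M i) q := fun i => contDiffAt_affFn _ _
  refine ⟨ContDiffAt.sum fun i _ => (hY i).mul (hgi i), ?_⟩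
  have h1 : ∀ i, heat w (fun q => fieldCoeff p Y M i q * dx (coordDir i) g q) q =
      coord i (Y + M (q.1 - p)) * heat w (dx (coordDir i) g) q
        - 2 * gradProd w (fieldCoeff p Y M i) (dx (coordDir i) g) q := fun i => by
    rw [heat_mul (hY i) (hgi i), fieldCoeff_apply]
    have : heat w (fieldCoeff p Y M i) q = 0 := heat_affFn _ _
    rw [this]; ring
  have h2 : heat w (fieldDeriv p Y M g) q =
      ∑ i, heat w (fun q => fieldCoeff p Y M i q * dx (coordDir i) g q) q :=
    heat_sum Finset.univ fun i _ => (hY i).mul (hgi i)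
  rw [h2]
  simp only [h1, Finset.sum_sub_distrib, ← Finset.mul_sum]
  congr 2
  simp only [gradProd, dirDeriv_fieldCoeff]
  rw [Finset.sum_comm]
  refine Finset.sum_congr rfl fun k _ => ?_
  have hB : ∀ v x : Cn n, hessForm g q v x = ∑ i, coord i x * dx v (dx (coordDir i) g) q := by
    intro v x
    conv_lhs => rw [sum_coord x]
    rw [map_sum]
    refine Finset.sum_congr rfl fun i _ => ?_
    rw [map_smul, smul_eq_mul, hessForm_apply (hg.contDiffAt_two hQ hq)]
  rw [hB, hB, Finset.sum_add_distrib]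

lemma abs_coord_field_le {n : ℕ} {p Y z : Cn n} {M : Cn n →L[ℂ] Cn n} {N R : ℝ} (hY : ‖Y‖ ≤ N)
    (hM : ‖M‖ ≤ N) (hz : ‖z‖ ≤ R) (hp : ‖p‖ ≤ R) : ‖Y + M (z - p)‖ ≤ N * (1 + 2 * R) := by
  have hN : 0 ≤ N := (norm_nonneg _).trans hY
  have h1 : ‖z - p‖ ≤ 2 * R := (norm_sub_le _ _).trans (by linarith)
  have h2 : ‖M (z - p)‖ ≤ N * (2 * R) :=
    (M.le_opNorm _).trans (mul_le_mul hM h1 (norm_nonneg _) hN)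
  refine (norm_add_le _ _).trans ?_
  linarith

lemma tame_fieldDeriv {n : ℕ} {Q : Set (Cn n × ℝ)} (hQ : IsOpen Q) {g : Cn n × ℝ → ℝ} {R N B : ℝ}
    (hR0 : 0 ≤ R) (hR : ∀ q ∈ Q, ‖q.1‖ ≤ R) (hg : ∀ i, Tame Q B (dx (coordDir i) g))
    {p Y : Cn n} {M : Cn n →L[ℂ] Cn n} (hp : ‖p‖ ≤ R) (hY : ‖Y‖ ≤ N) (hM : ‖M‖ ≤ N) :
    Tame Q (∑ _i : Fin n × Bool, 4 * (N * (2 + 2 * R) * |B|)) (fieldDeriv p Y M g) := by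
  have hN : 0 ≤ N := (norm_nonneg _).trans hY
  refine Tame.sum hQ Finset.univ fun i _ => ?_
  refine Tame.mul hQ (Tame.mono (tame_affFn hR0 hR _ _) ?_) ((hg i).mono (le_abs_self B))
  have h1 : ‖M p‖ ≤ N * R := (M.le_opNorm _).trans (mul_le_mul hM hp (norm_nonneg _) hN)
  have h2 : |coord i (Y - M p)| ≤ N + N * R :=
    (abs_coord_le i _).trans ((norm_sub_le _ _).trans (by linarith))
  have h3 : ‖(innerSL ℝ (coordDir i)).comp (M.restrictScalars ℝ)‖ ≤ N := by
    refine (ContinuousLinearMap.opNorm_comp_le _ _).trans ?_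
    rw [innerSL_apply_norm, norm_coordDir, one_mul, ContinuousLinearMap.norm_restrictScalars]
    exact hM
  have h4 := mul_le_mul_of_nonneg_right h3 (by linarith : 0 ≤ R + 1)
  linarith

namespace IsSolution

variable {n : ℕ} {Ω W : Set (Cn n)} {ρ : Cn n → ℝ} {r R κ C₀ T Cu B F : ℝ} {S : SolData n}

/-- The parabolic operator on the derivative of `u - φ` along an affine holomorphic field. -/
lemma exists_heat_field_le (hG : Geometry Ω W ρ r R κ C₀) (hn : 1 ≤ n) (hT : 0 < T)
    (Cu B F : ℝ) {a : ℝ} (ha : 0 < a) (N : ℝ) : ∃ C, 0 ≤ C ∧ ∀ S, IsSolution Ω T Cu B F S →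
      ∀ p ∈ closure Ω, ∀ (Y : Cn n) (M : Cn n →L[ℂ] Cn n), ‖Y‖ ≤ N → ‖M‖ ≤ N →
      ∀ q ∈ Ω ×ˢ Ioo 0 T, a ≤ q.2 → ∀ w, IsFrame (hessForm S.u q) w →
      |heat w (fun q => fieldDeriv p Y M S.u q - fieldDeriv p Y M S.φ q) q| ≤
          C * (1 + ∑ k, ‖w k‖ ^ 2) ∧
        |fieldDeriv p Y M S.u q - fieldDeriv p Y M S.φ q| ≤ C := by
  obtain ⟨A, hA0, hA⟩ := exists_abs_grad_le hG hn hT Cu B F ha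
  have hR := hG.R_nonneg
  set N' := |N| * (1 + 2 * R) with hN'
  set Cφ : ℝ := ∑ _i : Fin n × Bool, 4 * (|N| * (2 + 2 * R) * |B|) with hCφ
  have hCφ0 : 0 ≤ Cφ := Finset.sum_nonneg fun _ _ => by positivity
  set C₁ := 2 * n * (N' * (2 * n * |F| + |F| * A)) + 2 * (n * |N|) with hC₁
  have hN'0 : 0 ≤ N' := by positivity
  have hC₁0 : 0 ≤ C₁ := by positivity
  have hAN : 0 ≤ A * N' := by positivity
  refine ⟨C₁ + 2 * Cφ + A * N', by positivity, ?_⟩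
  intro S hS p hp Y M hY hM q hq hqa w hw
  obtain ⟨hCu, hB, hF⟩ := hS.bound_nonneg hG hT
  have hN : 0 ≤ N := (norm_nonneg _).trans hY
  have hO := hS.flow.isOpen_prod
  have hφ : Tame (Ω ×ˢ Ioo 0 T) B S.φ := hS.tame_φ [] (by simp)
  have hnorm : ∀ q ∈ Ω ×ˢ Ioo 0 T, ‖q.1‖ ≤ R := fun q hq =>
    hG.norm_le _ (hG.closure_subset (subset_closure hq.1))
  have hpR := hG.norm_le p (hG.closure_subset hp)
  have hN'e : N' = N * (1 + 2 * R) := by rw [hN', abs_of_nonneg hN]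
  have htφ : Tame (Ω ×ˢ Ioo 0 T) Cφ (fieldDeriv p Y M S.φ) := by
    have := tame_fieldDeriv (B := B) hO hR hnorm (fun i => hS.tame_φ [i] (by simp)) hpR hY hM
    rwa [← abs_of_nonneg hN] at this
  have hYz : ‖Y + M (q.1 - p)‖ ≤ N' := by
    rw [hN'e]; exact abs_coord_field_le hY hM (hnorm q hq) hpR
  obtain ⟨cu, hu⟩ := heat_fieldDeriv hO hS.flow.smooth p Y M w hq
  have cφ := htφ.smooth.contDiffAt_two hO hq
  have hsum := sum_norm_sq_nonneg w
  have hgrad : ∀ v, |dx v S.u q| ≤ A * ‖v‖ := fun v => by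
    have := hA S hS q.1 (subset_closure hq.1) q.2 hq.2 hqa v
    rwa [show S.u₁ (q.1, q.2) = gradForm S.u q from hS.c2.eq₁ hG.isOpen hS.flow.smooth hq] at this
  constructor
  · rw [heat_sub cu cφ]
    obtain ⟨b, c, hc, -, hbc⟩ := hS.flow.heat_dx hq hw
    have h1 : |heat w (fieldDeriv p Y M S.u) q| ≤ C₁ := by
      rw [hu]
      refine (abs_sub _ _).trans ?_
      refine add_le_add ?_ ?_
      · refine (Finset.abs_sum_le_sum_abs _ _).trans ?_
        calc _ ≤ ∑ _i : Fin n × Bool, N' * (2 * n * |F| + |F| * A) := by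
              refine Finset.sum_le_sum fun i _ => ?_
              rw [abs_mul]
              refine mul_le_mul ((abs_coord_le i _).trans hYz) ?_ (abs_nonneg _) hN'0
              obtain ⟨e1, e2⟩ := hbc (coordDir i)
              have e3 := hgrad (coordDir i)
              rw [norm_coordDir, mul_one] at e1 e3
              rw [e2, abs_of_nonneg hF]
              refine (abs_add_le _ _).trans (add_le_add e1 ?_)
              rw [abs_mul]
              exact mul_le_mul hc e3 (abs_nonneg _) hF
          _ = _ := by
              rw [Finset.sum_const, Finset.card_univ, nsmul_eq_mul]
              simp only [Fintype.card_prod, Fintype.card_fin, Fintype.card_bool]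
              push_cast; ring
      · rw [abs_mul, abs_of_nonneg (by norm_num : (0 : ℝ) ≤ 2)]
        refine mul_le_mul_of_nonneg_left ((hw.abs_sum_le M).trans ?_) (by norm_num)
        exact mul_le_mul_of_nonneg_left (hM.trans (le_abs_self N)) (Nat.cast_nonneg n)
    have h2 := htφ.abs_heat_le hO hq w
    refine (abs_sub _ _).trans ?_
    have h3 := mul_nonneg hC₁0 hsum
    have h4 := mul_nonneg hAN hsum
    linarith
  · rw [fieldDeriv_eq p Y M S.u]
    refine (abs_sub _ _).trans ?_
    have h1 := hgrad (Y + M (q.1 - p))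
    rw [← gradForm_apply] at h1
    have h2 := htφ.bound q hq
    have h3 := mul_le_mul_of_nonneg_left hYz hA0
    linarith

/-- The derivative of `u - φ` along an affine field, up to the boundary. -/
def fieldDiff (S : SolData n) (p Y : Cn n) (M : Cn n →L[ℂ] Cn n) (q : Cn n × ℝ) : ℝ :=
  (S.u₁ q - S.φ₁ q) (Y + M (q.1 - p))

lemma fieldDiff_eq (hS : IsSolution Ω T Cu B F S) (p Y : Cn n) (M : Cn n →L[ℂ] Cn n)
    {q : Cn n × ℝ} (hq : q ∈ Ω ×ˢ Ioo 0 T) :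
    fieldDiff S p Y M q = fieldDeriv p Y M S.u q - fieldDeriv p Y M S.φ q := by
  have hφ : Tame (Ω ×ˢ Ioo 0 T) B S.φ := hS.tame_φ [] (by simp)
  rw [fieldDeriv_eq, fieldDeriv_eq, fieldDiff, hS.c2.eq₁ hS.flow.isOpen hS.flow.smooth hq,
    hS.c2_φ.eq₁ hS.flow.isOpen hφ.smooth hq, sub_apply]

lemma continuousOn_fieldDiff (hS : IsSolution Ω T Cu B F S) (p Y : Cn n) (M : Cn n →L[ℂ] Cn n) :
    ContinuousOn (fieldDiff S p Y M) (closure Ω ×ˢ Ioo 0 T) := by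
  refine (hS.c2.cont₁.sub hS.c2_φ.cont₁).clm_apply (Continuous.continuousOn ?_)
  exact continuous_const.add (M.continuous.comp (continuous_fst.sub continuous_const))

/-- The barrier estimate for derivatives along affine holomorphic fields. -/
lemma exists_barrier (hG : Geometry Ω W ρ r R κ C₀) (hn : 1 ≤ n) (hT : 0 < T)
    (Cu B F : ℝ) {a : ℝ} (ha : 0 < a) (N Cg : ℝ) {K : ℝ} (hK : 0 ≤ K) : ∃ A, 0 ≤ A ∧
    ∀ S, IsSolution Ω T Cu B F S → ∀ p ∈ closure Ω, ∀ (Y : Cn n) (M : Cn n →L[ℂ] Cn n),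
      ‖Y‖ ≤ N → ‖M‖ ≤ N → ∀ g : Cn n × ℝ → ℝ, Tame (Ω ×ˢ Ioo 0 T) Cg g →
      ContinuousOn g (closure Ω ×ˢ Ioo 0 T) → ∀ t ∈ Ioo 0 T, a ≤ t →
      (∀ z ∈ frontier Ω, ∀ s ∈ Icc a t, -K * ‖z - p‖ ^ 2 ≤ fieldDiff S p Y M (z, s) + g (z, s)) →
      ∀ z ∈ closure Ω, -(T * K) * ‖z - p‖ ^ 2 + A * ρ z ≤
        (t - a) * (fieldDiff S p Y M (z, t) + g (z, t)) := by
  obtain ⟨K₀, hK₀0, hK₀⟩ := exists_abs_dt_le hG hn hT Cu B F ha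
  obtain ⟨C, hC0, hC⟩ := exists_heat_field_le hG hn hT Cu B F ha N
  have hκ := hG.κ_pos
  set c₀ := Real.exp (-K₀) / 4 with hc₀
  have hc₀0 : 0 < c₀ := by positivity
  -- The part C + |Cg| pays for differentiating the factor t - a, the part with T for the operator
  -- on the field derivative and on g. In A, the term D/c₀ turns constants into multiples of ∑ ‖w
  -- k‖² ≥ c₀, and 4TK pays for the squared distance.
  set D := C + |Cg| + T * (C + 2 * |Cg|) with hD
  have hD0 : 0 ≤ D := by positivity
  set A := (D * (1 + 1 / c₀) + 4 * (T * K) + 1) / κ with hA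
  have hA0 : 0 ≤ A := by positivity
  have hAκ : A * κ = D * (1 + 1 / c₀) + 4 * (T * K) + 1 := by rw [hA]; field_simp
  refine ⟨A, hA0, ?_⟩
  intro S hS p hp Y M hY hM g hg hgc t ht hat hbd z hz
  have hO := hS.flow.isOpen_prod
  have hCg : Cg ≤ |Cg| := le_abs_self Cg
  have hCg0 := abs_nonneg Cg
  have hsub : Icc a t ⊆ Ioo 0 T := fun s hs => ⟨ha.trans_le hs.1, hs.2.trans_lt ht.2⟩
  set P : Cn n × ℝ → ℝ := fun q => fieldDiff S p Y M q + g q with hP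
  set P' : Cn n × ℝ → ℝ := fun q =>
    (fieldDeriv p Y M S.u q - fieldDeriv p Y M S.φ q) + g q with hP'
  have hPP : EqOn P P' (Ω ×ˢ Ioo 0 T) := fun q hq => by
    simp only [hP, hP', hS.fieldDiff_eq p Y M hq]
  -- The squared distance, weighted by TK, takes care of the quadratic error on the lateral
  -- boundary, ρ vanishes there, and the factor q.2 - a removes the initial values.
  set G : Cn n × ℝ → ℝ := fun q => (A * liftFn ρ q - T * K * sqDist p q) - (q.2 - a) * P q with hG'
  set G' : Cn n × ℝ → ℝ := fun q =>
    (A * liftFn ρ q - T * K * sqDist p q) - (q.2 - a) * P' q with hG''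
  have hGG : ∀ q ∈ Ω ×ˢ Ioo 0 T, G =ᶠ[𝓝 q] G' := fun q hq => by
    filter_upwards [hO.mem_nhds hq] with q' hq'
    simp only [hG', hG'', hPP hq']
  have cρ : ∀ z ∈ Ω, ∀ s, ContDiffAt ℝ 2 (liftFn ρ) (z, s) := fun z hz s =>
    hG.contDiffAt (hG.closure_subset (subset_closure hz)) s
  have cA : ∀ z ∈ Ω, ∀ s, ContDiffAt ℝ 2 (fun q => A * liftFn ρ q) (z, s) := fun z hz s =>
    contDiffAt_const.mul (cρ z hz s)
  have cK : ∀ q, ContDiffAt ℝ 2 (fun q => T * K * sqDist p q) q := fun q =>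
    contDiffAt_const.mul (contDiffAt_sqDist p q)
  have hφ : Tame (Ω ×ˢ Ioo 0 T) B S.φ := hS.tame_φ [] (by simp)
  have cF : ∀ q ∈ Ω ×ˢ Ioo 0 T, ContDiffAt ℝ 2
      (fun q => fieldDeriv p Y M S.u q - fieldDeriv p Y M S.φ q) q := fun q hq =>
    (heat_fieldDeriv hO hS.flow.smooth p Y M (fun _ => 0) hq).1.sub
      (heat_fieldDeriv hO hφ.smooth p Y M (fun _ => 0) hq).1
  have cg : ∀ q ∈ Ω ×ˢ Ioo 0 T, ContDiffAt ℝ 2 g q := fun q hq => hg.smooth.contDiffAt_two hO hq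
  have cP : ∀ q ∈ Ω ×ˢ Ioo 0 T, ContDiffAt ℝ 2 P' q := fun q hq => (cF q hq).add (cg q hq)
  have cG : ∀ z ∈ Ω, ∀ s ∈ Ioo 0 T, ContDiffAt ℝ 2 G' (z, s) := fun z hz s hs =>
    ((cA z hz s).sub (cK _)).sub ((contDiffAt_shift a).mul (cP (z, s) ⟨hz, hs⟩))
  have hcont : ContinuousOn G (closure Ω ×ˢ Icc a t) := by
    refine ContinuousOn.sub (ContinuousOn.sub ?_ ?_) ?_
    · exact continuousOn_const.mul ((liftFn_contDiffOn hG.smooth).continuousOn.mono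
        (prod_mono hG.closure_subset (subset_univ _)))
    · exact continuousOn_const.mul (contDiff_sqDist p).continuous.continuousOn
    · exact (continuousOn_snd.sub continuousOn_const).mul
        (((hS.continuousOn_fieldDiff p Y M).add hgc).mono (prod_mono subset_rfl hsub))
  have hmain := parabolic_max hG.isOpen hG.isBounded (a := a) (b := t) (G := G) (M := 0) hcont
    (fun z hz s hs => (cG z hz s (hsub (Ioc_subset_Icc_self hs))).congr_of_eventuallyEq
      (hGG (z, s) ⟨hz, hsub (Ioc_subset_Icc_self hs)⟩)) ?_ ?_ ?_ z hz t ⟨hat, le_rfl⟩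
  · simp only [hG', hP, liftFn, sqDist] at hmain
    linarith
  · intro z hz s hs
    have h1 := hbd z hz s hs
    have h0 : 0 ≤ s - a := by linarith [hs.1]
    have hsT : s - a ≤ T := by linarith [(hsub hs).2]
    have h2 := mul_le_mul_of_nonneg_left h1 h0
    have h3 := mul_le_mul_of_nonneg_right hsT (mul_nonneg hK (sq_nonneg ‖z - p‖))
    simp only [hG', hP, liftFn, sqDist, hG.eq_zero hz]
    linarith
  · intro z hz
    have h1 := hG.neg_of_mem hz
    have h2 : 0 ≤ T * K * ‖z - p‖ ^ 2 := mul_nonneg (mul_nonneg hT.le hK) (sq_nonneg _)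
    have h3 := mul_nonpos_of_nonneg_of_nonpos hA0 h1.le
    simp only [hG', liftFn, sqDist, sub_self, zero_mul, sub_zero]
    linarith
  · intro z hz s hs _ _ hdt hh
    have hsI := hsub (Ioc_subset_Icc_self hs)
    have hq : (z, s) ∈ Ω ×ˢ Ioo 0 T := ⟨hz, hsI⟩
    obtain ⟨w, hw⟩ := hS.flow.exists_frame hq
    have h1 : 0 ≤ heat w G (z, s) := heat_nonneg_of_max hdt hh
    rw [heat_congr (hGG _ hq), hG'', heat_sub ((cA z hz s).sub (cK _))
      ((contDiffAt_shift a).mul (cP _ hq)), heat_sub (cA z hz s) (cK _),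
      heat_const_mul (cρ z hz s), heat_const_mul (contDiffAt_sqDist p _), heat_sqDist,
      heat_shift_mul a (cP _ hq), hP', heat_add (cF _ hq) (cg _ hq)] at h1
    obtain ⟨e1, e2⟩ := hC S hS p hp Y M hY hM (z, s) hq hs.1.le w hw
    have e3 := hg.abs_heat_le hO hq w
    have e4 := hg.bound _ hq
    have e5 := hG.heat_le (q := (z, s)) (subset_closure hz) w
    have e6 := exp_le_frame hn hw (hK₀ S hS z hz s hsI hs.1.le).2
    set τ := ∑ k, ‖w k‖ ^ 2 with hτ
    have hτ0 : 0 ≤ τ := sum_norm_sq_nonneg w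
    have e7 : 1 ≤ 1 / c₀ * τ := by
      rw [one_div, ← div_eq_inv_mul, le_div_iff₀ hc₀0]; linarith
    simp only at h1
    have h0 : 0 ≤ s - a := by linarith [hs.1]
    have hsT : s - a ≤ T := by linarith [hsI.2]
    set x := heat w (fun q => fieldDeriv p Y M S.u q - fieldDeriv p Y M S.φ q) (z, s)
    set y := heat w g (z, s)
    have e8 : -((s - a) * (x + y)) ≤ T * ((C + 2 * |Cg|) * (1 + τ)) := by
      have f1 : |x + y| ≤ (C + 2 * |Cg|) * (1 + τ) := by
        refine (abs_add_le _ _).trans ?_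
        have := mul_le_mul_of_nonneg_right hCg hτ0
        linarith
      refine (neg_le_abs _).trans ?_
      rw [abs_mul, abs_of_nonneg h0]
      exact mul_le_mul hsT f1 (abs_nonneg _) hT.le
    have e9 := mul_le_mul_of_nonneg_left e5 hA0
    have e10 : A * (-κ * τ) = -(D * (1 + 1 / c₀) + 4 * (T * K) + 1) * τ := by
      rw [← hAκ]; ring
    have e11 := neg_le_abs (fieldDeriv p Y M S.u (z, s) - fieldDeriv p Y M S.φ (z, s))
    have e12 := neg_le_abs (g (z, s))
    have e13 := mul_le_mul_of_nonneg_left e7 hD0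
    have e14 : 0 < τ := by
      have := Real.exp_pos (-K₀)
      linarith
    have e15 : (C + |Cg|) * 1 ≤ (C + |Cg|) * (1 + τ) :=
      mul_le_mul_of_nonneg_left (by linarith) (by linarith)
    have e16 : D * (1 + τ) = (C + |Cg|) * (1 + τ) + T * ((C + 2 * |Cg|) * (1 + τ)) := by
      rw [hD]; ring
    rw [e10] at e9
    linarith

end IsSolution

end

/-! ### Mixed second derivatives on the boundary. -/

noncomputable section

open Filter Topology

namespace IsSolution

variable {n : ℕ} {Ω W : Set (Cn n)} {ρ : Cn n → ℝ} {r R κ C₀ T Cu B F : ℝ} {S : SolData n}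

/-- On the boundary the differential of `u - φ` is a bounded multiple of that of `ρ`. -/
lemma exists_factor (hG : Geometry Ω W ρ r R κ C₀) (hn : 1 ≤ n) (hT : 0 < T)
    (Cu B F : ℝ) {a : ℝ} (ha : 0 < a) : ∃ A, 0 ≤ A ∧ ∀ S, IsSolution Ω T Cu B F S →
      ∀ p ∈ frontier Ω, ∀ t ∈ Ioo 0 T, a ≤ t → ∃ h : ℝ, |h| ≤ A ∧
      ∀ v, (S.u₁ (p, t) - S.φ₁ (p, t)) v = h * dRho ρ p v := by
  obtain ⟨A, hA0, hA⟩ := exists_abs_grad_sub_le hG hn hT Cu B F ha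
  refine ⟨A, hA0, fun S hS p hp t ht hat => ?_⟩
  have hpW := hG.closure_subset (frontier_subset_closure hp)
  have hA' : ∀ v, |(S.u₁ (p, t) - S.φ₁ (p, t)) v| ≤ A * |dRho ρ p v| := fun v => by
    rw [← hG.gradForm_eq hpW t]; exact hA S hS p hp t ht hat v
  have hν : 0 < ‖nRho ρ p‖ ^ 2 := pow_pos (hG.κ_pos.trans_le (hG.le_norm_nRho hp)) 2
  refine ⟨(S.u₁ (p, t) - S.φ₁ (p, t)) (nRho ρ p) / ‖nRho ρ p‖ ^ 2, ?_, fun v => ?_⟩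
  · rw [abs_div, abs_of_pos hν, div_le_iff₀ hν]
    have := hA' (nRho ρ p)
    rwa [dRho_nRho, abs_of_pos hν] at this
  -- Subtracting the normal component leaves a tangential vector, on which the estimate forces the
  -- differential of u - φ to vanish.
  · set c := dRho ρ p v / ‖nRho ρ p‖ ^ 2 with hc
    have h0 : dRho ρ p (v - c • nRho ρ p) = 0 := by
      rw [map_sub, map_smul, dRho_nRho, smul_eq_mul, hc, div_mul_cancel₀ _ hν.ne', sub_self]
    have h1 := hA' (v - c • nRho ρ p)
    rw [h0, abs_zero, mul_zero] at h1
    have h2 := abs_nonpos_iff.mp h1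
    rw [map_sub, map_smul, smul_eq_mul] at h2
    rw [eq_of_sub_eq_zero h2, hc]
    ring

lemma hasFDerivWithinAt_fieldDiff (hS : IsSolution Ω T Cu B F S) {p : Cn n} (hp : p ∈ closure Ω)
    (Y : Cn n) (M : Cn n →L[ℂ] Cn n) {t : ℝ} (ht : t ∈ Ioo 0 T) (c : ℝ) :
    ∃ L : Cn n →L[ℝ] ℝ, HasFDerivWithinAt (fun z => c * fieldDiff S p Y M (z, t)) L (closure Ω) p ∧
      ∀ v, L v = c * ((S.u₂ (p, t) - S.φ₂ (p, t)) v Y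
        + (S.u₁ (p, t) - S.φ₁ (p, t)) (M v)) := by
  have h1 := (hS.c2.sub hS.c2_φ).deriv₂ p hp t ht
  have h2 : HasFDerivAt (fun z : Cn n => Y + M (z - p)) (M.restrictScalars ℝ) p := by
    have e1 : HasFDerivAt (fun z : Cn n => (M.restrictScalars ℝ) (z - p)) (M.restrictScalars ℝ) p :=
      (M.restrictScalars ℝ).hasFDerivAt.comp p ((hasFDerivAt_id p).sub_const p)
    exact e1.const_add Y
  have h3 := (h1.clm_apply (h2.hasFDerivWithinAt (s := closure Ω))).const_mul c
  refine ⟨_, h3, fun v => ?_⟩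
  simp
  ring

/-- Reversing the field turns the one-sided barrier into a two-sided estimate. -/
lemma fieldDiff_neg (S : SolData n) (p Y : Cn n) (M : Cn n →L[ℂ] Cn n) (q : Cn n × ℝ) :
    fieldDiff S p (-Y) (-M) q = -fieldDiff S p Y M q := by
  have : -Y + (-M) (q.1 - p) = -(Y + M (q.1 - p)) := by
    rw [neg_apply]; abel
  rw [fieldDiff, fieldDiff, this, map_neg]

/-- The estimate of mixed second derivatives on the boundary, relative to the defining function. -/
lemma exists_mixed_aux (hG : Geometry Ω W ρ r R κ C₀) (hn : 1 ≤ n) (hT : 0 < T)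
    (Cu B F : ℝ) {a : ℝ} (ha : 0 < a) : ∃ C, 0 ≤ C ∧ ∀ S, IsSolution Ω T Cu B F S →
      ∀ p ∈ frontier Ω, ∀ t ∈ Ioo 0 T, a ≤ t → ∀ τ, ‖τ‖ ≤ 1 → dRho ρ p τ = 0 →
      ∃ M : Cn n →L[ℂ] Cn n, (∀ v, dRho ρ p (M v) = -hRho ρ p v τ) ∧
      ∀ v, (t - a) * |(S.u₂ (p, t) - S.φ₂ (p, t)) v τ
        + (S.u₁ (p, t) - S.φ₁ (p, t)) (M v)| ≤ C * |dRho ρ p v| := by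
  obtain ⟨A, hA0, hA⟩ := exists_abs_grad_sub_le hG hn hT Cu B F ha
  obtain ⟨Cf, hCf0, hCf⟩ := hG.exists_field
  obtain ⟨A', hA'0, hA'⟩ := exists_barrier hG hn hT Cu B F ha (max 1 Cf) 0 (mul_nonneg hA0 hCf0)
  refine ⟨A', hA'0, ?_⟩
  intro S hS p hp t ht hat τ hτ1 hτ
  have hpc := frontier_subset_closure hp
  -- With l = 0 the field equals τ at p and its ρ-derivative is O(‖z - p‖²). On the boundary the
  -- derivative of u - φ along it is then O(‖z - p‖²) too, as the barrier requires.
  obtain ⟨M, hM, hdM, hT2⟩ := hCf p hp τ 0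
  simp only [norm_zero, zero_add, zero_apply, hτ, zero_sub, sub_zero, add_zero] at hM hdM hT2
  have hMN : ‖M‖ ≤ max 1 Cf :=
    hM.trans ((mul_le_of_le_one_right hCf0 hτ1).trans (le_max_right _ _))
  have hYN : ‖τ‖ ≤ max 1 Cf := hτ1.trans (le_max_left _ _)
  refine ⟨M, hdM, fun v => ?_⟩
  have hbd : ∀ z ∈ frontier Ω, ∀ s ∈ Icc a t,
      |fieldDiff S p τ M (z, s)| ≤ A * Cf * ‖z - p‖ ^ 2 := by
    intro z hz s hs
    have hsI : s ∈ Ioo 0 T := ⟨ha.trans_le hs.1, hs.2.trans_lt ht.2⟩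
    have h1 := hA S hS z hz s hsI hs.1 (τ + M (z - p))
    rw [hG.gradForm_eq (hG.closure_subset (frontier_subset_closure hz))] at h1
    have h2 := hT2 z (frontier_subset_closure hz)
    have h3 : Cf * ‖τ‖ * ‖z - p‖ ^ 2 ≤ Cf * ‖z - p‖ ^ 2 :=
      mul_le_mul_of_nonneg_right (mul_le_of_le_one_right hCf0 hτ1) (sq_nonneg _)
    refine h1.trans ?_
    rw [mul_assoc]
    exact mul_le_mul_of_nonneg_left (h2.trans h3) hA0
  have hz0 : Tame (Ω ×ˢ Ioo 0 T) 0 (fun _ : Cn n × ℝ => (0 : ℝ)) := Tame.const 0 (by simp)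
  have b1 := hA' S hS p hpc τ M hYN hMN (fun _ => 0) hz0 continuousOn_const t ht hat
    (fun z hz s hs => by
      have := neg_abs_le (fieldDiff S p τ M (z, s))
      have := hbd z hz s hs
      linarith)
  have b2 := hA' S hS p hpc (-τ) (-M) (by rwa [norm_neg]) (by rwa [norm_neg]) (fun _ => 0) hz0
    continuousOn_const t ht hat
    (fun z hz s hs => by
      rw [fieldDiff_neg]
      have := le_abs_self (fieldDiff S p τ M (z, s))
      have := hbd z hz s hs
      linarith)
  obtain ⟨L, hL, hLv⟩ := hS.hasFDerivWithinAt_fieldDiff hpc τ M ht (t - a)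
  have h0 : (t - a) * fieldDiff S p τ M (p, t) = 0 := by
    have h1 := hA S hS p hp t ht hat τ
    rw [hG.gradForm_eq (hG.closure_subset hpc), hτ, abs_zero, mul_zero] at h1
    have h2 := abs_nonpos_iff.mp h1
    simp only [fieldDiff, sub_self, map_zero, add_zero]
    rw [h2, mul_zero]
  have hfin := hG.abs_deriv_le_of_barrier (t := 0) (K := T * (A * Cf)) (A := A') hp hL h0
    (fun z hz => by
      have e1 := b1 z (subset_closure hz)
      have e2 := b2 z (subset_closure hz)
      rw [fieldDiff_neg] at e2
      rw [abs_le]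
      constructor <;> linarith) v
  rw [hLv, abs_mul, abs_of_nonneg (by linarith : 0 ≤ t - a)] at hfin
  exact hfin

/-- The Hessian of `u - φ` on tangential vectors. -/
lemma exists_tangential (hG : Geometry Ω W ρ r R κ C₀) (hn : 1 ≤ n) (hT : 0 < T)
    (Cu B F : ℝ) {a : ℝ} (ha : 0 < a) : ∃ A, 0 ≤ A ∧ ∀ S, IsSolution Ω T Cu B F S →
      ∀ p ∈ frontier Ω, ∀ t ∈ Ioo 0 T, a ≤ t → ∃ h : ℝ, |h| ≤ A ∧
      (∀ v, (S.u₁ (p, t) - S.φ₁ (p, t)) v = h * dRho ρ p v) ∧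
      (a < t → ∀ v τ, dRho ρ p v = 0 → dRho ρ p τ = 0 →
        (S.u₂ (p, t) - S.φ₂ (p, t)) v τ = h * hRho ρ p v τ) := by
  obtain ⟨A, hA0, hA⟩ := exists_factor hG hn hT Cu B F ha
  obtain ⟨C, hC0, hC⟩ := exists_mixed_aux hG hn hT Cu B F ha
  refine ⟨A, hA0, fun S hS p hp t ht hat => ?_⟩
  obtain ⟨h, hh, hD⟩ := hA S hS p hp t ht hat
  refine ⟨h, hh, hD, fun hlt v τ hv hτ => ?_⟩
  rcases eq_or_ne τ 0 with rfl | hτ0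
  · simp
  have hτn : 0 < ‖τ‖ := norm_pos_iff.mpr hτ0
  obtain ⟨M, hM, hMv⟩ := hC S hS p hp t ht hat (‖τ‖⁻¹ • τ)
    (by rw [norm_smul, norm_inv, norm_norm, inv_mul_cancel₀ hτn.ne'])
    (by rw [map_smul, hτ, smul_zero])
  have h1 := hMv v
  rw [hv, abs_zero, mul_zero] at h1
  -- For tangential v the bound is zero and the factor t - a is positive, so the estimate is an
  -- identity: D²(u - φ)(v, τ) = -h dρ(M v) = h D²ρ(v, τ).
  have h2 := abs_nonpos_iff.mp (nonpos_of_mul_nonpos_right h1 (sub_pos.mpr hlt))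
  rw [hD, hM, map_smul, map_smul, smul_eq_mul, smul_eq_mul] at h2
  have h3 : ‖τ‖⁻¹ * ((S.u₂ (p, t) - S.φ₂ (p, t)) v τ - h * hRho ρ p v τ) = 0 := by
    linarith
  have h4 := (mul_eq_zero.mp h3).resolve_left (inv_pos.mpr hτn).ne'
  linarith

/-- The mixed second derivatives on the boundary. -/
lemma exists_mixed (hG : Geometry Ω W ρ r R κ C₀) (hn : 1 ≤ n) (hT : 0 < T)
    (Cu B F : ℝ) {a : ℝ} (ha : 0 < a) : ∃ C, 0 ≤ C ∧ ∀ S, IsSolution Ω T Cu B F S →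
      ∀ p ∈ frontier Ω, ∀ t ∈ Ioo 0 T, a < t → ∀ v τ, dRho ρ p τ = 0 →
      (t - a) * |(S.u₂ (p, t) - S.φ₂ (p, t)) v τ| ≤ C * ‖v‖ * ‖τ‖ := by
  obtain ⟨A, hA0, hA⟩ := exists_factor hG hn hT Cu B F ha
  obtain ⟨C, hC0, hC⟩ := exists_mixed_aux hG hn hT Cu B F ha
  have hC₀ := hG.C₀_nonneg
  refine ⟨C * C₀ + T * (A * ((2 * n) ^ 2 * C₀)), by positivity, ?_⟩
  intro S hS p hp t ht hat v τ hτ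
  have hpW := hG.closure_subset (frontier_subset_closure hp)
  rcases eq_or_ne τ 0 with rfl | hτ0
  · simp
  have hτn : 0 < ‖τ‖ := norm_pos_iff.mpr hτ0
  have hτ1 : ‖‖τ‖⁻¹ • τ‖ = 1 := by rw [norm_smul, norm_inv, norm_norm, inv_mul_cancel₀ hτn.ne']
  obtain ⟨M, hM, hMv⟩ := hC S hS p hp t ht hat.le (‖τ‖⁻¹ • τ) hτ1.le
    (by rw [map_smul, hτ, smul_zero])
  obtain ⟨h, hh, hD⟩ := hA S hS p hp t ht hat.le
  have h1 := hMv v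
  rw [hD, hM] at h1
  have h2 := hG.abs_dRho_le hpW v
  have h3 := hG.abs_hRho_le hpW v (‖τ‖⁻¹ • τ)
  rw [hτ1, mul_one] at h3
  set x := (S.u₂ (p, t) - S.φ₂ (p, t)) v (‖τ‖⁻¹ • τ) with hx
  set y := hRho ρ p v (‖τ‖⁻¹ • τ)
  have h4 : |x| ≤ |x + h * -y| + |h| * |y| := by
    have := abs_sub (x + h * -y) (h * -y)
    rw [add_sub_cancel_right, abs_mul, abs_neg] at this
    exact this
  have h5 : 0 ≤ t - a := by linarith
  have h6 : t - a ≤ T := by linarith [ht.2]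
  have h7 : (t - a) * |x| ≤ (C * C₀ + T * (A * ((2 * n) ^ 2 * C₀))) * ‖v‖ := by
    have e1 := mul_le_mul_of_nonneg_left h4 h5
    have e2 : |h| * |y| ≤ A * ((2 * n) ^ 2 * C₀ * ‖v‖) := mul_le_mul hh h3 (abs_nonneg _) hA0
    have e3 : (t - a) * (|h| * |y|) ≤ T * (A * ((2 * n) ^ 2 * C₀ * ‖v‖)) :=
      mul_le_mul h6 e2 (mul_nonneg (abs_nonneg _) (abs_nonneg _)) hT.le
    have e4 := mul_le_mul_of_nonneg_left h2 hC0
    linarith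
  have h8 : x = ‖τ‖⁻¹ * (S.u₂ (p, t) - S.φ₂ (p, t)) v τ := by rw [hx, map_smul, smul_eq_mul]
  rw [h8, abs_mul, abs_of_pos (inv_pos.mpr hτn)] at h7
  have h9 := mul_le_mul_of_nonneg_right h7 hτn.le
  refine le_trans (le_of_eq ?_) h9
  field_simp

end IsSolution

end

/-! ### The determinant on the boundary; reduction of the Laplacian to the normal direction. -/

noncomputable section

open Filter Topology

lemma realTrace_eq {n : ℕ} (B : RealBilin n) : realTrace B = ∑ i, B (coordDir i) (coordDir i) := by
  rw [Fintype.sum_prod_type, realTrace]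
  refine Finset.sum_congr rfl fun α _ => ?_
  rw [Fintype.sum_bool]
  simp only [levi, coordDir, if_true, dirY_eq]
  simp [add_comm]

namespace IsC2UpTo

variable {n : ℕ} {Ω : Set (Cn n)} {T : ℝ} {g : Cn n × ℝ → ℝ} {g₁ : Cn n × ℝ → Cn n →L[ℝ] ℝ}
  {g₂ : Cn n × ℝ → RealBilin n}

lemma continuousOn_levi (hg : IsC2UpTo Ω T g g₁ g₂) (x : Cn n) :
    ContinuousOn (fun q => levi (g₂ q) x) (closure Ω ×ˢ Ioo 0 T) :=
  (hg.cont₂ _ _).add (hg.cont₂ _ _)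

lemma continuousOn_det (hg : IsC2UpTo Ω T g g₁ g₂) :
    ContinuousOn (fun q => (leviMatrix (g₂ q)).det.re) (closure Ω ×ˢ Ioo 0 T) := by
  have h : ContinuousOn (fun q => leviMatrix (g₂ q)) (closure Ω ×ˢ Ioo 0 T) := by
    refine continuousOn_pi.mpr fun α => continuousOn_pi.mpr fun β => ?_
    simp only [leviMatrix, Matrix.of_apply, hform]
    refine ContinuousOn.div_const (ContinuousOn.add ?_ (continuousOn_const.mul ?_)) _
    · exact Complex.continuous_ofReal.comp_continuousOn ((hg.cont₂ _ _).add (hg.cont₂ _ _))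
    · exact Complex.continuous_ofReal.comp_continuousOn ((hg.cont₂ _ _).sub (hg.cont₂ _ _))
  exact Complex.continuous_re.comp_continuousOn
    ((Continuous.matrix_det continuous_id).comp_continuousOn h)

end IsC2UpTo

namespace IsSolution

variable {n : ℕ} {Ω W : Set (Cn n)} {ρ : Cn n → ℝ} {r R κ C₀ T Cu B F : ℝ} {S : SolData n}

lemma symm_u₂ (hS : IsSolution Ω T Cu B F S) {z : Cn n} (hz : z ∈ closure Ω) {t : ℝ}
    (ht : t ∈ Ioo 0 T) (v w : Cn n) : S.u₂ (z, t) v w = S.u₂ (z, t) w v :=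
  hS.c2.symm hS.flow.isOpen hS.flow.smooth hz ht v w

lemma symm_φ₂ (hS : IsSolution Ω T Cu B F S) {z : Cn n} (hz : z ∈ closure Ω) {t : ℝ}
    (ht : t ∈ Ioo 0 T) (v w : Cn n) : S.φ₂ (z, t) v w = S.φ₂ (z, t) w v :=
  hS.c2_φ.symm hS.flow.isOpen (hS.tame_φ [] (by simp)).smooth hz ht v w

/-- Polarization of the bound for pure second derivatives in coordinate directions. -/
lemma abs_φ₂_le (hS : IsSolution Ω T Cu B F S) (hG : Geometry Ω W ρ r R κ C₀) (hT : 0 < T)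
    {z : Cn n} (hz : z ∈ closure Ω) {t : ℝ} (ht : t ∈ Ioo 0 T) (v w : Cn n) :
    |S.φ₂ (z, t) v w| ≤ (2 * n) ^ 2 * B * ‖v‖ * ‖w‖ := by
  have hB := (hS.bound_nonneg hG hT).2.1
  refine ((S.φ₂ (z, t)).le_opNorm₂ v w).trans ?_
  gcongr
  refine norm_bilin_le hB fun i j => ?_
  have hs := hS.symm_φ₂ hz ht (coordDir i) (coordDir j)
  have h1 := hS.φ₂_le hz ht (coordDir i + coordDir j)
  have h2 := hS.φ₂_le hz ht (coordDir i - coordDir j)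
  have h3 := parallelogram_law_with_norm ℝ (coordDir i : Cn n) (coordDir j)
  rw [norm_coordDir, norm_coordDir] at h3
  have e : 4 * S.φ₂ (z, t) (coordDir i) (coordDir j) =
      S.φ₂ (z, t) (coordDir i + coordDir j) (coordDir i + coordDir j)
        - S.φ₂ (z, t) (coordDir i - coordDir j) (coordDir i - coordDir j) := by
    simp only [map_add, map_sub, add_apply, sub_apply, hs]
    ring
  have h4 : B * ‖(coordDir i : Cn n) + coordDir j‖ ^ 2 + B * ‖(coordDir i : Cn n) - coordDir j‖ ^ 2
      = B * 4 := by
    rw [← mul_add]; congr 1; linarith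
  rw [abs_le] at h1 h2 ⊢
  constructor <;> linarith [h1.1, h1.2, h2.1, h2.2]

/-- Up to the boundary the Levi form is positive definite with determinant bounded above and
below. -/
lemma exists_det_bounds (hG : Geometry Ω W ρ r R κ C₀) (hn : 1 ≤ n) (hT : 0 < T)
    (Cu B F : ℝ) {a : ℝ} (ha : 0 < a) : ∃ K, 0 ≤ K ∧ ∀ S, IsSolution Ω T Cu B F S →
      ∀ z ∈ closure Ω, ∀ t ∈ Ioo 0 T, a ≤ t → (leviMatrix (S.u₂ (z, t))).PosDef ∧
        Real.exp (-K) ≤ (leviMatrix (S.u₂ (z, t))).det.re ∧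
        (leviMatrix (S.u₂ (z, t))).det.re ≤ Real.exp K := by
  obtain ⟨K, hK0, hK⟩ := exists_abs_dt_le hG hn hT Cu B F ha
  refine ⟨K, hK0, fun S hS z hz t ht hat => ?_⟩
  have hc := IsC2UpTo.slice_continuousOn hS.c2.continuousOn_det ht
  have he : ∀ y ∈ Ω, S.u₂ (y, t) = hessForm S.u (y, t) := fun y hy =>
    hS.c2.eq₂ hS.flow.isOpen hS.flow.smooth ⟨hy, ht⟩
  have hb : ∀ y ∈ Ω, Real.exp (-K) ≤ (leviMatrix (S.u₂ (y, t))).det.re ∧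
      (leviMatrix (S.u₂ (y, t))).det.re ≤ Real.exp K := fun y hy => by
    rw [he y hy]
    exact hS.flow.det_bounds ⟨hy, ht⟩ (hK S hS y hy t ht hat).2
  have h1 := le_on_closure (fun y hy => (hb y hy).1) continuousOn_const hc hz
  have h2 := le_on_closure (fun y hy => (hb y hy).2) hc continuousOn_const hz
  refine ⟨?_, h1, h2⟩
  have hsymm := hS.symm_u₂ hz ht
  -- Limits of positive forms are only semidefinite; the lower bound of the determinant excludes a
  -- kernel.
  have hpsd : (leviMatrix (S.u₂ (z, t))).PosSemidef := by
    rw [leviMatrix_posSemidef_iff hsymm]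
    intro x
    refine le_on_closure (f := fun _ => (0 : ℝ)) (fun y hy => ?_) continuousOn_const
      (IsC2UpTo.slice_continuousOn (hS.c2.continuousOn_levi x) ht) hz
    rw [he y hy]
    exact (leviMatrix_posSemidef_iff (hS.flow.hess_symm ⟨hy, ht⟩)).mp
      (hS.flow.posDef _ ⟨hy, ht⟩).posSemidef x
  rw [hpsd.posDef_iff_isUnit, Matrix.isUnit_iff_isUnit_det, isUnit_iff_ne_zero]
  intro h0
  rw [h0, Complex.zero_re] at h1
  exact absurd (Real.exp_pos (-K)) (not_lt.mpr h1)

/-- A bound for the second normal derivative on the boundary bounds the Laplacian. -/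
lemma exists_trace_le_of_normal (hG : Geometry Ω W ρ r R κ C₀) (hn : 1 ≤ n) (hT : 0 < T)
    (Cu B F : ℝ) {a : ℝ} (ha : 0 < a) {C₁ : ℝ} (hC₁ : 0 ≤ C₁) :
    ∃ Λ, 0 ≤ Λ ∧ ∀ S, IsSolution Ω T Cu B F S →
      ∀ p ∈ frontier Ω, ∀ t ∈ Ioo 0 T, a < t →
      (t - a) * (S.u₂ (p, t) - S.φ₂ (p, t)) (nRho ρ p) (nRho ρ p) ≤ C₁ →
      (t - a) * realTrace (S.u₂ (p, t)) ≤ Λ := by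
  obtain ⟨C, hC0, hC⟩ := exists_mixed hG hn hT Cu B F ha
  have hκ := hG.κ_pos
  have hD0 : 0 ≤ C₁ / κ ^ 2 + 8 * C + T * |B| := by positivity
  refine ⟨2 * n * (C₁ / κ ^ 2 + 8 * C + T * |B|), by positivity, ?_⟩
  intro S hS p hp t ht hat hν
  have hpc := frontier_subset_closure hp
  set ν := nRho ρ p with hνd
  set D := S.u₂ (p, t) - S.φ₂ (p, t) with hD
  have hsymm : ∀ v w, D v w = D w v := fun v w => by
    simp only [hD, sub_apply, hS.symm_u₂ hpc ht v w, hS.symm_φ₂ hpc ht v w]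
  have hν0 : 0 < ‖ν‖ := hκ.trans_le (hG.le_norm_nRho hp)
  have hta : 0 ≤ t - a := by linarith
  rw [realTrace_eq, Finset.mul_sum]
  have key : ∀ i, (t - a) * S.u₂ (p, t) (coordDir i) (coordDir i) ≤
      C₁ / κ ^ 2 + 8 * C + T * |B| := by
    intro i
    set e : Cn n := coordDir i with he
    have he1 : ‖e‖ = 1 := norm_coordDir i
    -- Split each coordinate direction as e = cν + τ with τ tangential. Only the term c² D(ν, ν) is
    -- not covered by `exists_mixed`.
    set c := dRho ρ p e / ‖ν‖ ^ 2 with hc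
    set τ := e - c • ν with hτd
    have hτ : dRho ρ p τ = 0 := by
      rw [hτd, map_sub, map_smul, hνd, dRho_nRho, smul_eq_mul, hc, hνd,
        div_mul_cancel₀ _ (pow_pos hν0 2).ne', sub_self]
    have hcν : |c| * ‖ν‖ ≤ 1 := by
      have h1 : |dRho ρ p e| ≤ ‖ν‖ := by
        rw [← inner_nRho]
        simpa [he1] using abs_real_inner_le_norm (nRho ρ p) e
      rw [hc, abs_div, abs_of_pos (pow_pos hν0 2), div_mul_eq_mul_div, div_le_one (pow_pos hν0 2),
        pow_two]
      exact mul_le_mul_of_nonneg_right h1 hν0.le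
    have hτ2 : ‖τ‖ ≤ 2 := by
      refine (norm_sub_le _ _).trans ?_
      rw [he1, norm_smul, Real.norm_eq_abs]
      linarith
    have hc2 : c ^ 2 ≤ 1 / κ ^ 2 := by
      have h1 : |c| * κ ≤ 1 :=
        (mul_le_mul_of_nonneg_left (hG.le_norm_nRho hp) (abs_nonneg c)).trans hcν
      rw [le_div_iff₀ (pow_pos hκ 2), ← sq_abs c, ← mul_pow]
      exact pow_le_one₀ (mul_nonneg (abs_nonneg c) hκ.le) h1
    have hexp : D e e = c ^ 2 * D ν ν + 2 * c * D ν τ + D τ τ := by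
      have : e = c • ν + τ := by rw [hτd]; abel
      rw [this]
      simp only [map_add, map_smul, add_apply, smul_apply, smul_eq_mul, hsymm τ ν]
      ring
    have m1 := hC S hS p hp t ht hat ν τ hτ
    have m2 := hC S hS p hp t ht hat τ τ hτ
    have e1 : c ^ 2 * ((t - a) * D ν ν) ≤ C₁ / κ ^ 2 := by
      calc c ^ 2 * ((t - a) * D ν ν) ≤ c ^ 2 * C₁ := mul_le_mul_of_nonneg_left hν (sq_nonneg c)
        _ ≤ 1 / κ ^ 2 * C₁ := mul_le_mul_of_nonneg_right hc2 hC₁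
        _ = _ := by ring
    have e2 : 2 * c * ((t - a) * D ν τ) ≤ 4 * C := by
      have f1 : 2 * c * ((t - a) * D ν τ) ≤ 2 * |c| * ((t - a) * |D ν τ|) := by
        refine (le_abs_self _).trans (le_of_eq ?_)
        rw [abs_mul, abs_mul, abs_mul, abs_of_nonneg hta]
        norm_num
      have f2 : |c| * ((t - a) * |D ν τ|) ≤ |c| * (C * ‖ν‖ * ‖τ‖) :=
        mul_le_mul_of_nonneg_left m1 (abs_nonneg c)
      have f3 : |c| * (C * ‖ν‖ * ‖τ‖) ≤ C * 2 := by
        calc |c| * (C * ‖ν‖ * ‖τ‖) = C * ((|c| * ‖ν‖) * ‖τ‖) := by ring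
          _ ≤ C * (1 * 2) := mul_le_mul_of_nonneg_left
            (mul_le_mul hcν hτ2 (norm_nonneg _) zero_le_one) hC0
          _ = _ := by ring
      linarith
    have e3 : (t - a) * D τ τ ≤ 4 * C := by
      have f1 : (t - a) * D τ τ ≤ (t - a) * |D τ τ| :=
        mul_le_mul_of_nonneg_left (le_abs_self _) hta
      have f2 : C * ‖τ‖ * ‖τ‖ ≤ C * 2 * 2 :=
        mul_le_mul (mul_le_mul_of_nonneg_left hτ2 hC0) hτ2 (norm_nonneg _) (by linarith)
      linarith
    have e4 : (t - a) * S.φ₂ (p, t) e e ≤ T * |B| := by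
      have f1 := hS.φ₂_le hpc ht e
      rw [he1, one_pow, mul_one] at f1
      exact mul_le_mul_of_nonneg_left ((le_abs_self _).trans (f1.trans (le_abs_self B))) hta
        |>.trans (mul_le_mul_of_nonneg_right (by linarith [ht.2]) (abs_nonneg B))
    have e5 : S.u₂ (p, t) e e = D e e + S.φ₂ (p, t) e e := by simp [hD]
    rw [e5, hexp]
    linarith
  refine (Finset.sum_le_sum fun i _ => key i).trans (le_of_eq ?_)
  simp
  ring

end IsSolution

end

/-! ### Vector fields tangential to the level sets of ρ. -/

noncomputable section

open Filter Topology

lemma norm_sq_eq_sum_coord {n : ℕ} (x : Cn n) : ‖x‖ ^ 2 = ∑ i, coord i x ^ 2 := by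
  rw [EuclideanSpace.norm_sq_eq, Fintype.sum_prod_type]
  refine Finset.sum_congr rfl fun α _ => ?_
  rw [Fintype.sum_bool, Complex.sq_norm, Complex.normSq_apply]
  simp [coord]
  ring

/-- Along a varying vector the Levi form becomes polynomial in its coordinates, from which
continuity and tameness can be read off. -/
lemma levi_eq_sum {n : ℕ} (B : RealBilin n) (x : Cn n) :
    levi B x = ∑ i, ∑ j, coord i x * coord j x *
      (B (coordDir i) (coordDir j) + B (Complex.I • coordDir i) (Complex.I • coordDir j)) := by
  have h : ∀ A : Cn n →ₗ[ℝ] Cn n →ₗ[ℝ] ℝ, A x x =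
      ∑ i, ∑ j, coord i x * coord j x * A (coordDir i) (coordDir j) := fun A => by
    conv_lhs => rw [sum_coord x]
    simp only [map_sum, map_smul, LinearMap.sum_apply, LinearMap.smul_apply, smul_eq_mul,
      Finset.mul_sum]
    rw [Finset.sum_comm]
    exact Finset.sum_congr rfl fun i _ => Finset.sum_congr rfl fun j _ => by ring
  let J : Cn n →ₗ[ℝ] Cn n := LinearMap.lsmul ℂ (Cn n) Complex.I |>.restrictScalars ℝ
  let A : Cn n →ₗ[ℝ] Cn n →ₗ[ℝ] ℝ :=
    LinearMap.mk₂ ℝ (fun x y => B x y + B (Complex.I • x) (Complex.I • y))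
      (fun x x' y => by simp only [smul_add, map_add, add_apply]; ring)
      (fun c x y => by
        simp only [I_smul_real_smul, map_smul, smul_apply, smul_eq_mul]; ring)
      (fun x y y' => by simp only [smul_add, map_add]; ring)
      (fun c x y => by simp only [I_smul_real_smul, map_smul, smul_eq_mul]; ring)
  exact h A

lemma continuous_coord {n : ℕ} (i : Fin n × Bool) : Continuous (coord i : Cn n → ℝ) := by
  have : (coord i : Cn n → ℝ) = fun v => inner ℝ (coordDir i) v := funext (coord_eq_inner i)
  rw [this]
  fun_prop

/-- The `‖∇ρ‖²`-multiple of the projection of `x` to the complex tangent space of the level set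
of `ρ`. -/
def tangField {n : ℕ} (ρ : Cn n → ℝ) (x z : Cn n) : Cn n :=
  ‖nRho ρ z‖ ^ 2 • x - dRho ρ z x • nRho ρ z + dRho ρ z (Complex.I • x) • Complex.I • nRho ρ z

section TangField

variable {n : ℕ} (ρ : Cn n → ℝ) (x z : Cn n)

lemma dRho_I_smul_nRho : dRho ρ z (Complex.I • nRho ρ z) = 0 := by
  rw [dRho_smul_nRho, Complex.I_re, zero_mul]

lemma dRho_tangField : dRho ρ z (tangField ρ x z) = 0 := by
  simp only [tangField, map_add, map_sub, map_smul, dRho_nRho, dRho_I_smul_nRho, smul_eq_mul]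
  ring

lemma dRho_I_smul_tangField : dRho ρ z (Complex.I • tangField ρ x z) = 0 := by
  simp only [tangField, smul_add, smul_sub, I_smul_real_smul, I_smul_I_smul, map_add, map_sub,
    map_smul, map_neg, dRho_nRho, dRho_I_smul_nRho, smul_eq_mul]
  ring

variable {ρ x z}

lemma tangField_of_tangential (h : dRho ρ z x = 0) (h' : dRho ρ z (Complex.I • x) = 0) :
    tangField ρ x z = ‖nRho ρ z‖ ^ 2 • x := by
  simp [tangField, h, h']

lemma coord_nRho (i : Fin n × Bool) : coord i (nRho ρ z) = dRho ρ z (coordDir i) := by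
  rw [coord_eq_inner, real_inner_comm, inner_nRho]

lemma coord_I_smul_nRho (i : Fin n × Bool) :
    coord i (Complex.I • nRho ρ z) = -dRho ρ z (Complex.I • coordDir i) := by
  rw [coord_eq_inner, ← inner_nRho, real_inner_comm (Complex.I • coordDir i)]
  have h := inner_I_smul_I_smul (coordDir i : Cn n) (Complex.I • nRho ρ z)
  rw [I_smul_I_smul, inner_neg_right] at h
  exact h.symm

lemma norm_nRho_sq : ‖nRho ρ z‖ ^ 2 = ∑ i, dRho ρ z (coordDir i) * dRho ρ z (coordDir i) := by
  rw [norm_sq_eq_sum_coord]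
  exact Finset.sum_congr rfl fun i _ => by rw [coord_nRho, pow_two]

/-- The coordinates are polynomial in the first derivatives of ρ. No division by ‖∇ρ‖ occurs, so the
field is tame on all of W even where the gradient vanishes. -/
lemma coord_tangField (i : Fin n × Bool) : coord i (tangField ρ x z) =
    coord i x * (∑ j, dRho ρ z (coordDir j) * dRho ρ z (coordDir j))
      + (-1 * (dRho ρ z x * dRho ρ z (coordDir i))
      + -1 * (dRho ρ z (Complex.I • x) * dRho ρ z (Complex.I • coordDir i))) := by
  have h : ∀ v w : Cn n, coord i (v + w) = coord i v + coord i w := fun v w => by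
    simp only [coord_eq_inner, inner_add_right]
  have h' : ∀ v w : Cn n, coord i (v - w) = coord i v - coord i w := fun v w => by
    simp only [coord_eq_inner, inner_sub_right]
  have h'' : ∀ (c : ℝ) (v : Cn n), coord i (c • v) = c * coord i v := fun c v => by
    simp only [coord_eq_inner, real_inner_smul_right]
  rw [tangField, h, h', h'', h'', h'', coord_nRho, coord_I_smul_nRho, norm_nRho_sq]
  ring

end TangField

namespace Tame

variable {n : ℕ} {Q : Set (Cn n × ℝ)} {C : ℝ} {g : Cn n × ℝ → ℝ}

lemma dx_of_coord (hQ : IsOpen Q) (hg : ∀ i, Tame Q C (dx (coordDir i) g)) (hC : 0 ≤ C) {v : Cn n}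
    (hv : ‖v‖ ≤ 1) : Tame Q (∑ _i : Fin n × Bool, C) (dx v g) := by
  have h : Tame Q (∑ i : Fin n × Bool, |coord i v| * C)
      (fun q => ∑ i : Fin n × Bool, coord i v * dx (coordDir i) g q) :=
    Tame.sum hQ _ fun i _ => (hg i).const_mul hQ _
  refine (h.congr hQ fun q _ => (dx_eq_sum v g q).symm).mono (Finset.sum_le_sum fun i _ => ?_)
  exact mul_le_of_le_one_left hC ((abs_coord_le i v).trans hv)

lemma hess_of_coord (hQ : IsOpen Q) (hs : ContDiffOn ℝ ∞ g Q)
    (hg : ∀ i j, Tame Q C (dx (coordDir i) (dx (coordDir j) g))) (hC : 0 ≤ C) {v w : Cn n}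
    (hv : ‖v‖ ≤ 1) (hw : ‖w‖ ≤ 1) :
    Tame Q (∑ _i : Fin n × Bool, ∑ _j : Fin n × Bool, C) (fun q => hessForm g q v w) := by
  have h : Tame Q (∑ i : Fin n × Bool, ∑ j : Fin n × Bool, |coord i v * coord j w| * C)
      (fun q => ∑ i : Fin n × Bool, ∑ j : Fin n × Bool,
        coord i v * coord j w * dx (coordDir i) (dx (coordDir j) g) q) :=
    Tame.sum hQ _ fun i _ => Tame.sum hQ _ fun j _ => (hg i j).const_mul hQ _
  refine (h.congr hQ fun q hq => ?_).mono
    (Finset.sum_le_sum fun i _ => Finset.sum_le_sum fun j _ => ?_)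
  · show _ = hessForm g q v w
    rw [hessForm_eq_sum]
    exact Finset.sum_congr rfl fun i _ => Finset.sum_congr rfl fun j _ => by
      rw [hessForm_apply (hs.contDiffAt_two hQ hq)]
  · refine mul_le_of_le_one_left hC ?_
    rw [abs_mul]
    exact mul_le_one₀ ((abs_coord_le i v).trans hv) (abs_nonneg _) ((abs_coord_le j w).trans hw)

/-- The Levi form of a tame function along a tame vector field. -/
lemma levi_field (hQ : IsOpen Q) (hs : ContDiffOn ℝ ∞ g Q)
    (hg : ∀ i j, Tame Q C (dx (coordDir i) (dx (coordDir j) g))) (hC : 0 ≤ C) {Cx : ℝ}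
    {X : Cn n × ℝ → Cn n} (hX : ∀ i, Tame Q Cx (fun q => coord i (X q))) :
    Tame Q (∑ _i : Fin n × Bool, ∑ _j : Fin n × Bool, 4 * (4 * (Cx * Cx) *
      ((∑ _i : Fin n × Bool, ∑ _j : Fin n × Bool, C) +
        ∑ _i : Fin n × Bool, ∑ _j : Fin n × Bool, C))) (fun q => levi (hessForm g q) (X q)) := by
  have h1 : ∀ i : Fin n × Bool, ‖(coordDir i : Cn n)‖ ≤ 1 := fun i => (norm_coordDir i).le
  have h2 : ∀ i : Fin n × Bool, ‖Complex.I • (coordDir i : Cn n)‖ ≤ 1 := fun i => by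
    rw [norm_I_smul]; exact h1 i
  refine Tame.congr hQ (Tame.sum hQ Finset.univ fun i _ => Tame.sum hQ Finset.univ fun j _ =>
    ((hX i).mul hQ (hX j)).mul hQ ((hess_of_coord hQ hs hg hC (h1 i) (h1 j)).add hQ
      (hess_of_coord hQ hs hg hC (h2 i) (h2 j)))) fun q _ => ?_
  exact (levi_eq_sum _ _).symm

lemma exists_pow {Cg : ℝ} (hQ : IsOpen Q) (hg : Tame Q Cg g) (m : ℕ) :
    ∃ C, Tame Q C (fun q => g q ^ m) := by
  induction m with
  | zero => exact ⟨1, by simpa using Tame.const (Q := Q) (1 : ℝ) (by simp)⟩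
  | succ m ih =>
    obtain ⟨C, hC⟩ := ih
    exact ⟨_, by simpa only [pow_succ] using hC.mul hQ hg⟩

lemma shift {T : ℝ} {Ω : Set (Cn n)} {a : ℝ} (ha : a ∈ Icc 0 T) :
    Tame (Ω ×ˢ Ioo 0 T) (T + 1) (fun q => q.2 - a) where
  smooth := (contDiff_snd.sub contDiff_const).contDiffOn
  bound := fun q hq => by
    rw [abs_le]; constructor <;> linarith [hq.2.1, hq.2.2, ha.1, ha.2]
  dt_bound := fun q _ => by
    rw [dirDeriv_shift, abs_one]; linarith [ha.1.trans ha.2]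
  dx_bound := fun q _ v => by
    rw [dirDeriv_shift, abs_zero]
    exact mul_nonneg (by linarith [ha.1.trans ha.2]) (norm_nonneg _)
  hess_bound := fun q _ v => by
    have : dx v (fun q : Cn n × ℝ => q.2 - a) = fun _ => 0 := funext fun _ => dirDeriv_shift a v 0
    rw [this, dirDeriv_const, abs_zero]
    exact mul_nonneg (by linarith [ha.1.trans ha.2]) (sq_nonneg _)

end Tame

namespace Geometry

variable {n : ℕ} {Ω W : Set (Cn n)} {ρ : Cn n → ℝ} {r R κ C₀ : ℝ}

lemma isOpen_cyl (hG : Geometry Ω W ρ r R κ C₀) : IsOpen (W ×ˢ (univ : Set ℝ)) :=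
  hG.isOpen_nbhd.prod isOpen_univ

lemma exists_tame_dRho (hG : Geometry Ω W ρ r R κ C₀) : ∃ C, 0 ≤ C ∧ ∀ v : Cn n, ‖v‖ ≤ 1 →
    Tame (W ×ˢ univ) C (fun q => dRho ρ q.1 v) := by
  have hC₀ := hG.C₀_nonneg
  refine ⟨∑ _i : Fin n × Bool, C₀, Finset.sum_nonneg fun _ _ => hC₀, fun v hv => ?_⟩
  refine (Tame.dx_of_coord hG.isOpen_cyl (g := liftFn ρ)
    (fun i => hG.tame [i] (by simp)) hC₀ hv).congr hG.isOpen_cyl fun q hq => ?_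
  show dx v (liftFn ρ) q = dRho ρ q.1 v
  rw [← hG.gradForm_eq hq.1 q.2, gradForm_apply]

lemma exists_tame_tangField (hG : Geometry Ω W ρ r R κ C₀) : ∃ C, 0 ≤ C ∧ ∀ x : Cn n, ‖x‖ ≤ 1 →
    ∀ i, Tame (W ×ˢ univ) C (fun q => coord i (tangField ρ x q.1)) := by
  obtain ⟨C, hC0, hC⟩ := hG.exists_tame_dRho
  have hO := hG.isOpen_cyl
  have hs0 : (0 : ℝ) ≤ ∑ _j : Fin n × Bool, 4 * (C * C) :=
    Finset.sum_nonneg fun _ _ => mul_nonneg (by norm_num) (mul_nonneg hC0 hC0)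
  refine ⟨(∑ _j : Fin n × Bool, 4 * (C * C)) + (|(-1 : ℝ)| * (4 * (C * C)) +
    |(-1 : ℝ)| * (4 * (C * C))), add_nonneg hs0 (by positivity), fun x hx i => ?_⟩
  have h1 : ∀ i : Fin n × Bool, ‖(coordDir i : Cn n)‖ ≤ 1 := fun i => (norm_coordDir i).le
  have h2 : ∀ v : Cn n, ‖v‖ ≤ 1 → ‖Complex.I • v‖ ≤ 1 := fun v hv => by rwa [norm_I_smul]
  have t1 : Tame (W ×ˢ univ) (∑ _j : Fin n × Bool, 4 * (C * C))
      (fun q => coord i x * ∑ j, dRho ρ q.1 (coordDir j) * dRho ρ q.1 (coordDir j)) := by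
    refine ((Tame.sum hO Finset.univ fun j _ =>
      (hC _ (h1 j)).mul hO (hC _ (h1 j))).const_mul hO (coord i x)).mono ?_
    exact mul_le_of_le_one_left hs0 ((abs_coord_le i x).trans hx)
  refine (t1.add hO ((((hC x hx).mul hO (hC _ (h1 i))).const_mul hO (-1)).add hO
    (((hC _ (h2 x hx)).mul hO (hC _ (h2 _ (h1 i)))).const_mul hO (-1)))).congr hO fun q _ => ?_
  exact (coord_tangField i).symm

lemma continuousOn_dRho (hG : Geometry Ω W ρ r R κ C₀) (v : Cn n) :
    ContinuousOn (fun z => dRho ρ z v) (closure Ω) := by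
  obtain ⟨C, -, hC⟩ := hG.exists_dRho_taylor
  refine fun p hp => tendsto_iff_norm_sub_tendsto_zero.mpr ?_
  have h : Tendsto (fun z => C * ‖z - p‖ * ‖v‖) (𝓝[closure Ω] p) (𝓝 (C * ‖p - p‖ * ‖v‖)) := by
    refine Tendsto.mono_left ?_ nhdsWithin_le_nhds
    exact ((continuous_const.mul (continuous_id.sub continuous_const).norm).mul
      continuous_const).tendsto p
  rw [sub_self, norm_zero, mul_zero, zero_mul] at h
  refine squeeze_zero' (Eventually.of_forall fun _ => norm_nonneg _) ?_ h
  filter_upwards [self_mem_nhdsWithin] with z hz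
  exact (hC p hp z hz v).1

lemma continuousOn_coord_tangField (hG : Geometry Ω W ρ r R κ C₀) (x : Cn n) (i : Fin n × Bool) :
    ContinuousOn (fun z => coord i (tangField ρ x z)) (closure Ω) := by
  simp only [coord_tangField]
  have h := hG.continuousOn_dRho
  exact (continuousOn_const.mul (continuousOn_finsetSum _ fun j _ => (h _).mul (h _))).add
    ((continuousOn_const.mul ((h _).mul (h _))).add (continuousOn_const.mul ((h _).mul (h _))))

/-- A tame function which is continuous up to the boundary is Lipschitz along inward segments. -/
lemma eventually_abs_sub_le (hG : Geometry Ω W ρ r R κ C₀) {p : Cn n} (hp : p ∈ frontier Ω)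
    {v : Cn n} (hv : dRho ρ p v < 0) {T C : ℝ} {g : Cn n × ℝ → ℝ} (hg : Tame (Ω ×ˢ Ioo 0 T) C g)
    (hc : ContinuousOn g (closure Ω ×ˢ Ioo 0 T)) {t : ℝ} (ht : t ∈ Ioo 0 T) :
    ∀ᶠ s : ℝ in 𝓝[>] 0, |g (p + s • v, t) - g (p, t)| ≤ C * ‖s • v‖ := by
  have hv' : gradForm (liftFn ρ) (p, t) v < 0 := by
    rwa [hG.gradForm_eq (hG.closure_subset (frontier_subset_closure hp))]
  obtain ⟨s₀, hs₀, hsub⟩ := mem_nhdsGT_iff_exists_Ioo_subset.mp (hG.eventually_mem hp hv')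
  have hO : IsOpen (Ω ×ˢ Ioo 0 T) := hG.isOpen.prod isOpen_Ioo
  filter_upwards [Ioo_mem_nhdsGT hs₀] with s hs
  have hmem : ∀ x ∈ Ioc 0 s, p + x • v ∈ Ω := fun x hx => hsub ⟨hx.1, hx.2.trans_lt hs.2⟩
  have hcont : ContinuousOn (fun x : ℝ => g (p + x • v, t)) (Icc 0 s) := by
    refine hc.comp (Continuous.continuousOn (by fun_prop)) fun x hx => ⟨?_, ht⟩
    rcases eq_or_lt_of_le hx.1 with h | h
    · simpa [← h] using frontier_subset_closure hp
    · exact subset_closure (hmem x ⟨h, hx.2⟩)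
  have hder : ∀ x ∈ Ioo 0 s, HasDerivAt (fun x : ℝ => g (p + x • v, t))
      (dx v g (p + x • v, t)) x := fun x hx => by
    have hq : (p + x • v, t) ∈ Ω ×ˢ Ioo 0 T := ⟨hmem x ⟨hx.1, hx.2.le⟩, ht⟩
    have e : (p, t) + x • (v, (0 : ℝ)) = (p + x • v, t) := by simp
    have := _root_.hasDerivAt_line (g := g) (q := (p, t)) (v := (v, (0 : ℝ))) (s := x)
      (by rw [e]; exact (hg.smooth.contDiffAt_two hO hq).differentiableAt (by simp))
    rw [e] at this
    refine this.congr_of_eventuallyEq (Eventually.of_forall fun y => ?_)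
    simp
  obtain ⟨x, hx, hxe⟩ := exists_hasDerivAt_eq_slope _ _ hs.1 hcont hder
  have hb := hg.dx_bound (p + x • v, t) ⟨hmem x ⟨hx.1, hx.2.le⟩, ht⟩ v
  rw [sub_zero, zero_smul, add_zero, eq_div_iff hs.1.ne'] at hxe
  rw [← hxe, abs_mul, norm_smul, Real.norm_eq_abs, mul_comm, mul_left_comm]
  exact mul_le_mul_of_nonneg_left hb (abs_nonneg s)

end Geometry

end

/-! ### The normal second derivative where the tangential Levi form is minimal. -/

noncomputable section

open Filter Topology

namespace Geometry

variable {n : ℕ} {Ω W : Set (Cn n)} {ρ : Cn n → ℝ} {r R κ C₀ : ℝ}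

/-- An affine holomorphic field whose `ρ`-derivative agrees to second order with the Levi form of
`ρ` along a tangential field. -/
lemma exists_field_levi (hG : Geometry Ω W ρ r R κ C₀) : ∃ N K, 0 ≤ N ∧ 0 ≤ K ∧
    ∀ p ∈ frontier Ω, ∀ x : Cn n, ‖x‖ ≤ 1 → ∃ M : Cn n →L[ℂ] Cn n, ‖M‖ ≤ N ∧
      ‖(levi (hRho ρ p) (tangField ρ x p) / ‖nRho ρ p‖ ^ 2) • nRho ρ p‖ ≤ N ∧
      ∀ z ∈ closure Ω, |dRho ρ z ((levi (hRho ρ p) (tangField ρ x p) / ‖nRho ρ p‖ ^ 2) • nRho ρ p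
        + M (z - p)) - levi (hRho ρ z) (tangField ρ x z)| ≤ K * ‖z - p‖ ^ 2 := by
  obtain ⟨Cx, -, hCx⟩ := hG.exists_tame_tangField
  obtain ⟨Cf, hCf0, hCf⟩ := hG.exists_field
  have hC₀ := hG.C₀_nonneg
  have hO := hG.isOpen_cyl
  have hκ := hG.κ_pos
  have hr := hG.r_pos
  have htame := fun (x : Cn n) (hx : ‖x‖ ≤ 1) => Tame.levi_field hO
    (liftFn_contDiffOn hG.smooth) (fun i j => hG.tame [i, j] (by simp)) hC₀
    (X := fun q => tangField ρ x q.1) (hCx x hx)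
  set C := ∑ _i : Fin n × Bool, ∑ _j : Fin n × Bool, 4 * (4 * (Cx * Cx) *
      ((∑ _i : Fin n × Bool, ∑ _j : Fin n × Bool, C₀) +
        ∑ _i : Fin n × Bool, ∑ _j : Fin n × Bool, C₀)) with hC
  have hC0 : 0 ≤ C := by
    obtain ⟨z, hz⟩ := hG.nonempty
    exact (htame 0 (by simp)).nonneg ⟨(z, 0), hG.closure_subset (subset_closure hz), mem_univ _⟩
  refine ⟨Cf * (C + C / κ) + C / κ, Cf * (C + C / κ) + C * (1 + 2 / r + 2 / r ^ 2),
    by positivity, by positivity, ?_⟩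
  intro p hp x hx
  have hpc := frontier_subset_closure hp
  have hpW := hG.closure_subset hpc
  have hν : 0 < ‖nRho ρ p‖ := hκ.trans_le (hG.le_norm_nRho hp)
  have ht := htame x hx
  set θ : Cn n × ℝ → ℝ := fun q => levi (hessForm (liftFn ρ) q) (tangField ρ x q.1) with hθ
  have hθp : |θ (p, 0)| ≤ C := ht.bound (p, 0) ⟨hpW, mem_univ _⟩
  -- Y is the multiple of the gradient whose ρ-derivative at p is the Levi form of ρ along the
  -- tangential field; M then matches the first order variation l of that quantity.
  set Y := (levi (hRho ρ p) (tangField ρ x p) / ‖nRho ρ p‖ ^ 2) • nRho ρ p with hY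
  have hθ0 : levi (hRho ρ p) (tangField ρ x p) = θ (p, 0) := rfl
  have hYn : ‖Y‖ ≤ C / κ := by
    rw [hY, hθ0, norm_smul, Real.norm_eq_abs, abs_div, abs_of_pos (pow_pos hν 2),
      div_mul_eq_mul_div, pow_two, mul_div_mul_right _ _ hν.ne']
    exact div_le_div₀ hC0 hθp hκ (hG.le_norm_nRho hp)
  have hYd : dRho ρ p Y = θ (p, 0) := by
    rw [hY, map_smul, dRho_nRho, smul_eq_mul, hθ0, div_mul_cancel₀ _ (pow_pos hν 2).ne']
  set l := gradForm θ (p, 0) with hl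
  have hln : ‖l‖ ≤ C := ContinuousLinearMap.opNorm_le_bound _ hC0 fun v => by
    rw [hl, gradForm_apply]; exact ht.dx_bound (p, 0) ⟨hpW, mem_univ _⟩ v
  obtain ⟨M, hM, -, hM2⟩ := hCf p hp Y l
  have hsum : Cf * (‖l‖ + ‖Y‖) ≤ Cf * (C + C / κ) :=
    mul_le_mul_of_nonneg_left (add_le_add hln hYn) hCf0
  have hCκ : 0 ≤ C / κ := div_nonneg hC0 hκ.le
  refine ⟨M, by linarith, ?_, fun z hz => ?_⟩
  · have : 0 ≤ Cf * (C + C / κ) := mul_nonneg hCf0 (by linarith)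
    linarith
  have h1 := hM2 z hz
  have h2 := (Tame.taylor hG ht hpc hz).2
  rw [← gradForm_apply, ← hl] at h2
  rw [hYd] at h1
  have h3 := mul_le_mul_of_nonneg_right hsum (sq_nonneg ‖z - p‖)
  have e : dRho ρ z (Y + M (z - p)) - levi (hRho ρ z) (tangField ρ x z) =
      (dRho ρ z (Y + M (z - p)) - (θ (p, 0) + l (z - p)))
        - (θ (z, 0) - θ (p, 0) - l (z - p)) := by
    have : levi (hRho ρ z) (tangField ρ x z) = θ (z, 0) := rfl
    rw [this]; ring
  rw [e]
  refine (abs_sub _ _).trans ?_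
  rw [add_mul]
  linarith

end Geometry

/-- The boundary datum attached to a lower bound `μ (t - a)ⁿ` of the tangential Levi form. -/
def leviGap {n : ℕ} (S : SolData n) (ρ : Cn n → ℝ) (a μ : ℝ) (x : Cn n) (q : Cn n × ℝ) : ℝ :=
  levi (S.φ₂ q) (tangField ρ x q.1) - μ * (q.2 - a) ^ n * ‖tangField ρ x q.1‖ ^ 2

namespace IsSolution

variable {n : ℕ} {Ω W : Set (Cn n)} {ρ : Cn n → ℝ} {r R κ C₀ T Cu B F : ℝ} {S : SolData n}

lemma continuousOn_leviGap (hS : IsSolution Ω T Cu B F S) (hG : Geometry Ω W ρ r R κ C₀)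
    (a μ : ℝ) (x : Cn n) : ContinuousOn (leviGap S ρ a μ x) (closure Ω ×ˢ Ioo 0 T) := by
  have hc : ∀ i, ContinuousOn (fun q : Cn n × ℝ => coord i (tangField ρ x q.1))
      (closure Ω ×ˢ Ioo 0 T) := fun i =>
    (hG.continuousOn_coord_tangField x i).comp continuousOn_fst fun q hq => hq.1
  unfold leviGap
  simp only [levi_eq_sum, norm_sq_eq_sum_coord]
  refine ContinuousOn.sub ?_ (ContinuousOn.mul (by fun_prop) ?_)
  · exact continuousOn_finsetSum _ fun i _ => continuousOn_finsetSum _ fun j _ =>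
      ((hc i).mul (hc j)).mul ((hS.c2_φ.cont₂ _ _).add (hS.c2_φ.cont₂ _ _))
  · exact continuousOn_finsetSum _ fun i _ => (hc i).pow 2

lemma exists_tame_leviGap (hG : Geometry Ω W ρ r R κ C₀) {a : ℝ} (ha : a ∈ Icc 0 T)
    (Cu B F : ℝ) : ∃ C, 0 ≤ C ∧ ∀ S, IsSolution Ω T Cu B F S → ∀ μ ∈ Icc (0 : ℝ) 1, ∀ x : Cn n,
      ‖x‖ ≤ 1 → Tame (Ω ×ˢ Ioo 0 T) C (leviGap S ρ a μ x) := by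
  obtain ⟨Cx, hCx0, hCx⟩ := hG.exists_tame_tangField
  have hO : IsOpen (Ω ×ˢ Ioo 0 T) := hG.isOpen.prod isOpen_Ioo
  obtain ⟨Ct, hCt⟩ := (Tame.shift (Ω := Ω) ha).exists_pow hO n
  have hsub : Ω ×ˢ Ioo 0 T ⊆ W ×ˢ univ :=
    prod_mono (subset_closure.trans hG.closure_subset) (subset_univ _)
  set C₁ := ∑ _i : Fin n × Bool, ∑ _j : Fin n × Bool, 4 * (4 * (Cx * Cx) *
      ((∑ _i : Fin n × Bool, ∑ _j : Fin n × Bool, |B|) +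
        ∑ _i : Fin n × Bool, ∑ _j : Fin n × Bool, |B|)) with hC₁
  set C₂ := 4 * (Ct * ∑ _i : Fin n × Bool, 4 * (Cx * Cx)) with hC₂
  refine ⟨|C₁| + |C₂|, by positivity, fun S hS μ hμ x hx => ?_⟩
  have hX : ∀ i, Tame (Ω ×ˢ Ioo 0 T) Cx (fun q : Cn n × ℝ => coord i (tangField ρ x q.1)) :=
    fun i => (hCx x hx i).mono_set hsub
  have hφ : ContDiffOn ℝ ∞ S.φ (Ω ×ˢ Ioo 0 T) := (hS.tame_φ [] (by simp)).smooth
  have t1 := Tame.levi_field hO hφ (fun i j => (hS.tame_φ [i, j] (by simp)).mono (le_abs_self B))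
    (abs_nonneg B) hX
  have t2 := hCt.mul hO (Tame.sum hO Finset.univ fun i _ => (hX i).mul hO (hX i))
  refine ((t1.add hO (t2.const_mul hO (-μ))).congr hO fun q hq => ?_).mono ?_
  · simp only [leviGap, hS.c2_φ.eq₂ hG.isOpen hφ hq, norm_sq_eq_sum_coord]
    simp only [pow_two]
    ring
  · refine add_le_add (le_abs_self _) ?_
    rw [abs_neg, abs_of_nonneg hμ.1]
    refine (mul_le_mul_of_nonneg_left (le_abs_self _) hμ.1).trans ?_
    exact mul_le_of_le_one_left (abs_nonneg _) hμ.2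

/-- Trudinger's bound for the second normal derivative at a point where the tangential Levi form
is minimal. -/
lemma exists_normal_le (hG : Geometry Ω W ρ r R κ C₀) (hn : 1 ≤ n) (hT : 0 < T)
    (Cu B F : ℝ) {a : ℝ} (ha : 0 < a) (haT : a ≤ T) : ∃ C, 0 ≤ C ∧ ∀ S, IsSolution Ω T Cu B F S →
      ∀ p ∈ frontier Ω, ∀ t ∈ Ioo 0 T, a < t → ∀ x, ‖x‖ = 1 → dRho ρ p x = 0 →
      dRho ρ p (Complex.I • x) = 0 → ∀ μ ∈ Icc (0 : ℝ) 1,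
      (∀ z ∈ frontier Ω, ∀ s ∈ Icc a t, ∀ y, dRho ρ z y = 0 → dRho ρ z (Complex.I • y) = 0 →
        μ * (s - a) ^ n * ‖y‖ ^ 2 ≤ levi (S.u₂ (z, s)) y) →
      levi (S.u₂ (p, t)) x = μ * (t - a) ^ n →
      (t - a) * (S.u₂ (p, t) - S.φ₂ (p, t)) (nRho ρ p) (nRho ρ p) ≤ C := by
  obtain ⟨N, K, hN0, hK0, hF⟩ := hG.exists_field_levi
  -- The Hessian identity holds only strictly after the starting time. Starting from a/2 makes it
  -- available on the whole interval [a, t].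
  obtain ⟨A, hA0, hA⟩ := exists_tangential hG hn hT Cu B F (half_pos ha)
  obtain ⟨Cg, hCg0, hCg⟩ := exists_tame_leviGap hG ⟨ha.le, haT⟩ Cu B F
  obtain ⟨A', hA'0, hA'⟩ := exists_barrier hG hn hT Cu B F ha N Cg (mul_nonneg hA0 hK0)
  have hκ := hG.κ_pos
  have hC₀ := hG.C₀_nonneg
  set C := A' * C₀ ^ 2 + T * Cg * C₀ + T * (A * (C₀ * (N * C₀))) with hC
  have hC0 : 0 ≤ C := by positivity
  refine ⟨C / κ ^ 3, by positivity, ?_⟩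
  intro S hS p hp t ht hat x hx hx1 hx2 μ hμ hmin heq
  have hpc := frontier_subset_closure hp
  have hpW := hG.closure_subset hpc
  have hν : κ ≤ ‖nRho ρ p‖ := hG.le_norm_nRho hp
  have hν0 : 0 < ‖nRho ρ p‖ := hκ.trans_le hν
  have hνC := hG.norm_nRho_le hpW
  obtain ⟨M, hM, hY, hfield⟩ := hF p hp x hx.le
  have hgt := hCg S hS μ hμ x hx.le
  have hgc := hS.continuousOn_leviGap hG a μ x
  set θp := levi (hRho ρ p) (tangField ρ x p) / ‖nRho ρ p‖ ^ 2 with hθp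
  set Y := θp • nRho ρ p with hYd
  set ν := nRho ρ p with hνd
  have hta : 0 < t - a := by linarith
  have htT : t - a ≤ T := by linarith [ht.2]
  -- On tangential vectors the Hessian of u is that of φ plus h times that of ρ, so the excess of
  -- the Levi form of u over μ(s - a)ⁿ times the squared norm splits into `leviGap`, known data, and
  -- h times the Levi form of ρ.
  have hgap : ∀ z ∈ frontier Ω, ∀ s ∈ Icc a t, ∃ h : ℝ, |h| ≤ A ∧
      (∀ v, (S.u₁ (z, s) - S.φ₁ (z, s)) v = h * dRho ρ z v) ∧
      h * levi (hRho ρ z) (tangField ρ x z) + leviGap S ρ a μ x (z, s) =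
        levi (S.u₂ (z, s)) (tangField ρ x z) - μ * (s - a) ^ n * ‖tangField ρ x z‖ ^ 2 := by
    intro z hz s hs
    obtain ⟨h, hh, hD, hD2⟩ := hA S hS z hz s ⟨ha.trans_le hs.1, hs.2.trans_lt ht.2⟩
      (by linarith [hs.1])
    refine ⟨h, hh, hD, ?_⟩
    have h2 := hD2 (by linarith [hs.1])
    have e1 := h2 _ _ (dRho_tangField ρ x z) (dRho_tangField ρ x z)
    have e2 := h2 _ _ (dRho_I_smul_tangField ρ x z) (dRho_I_smul_tangField ρ x z)
    simp only [sub_apply] at e1 e2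
    simp only [leviGap, levi]
    linarith
  -- That excess is nonnegative by assumption. The derivative of u - φ along the affine field is h
  -- dρ(Y + M(z - p)), which replaces h times the Levi form of ρ up to O(‖z - p‖²).
  have hlow : ∀ z ∈ frontier Ω, ∀ s ∈ Icc a t,
      -(A * K) * ‖z - p‖ ^ 2 ≤ fieldDiff S p Y M (z, s) + leviGap S ρ a μ x (z, s) := by
    intro z hz s hs
    obtain ⟨h, hh, hD, hg⟩ := hgap z hz s hs
    have h1 := hmin z hz s hs _ (dRho_tangField ρ x z) (dRho_I_smul_tangField ρ x z)
    have h2 := hfield z (frontier_subset_closure hz)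
    rw [fieldDiff, hD]
    have h3 : |h * (dRho ρ z (Y + M (z - p)) - levi (hRho ρ z) (tangField ρ x z))| ≤
        A * (K * ‖z - p‖ ^ 2) := by
      rw [abs_mul]; exact mul_le_mul hh h2 (abs_nonneg _) hA0
    have h4 := (_root_.abs_le.mp h3).1
    rw [mul_sub] at h4
    show _ ≤ h * dRho ρ z (Y + M (z - p)) + _
    linarith
  have hbar := hA' S hS p hpc Y M hY hM _ hgt hgc t ht hat.le hlow
  obtain ⟨h, hh, hD, hg⟩ := hgap p hp t ⟨hat.le, le_rfl⟩
  have htan : tangField ρ x p = ‖ν‖ ^ 2 • x := tangField_of_tangential hx1 hx2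
  have hYp : dRho ρ p Y = levi (hRho ρ p) (tangField ρ x p) := by
    rw [hYd, map_smul, dRho_nRho, smul_eq_mul, hθp, div_mul_cancel₀ _ (pow_pos hν0 2).ne']
  -- At (p, t) the excess is zero by `heq`, so the lower barrier touches and bounds a one-sided
  -- normal derivative.
  have hzero : fieldDiff S p Y M (p, t) + leviGap S ρ a μ x (p, t) = 0 := by
    have e : fieldDiff S p Y M (p, t) = h * levi (hRho ρ p) (tangField ρ x p) := by
      rw [fieldDiff, sub_self, map_zero, add_zero, hD, hYp]
    rw [e, hg, htan, levi_real_smul, norm_smul, heq, hx, Real.norm_eq_abs,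
      abs_of_nonneg (sq_nonneg ‖ν‖)]
    ring
  obtain ⟨L, hL, hLv⟩ := hS.hasFDerivWithinAt_fieldDiff hpc Y M ht (-(t - a))
  have hin : gradForm (liftFn ρ) (p, t) (-ν) < 0 := by
    rw [hG.gradForm_eq hpW, map_neg, hνd, dRho_nRho, ← hνd]
    exact neg_neg_of_pos (pow_pos hν0 2)
  have hin' : dRho ρ p (-ν) < 0 := by rwa [hG.gradForm_eq hpW] at hin
  -- The direction is -ν, which points inward. `leviGap` is tame but no derivative of it at the
  -- boundary is used, only its Lipschitz bound along the ray, which is the B-term of the barrier.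
  have hfin := hG.deriv_le_of_barrier hp hL (K := T * (A * K)) (A := A') (B := T * Cg) hin (by
    filter_upwards [hG.eventually_mem hp hin, hG.eventually_abs_sub_le hp hin' hgt hgc ht]
      with s hs hlip
    have b := hbar _ (subset_closure hs)
    have e : p + s • -ν - p = s • -ν := by abel
    rw [e] at b
    have l1 := (le_abs_self _).trans hlip
    have l2 : (t - a) * (leviGap S ρ a μ x (p + s • -ν, t) - leviGap S ρ a μ x (p, t)) ≤
        T * (Cg * ‖s • -ν‖) :=
      (mul_le_mul_of_nonneg_left l1 hta.le).trans
        (mul_le_mul_of_nonneg_right htT (mul_nonneg hCg0 (norm_nonneg _)))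
    have e2 : fieldDiff S p Y M (p, t) = -leviGap S ρ a μ x (p, t) := by linarith
    rw [e2]
    linarith)
  rw [hLv, hG.gradForm_eq hpW, map_neg, map_neg, map_neg, neg_apply, hD, norm_neg,
    map_neg (dRho ρ p), hνd, dRho_nRho, ← hνd] at hfin
  set D := S.u₂ (p, t) - S.φ₂ (p, t) with hDd
  have hDY : D ν Y = θp * D ν ν := by rw [hYd, map_smul, smul_eq_mul]
  rw [hDY] at hfin
  have hMν : |h * dRho ρ p (M ν)| ≤ A * (C₀ * (N * C₀)) := by
    rw [abs_mul]
    refine mul_le_mul hh ?_ (abs_nonneg _) hA0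
    refine (hG.abs_dRho_le hpW _).trans (mul_le_mul_of_nonneg_left ?_ hC₀)
    exact (M.le_opNorm ν).trans (mul_le_mul hM hνC (norm_nonneg _) hN0)
  have f1 : (t - a) * |h * dRho ρ p (M ν)| ≤ T * (A * (C₀ * (N * C₀))) :=
    mul_le_mul htT hMν (abs_nonneg _) hT.le
  have f2 : -((t - a) * (h * dRho ρ p (M ν))) ≤ (t - a) * |h * dRho ρ p (M ν)| := by
    rw [← mul_neg]; exact mul_le_mul_of_nonneg_left (neg_le_abs _) hta.le
  have f3 : A' * ‖ν‖ ^ 2 ≤ A' * C₀ ^ 2 :=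
    mul_le_mul_of_nonneg_left (pow_le_pow_left₀ hν0.le hνC 2) hA'0
  have f4 : T * Cg * ‖ν‖ ≤ T * Cg * C₀ :=
    mul_le_mul_of_nonneg_left hνC (mul_nonneg hT.le hCg0)
  have f5 : θp * ((t - a) * D ν ν) ≤ C := by
    have : θp * ((t - a) * D ν ν) + (t - a) * (h * dRho ρ p (M ν)) ≤
        A' * ‖ν‖ ^ 2 + T * Cg * ‖ν‖ := by linarith
    linarith
  -- The derivative just bounded contains θp D(ν, ν). Strict plurisubharmonicity of ρ and the lower
  -- bound of its gradient keep θp away from zero, so D(ν, ν) is bounded above.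
  have f6 : κ ^ 3 ≤ θp := by
    have g1 := hG.levi_hRho_ge hpc (tangField ρ x p)
    rw [hθp, le_div_iff₀ (pow_pos hν0 2)]
    refine le_trans ?_ g1
    rw [htan, norm_smul, hx, mul_one, Real.norm_eq_abs, abs_of_nonneg (sq_nonneg _)]
    have g2 : κ ^ 2 * ‖ν‖ ^ 2 ≤ (‖ν‖ ^ 2) ^ 2 := by
      rw [pow_two (‖ν‖ ^ 2)]
      exact mul_le_mul_of_nonneg_right (pow_le_pow_left₀ hκ.le hν 2) (sq_nonneg _)
    calc κ ^ 3 * ‖ν‖ ^ 2 = κ * (κ ^ 2 * ‖ν‖ ^ 2) := by ring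
      _ ≤ _ := mul_le_mul_of_nonneg_left g2 hκ.le
  rw [le_div_iff₀ (pow_pos hκ 3)]
  rcases le_total 0 ((t - a) * D ν ν) with h0 | h0
  · rw [mul_comm]
    exact (mul_le_mul_of_nonneg_right f6 h0).trans f5
  · exact (mul_nonpos_of_nonpos_of_nonneg h0 (pow_pos hκ 3).le).trans hC0

end IsSolution

end

/-! ### Lower bound of the Levi form in complex tangential directions. -/

noncomputable section

open Filter Topology

namespace Geometry

variable {n : ℕ} {Ω W : Set (Cn n)} {ρ : Cn n → ℝ} {r R κ C₀ : ℝ}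

lemma continuousOn_dRho_apply (hG : Geometry Ω W ρ r R κ C₀) {X : Type*} [TopologicalSpace X]
    {K : Set X} {f g : X → Cn n} (hf : ContinuousOn f K) (hfK : MapsTo f K (closure Ω))
    (hg : ContinuousOn g K) : ContinuousOn (fun q => dRho ρ (f q) (g q)) K := by
  have : (fun q => dRho ρ (f q) (g q)) =
      fun q => ∑ i : Fin n × Bool, coord i (g q) * dRho ρ (f q) (coordDir i) := by
    ext q
    conv_lhs => rw [sum_coord (g q)]
    simp only [map_sum, map_smul, smul_eq_mul]
  rw [this]
  exact continuousOn_finsetSum _ fun i _ => ((continuous_coord i).comp_continuousOn hg).mul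
    ((hG.continuousOn_dRho _).comp hf hfK)

end Geometry

/-- Pairs of a boundary point and a unit complex tangent vector, over a time interval. -/
def unitTangent {n : ℕ} (Ω : Set (Cn n)) (ρ : Cn n → ℝ) (a b : ℝ) : Set ((Cn n × ℝ) × Cn n) :=
  {q | q ∈ (frontier Ω ×ˢ Icc a b) ×ˢ Metric.sphere (0 : Cn n) 1 ∧
    dRho ρ q.1.1 q.2 = 0 ∧ dRho ρ q.1.1 (Complex.I • q.2) = 0}

lemma isCompact_unitTangent {n : ℕ} {Ω W : Set (Cn n)} {ρ : Cn n → ℝ} {r R κ C₀ : ℝ}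
    (hG : Geometry Ω W ρ r R κ C₀) (a b : ℝ) : IsCompact (unitTangent Ω ρ a b) := by
  have hK : IsCompact ((frontier Ω ×ˢ Icc a b) ×ˢ Metric.sphere (0 : Cn n) 1) :=
    (hG.isCompact_frontier.prod isCompact_Icc).prod (isCompact_sphere 0 1)
  refine hK.of_isClosed_subset ?_ fun q hq => hq.1
  have hm : MapsTo (fun q : (Cn n × ℝ) × Cn n => q.1.1)
      ((frontier Ω ×ˢ Icc a b) ×ˢ Metric.sphere (0 : Cn n) 1) (closure Ω) :=
    fun q hq => frontier_subset_closure hq.1.1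
  have c1 := hG.continuousOn_dRho_apply (g := fun q => q.2) (by fun_prop) hm (by fun_prop)
  have c2 := hG.continuousOn_dRho_apply (g := fun q => Complex.I • q.2) (by fun_prop) hm
    (by fun_prop)
  have h1 := c1.preimage_isClosed_of_isClosed hK.isClosed (isClosed_singleton (x := (0 : ℝ)))
  have h2 := c2.preimage_isClosed_of_isClosed hK.isClosed (isClosed_singleton (x := (0 : ℝ)))
  convert h1.inter h2 using 1
  ext q
  simp only [unitTangent, mem_ofPred_eq, mem_inter_iff, mem_preimage, mem_singleton_iff]
  tauto

namespace IsSolution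

variable {n : ℕ} {Ω W : Set (Cn n)} {ρ : Cn n → ℝ} {r R κ C₀ T Cu B F : ℝ} {S : SolData n}

/-- The lower bound of the Levi form in the complex tangential directions. -/
lemma exists_le_levi_tangential (hG : Geometry Ω W ρ r R κ C₀) (hn : 1 ≤ n) (hT : 0 < T)
    (Cu B F : ℝ) {a : ℝ} (ha : 0 < a) : ∃ c, 0 < c ∧ ∀ S, IsSolution Ω T Cu B F S →
      ∀ z ∈ frontier Ω, ∀ t ∈ Ioo 0 T, a ≤ t → ∀ y, dRho ρ z y = 0 →
      dRho ρ z (Complex.I • y) = 0 → c * (t - a) ^ n * ‖y‖ ^ 2 ≤ levi (S.u₂ (z, t)) y := by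
  -- For a > T there is no admissible time.
  rcases lt_or_ge T a with haT | haT
  · exact ⟨1, one_pos, fun S hS z hz t ht hat => by linarith [ht.2]⟩
  obtain ⟨K, hK0, hK⟩ := exists_det_bounds hG hn hT Cu B F ha
  obtain ⟨C, hC0, hC⟩ := exists_normal_le hG hn hT Cu B F ha haT
  obtain ⟨Λ, hΛ0, hΛ⟩ := exists_trace_le_of_normal hG hn hT Cu B F ha hC0
  set m₀ := max 1 (Real.exp K * (T * Λ ^ (n - 1))) with hm₀
  have hm₀1 : 1 ≤ m₀ := le_max_left _ _
  have hm₀0 : 0 < m₀ := one_pos.trans_le hm₀1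
  refine ⟨1 / m₀, one_div_pos.mpr hm₀0, ?_⟩
  intro S hS z hz t ht hat y hy hy'
  rcases eq_or_ne y 0 with rfl | hy0
  · simp [levi]
  have hyn : 0 < ‖y‖ := norm_pos_iff.mpr hy0
  have hpos : ∀ q ∈ unitTangent Ω ρ a t, 0 < levi (S.u₂ q.1) q.2 := by
    rintro ⟨⟨p, s⟩, x⟩ ⟨⟨⟨hp, hs⟩, hx⟩, -⟩
    have hsI : s ∈ Ioo 0 T := ⟨ha.trans_le hs.1, hs.2.trans_lt ht.2⟩
    have hpc := frontier_subset_closure hp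
    refine (leviMatrix_posDef_iff (hS.symm_u₂ hpc hsI)).mp (hK S hS p hpc s hsI hs.1).1 x ?_
    rintro rfl
    simp at hx
  have hcl : ContinuousOn (fun q : (Cn n × ℝ) × Cn n => levi (S.u₂ q.1) q.2)
      (unitTangent Ω ρ a t) := by
    simp only [levi_eq_sum]
    have hm : MapsTo (fun q : (Cn n × ℝ) × Cn n => q.1) (unitTangent Ω ρ a t)
        (closure Ω ×ˢ Ioo 0 T) := fun q hq => ⟨frontier_subset_closure hq.1.1.1,
      ha.trans_le hq.1.1.2.1, hq.1.1.2.2.trans_lt ht.2⟩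
    have hcc : ∀ i, ContinuousOn (fun q : (Cn n × ℝ) × Cn n => coord i q.2)
        (unitTangent Ω ρ a t) := fun i =>
      ((continuous_coord i).comp continuous_snd).continuousOn
    exact continuousOn_finsetSum _ fun i _ => continuousOn_finsetSum _ fun j _ =>
      ((hcc i).mul (hcc j)).mul
        (((hS.c2.cont₂ _ _).add (hS.c2.cont₂ _ _)).comp continuousOn_fst hm)
  have hcΦ : ContinuousOn (fun q : (Cn n × ℝ) × Cn n => (q.1.2 - a) ^ n / levi (S.u₂ q.1) q.2)
      (unitTangent Ω ρ a t) :=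
    ContinuousOn.div (by fun_prop) hcl fun q hq => (hpos q hq).ne'
  have hymem : ((z, t), ‖y‖⁻¹ • y) ∈ unitTangent Ω ρ a t := by
    refine ⟨⟨⟨hz, hat, le_rfl⟩, ?_⟩, ?_, ?_⟩
    · simp [norm_smul, hyn.ne']
    · simp [hy]
    · rw [I_smul_real_smul, map_smul, hy', smul_zero]
  -- The quotient (s - a)ⁿ / levi is continuous up to s = a, where it vanishes because n ≥ 1. Its
  -- maximum over unit tangent vectors gives the minimal weighted Levi form required by
  -- `exists_normal_le`.
  obtain ⟨⟨⟨p, s⟩, x⟩, hq, hmax⟩ := (isCompact_unitTangent hG a t).exists_isMaxOn ⟨_, hymem⟩ hcΦ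
  have hqpos := hpos _ hq
  obtain ⟨⟨⟨hp, hs⟩, hx⟩, hx1, hx2⟩ := hq
  simp only [mem_sphere_zero_iff_norm] at hx hp hs hx1 hx2 hqpos
  have hmax' : ∀ q ∈ unitTangent Ω ρ a t,
      (q.1.2 - a) ^ n / levi (S.u₂ q.1) q.2 ≤ (s - a) ^ n / levi (S.u₂ (p, s)) x := hmax
  set m := (s - a) ^ n / levi (S.u₂ (p, s)) x with hm
  -- If m ≤ 1 there is nothing to prove; otherwise μ = 1/m lies in [0, 1], as `exists_normal_le`
  -- demands.
  have hmm : m ≤ m₀ := by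
    rcases le_or_gt m 1 with h1 | h1
    · exact h1.trans hm₀1
    have hm0 : 0 < m := one_pos.trans h1
    have has : a < s := by
      rcases eq_or_lt_of_le hs.1 with h | h
      · rw [hm, ← h, sub_self, zero_pow (by omega), zero_div] at hm0
        exact absurd hm0 (lt_irrefl _)
      · exact h
    have hsI : s ∈ Ioo 0 T := ⟨ha.trans has, hs.2.trans_lt ht.2⟩
    have hsa : 0 < s - a := by linarith
    have hpc := frontier_subset_closure hp
    have heq : levi (S.u₂ (p, s)) x = 1 / m * (s - a) ^ n := by
      rw [hm, one_div_div, div_mul_cancel₀ _ (pow_pos hsa n).ne']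
    have hnorm := hC S hS p hp s hsI has x hx hx1 hx2 (1 / m)
      ⟨(one_div_pos.mpr hm0).le, (div_le_one hm0).mpr h1.le⟩ (by
        intro z' hz' s' hs' y' hy1 hy2
        rcases eq_or_ne y' 0 with rfl | hy0'
        · simp [levi]
        have hyn' : 0 < ‖y'‖ := norm_pos_iff.mpr hy0'
        have hmem : ((z', s'), ‖y'‖⁻¹ • y') ∈ unitTangent Ω ρ a t := by
          refine ⟨⟨⟨hz', hs'.1, hs'.2.trans hs.2⟩, ?_⟩, ?_, ?_⟩
          · simp [norm_smul, hyn'.ne']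
          · simp [hy1]
          · rw [I_smul_real_smul, map_smul, hy2, smul_zero]
        have h2 := hmax' _ hmem
        have h3 := hpos _ hmem
        simp only at h2 h3
        rw [div_le_iff₀ h3, levi_real_smul] at h2
        have h4 : levi (S.u₂ (z', s')) y' = ‖y'‖ ^ 2 * (‖y'‖⁻¹ ^ 2 * levi (S.u₂ (z', s')) y') := by
          rw [← mul_assoc, ← mul_pow, mul_inv_cancel₀ hyn'.ne', one_pow, one_mul]
        rw [h4, mul_comm (_ * _)]
        refine mul_le_mul_of_nonneg_left ?_ (sq_nonneg _)
        rw [one_div_mul_eq_div, div_le_iff₀ hm0]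
        linarith) heq
    have htr := hΛ S hS p hp s hsI has hnorm
    obtain ⟨hpd, hdet, -⟩ := hK S hS p hpc s hsI has.le
    have htr' : realTrace (S.u₂ (p, s)) ≤ Λ / (s - a) := by
      rw [le_div_iff₀ hsa]; linarith
    -- The trace is at most Λ/(s - a), so the lower bound of the determinant gives exp(-K) ≤ ((s -
    -- a)ⁿ/m)(Λ/(s - a))ⁿ⁻¹. One power of s - a survives, is bounded by T, and m is bounded.
    have hlev := levi_ge_of_trace_le (hS.symm_u₂ hpc hsI) hpd htr' x
    rw [hx, one_pow, mul_one, heq, div_pow] at hlev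
    have h5 : (s - a) ^ n = (s - a) * (s - a) ^ (n - 1) := by
      rw [← pow_succ', Nat.sub_add_cancel hn]
    have h6 : 1 / m * (s - a) ^ n * (Λ ^ (n - 1) / (s - a) ^ (n - 1)) =
        (s - a) * Λ ^ (n - 1) / m := by
      rw [h5]
      have := (pow_pos hsa (n - 1)).ne'
      field_simp
    rw [h6] at hlev
    have h7 := hdet.trans hlev
    rw [le_div_iff₀ hm0] at h7
    have h8 : (s - a) * Λ ^ (n - 1) ≤ T * Λ ^ (n - 1) :=
      mul_le_mul_of_nonneg_right (by linarith [hsI.2]) (pow_nonneg hΛ0 _)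
    have h9 : m ≤ Real.exp K * (T * Λ ^ (n - 1)) := by
      have := mul_le_mul_of_nonneg_left (h7.trans h8) (Real.exp_pos K).le
      rwa [← mul_assoc, ← Real.exp_add, add_neg_cancel, Real.exp_zero, one_mul] at this
    exact h9.trans (le_max_right _ _)
  have h1 := (hmax' _ hymem).trans hmm
  have h2 := hpos _ hymem
  simp only at h1 h2
  rw [div_le_iff₀ h2, levi_real_smul] at h1
  have h4 : levi (S.u₂ (z, t)) y = ‖y‖ ^ 2 * (‖y‖⁻¹ ^ 2 * levi (S.u₂ (z, t)) y) := by
    rw [← mul_assoc, ← mul_pow, mul_inv_cancel₀ hyn.ne', one_pow, one_mul]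
  rw [h4, mul_comm (_ * _)]
  refine mul_le_mul_of_nonneg_left ?_ (sq_nonneg _)
  rw [one_div_mul_eq_div, div_le_iff₀ hm₀0]
  linarith

/-- The mixed second derivatives of the solution on the boundary. -/
lemma exists_abs_u₂_le (hG : Geometry Ω W ρ r R κ C₀) (hn : 1 ≤ n) (hT : 0 < T)
    (Cu B F : ℝ) {a : ℝ} (ha : 0 < a) : ∃ C, 0 ≤ C ∧ ∀ S, IsSolution Ω T Cu B F S →
      ∀ p ∈ frontier Ω, ∀ t ∈ Ioo 0 T, a ≤ t → ∀ v τ, dRho ρ p τ = 0 →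
      |S.u₂ (p, t) v τ| ≤ C * ‖v‖ * ‖τ‖ := by
  obtain ⟨C, hC0, hC⟩ := exists_mixed hG hn hT Cu B F (half_pos ha)
  have h0 : 0 ≤ C / (a / 2) + (2 * n) ^ 2 * |B| := by positivity
  refine ⟨C / (a / 2) + (2 * n) ^ 2 * |B|, h0, fun S hS p hp t ht hat v τ hτ => ?_⟩
  have hpc := frontier_subset_closure hp
  have h1 := hC S hS p hp t ht (by linarith) v τ hτ
  have h2 := hS.abs_φ₂_le hG hT hpc ht v τ
  have hB : |B| = B := abs_of_nonneg (hS.bound_nonneg hG hT).2.1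
  have h3 : |(S.u₂ (p, t) - S.φ₂ (p, t)) v τ| ≤ C / (a / 2) * ‖v‖ * ‖τ‖ := by
    rw [div_mul_eq_mul_div, div_mul_eq_mul_div, le_div_iff₀ (half_pos ha)]
    refine le_trans ?_ h1
    rw [mul_comm]
    exact mul_le_mul_of_nonneg_right (by linarith) (abs_nonneg _)
  have h4 : S.u₂ (p, t) v τ = (S.u₂ (p, t) - S.φ₂ (p, t)) v τ + S.φ₂ (p, t) v τ := by simp
  rw [h4, hB, add_mul, add_mul]
  exact (abs_add_le _ _).trans (add_le_add h3 h2)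

end IsSolution

end

/-! ### The Laplacian on the boundary and in the interior. -/

noncomputable section

open Filter Topology

lemma levi_add_vec {n : ℕ} {B : RealBilin n} (hB : ∀ x y, B x y = B y x) (x y : Cn n) :
    levi B (x + y) =
      levi B x + 2 * (B x y + B (Complex.I • x) (Complex.I • y)) + levi B y := by
  simp only [levi, smul_add, map_add, add_apply, hB y x,
    hB (Complex.I • y) (Complex.I • x)]
  ring

namespace IsSolution

variable {n : ℕ} {Ω W : Set (Cn n)} {ρ : Cn n → ℝ} {r R κ C₀ T Cu B F : ℝ} {S : SolData n}

/-- The Laplacian estimate on the boundary. -/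
lemma exists_trace_frontier_le (hG : Geometry Ω W ρ r R κ C₀) (hn : 1 ≤ n) (hT : 0 < T)
    (Cu B F : ℝ) {a : ℝ} (ha : 0 < a) : ∃ A, 0 ≤ A ∧ ∀ S, IsSolution Ω T Cu B F S →
      ∀ p ∈ frontier Ω, ∀ t ∈ Ioo 0 T, a ≤ t → realTrace (S.u₂ (p, t)) ≤ A := by
  have ha2 := half_pos ha
  obtain ⟨K, hK0, hK⟩ := exists_det_bounds hG hn hT Cu B F ha
  obtain ⟨c, hc0, hc⟩ := exists_le_levi_tangential hG hn hT Cu B F ha2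
  obtain ⟨C, hC0, hC⟩ := exists_abs_u₂_le hG hn hT Cu B F ha
  have hC₀ := hG.C₀_nonneg
  set c₁ := c * (a / 2) ^ n with hc₁
  have hc₁0 : 0 < c₁ := by positivity
  -- The part 8C²/c₁ absorbs the mixed terms by Young's inequality against half of the tangential
  -- bound c₁; the 1 is what remains in the normal direction.
  set k := 1 + 8 * C ^ 2 / c₁ with hk
  have hk0 : 0 ≤ k := by positivity
  obtain ⟨Λ, hΛ0, hΛ⟩ := exists_trace_le_of_normal hG hn hT Cu B F ha2
    (C₁ := T * (k * C₀ ^ 2 + C * C₀ ^ 2 + |B| * C₀ ^ 2)) (by positivity)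
  set μ := min 1 (c₁ / 2) / 2 with hμ
  have hμ0 : 0 < μ := by positivity
  set A₁ := 4 * n * Real.exp K / (μ / 4) ^ (n - 1) with hA₁
  have hA₁0 : 0 ≤ A₁ := by positivity
  have hA₂0 : 0 ≤ Λ / (a / 2) := by positivity
  refine ⟨A₁ + Λ / (a / 2), add_nonneg hA₁0 hA₂0, ?_⟩
  intro S hS p hp t ht hat
  have hpc := frontier_subset_closure hp
  obtain ⟨hpd, -, hdet⟩ := hK S hS p hpc t ht hat
  have hsymm := hS.symm_u₂ hpc ht
  set U := S.u₂ (p, t) with hU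
  set ν := nRho ρ p with hν
  have hνp : 0 < ‖ν‖ ^ 2 := pow_pos (hG.κ_pos.trans_le (hG.le_norm_nRho hp)) 2
  have hνC : ‖ν‖ ^ 2 ≤ C₀ ^ 2 :=
    pow_le_pow_left₀ (norm_nonneg _) (hG.norm_nRho_le (hG.closure_subset hpc)) 2
  -- If the Levi form on ν is large, the whole Levi form is bounded below and the upper bound of the
  -- determinant bounds the trace. If it is small, it bounds the normal second derivative from
  -- above, because Iν is tangential, and `exists_trace_le_of_normal` applies.
  rcases le_or_gt (k * ‖ν‖ ^ 2) (levi U ν) with hbig | hsmall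
  · have hlow : ∀ x, μ * ‖x‖ ^ 2 ≤ levi U x := by
      intro x
      -- The complex component of x along ν. Removing it makes both ξ and Iξ tangential, so that the
      -- tangential lower bound applies to ξ and the mixed bounds to both terms of the polarization.
      set ζ : ℂ := ⟨dRho ρ p x / ‖ν‖ ^ 2, -(dRho ρ p (Complex.I • x) / ‖ν‖ ^ 2)⟩ with hζ
      set y := ζ • ν with hy
      set ξ := x - y with hξ
      have hξ1 : dRho ρ p ξ = 0 := by
        rw [hξ, map_sub, hy, dRho_smul_nRho, ← hν, hζ]
        simp only
        rw [div_mul_cancel₀ _ hνp.ne', sub_self]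
      have hξ2 : dRho ρ p (Complex.I • ξ) = 0 := by
        rw [hξ, smul_sub, map_sub, hy, smul_smul, dRho_smul_nRho, ← hν, hζ]
        simp only [Complex.mul_re, Complex.I_re, Complex.I_im, zero_mul, one_mul, zero_sub, neg_neg]
        rw [div_mul_cancel₀ _ hνp.ne', sub_self]
      have e1 : levi U x = levi U y + 2 * (U y ξ + U (Complex.I • y) (Complex.I • ξ))
          + levi U ξ := by
        rw [← levi_add_vec hsymm, hξ, add_sub_cancel]
      have b1 := (_root_.abs_le.mp (hC S hS p hp t ht hat y ξ hξ1)).1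
      have b2 := (_root_.abs_le.mp (hC S hS p hp t ht hat (Complex.I • y) _ hξ2)).1
      rw [norm_I_smul, norm_I_smul] at b2
      have b3 : c₁ * ‖ξ‖ ^ 2 ≤ levi U ξ := by
        refine le_trans ?_ (hc S hS p hp t ht (by linarith) ξ hξ1 hξ2)
        refine mul_le_mul_of_nonneg_right ?_ (sq_nonneg _)
        exact mul_le_mul_of_nonneg_left (pow_le_pow_left₀ ha2.le (by linarith) n) hc0.le
      have b4 : k * ‖y‖ ^ 2 ≤ levi U y := by
        rw [hy, levi_smul, norm_smul, mul_pow, Complex.sq_norm, mul_left_comm]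
        exact mul_le_mul_of_nonneg_left hbig (Complex.normSq_nonneg ζ)
      have b5 : 4 * C * ‖y‖ * ‖ξ‖ ≤ 8 * C ^ 2 / c₁ * ‖y‖ ^ 2 + c₁ / 2 * ‖ξ‖ ^ 2 := by
        have : 0 ≤ (4 * C * ‖y‖ - c₁ * ‖ξ‖) ^ 2 / (2 * c₁) := by positivity
        have e : (4 * C * ‖y‖ - c₁ * ‖ξ‖) ^ 2 / (2 * c₁) =
            8 * C ^ 2 / c₁ * ‖y‖ ^ 2 + c₁ / 2 * ‖ξ‖ ^ 2 - 4 * C * ‖y‖ * ‖ξ‖ := by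
          field_simp
          ring
        linarith
      have b6 : ‖x‖ ^ 2 ≤ 2 * (‖y‖ ^ 2 + ‖ξ‖ ^ 2) := by
        have h1 : ‖x‖ ≤ ‖y‖ + ‖ξ‖ := by
          have : x = y + ξ := by rw [hξ, add_sub_cancel]
          conv_lhs => rw [this]
          exact norm_add_le _ _
        have h2 := pow_le_pow_left₀ (norm_nonneg x) h1 2
        linarith [sq_nonneg (‖y‖ - ‖ξ‖)]
      have b7 := mul_le_mul_of_nonneg_left b6 hμ0.le
      have b8 : 2 * μ * ‖y‖ ^ 2 ≤ 1 * ‖y‖ ^ 2 := mul_le_mul_of_nonneg_right (by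
        rw [hμ, mul_div_cancel₀ _ two_ne_zero]; exact min_le_left _ _) (sq_nonneg _)
      have b9 : 2 * μ * ‖ξ‖ ^ 2 ≤ c₁ / 2 * ‖ξ‖ ^ 2 := mul_le_mul_of_nonneg_right (by
        rw [hμ, mul_div_cancel₀ _ two_ne_zero]; exact min_le_right _ _) (sq_nonneg _)
      have b10 : k * ‖y‖ ^ 2 = ‖y‖ ^ 2 + 8 * C ^ 2 / c₁ * ‖y‖ ^ 2 := by rw [hk]; ring
      linarith
    have h1 := trace_le_of_levi_ge hsymm hpd hμ0 hlow
    have h2 : realTrace U ≤ A₁ := by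
      rw [hA₁, le_div_iff₀ (pow_pos (by linarith) _)]
      exact h1.trans (mul_le_mul_of_nonneg_left hdet (by positivity))
    linarith
  · have hta : 0 < t - a / 2 := by linarith
    have h1 := (_root_.abs_le.mp (hC S hS p hp t ht hat (Complex.I • ν) (Complex.I • ν)
      (dRho_I_smul_nRho ρ p))).1
    rw [norm_I_smul] at h1
    have h2 := (_root_.abs_le.mp (hS.φ₂_le hpc ht ν)).1
    have h3 : (S.u₂ (p, t) - S.φ₂ (p, t)) ν ν ≤ k * C₀ ^ 2 + C * C₀ ^ 2 + |B| * C₀ ^ 2 := by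
      have e1 : levi U ν = U ν ν + U (Complex.I • ν) (Complex.I • ν) := rfl
      have e2 := mul_le_mul_of_nonneg_left hνC hk0
      have e3 := mul_le_mul_of_nonneg_left hνC hC0
      have e4 := mul_le_mul_of_nonneg_left hνC (abs_nonneg B)
      have e5 := mul_le_mul_of_nonneg_right (le_abs_self B) hνp.le
      simp only [sub_apply]
      linarith
    have h4 : (t - a / 2) * (S.u₂ (p, t) - S.φ₂ (p, t)) ν ν ≤
        T * (k * C₀ ^ 2 + C * C₀ ^ 2 + |B| * C₀ ^ 2) :=
      (mul_le_mul_of_nonneg_left h3 hta.le).trans (mul_le_mul_of_nonneg_right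
        (by linarith [ht.2]) (by positivity))
    have h5 := hΛ S hS p hp t ht (by linarith) h4
    have h6 : realTrace U ≤ Λ / (a / 2) := by
      rcases le_total (realTrace U) 0 with h | h
      · exact h.trans hA₂0
      · rw [le_div_iff₀ ha2]
        refine le_trans ?_ h5
        rw [mul_comm]
        exact mul_le_mul_of_nonneg_right (by linarith) h
    linarith

lemma realTrace_nonneg (hG : Geometry Ω W ρ r R κ C₀) (hn : 1 ≤ n) (hT : 0 < T)
    (hS : IsSolution Ω T Cu B F S) {z : Cn n} (hz : z ∈ closure Ω) {t : ℝ} (ht : t ∈ Ioo 0 T) :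
    0 ≤ realTrace (S.u₂ (z, t)) := by
  obtain ⟨K, -, hK⟩ := exists_det_bounds hG hn hT Cu B F ht.1
  have h := (leviMatrix_posSemidef_iff (hS.symm_u₂ hz ht)).mp
    (hK S hS z hz t ht le_rfl).1.posSemidef
  exact Finset.sum_nonneg fun α _ => h _

lemma continuousOn_realTrace (hS : IsSolution Ω T Cu B F S) :
    ContinuousOn (fun q => realTrace (S.u₂ q)) (closure Ω ×ˢ Ioo 0 T) :=
  continuousOn_finsetSum _ fun _ _ => hS.c2.continuousOn_levi _

set_option maxHeartbeats 400000 in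
/-- The Laplacian estimate. -/
lemma exists_trace_le (hG : Geometry Ω W ρ r R κ C₀) (hn : 1 ≤ n) (hT : 0 < T)
    (Cu B F : ℝ) {a : ℝ} (ha : 0 < a) : ∃ A, 0 ≤ A ∧ ∀ S, IsSolution Ω T Cu B F S →
      ∀ z ∈ closure Ω, ∀ t ∈ Ioo 0 T, a ≤ t → realTrace (S.u₂ (z, t)) ≤ A := by
  obtain ⟨K, hK0, hK⟩ := exists_abs_dt_le hG hn hT Cu B F (half_pos ha)
  obtain ⟨G, hG0, hGr⟩ := exists_abs_grad_coord_le hG hn hT Cu B F (half_pos ha)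
  obtain ⟨A, hA0, hA⟩ := exists_trace_frontier_le hG hn hT Cu B F (half_pos ha)
  have hR := hG.R_nonneg
  have hC4 : 0 ≤ Real.exp K ^ n + 4 * n * Real.exp K * Real.exp K := by positivity
  have hC4' : 0 ≤ 4 * n * Real.exp K := by positivity
  obtain ⟨C, hC0, hC⟩ := exists_power_bound (σ := 1 / (2 * n)) (by positivity) (τ := T)
    (S₀ := 1 + A) (N₀ := R ^ 2) (C₁ := 2 * n * (2 * |F| * (1 + G ^ 2))) (C₂ := 0)
    (C₃ := 2 * R ^ 2)
    (C₄ := (Real.exp K ^ n + 4 * n * Real.exp K * Real.exp K) ^ (1 / n : ℝ)) hT.le (by positivity)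
    (by positivity) (by positivity) le_rfl (by positivity) (by positivity)
  have hC1 : 0 ≤ 2 * n * (2 * |F| * (1 + G ^ 2)) := by positivity
  have hCa : 0 ≤ (C / (a / 2)) ^ (2 * n) := by positivity
  refine ⟨(C / (a / 2)) ^ (2 * n), hCa, ?_⟩
  intro S hS z hz t ht hat
  obtain ⟨hCu, hB, hF⟩ := hS.bound_nonneg hG hT
  -- Here N is the squared distance to the origin alone, whose operator is exactly -4 ∑ ‖w k‖² = -Z;
  -- hence C₂ = 0.
  set s : Cn n × ℝ → ℝ := fun q => 1 + realTrace (S.u₂ q) with hs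
  have hsub : Icc (a / 2) t ⊆ Ioo 0 T := fun s hs => ⟨by linarith [hs.1], hs.2.trans_lt ht.2⟩
  have hsubc : closure Ω ×ˢ Icc (a / 2) t ⊆ closure Ω ×ˢ Ioo 0 T := prod_mono subset_rfl hsub
  have hs1 : ∀ z ∈ closure Ω, ∀ t ∈ Ioo 0 T, 1 ≤ s (z, t) := fun z hz t ht => by
    have := realTrace_nonneg hG hn hT hS hz ht
    simp only [hs]; linarith
  have hO := hS.flow.isOpen_prod
  have hmain := hC (a := a / 2) (b := t) (s := s) (N := sqDist 0) hG.isOpen hG.isBounded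
    (by linarith [ht.2]) ?_ ?_ ?_ ?_ ?_ ?_ z hz t ⟨by linarith, le_rfl⟩
  · have h0 := zero_le_one.trans (hs1 z hz t ht)
    have h1 : (a / 2) * s (z, t) ^ (1 / (2 * n) : ℝ) ≤ C :=
      le_trans (mul_le_mul_of_nonneg_right (by linarith) (Real.rpow_nonneg h0 _)) hmain
    have h2 := le_pow_of_mul_rpow_le hn h0 (half_pos ha) h1
    simp only [hs] at h2
    linarith
  · exact continuousOn_const.add (hS.continuousOn_realTrace.mono hsubc)
  · exact (contDiff_sqDist 0).continuous.continuousOn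
  · exact fun z hz t ht => hs1 z hz t (hsub ht)
  · intro z hz t ht
    simp only [sqDist, sub_zero]
    rw [abs_of_nonneg (sq_nonneg _)]
    exact pow_le_pow_left₀ (norm_nonneg z) (hG.norm_le z (hG.closure_subset hz)) 2
  · intro z hz t ht
    have := hA S hS z hz t (hsub ht) ht.1
    simp only [hs]; linarith
  · intro z hz t ht'
    have htI := Ioc_subset_Icc_self ht'
    have hq : (z, t) ∈ Ω ×ˢ Ioo 0 T := ⟨hz, hsub htI⟩
    obtain ⟨w, hw⟩ := hS.flow.exists_frame hq
    have su : ∀ i, ContDiffOn ℝ ∞ (dx (coordDir i) (dx (coordDir i) S.u)) (Ω ×ˢ Ioo 0 T) :=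
      fun i => dirDeriv_contDiffOn hO (dirDeriv_contDiffOn hO hS.flow.smooth _) _
    have cu : ∀ i, ContDiffAt ℝ 2 (dx (coordDir i) (dx (coordDir i) S.u)) (z, t) :=
      fun i => (su i).contDiffAt_two hO hq
    have hse : s =ᶠ[𝓝 (z, t)] fun q => 1 + ∑ i, dx (coordDir i) (dx (coordDir i) S.u) q := by
      filter_upwards [hO.mem_nhds hq] with q hq
      simp only [hs, hS.c2.eq₂ hG.isOpen hS.flow.smooth hq, realTrace_eq,
        hessForm_apply (hS.flow.contDiffAt hq)]
    have hsc' : ContDiffAt ℝ 2 (fun q => ∑ i, dx (coordDir i) (dx (coordDir i) S.u) q) (z, t) :=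
      ContDiffAt.sum fun i _ => cu i
    have hsum : 0 ≤ 4 * ∑ k, ‖w k‖ ^ 2 := mul_nonneg (by norm_num) (sum_norm_sq_nonneg w)
    have hst := hs1 z (subset_closure hz) t (hsub htI)
    have hKt := (hK S hS z hz t (hsub htI) ht'.1.le).2
    refine ⟨(contDiffAt_const.add hsc').congr_of_eventuallyEq hse, contDiffAt_sqDist 0 _, w,
      4 * ∑ k, ‖w k‖ ^ 2, hsum, ?_, ?_, ?_, ?_⟩
    · obtain ⟨c, -, hc0, hc⟩ := hS.flow.heat_dx_dx hq hw
      rw [heat_congr hse, heat_add contDiffAt_const hsc', heat_const, zero_add,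
        heat_sum _ fun i _ => cu i]
      have htr : 0 ≤ ∑ i, dx (coordDir i) (dx (coordDir i) S.u) (z, t) := by
        have := hse.eq_of_nhds
        linarith
      have h1 : ∀ i, heat w (dx (coordDir i) (dx (coordDir i) S.u)) (z, t) ≤
          2 * |F| * (1 + G ^ 2) + c * dx (coordDir i) (dx (coordDir i) S.u) (z, t) := by
        intro i
        refine (hc i).trans (add_le_add_left ?_ _)
        rw [abs_of_nonneg hF]
        refine mul_le_mul_of_nonneg_left ?_ (by linarith)
        have h2 := hGr S hS z (subset_closure hz) t (hsub htI) ht'.1.le i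
        rw [hS.c2.eq₁ hG.isOpen hS.flow.smooth hq, gradForm_apply] at h2
        linarith [sq_le_sq' (_root_.abs_le.mp h2).1 (_root_.abs_le.mp h2).2]
      refine (Finset.sum_le_sum fun i _ => h1 i).trans ?_
      rw [Finset.sum_add_distrib, ← Finset.mul_sum _ _ c]
      -- The term f_u Δu is dropped, since f_u ≤ 0 and Δu ≥ 0.
      have h3 := mul_nonpos_of_nonpos_of_nonneg hc0 htr
      have h4 : ∑ _i : Fin n × Bool, 2 * |F| * (1 + G ^ 2) = 2 * n * (2 * |F| * (1 + G ^ 2)) := by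
        rw [Finset.sum_const, Finset.card_univ, nsmul_eq_mul, Fintype.card_prod, Fintype.card_fin,
          Fintype.card_bool]
        push_cast
        ring
      rw [h4]
      have h5 := le_mul_of_one_le_right hC1 hst
      linarith
    · rw [heat_sqDist]; linarith
    · have h3 := gradSq_sqDist_le 0 w (q := (z, t)) (R := R)
        (by simpa using hG.norm_le z (hG.closure_subset (subset_closure hz)))
      linarith
    · have h2 := hS.flow.trace_le_of_frame hq hKt hw
      have h3 := exp_le_frame hn hw hKt
      set Z := 4 * ∑ k, ‖w k‖ ^ 2 with hZ
      refine rpow_sq_le_of_le_pow hn (zero_le_one.trans hst) hC4 hsum ?_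
      rw [add_mul]
      simp only [hs]
      refine add_le_add (one_le_mul_pow h3) ?_
      rw [hS.c2.eq₂ hG.isOpen hS.flow.smooth hq]
      refine h2.trans ?_
      rw [mul_assoc (4 * (n : ℝ) * Real.exp K)]
      refine mul_le_mul_of_nonneg_left ?_ hC4'
      -- The trace bound has degree n - 1 in Z; since Z is bounded below, it is also bounded by a
      -- multiple of Zⁿ.
      have h4 : 1 ≤ Real.exp K * Z := by
        have := mul_le_mul_of_nonneg_left h3 (Real.exp_pos K).le
        rwa [← Real.exp_add, add_neg_cancel, Real.exp_zero] at this
      calc Z ^ (n - 1) ≤ Z ^ (n - 1) * (Real.exp K * Z) :=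
            le_mul_of_one_le_right (pow_nonneg hsum _) h4
        _ = Real.exp K * (Z ^ (n - 1) * Z) := by ring
        _ = Real.exp K * Z ^ n := by rw [← pow_succ, Nat.sub_add_cancel hn]

end IsSolution

end

/-! ### Translation to the gradient, time derivative and Laplacian of the statement. -/

noncomputable section

open Filter Topology

lemma orthonormal_coordDir (n : ℕ) : Orthonormal ℝ (coordDir : Fin n × Bool → Cn n) := by
  rw [orthonormal_iff_ite]
  rintro ⟨i, b⟩ ⟨j, b'⟩
  rw [← coord_eq_inner]
  rcases eq_or_ne i j with rfl | hij
  · cases b <;> cases b' <;> simp [coord, coordDir, dirX, dirY]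
  · cases b <;> cases b' <;> simp [coord, coordDir, dirX, dirY, hij]

/-- The real orthonormal basis of the coordinate directions. -/
def coordBasis (n : ℕ) : OrthonormalBasis (Fin n × Bool) ℝ (Cn n) :=
  OrthonormalBasis.mk (orthonormal_coordDir n) fun v _ => by
    rw [sum_coord v]
    exact Submodule.sum_mem _ fun i _ => Submodule.smul_mem _ _
      (Submodule.subset_span (mem_range_self i))

section Slice

variable {n : ℕ} {u : Cn n × ℝ → ℝ} {z : Cn n} {t : ℝ}

lemma norm_gradient_slice (hu : DifferentiableAt ℝ u (z, t)) :
    ‖gradient (fun w => u (w, t)) z‖ = ‖gradForm u (z, t)‖ := by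
  rw [gradient, LinearIsometryEquiv.norm_map, (hasFDerivAt_slice hu).fderiv]

lemma deriv_slice (hu : DifferentiableAt ℝ u (z, t)) :
    deriv (fun s => u (z, s)) t = dt u (z, t) := by
  have h : HasDerivAt (fun s : ℝ => (z, s)) ((0 : Cn n), (1 : ℝ)) t :=
    (hasDerivAt_const t z).prodMk (hasDerivAt_id t)
  exact (hu.hasFDerivAt.comp_hasDerivAt t h).deriv

lemma laplacian_slice (hu : ContDiffAt ℝ 2 u (z, t)) :
    Laplacian.laplacian (fun w => u (w, t)) z = realTrace (hessForm u (z, t)) := by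
  have h1 : fderiv ℝ (fun w => u (w, t)) =ᶠ[𝓝 z] fun y => gradForm u (y, t) := by
    have hc : ContinuousAt (fun y : Cn n => (y, t)) z := by fun_prop
    filter_upwards [hc.eventually hu.eventually_differentiableAt] with y hy
    exact (hasFDerivAt_slice hy).fderiv
  have h2 : fderiv ℝ (fderiv ℝ (fun w => u (w, t))) z = hessForm u (z, t) := by
    rw [h1.fderiv_eq]
    exact (hasFDerivAt_gradForm_slice hu).fderiv
  rw [InnerProductSpace.laplacian_eq_iteratedFDeriv_orthonormalBasis _ (coordBasis n), realTrace_eq]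
  refine Finset.sum_congr rfl fun i _ => ?_
  rw [iteratedFDeriv_two_apply, h2, coordBasis, OrthonormalBasis.coe_mk]
  rfl

end Slice

lemma dirDeriv_valDir {n : ℕ} {f : RhsSpace n → ℝ} {t : ℝ} {z : Cn n} {r : ℝ}
    (hf : DifferentiableAt ℝ f (t, z, r)) :
    dirDeriv (valDir n) f (t, z, r) = deriv (fun v => f (t, z, v)) r := by
  have h : HasDerivAt (fun v : ℝ => (t, z, v)) (valDir n) r :=
    (hasDerivAt_const r t).prodMk ((hasDerivAt_const r z).prodMk (hasDerivAt_id r))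
  exact (hf.hasFDerivAt.comp_hasDerivAt r h).deriv.symm

/-- The hypotheses of the theorem in the form used by the estimates. -/
lemma exists_isSolution {n : ℕ} {Ω W : Set (Cn n)} {ρ : Cn n → ℝ} {r R κ C₀ T : ℝ}
    (hG : Geometry Ω W ρ r R κ C₀) {C_u C_φ C_f : ℝ≥0} {φ : Cn n × ℝ → ℝ} {f : RhsSpace n → ℝ}
    {u : Cn n × ℝ → ℝ} (hφ : ContDiffOn ℝ ∞ φ (closure Ω ×ˢ Ico 0 T))
    (hf : ContDiffOn ℝ ∞ f (Ico 0 T ×ˢ closure Ω ×ˢ univ))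
    (hu : ContDiffOn ℝ ∞ u (Ω ×ˢ Ioo 0 T)) (hu21 : IsC21 Ω T u)
    (hpos : ∀ z ∈ Ω, ∀ t ∈ Ioo 0 T, (complexHessian (fun w => u (w, t)) z).PosDef)
    (heq : ∀ z ∈ Ω, ∀ t ∈ Ioo 0 T, deriv (fun s => u (z, s)) t =
      Real.log (complexHessian (fun w => u (w, t)) z).det.re + f (t, z, u (z, t)))
    (hb : ∀ z ∈ frontier Ω, ∀ t ∈ Ico 0 T, u (z, t) = φ (z, t))
    (hi : ∀ z ∈ closure Ω, |u (z, 0)| ≤ C_u)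
    (hfu : ∀ t ∈ Ioo 0 T, ∀ z ∈ Ω, ∀ r : ℝ, deriv (fun v => f (t, z, v)) r ≤ 0)
    (hfC : rhsCkNorm 2 Ω T f ≤ C_f) (hφC : parabolicCkNorm 4 Ω T φ ≤ C_φ) :
    ∃ S : SolData n, S.u = u ∧ IsSolution Ω T C_u ((2 * n + 1) ^ 2 * C_φ) C_f S := by
  obtain ⟨u₁, u₂, h2u⟩ := exists_isC2UpTo_of_isC21 hG hu hu21
  obtain ⟨φ₁, φ₂, h2φ⟩ := exists_isC2UpTo_of_contDiffOn hG hφ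
  have hO : IsOpen (Ω ×ˢ Ioo 0 T) := hG.isOpen.prod isOpen_Ioo
  have hOf : IsOpen (Ioo 0 T ×ˢ Ω ×ˢ (univ : Set ℝ)) :=
    isOpen_Ioo.prod (hG.isOpen.prod isOpen_univ)
  have hφ' : ContDiffOn ℝ ∞ φ (Ω ×ˢ Ioo 0 T) :=
    hφ.mono (prod_mono subset_closure Ioo_subset_Ico_self)
  have hf' : ContDiffOn ℝ ∞ f (Ioo 0 T ×ˢ Ω ×ˢ univ) :=
    hf.mono (prod_mono Ioo_subset_Ico_self (prod_mono subset_closure subset_rfl))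
  have hcu : ∀ z ∈ Ω, ∀ t ∈ Ioo 0 T, ContDiffAt ℝ 2 u (z, t) := fun z hz t ht =>
    hu.contDiffAt_two hO ⟨hz, ht⟩
  have hB := fun j L l (h : j + L.length + l ≤ 2) p hp =>
    abs_deriv_le_of_rhsCkNorm hG.isOpen hf' hfC j L l h (q := p) hp
  refine ⟨⟨φ, f, u, φ₁, φ₂, u₁, u₂⟩, rfl, ?_⟩
  refine ⟨⟨hG.isOpen, hf', hu, ?_, ?_, ?_, ?_, ?_, ?_, ?_, ?_, ?_, ?_⟩, hu21,
    isC21_continuousOn hG.isBounded hu21, h2u, hφ, h2φ,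
    fun L hL => tame_wordDeriv hG.isOpen hφ' hφC L hL, hb, hi⟩
  · rintro ⟨z, t⟩ ⟨hz, ht⟩
    rw [← complexHessian_slice (hcu z hz t ht)]
    exact hpos z hz t ht
  · rintro ⟨z, t⟩ ⟨hz, ht⟩
    rw [← complexHessian_slice (hcu z hz t ht),
      ← deriv_slice ((hcu z hz t ht).differentiableAt (by simp))]
    exact heq z hz t ht
  · exact fun p hp => hB 0 [] 0 (by simp) p hp
  · exact fun p hp => hB 1 [] 0 (by simp) p hp
  · exact fun p hp i => hB 0 [i] 0 (by simp) p hp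
  · exact fun p hp => hB 0 [] 1 (by simp) p hp
  · rintro ⟨t, z, r⟩ ⟨ht, hz, hr⟩
    rw [dirDeriv_valDir ((hf'.contDiffAt_two hOf ⟨ht, hz, hr⟩).differentiableAt (by simp))]
    exact hfu t ht z hz r
  · exact fun p hp i => hB 0 [i, i] 0 (by simp) p hp
  · exact fun p hp i => hB 0 [i] 1 (by simp) p hp
  · exact fun p hp => hB 0 [] 2 (by simp) p hp

lemma exists_total_le {n : ℕ} {Ω W : Set (Cn n)} {ρ : Cn n → ℝ} {r R κ C₀ T : ℝ}
    (hG : Geometry Ω W ρ r R κ C₀) (hn : 1 ≤ n) (hT : 0 < T) (Cu B F : ℝ) {a : ℝ} (ha : 0 < a) :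
    ∃ C, ∀ S : SolData n, IsSolution Ω T Cu B F S → ∀ z ∈ Ω, ∀ t ∈ Ioo a T,
      ‖gradForm S.u (z, t)‖ + |dt S.u (z, t)| + realTrace (hessForm S.u (z, t)) ≤ C := by
  obtain ⟨A, hA0, hA⟩ := IsSolution.exists_abs_grad_le hG hn hT Cu B F ha
  obtain ⟨K, -, hK⟩ := IsSolution.exists_abs_dt_le hG hn hT Cu B F ha
  obtain ⟨L, -, hL⟩ := IsSolution.exists_trace_le hG hn hT Cu B F ha
  refine ⟨A + K + L, fun S hS z hz t ht => ?_⟩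
  have hq : (z, t) ∈ Ω ×ˢ Ioo 0 T := ⟨hz, ha.trans ht.1, ht.2⟩
  have h1 := hA S hS z (subset_closure hz) t hq.2 ht.1.le
  have h3 := hL S hS z (subset_closure hz) t hq.2 ht.1.le
  rw [hS.c2.eq₂ hG.isOpen hS.flow.smooth hq] at h3
  rw [hS.c2.eq₁ hG.isOpen hS.flow.smooth hq] at h1
  exact add_le_add (add_le_add (ContinuousLinearMap.opNorm_le_bound _ hA0 h1)
    (hK S hS z hz t hq.2 ht.1.le).1) h3

end

theorem theorem2 (n : ℕ) (hn : 1 ≤ n) (Ω : Set (EuclideanSpace ℂ (Fin n)))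
    (hΩ : IsBoundedSmoothStrictlyPseudoconvex Ω) (T : ℝ) (hT : 0 < T) (C_u C_φ C_f : ℝ≥0) :
    ∃ (M₀ : ℝ) (C : ℝ → ℝ),
      ∀ (φ : EuclideanSpace ℂ (Fin n) × ℝ → ℝ) (f : ℝ × EuclideanSpace ℂ (Fin n) × ℝ → ℝ)
        (u : EuclideanSpace ℂ (Fin n) × ℝ → ℝ),
        ContDiffOn ℝ ∞ φ (closure Ω ×ˢ Ico 0 T) →
        ContDiffOn ℝ ∞ f (Ico 0 T ×ˢ closure Ω ×ˢ univ) →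
        ContDiffOn ℝ ∞ u (Ω ×ˢ Ioo 0 T) →
        IsC21 Ω T u →
        (∀ z ∈ Ω, ∀ t ∈ Ioo 0 T, (complexHessian (fun w => u (w, t)) z).PosDef) →
        (∀ z ∈ Ω, ∀ t ∈ Ioo 0 T, deriv (fun s => u (z, s)) t =
          Real.log (complexHessian (fun w => u (w, t)) z).det.re + f (t, z, u (z, t))) →
        (∀ z ∈ frontier Ω, ∀ t ∈ Ico 0 T, u (z, t) = φ (z, t)) →
        (∀ z ∈ closure Ω, |u (z, 0)| ≤ C_u) →
        (∀ t ∈ Ioo 0 T, ∀ z ∈ Ω, ∀ r : ℝ, deriv (fun v => f (t, z, v)) r ≤ 0) →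
        rhsCkNorm 2 Ω T f ≤ C_f →
        parabolicCkNorm 4 Ω T φ ≤ C_φ →
        (∀ z ∈ Ω, ∀ t ∈ Ioo 0 T, |u (z, t)| ≤ M₀) ∧
        (∀ ε ∈ Ioo 0 T, ∀ z ∈ Ω, ∀ t ∈ Ioo ε T,
          ‖gradient (fun w => u (w, t)) z‖ + |deriv (fun s => u (z, s)) t|
            + Laplacian.laplacian (fun w => u (w, t)) z ≤ C ε) := by
  obtain ⟨W, ρ, r, R, κ, C₀, hG⟩ := exists_geometry hΩ
  obtain ⟨M, -, hM⟩ := IsSolution.exists_abs_u_le hG hn hT C_u ((2 * n + 1) ^ 2 * C_φ) C_f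
  have hkey : ∀ ε : ℝ, ∃ C, 0 < ε → ∀ S : SolData n,
      IsSolution Ω T C_u ((2 * n + 1) ^ 2 * C_φ) C_f S → ∀ z ∈ Ω, ∀ t ∈ Ioo ε T,
      ‖gradForm S.u (z, t)‖ + |dirDeriv ((0 : Cn n), (1 : ℝ)) S.u (z, t)|
        + realTrace (hessForm S.u (z, t)) ≤ C := by
    intro ε
    by_cases hε : 0 < ε
    · obtain ⟨C, hC⟩ := exists_total_le hG hn hT C_u ((2 * n + 1) ^ 2 * C_φ) C_f hε
      exact ⟨C, fun _ => hC⟩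
    -- The constant has to be a function of all real ε; its value at nonpositive ε plays no role.
    · exact ⟨0, fun h => absurd h hε⟩
  choose C hC using hkey
  refine ⟨M, C, ?_⟩
  intro φ f u hφ hf hu hu21 hpos heq hb hi hfu hfC hφC
  obtain ⟨S, rfl, hS⟩ := exists_isSolution hG hφ hf hu hu21 hpos heq hb hi hfu hfC hφC
  refine ⟨fun z hz t ht => hM S hS z (subset_closure hz) t ht, fun ε hε z hz t ht => ?_⟩
  have hc := hS.flow.contDiffAt (q := (z, t)) ⟨hz, hε.1.trans ht.1, ht.2⟩
  have hd : DifferentiableAt ℝ S.u (z, t) := hc.differentiableAt (by simp)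
  rw [norm_gradient_slice hd, deriv_slice hd, laplacian_slice hc]
  exact hC ε hε.1 S hS z hz t ht
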